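/- Let $k$ be an algebraically closed field (of any characteristic) and let $C$ be a curve over $k$, i.e. a reduced connected one-dimensional scheme of finite type over $k$. Let $m\ge 1$ and let $p\in C$ be an elliptic $m$-fold point, i.e. there is an isomorphism of $k$-algebras $$\hat{\mathcal O}_{C,p}\simeq\begin{cases}k[[x,y]]/(y^2-x^3)& m=1,\\ k[[x,y]]/(y^2-yx^2)& m=2,\\ k[[x,y]]/(x^2y-xy^2)& m=3,\\ k[[x_1,\dots,x_{m-1}]]/(x_hx_i-x_hx_j : h,i,j \text{ distinct})& m\ge 4.\end{cases}$$ Let $\pi:\tilde C\to C$ be the normalization of $C$ at $p$ (an isomorphism away from $p$). For a reduced curve $X$ over $k$, let $\omega_X$ denote its dualizing sheaf, realized as the $\mathcal O_X$-module of those rational differentials $\omega$ (families of Kähler differentials over $k$ of the function fields of the irreducible components) such that for every closed point $x$ and every $f\in\mathcal O_{X,x}$ the sum of the residues of $f\omega$ over all points of the normalization of $X$ lying above $x$ is zero; for an effective divisor $D$ supported at regular points, $\omega_X(D)$ is regarded as a sheaf of rational differentials in the same way. Then $\pi^{-1}(p)$ consists of exactly $m$ points $p_1,\dots,p_m$, and: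 1. $\omega_C$ is invertible near $p$: there is an open neighbourhood $U$ of $p$ with $\omega_C|_U\simeq\mathcal O_U$. In other words, $C$ is Gorenstein at $p$. 2. $\pi^*\omega_C=\omega_{\tilde C}(2p_1+\dots+2p_m)$: there is an isomorphism of $\mathcal O_{\tilde C}$-modules $\pi^*\omega_C\simeq\omega_{\tilde C}(2p_1+\dots+2p_m)$ which sends the pullback of each local section of $\omega_C$ to its pullback as a rational differential. 3. There are an open neighbourhood $U$ of $p$ and a section $\sigma\in\omega_C(U)$ such that multiplication by $\sigma$ is an isomorphism $\mathcal O_U\simeq\omega_C|_U$, and the rational differential $\pi^*\sigma$ on $\tilde C$ has a pole of order exactly two at each of $p_1,\dots,p_m$. -/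

import Mathlib

open CategoryTheory AlgebraicGeometry TopologicalSpace

universe u

noncomputable section

namespace RosenlichtCurve

/-! ### Curves over `k` -/

/-- A curve over `k`: a reduced connected one-dimensional scheme of finite type over `k`. -/
class IsCurve (k : Type u) [Field k] (C : Scheme.{u}) [C.Over (Spec (.of k))] : Prop where
  isReduced : IsReduced C
  connected : ConnectedSpace C
  locallyOfFiniteType : LocallyOfFiniteType (C ↘ Spec (.of k))
  quasiCompact : QuasiCompact (C ↘ Spec (.of k))
  dim_eq_one : topologicalKrullDim C = 1

/-- The structure map `k → 𝒪_{X,x}`. -/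
def toStalk (k : Type u) [Field k] (X : Scheme.{u}) [X.Over (Spec (.of k))] (x : X) :
    k →+* X.presheaf.stalk x :=
  ((Scheme.ΓSpecIso (.of k)).inv ≫ (X ↘ Spec (.of k)).appTop ≫
    X.presheaf.germ ⊤ x (Opens.mem_top x)).hom

/-- Residue fields of a `k`-scheme are `k`-algebras. -/
instance algebraResidueField (k : Type u) [Field k] (X : Scheme.{u}) [X.Over (Spec (.of k))]
    (x : X) : Algebra k (X.residueField x) :=
  ((X.residue x).hom.comp (toStalk k X x)).toAlgebra

/-! ### Elliptic `m`-fold points -/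

/-- The completed local ring of `X` at `x` is isomorphic, over `k`, to `k[[x₁, …, xₙ]] / I`. -/
def HasCompletedLocalRing (k : Type u) [Field k] (X : Scheme.{u}) [X.Over (Spec (.of k))]
    (x : X) {n : ℕ} (I : Ideal (MvPowerSeries (Fin n) k)) : Prop :=
  ∃ e : AdicCompletion (IsLocalRing.maximalIdeal (X.presheaf.stalk x)) (X.presheaf.stalk x) ≃+*
      (MvPowerSeries (Fin n) k ⧸ I),
    ∀ a : k, e (algebraMap (X.presheaf.stalk x) _ (toStalk k X x a)) =
      Ideal.Quotient.mk I (MvPowerSeries.C a)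

open MvPowerSeries in
/-- `p` is an elliptic `m`-fold point (`m ≥ 1`): the ordinary cusp (`m = 1`), the ordinary tacnode
(`m = 2`), the planar triple point (`m = 3`), and for `m ≥ 4` the cone over `m` general points,
`k[[x₁, …, x_{m-1}]] / (x_h x_i - x_h x_j : h, i, j distinct)`. -/
def IsEllipticMFoldPoint (k : Type u) [Field k] (C : Scheme.{u}) [C.Over (Spec (.of k))]
    (p : C) : ℕ → Prop
  | 0 => False
  | 1 => HasCompletedLocalRing k C p (n := 2) (Ideal.span {X 1 ^ 2 - X 0 ^ 3})
  | 2 => HasCompletedLocalRing k C p (n := 2) (Ideal.span {X 1 ^ 2 - X 1 * X 0 ^ 2})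
  | 3 => HasCompletedLocalRing k C p (n := 2) (Ideal.span {X 0 ^ 2 * X 1 - X 0 * X 1 ^ 2})
  | m + 4 => HasCompletedLocalRing k C p (n := m + 3)
      (Ideal.span {f | ∃ h i j : Fin (m + 3), h ≠ i ∧ h ≠ j ∧ i ≠ j ∧
        f = X h * X i - X h * X j})

/-! ### Rational differentials and residues -/

/-- Let `A` be a discrete valuation ring of the field `K`, containing `k` and with residue field
`k`. A `k`-linear map `r : Ω_{K/k} → k` is the residue at `A` if for some uniformizer `t` it
kills `A dt` and `t⁻ⁿ dt` for `n ≥ 2`, and takes the value `1` at `t⁻¹ dt`. (For a function field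
`K` in one variable there is exactly one such map; it does not depend on `t`.) -/
def IsResidue {k K : Type u} [Field k] [Field K] [Algebra k K] (A : ValuationSubring K)
    (r : Ω[K⁄k] →ₗ[k] k) : Prop :=
  ∃ t : A, IsLocalRing.maximalIdeal A = Ideal.span {t} ∧
    (∀ h ∈ A, r (h • KaehlerDifferential.D k K (t : K)) = 0) ∧
    r ((t : K)⁻¹ • KaehlerDifferential.D k K (t : K)) = 1 ∧
    ∀ n : ℕ, 2 ≤ n → r (((t : K)⁻¹) ^ n • KaehlerDifferential.D k K (t : K)) = 0

/-- The map `𝒪_{X,x} → κ(η)` for a generization `η` of `x`; when `X` is reduced and `η` is the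
generic point of a component through `x`, this restricts a function to that component. -/
def toBranch (X : Scheme.{u}) {η x : X} (h : η ⤳ x) : X.presheaf.stalk x →+* X.residueField η :=
  (X.presheaf.stalkSpecializes h ≫ X.residue η).hom

/-- For a closed point `x` of a curve `X`, the points of the normalization of `X` lying above `x`:
pairs consisting of an irreducible component of `X` through `x` (given by its generic point `η`)
and a valuation ring of its function field dominating the local ring at `x`. -/
structure Branch (X : Scheme.{u}) (x : X) where
  /-- the generic point of the component -/
  η : X
  generic : η ∈ genericPoints X
  specializes : η ⤳ x
  /-- the local ring of the normalization -/
  ring : ValuationSubring (X.residueField η)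
  le : ∀ f : X.presheaf.stalk x, toBranch X specializes f ∈ ring
  dominates : ∀ f ∈ IsLocalRing.maximalIdeal (X.presheaf.stalk x),
    toBranch X specializes f ∈ ring.nonunits

/-- The generic points of the irreducible components meeting `U`. -/
abbrev GenericIn (X : Scheme.{u}) (U : X.Opens) : Type u := {η : X // η ∈ genericPoints X ∧ η ∈ U}

/-- The rational differentials on `U`: a differential of the function field of each
irreducible component of `U`. -/
def RatDiff (k : Type u) [Field k] (X : Scheme.{u}) [X.Over (Spec (.of k))] (U : X.Opens) :
    Type u :=
  ∀ η : GenericIn X U, Ω[X.residueField η.1⁄k]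

section RatDiff

variable (k : Type u) [Field k] (X : Scheme.{u}) [X.Over (Spec (.of k))]

instance (U : X.Opens) : AddCommGroup (RatDiff k X U) :=
  inferInstanceAs (AddCommGroup (∀ η : GenericIn X U, Ω[X.residueField η.1⁄k]))

/-- A function `f ∈ 𝒪_X(U)` acts on the component with generic point `η` as its image in `κ(η)`. -/
instance (U : X.Opens) : Module Γ(X, U) (RatDiff k X U) :=
  letI : Module (∀ η : GenericIn X U, X.residueField η.1) (RatDiff k X U) :=
    inferInstanceAs (Module (∀ η : GenericIn X U, X.residueField η.1)
      (∀ η : GenericIn X U, Ω[X.residueField η.1⁄k]))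
  Module.compHom (RatDiff k X U)
    (RingHom.pi fun η : GenericIn X U => (X.evaluation U η.1 η.2.2).hom)

variable {k X}

lemma RatDiff.smul_apply {U : X.Opens} (f : Γ(X, U)) (ω : RatDiff k X U) (η : GenericIn X U) :
    (f • ω) η = (X.evaluation U η.1 η.2.2).hom f • ω η := rfl

/-- Restriction of rational differentials to a smaller open set. -/
def RatDiff.res {U V : X.Opens} (h : V ≤ U) (ω : RatDiff k X U) : RatDiff k X V :=
  fun η => ω ⟨η.1, η.2.1, h η.2.2⟩

/-- The component at a branch `b` of a rational differential `ω` defined near `x`. -/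
def RatDiff.atBranch {U : X.Opens} (ω : RatDiff k X U) {x : X} (hx : x ∈ U) (b : Branch X x) :
    Ω[X.residueField b.η⁄k] :=
  ω ⟨b.η, b.generic, b.specializes.mem_open U.isOpen hx⟩

/-- The residue condition at `x` for `ω`, tested against a single function `f ∈ 𝒪_{X,x}`:
the sum over all points `b` of the normalization above `x` of `Res_b (f ω)` vanishes.
(A closed point of a curve has only finitely many branches.) -/
def ResidueSumVanishes {U : X.Opens} (ω : RatDiff k X U) {x : X} (hx : x ∈ U)
    (f : X.presheaf.stalk x) : Prop :=
  ∀ [Fintype (Branch X x)] (r : ∀ b : Branch X x, Ω[X.residueField b.η⁄k] →ₗ[k] k),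
    (∀ b, IsResidue b.ring (r b)) →
      ∑ b, r b (toBranch X b.specializes f • ω.atBranch hx b) = 0

variable (k X)

/-- The sections over `U` of the twisted dualizing sheaf `ω_X(D)` of a reduced curve `X`, where
`D = ∑ D(x) x` is an effective divisor supported at regular points: the rational differentials `ω`
such that, for every closed point `x` of `U`, the sum over the points of the normalization above
`x` of the residues of `f ω` vanishes for all `f ∈ 𝒪_X(-D)_x = 𝔪_x ^ D(x)`.
For `D = 0` these are the regular differentials of Rosenlicht and Serre. -/
def omegaSections (D : X → ℕ) (U : X.Opens) : Submodule Γ(X, U) (RatDiff k X U) where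
  carrier := {ω | ∀ (x : X) (hx : x ∈ U), IsClosed ({x} : Set X) →
    ∀ f ∈ IsLocalRing.maximalIdeal (X.presheaf.stalk x) ^ D x, ResidueSumVanishes ω hx f}
  add_mem' {a b} ha hb x hx hc f hf _ r hr := by
    have h1 := ha x hx hc f hf r hr
    have h2 := hb x hx hc f hf r hr
    have (b' : Branch X x) : RatDiff.atBranch (a + b) hx b' = a.atBranch hx b' + b.atBranch hx b' :=
      rfl
    simp only [this, smul_add, map_add, Finset.sum_add_distrib, h1, h2, add_zero]
  zero_mem' x hx hc f hf _ r hr := by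
    have (b : Branch X x) : RatDiff.atBranch (0 : RatDiff k X U) hx b = 0 := rfl
    simp only [this, smul_zero, map_zero, Finset.sum_const_zero]
  smul_mem' g ω hω x hx hc f hf _ r hr := by
    have h := hω x hx hc (f * X.presheaf.germ U x hx g) (Ideal.mul_mem_right _ _ hf) r hr
    rw [← h]
    refine Finset.sum_congr rfl fun b _ => ?_
    have h1 : (g • ω).atBranch hx b = (X.evaluation U b.η
        (b.specializes.mem_open U.isOpen hx)).hom g • ω.atBranch hx b := rfl
    have h2 : (X.evaluation U b.η (b.specializes.mem_open U.isOpen hx)).hom g =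
        toBranch X b.specializes ((X.presheaf.germ U x hx).hom g) := by
      change _ = (X.presheaf.germ U x hx ≫ X.presheaf.stalkSpecializes b.specializes ≫
        X.residue b.η).hom g
      rw [TopCat.Presheaf.germ_stalkSpecializes_assoc]
      rfl
    rw [h1, h2, smul_smul, map_mul]

lemma res_mem_omegaSections (D : X → ℕ) {U V : X.Opens} (h : V ≤ U) {ω : RatDiff k X U}
    (hω : ω ∈ omegaSections k X D U) : ω.res h ∈ omegaSections k X D V :=
  fun x hx hc f hf _ r hr => hω x (h hx) hc f hf r hr

/-- The presheaf of abelian groups `U ↦ ω_X(D)(U)`. -/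
def omegaAb (D : X → ℕ) : (Opens X)ᵒᵖ ⥤ Ab.{u} where
  obj U := AddCommGrpCat.of (omegaSections k X D U.unop)
  map i := AddCommGrpCat.ofHom
    { toFun := fun ω => ⟨ω.1.res i.unop.le, res_mem_omegaSections k X D i.unop.le ω.2⟩
      map_zero' := rfl
      map_add' := fun _ _ => rfl }
  map_id _ := rfl
  map_comp _ _ := rfl

instance (D : X → ℕ) (U : (Opens X)ᵒᵖ) :
    Module (X.ringCatSheaf.obj.obj U) ((omegaAb k X D).obj U) :=
  inferInstanceAs (Module Γ(X, U.unop) (omegaSections k X D U.unop))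

lemma omegaAb_map_smul (D : X → ℕ) ⦃U V : (Opens X)ᵒᵖ⦄ (i : U ⟶ V)
    (g : X.ringCatSheaf.obj.obj U) (ω : (omegaAb k X D).obj U) :
    (omegaAb k X D).map i (g • ω) = X.ringCatSheaf.obj.map i g • (omegaAb k X D).map i ω := by
  apply Subtype.ext
  funext η
  have h : (X.evaluation U.unop η.1 (i.unop.le η.2.2)).hom g =
      (X.evaluation V.unop η.1 η.2.2).hom ((X.presheaf.map i).hom g) := by
    change _ = (X.presheaf.map i ≫ X.evaluation V.unop η.1 η.2.2).hom g
    rw [Scheme.evaluation, Scheme.evaluation, ← i.op_unop, X.presheaf.germ_res_assoc]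
  exact congrArg (· • (ω.1 : RatDiff k X U.unop) ⟨η.1, η.2.1, i.unop.le η.2.2⟩) h

lemma omegaAb_isSheaf (D : X → ℕ) : TopCat.Presheaf.IsSheaf (X := X) (omegaAb k X D) := by
  rw [TopCat.Presheaf.isSheaf_iff_isSheafUniqueGluing]
  intro ι U sf hsf
  have hc : ∀ (i j : ι) (η : X) (hη : η ∈ genericPoints X) (hi : η ∈ U i) (hj : η ∈ U j),
      (sf i).1 ⟨η, hη, hi⟩ = (sf j).1 ⟨η, hη, hj⟩ := fun i j η hη hi hj =>
    congrFun (congrArg Subtype.val (hsf i j)) ⟨η, hη, hi, hj⟩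
  have hex : ∀ η : GenericIn X (iSup U), ∃ i, η.1 ∈ U i := fun η => by
    simpa using η.2.2
  let ω : RatDiff k X (iSup U) := fun η =>
    (sf (hex η).choose).1 ⟨η.1, η.2.1, (hex η).choose_spec⟩
  have hω : ∀ i (η : X) (hη : η ∈ genericPoints X) (hi : η ∈ U i),
      ω ⟨η, hη, Opens.mem_iSup.2 ⟨i, hi⟩⟩ = (sf i).1 ⟨η, hη, hi⟩ := fun i η hη hi =>
    hc _ i η hη (hex ⟨η, hη, Opens.mem_iSup.2 ⟨i, hi⟩⟩).choose_spec hi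
  have hmem : ω ∈ omegaSections k X D (iSup U) := by
    intro x hx hcl f hf _ r hr
    obtain ⟨i, hi⟩ := Opens.mem_iSup.1 hx
    rw [← (sf i).2 x hi hcl f hf r hr]
    refine Finset.sum_congr rfl fun b _ => ?_
    have : ω.atBranch hx b = RatDiff.atBranch (sf i).1 hi b :=
      hω i b.η b.generic (b.specializes.mem_open (U i).isOpen hi)
    rw [this]
  refine ⟨⟨ω, hmem⟩, fun i => ?_, fun ω' hω' => ?_⟩
  · apply Subtype.ext
    funext η
    exact hω i η.1 η.2.1 η.2.2
  · apply Subtype.ext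
    funext η
    obtain ⟨i, hi⟩ := hex η
    exact (congrFun (congrArg Subtype.val (hω' i)) ⟨η.1, η.2.1, hi⟩).trans
      (hω i η.1 η.2.1 hi).symm

/-- The twisted dualizing sheaf `ω_X(D)` of a reduced curve `X` over `k`, as a sheaf of
`𝒪_X`-modules, for an effective divisor `D = ∑ D(x) x` supported at regular points. -/
def omegaTwist (D : X → ℕ) : X.Modules where
  val := PresheafOfModules.ofPresheaf (R := X.ringCatSheaf.obj) (omegaAb k X D)
    (omegaAb_map_smul k X D)
  isSheaf := omegaAb_isSheaf k X D

/-- The dualizing sheaf `ω_X` of a reduced curve `X` over `k`: the sheaf of rational differentials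
`ω` with `∑ Res (f ω) = 0` for all functions `f` regular at `x`, the sum being over the points of
the normalization above `x`. -/
def omega : X.Modules := omegaTwist k X 0

variable {k X}

/-- The rational differential underlying a section of `ω_X(D)`. -/
def sectionToRatDiff {D : X → ℕ} {U : X.Opens} (s : Γ(omegaTwist k X D, U)) : RatDiff k X U :=
  Subtype.val (p := fun ω => ω ∈ omegaSections k X D U) s

open Classical in
/-- The divisor `n q₁ + ⋯ + n qₘ`. -/
def multipleOfPoints (n : ℕ) {m : ℕ} (q : Fin m → X) : X → ℕ := fun x =>
  ∑ i, if x = q i then n else 0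

variable (k X)

/-- The dualizing sheaf is invertible near `p`, i.e. `X` is Gorenstein at `p`. -/
def IsGorensteinAt (p : X) : Prop :=
  ∃ U : X.Opens, p ∈ U ∧
    Nonempty ((omega k X).restrict U.ι ≅ SheafOfModules.unit U.toScheme.ringCatSheaf)

variable {k X}

/-- The section `σ` of `ω_X` over `U` generates `ω_X` on `U`: multiplication by `σ` is an
isomorphism from `𝒪_U` to `ω_X|_U`. -/
def IsGenerator {U : X.Opens} (σ : RatDiff k X U) : Prop :=
  σ ∈ omegaSections k X 0 U ∧ ∀ (V : X.Opens) (h : V ≤ U), ∀ τ ∈ omegaSections k X 0 V,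
    ∃! g : Γ(X, V), τ = g • σ.res h

/-- The rational differential `ω` has a pole of order exactly `n` at the regular point `q` of the
curve `X`: `t ^ n ω = u dt` for a uniformizer `t` and a unit `u` of the local ring at `q`. -/
def HasPoleOfOrder {U : X.Opens} (ω : RatDiff k X U) (q : X) (n : ℕ) : Prop :=
  q ∈ U ∧ ∃ t u : X.presheaf.stalk q,
    IsLocalRing.maximalIdeal (X.presheaf.stalk q) = Ideal.span {t} ∧ IsUnit u ∧
    ∀ (η : GenericIn X U) (h : η.1 ⤳ q),
      toBranch X h t ^ n • ω η =
        toBranch X h u • KaehlerDifferential.D k (X.residueField η.1) (toBranch X h t)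

end RatDiff

/-! ### Pullback of rational differentials -/

section Pullback

variable (k : Type u) [Field k] {X Y : Scheme.{u}} [X.Over (Spec (.of k))] [Y.Over (Spec (.of k))]
  (f : Y ⟶ X) [f.IsOver (Spec (.of k))]

lemma residueFieldMap_algebraMap (y : Y) (a : k) :
    (f.residueFieldMap y).hom (algebraMap k (X.residueField (f y)) a) =
      algebraMap k (Y.residueField y) a := by
  have h : X.presheaf.germ ⊤ (f y) (Opens.mem_top (f y)) ≫ X.residue (f y) ≫ f.residueFieldMap y =
      f.appTop ≫ Y.presheaf.germ ⊤ y (Opens.mem_top y) ≫ Y.residue y := by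
    rw [Scheme.residue_residueFieldMap]
    exact Scheme.Hom.germ_stalkMap_assoc f ⊤ y (Opens.mem_top (f y)) (Y.residue y)
  have h2 : (Scheme.ΓSpecIso (.of k)).inv ≫ (X ↘ Spec (.of k)).appTop ≫
      X.presheaf.germ ⊤ (f y) (Opens.mem_top (f y)) ≫ X.residue (f y) ≫ f.residueFieldMap y =
      (Scheme.ΓSpecIso (.of k)).inv ≫ (Y ↘ Spec (.of k)).appTop ≫
        Y.presheaf.germ ⊤ y (Opens.mem_top y) ≫ Y.residue y := by
    rw [h, ← Scheme.Hom.comp_appTop_assoc, comp_over]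
  exact congrArg (fun φ => φ.hom a) h2

/-- The pullback `Ω_{κ(f(y))/k} → Ω_{κ(y)/k}` of differentials. -/
def kaehlerPullback (y : Y) : Ω[X.residueField (f y)⁄k] →+ Ω[Y.residueField y⁄k] :=
  letI : Algebra (X.residueField (f y)) (Y.residueField y) := (f.residueFieldMap y).hom.toAlgebra
  haveI : IsScalarTower k (X.residueField (f y)) (Y.residueField y) :=
    .of_algebraMap_eq fun a => (residueFieldMap_algebraMap k f y a).symm
  (KaehlerDifferential.map k k (X.residueField (f y)) (Y.residueField y)).toAddMonoidHom

open Classical in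
/-- The pullback of a rational differential along a morphism `f : Y ⟶ X` that maps generic points
of components to generic points of components (such as a normalization); it is set to zero on
the components of `Y` for which this fails. -/
def pullbackRatDiff {U : X.Opens} (ω : RatDiff k X U) : RatDiff k Y (f ⁻¹ᵁ U) := fun η =>
  if h : f η.1 ∈ genericPoints X then kaehlerPullback k f η.1 (ω ⟨f η.1, h, η.2.2⟩) else 0

end Pullback

/-! ### The normalization at a point -/

section Normalization

variable (k : Type u) [Field k] (C : Scheme.{u}) [C.Over (Spec (.of k))] [IsCurve k C] (p : C)

/-- The complement of a closed point `p`. -/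
def complement (C : Scheme.{u}) (p : C) : C.Opens := ⟨(closure {p})ᶜ, isClosed_closure.isOpen_compl⟩

lemma quasiCompact_complement_ι (k : Type u) [Field k] (C : Scheme.{u}) [C.Over (Spec (.of k))]
    [IsCurve k C] (p : C) : QuasiCompact (complement C p).ι := by
  have := IsCurve.locallyOfFiniteType (k := k) (C := C)
  have : IsLocallyNoetherian C := LocallyOfFiniteType.isLocallyNoetherian (C ↘ Spec (.of k))
  infer_instance

/-- The normalization `C̃` of the curve `C` at the closed point `p`: the relative spectrum of
the integral closure of `𝒪_C` in `j_* 𝒪_{C ∖ p}`, where `j` is the inclusion of `C ∖ p`. It is `C`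
away from `p`, and near the isolated singular point `p` it is the spectrum of the integral closure
of `𝒪_C` in its total ring of fractions. -/
def normalizationAt : Scheme.{u} :=
  haveI := quasiCompact_complement_ι k C p
  (complement C p).ι.normalization

/-- The normalization map `π : C̃ ⟶ C` at `p`. -/
def normalizationMap : normalizationAt k C p ⟶ C :=
  haveI := quasiCompact_complement_ι k C p
  (complement C p).ι.fromNormalization

instance : (normalizationAt k C p).Over (Spec (.of k)) :=
  ⟨normalizationMap k C p ≫ C ↘ Spec (.of k)⟩

instance : (normalizationMap k C p).IsOver (Spec (.of k)) := ⟨rfl⟩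

end Normalization

end RosenlichtCurve

end

open RosenlichtCurve

/-!
Let `O` be the local ring of the curve `X` at the elliptic `m`-fold point `p`. The model rings are
parametrized explicitly by `m` branches, and in each case `O` turns out to be, up to completion,
the ring of families `(g₁, …, gₘ)` of power series with equal constant terms whose linear terms
satisfy a single relation `∑ cᵢ gᵢ'(0) = 0` with all `cᵢ ≠ 0` (`IsSeriesModel`, `IsElliptic`).
Everything else is deduced from this description, in which the conductor is `∏ (t²)`.

The branches of the curve at `p` in the sense of valuation rings dominating `O` correspond to these
`m` formal branches (`IsFormalBranches.branchEquiv`). Differentials are expanded along a branch as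
`h(t) dt / t`, the residue being the constant coefficient of `h` (`residue_eq_coeff_zero`). Testing
against the conductor shows that sections of `ω_X` satisfy `ord h ≥ -1`. If the expansions are
`hᵢ = aᵢ t⁻¹ + bᵢ + …`, then the residue conditions become `∑ᵢ (bᵢ f(p) + aᵢ fᵢ'(0)) = 0` for
all `f ∈ O`, that is, `∑ bᵢ = 0` and `(aᵢ)` is proportional to `(cᵢ)`. Choose a rational
differential `σ` with `hᵢ = cᵢ t⁻¹ + O(t)` on every branch (`IsElliptic.exists_isAdapted`). The
conditions on a section `τ = g σ` then say that the functions `gᵢ` have equal values and satisfy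
the relation defining `O`, so `g ∈ O` (`IsElliptic.exists_eq_smul`) and `σ` generates the stalk at
`p`. At the other points near `p` the differential `σ` is `u dt` with `u` a unit and `t` a
uniformizer, and there too it is a generator; for this one needs that the differentials of the
function fields are one-dimensional, spanned by the differential of a uniformizer of a branch
(`IsFormalBranches.isExactSpan`). Hence `σ` generates `ω_X` near `p`
(`IsElliptic.exists_isGenerator`), and the curve is Gorenstein at `p`.

The normalization `π : Y ⟶ X` at `p` is used only through the properties `IsNormalizationAt`. Since
the conductor multiplies functions regular along all branches into `O`, such functions are integral
over `O` and define functions on `Y` (`IsNormalizationAt.exists_section`). Functions separating the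
branches show that the points above `p` are exactly the centers of the branches and that their
local rings are the corresponding discrete valuation rings (`IsNormalizationAt.exists_isCenter`,
`exists_point`, `eq_of_isCenter`). There `σ` has expansion `cᵢ t⁻² dt + …`, a double pole, so it
generates `ω_Y(2 p₁ + ⋯ + 2 pₘ)`.

For the isomorphism `π^* ω_X ≅ ω_Y(2 p₁ + ⋯ + 2 pₘ)`, pulling back differentials gives a morphism
`ω_X ⟶ π_* ω_Y(2 p₁ + ⋯ + 2 pₘ)`. Its adjoint is an isomorphism because the sections of the target
are locally multiples of pulled back sections, and because the linear relations between the latter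
already hold in `π^* ω_X` (`isIso_of_locally_smul`): near the points above `p` both statements
follow from the generator `σ`, and elsewhere `π` is locally an isomorphism.
-/

noncomputable section

namespace EllipticPoint

/-! ### The model rings `k[[x]] / I` and their branches -/

section Series

variable {k : Type*} [Field k] {n : ℕ}

/-- The maximal ideal `(x₁, …, xₙ)` of `k[[x₁, …, xₙ]]`. -/
def varIdeal (k : Type*) [Field k] (n : ℕ) : Ideal (MvPowerSeries (Fin n) k) :=
  Ideal.span (Set.range MvPowerSeries.X)

lemma monomial_mem_varIdeal_pow (d : Fin n →₀ ℕ) {N : ℕ} (h : N ≤ d.degree) (r : k) :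
    MvPowerSeries.monomial d r ∈ varIdeal k n ^ N := by
  induction N generalizing d with
  | zero => simp
  | succ N ih =>
    obtain ⟨j, hj⟩ : ∃ j, d j ≠ 0 := by
      by_contra! hc
      have : d = 0 := Finsupp.ext hc
      simp [this] at h
    have hle : Finsupp.single j 1 ≤ d := by
      rw [Finsupp.single_le_iff]; omega
    have hd : d = Finsupp.single j 1 + (d - Finsupp.single j 1) := (add_tsub_cancel_of_le hle).symm
    have hdeg : d.degree = 1 + (d - Finsupp.single j 1).degree := by
      conv_lhs => rw [hd]
      simp [map_add, Finsupp.degree_single]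
    have : MvPowerSeries.monomial d r =
        MvPowerSeries.X j * MvPowerSeries.monomial (d - Finsupp.single j 1) r := by
      rw [MvPowerSeries.X, MvPowerSeries.monomial_mul_monomial, ← hd, one_mul]
    rw [this, pow_succ']
    exact Ideal.mul_mem_mul (Ideal.subset_span ⟨j, rfl⟩) (ih _ (by omega))

lemma mem_varIdeal_pow_of_coeff (N : ℕ) (f : MvPowerSeries (Fin n) k)
    (h : ∀ d : Fin n →₀ ℕ, d.degree < N → MvPowerSeries.coeff d f = 0) :
    f ∈ varIdeal k n ^ N := by
  classical
  induction N generalizing f with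
  | zero => simp
  | succ N ih =>
    have hp : ∀ d : Fin n →₀ ℕ, d ≠ 0 → ∃ j, d j ≠ 0 := fun d hd => by
      by_contra! hc
      exact hd (Finsupp.ext hc)
    -- `X j` divides the part of `f` made of the monomials for which `j` is the chosen variable
    let pick : (Fin n →₀ ℕ) → Option (Fin n) := fun d => if hd : d ≠ 0 then some (hp d hd).choose
      else none
    have hpick : ∀ d j, pick d = some j → d j ≠ 0 := by
      intro d j hj
      simp only [pick] at hj
      split_ifs at hj with hd
      · rw [Option.some.injEq] at hj
        exact hj ▸ (hp d hd).choose_spec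
    let g : Fin n → MvPowerSeries (Fin n) k := fun j e =>
      if pick (e + Finsupp.single j 1) = some j then
        MvPowerSeries.coeff (e + Finsupp.single j 1) f else 0
    have hgc : ∀ j e, MvPowerSeries.coeff e (g j) =
      if pick (e + Finsupp.single j 1) = some j then
        MvPowerSeries.coeff (e + Finsupp.single j 1) f else 0 := fun j e => rfl
    have hf : f = ∑ j, MvPowerSeries.X j * g j := by
      ext d
      rw [map_sum]
      have hterm : ∀ j, MvPowerSeries.coeff d (MvPowerSeries.X j * g j) =
          if pick d = some j then MvPowerSeries.coeff d f else 0 := by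
        intro j
        rw [MvPowerSeries.X, MvPowerSeries.coeff_monomial_mul, hgc]
        by_cases hle : Finsupp.single j 1 ≤ d
        · rw [if_pos hle, tsub_add_cancel_of_le hle, one_mul]
        · rw [if_neg hle, if_neg]
          intro hj
          apply hle
          rw [Finsupp.single_le_iff]
          have := hpick d j hj
          omega
      rw [Finset.sum_congr rfl fun j _ => hterm j]
      by_cases hd : d = 0
      · subst hd
        rw [h 0 (by simp)]
        simp
      · have : pick d = some (hp d hd).choose := by simp [pick, hd]
        simp [this]
    rw [hf, pow_succ']
    refine Ideal.sum_mem _ fun j _ => Ideal.mul_mem_mul (Ideal.subset_span ⟨j, rfl⟩) (ih _ ?_)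
    intro e he
    rw [hgc]
    split_ifs
    · exact h _ (by simp [map_add, Finsupp.degree_single]; omega)
    · rfl

lemma exists_polynomial_add (N : ℕ) (f : MvPowerSeries (Fin n) k) :
    ∃ p : MvPolynomial (Fin n) k, f - (p : MvPowerSeries (Fin n) k) ∈ varIdeal k n ^ N := by
  refine ⟨f.truncTotal N, mem_varIdeal_pow_of_coeff N _ fun d hd => ?_⟩
  rw [map_sub, MvPolynomial.coeff_coe, MvPowerSeries.coeff_truncTotal _ hd, sub_self]

/-- The maps `ψᵢ : k[[x]] → k[[t]]` present `k[[x]] / I` as the subring of `∏ᵢ k[[t]]` of those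
families with equal constant terms whose linear terms satisfy the relation `∑ cᵢ gᵢ'(0) = 0`, up to
completion: the `t`-adic and the `(x)`-adic topology agree, and the image is dense. -/
structure IsSeriesModel {ι : Type*} [Fintype ι] (I : Ideal (MvPowerSeries (Fin n) k))
    (ψ : ι → MvPowerSeries (Fin n) k →ₐ[k] PowerSeries k) (c : ι → k) : Prop where
  c_ne : ∀ i, c i ≠ 0
  kills : ∀ i, ∀ f ∈ I, ψ i f = 0
  dvd : ∀ i, ∀ f ∈ varIdeal k n, PowerSeries.X ∣ ψ i f
  lin : ∀ f, ∑ i, c i * PowerSeries.coeff 1 (ψ i f) = 0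
  sep : ∀ N, ∃ M, ∀ f, (∀ i, PowerSeries.X ^ M ∣ ψ i f) → f ∈ I ⊔ varIdeal k n ^ N
  approx : ∀ g : ι → PowerSeries k,
    (∀ i j, PowerSeries.constantCoeff (g i) = PowerSeries.constantCoeff (g j)) →
    ∑ i, c i * PowerSeries.coeff 1 (g i) = 0 → ∀ N, ∃ f, ∀ i, PowerSeries.X ^ N ∣ g i - ψ i f

/-- The substitution `xⱼ ↦ aⱼ(t)`. -/
def substHom (a : Fin n → PowerSeries k) (ha : ∀ j, PowerSeries.X ∣ a j) :
    MvPowerSeries (Fin n) k →ₐ[k] PowerSeries k :=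
  MvPowerSeries.substAlgHom (MvPowerSeries.hasSubst_of_constantCoeff_zero (a := a)
    fun j => PowerSeries.X_dvd_iff.1 (ha j))

lemma substHom_X (a : Fin n → PowerSeries k) (ha : ∀ j, PowerSeries.X ∣ a j) (j : Fin n) :
    substHom a ha (MvPowerSeries.X j) = a j :=
  MvPowerSeries.substAlgHom_X _ j

lemma substHom_monomial (a : Fin n → PowerSeries k) (ha : ∀ j, PowerSeries.X ∣ a j)
    (d : Fin n →₀ ℕ) :
    substHom a ha (MvPowerSeries.monomial d 1) = d.prod fun j e => a j ^ e :=
  (MvPowerSeries.substAlgHom_monomial _ d 1).trans (by rw [map_one, one_mul])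

lemma substHom_varIdeal_pow (a : Fin n → PowerSeries k) (ha : ∀ j, PowerSeries.X ∣ a j) (N : ℕ)
    {f : MvPowerSeries (Fin n) k} (hf : f ∈ varIdeal k n ^ N) :
    PowerSeries.X ^ N ∣ substHom a ha f := by
  have h1 : varIdeal k n ≤ (Ideal.span {PowerSeries.X}).comap (substHom a ha).toRingHom := by
    refine Ideal.span_le.2 ?_
    rintro _ ⟨j, rfl⟩
    change substHom a ha (MvPowerSeries.X j) ∈ Ideal.span {PowerSeries.X}
    rw [substHom_X]
    exact Ideal.mem_span_singleton.2 (ha j)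
  have h2 := Ideal.pow_right_mono h1 N hf
  have h3 := Ideal.le_comap_pow (substHom a ha).toRingHom N h2
  rw [Ideal.span_singleton_pow] at h3
  exact Ideal.mem_span_singleton.1 h3

/-- A criterion for `IsSeriesModel` by normal forms: `NF N` assigns to a family of power series
the combination of normal monomials that has the same terms of low order. -/
lemma IsSeriesModel.of_normalForm {ι : Type*} [Fintype ι] {I : Ideal (MvPowerSeries (Fin n) k)}
    (a : ι → Fin n → PowerSeries k) (ha : ∀ i j, PowerSeries.X ∣ a i j) (c : ι → k)
    (hc : ∀ i, c i ≠ 0) (hI : ∀ i, ∀ f ∈ I, substHom (a i) (ha i) f = 0)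
    (hvar : ∀ j, ∑ i, c i * PowerSeries.coeff 1 (a i j) = 0)
    (L : ℕ → ℕ) (hL : ∀ N, N ≤ L N)
    (NF : ℕ → (ι → PowerSeries k) →ₗ[k] MvPowerSeries (Fin n) k)
    (hmono : ∀ N (d : Fin n →₀ ℕ), MvPowerSeries.monomial d (1 : k) -
      NF N (fun i => substHom (a i) (ha i) (MvPowerSeries.monomial d 1)) ∈ I ⊔ varIdeal k n ^ N)
    (hz : ∀ N g, (∀ i, PowerSeries.X ^ (L N) ∣ g i) → NF N g = 0)
    (happ : ∀ N (g : ι → PowerSeries k),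
      (∀ i j, PowerSeries.constantCoeff (g i) = PowerSeries.constantCoeff (g j)) →
      ∑ i, c i * PowerSeries.coeff 1 (g i) = 0 →
      ∀ i, PowerSeries.X ^ N ∣ g i - substHom (a i) (ha i) (NF N g)) :
    IsSeriesModel I (fun i => substHom (a i) (ha i)) c where
  c_ne := hc
  kills := hI
  dvd i f hf := by
    have := substHom_varIdeal_pow (a i) (ha i) 1 (f := f) (by rwa [pow_one])
    rwa [pow_one] at this
  lin f := by
    -- the functional vanishes on constants, on the variables and on products of two variables
    have hsq : ∀ r ∈ varIdeal k n ^ 2, ∀ i,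
        PowerSeries.coeff 1 (substHom (a i) (ha i) r) = 0 := fun r hr i =>
      PowerSeries.X_pow_dvd_iff.1 (substHom_varIdeal_pow (a i) (ha i) 2 hr) 1 (by norm_num)
    have hmon : ∀ (d : Fin n →₀ ℕ), ∑ i, c i *
        PowerSeries.coeff 1 (substHom (a i) (ha i) (MvPowerSeries.monomial d 1)) = 0 := by
      intro d
      rcases lt_or_ge d.degree 2 with h | h
      · have h' : d.degree = 0 ∨ d.degree = 1 := by omega
        rcases h' with h | h
        · rw [Finsupp.degree_eq_zero_iff] at h
          subst h
          refine Finset.sum_eq_zero fun i _ => ?_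
          rw [substHom_monomial]
          simp [PowerSeries.coeff_one]
        · obtain ⟨j, rfl⟩ : ∃ j, d = Finsupp.single j 1 := by
            obtain ⟨j, hj⟩ : ∃ j, d j ≠ 0 := by
              by_contra! hc
              have : d = 0 := Finsupp.ext hc
              simp [this] at h
            have hle : Finsupp.single j 1 ≤ d := by
              rw [Finsupp.single_le_iff]; omega
            have hd : d = Finsupp.single j 1 + (d - Finsupp.single j 1) :=
              (add_tsub_cancel_of_le hle).symm
            rw [hd, map_add, Finsupp.degree_single] at h
            have h0 : d - Finsupp.single j 1 = 0 := (Finsupp.degree_eq_zero_iff _).1 (by omega)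
            exact ⟨j, by rw [hd, h0, add_zero]⟩
          change ∑ i, c i * PowerSeries.coeff 1 (substHom (a i) (ha i) (MvPowerSeries.X j)) = 0
          simp_rw [substHom_X]
          exact hvar j
      · exact Finset.sum_eq_zero fun i _ => by
          rw [hsq _ (monomial_mem_varIdeal_pow d h 1), mul_zero]
    obtain ⟨p, hp⟩ := exists_polynomial_add 2 f
    have hpol : ∀ p : MvPolynomial (Fin n) k, ∑ i, c i *
        PowerSeries.coeff 1 (substHom (a i) (ha i) (p : MvPowerSeries (Fin n) k)) = 0 := by
      intro p
      induction p using MvPolynomial.induction_on' with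
      | monomial d r =>
        have : ((MvPolynomial.monomial d r : MvPolynomial (Fin n) k) : MvPowerSeries (Fin n) k) =
            r • MvPowerSeries.monomial d 1 := by
          rw [MvPolynomial.coe_monomial, ← map_smul, smul_eq_mul, mul_one]
        simp only [this, map_smul, smul_eq_mul, mul_left_comm _ r, ← Finset.mul_sum, hmon, mul_zero]
      | add p q hp hq =>
        simp only [MvPolynomial.coe_add, map_add, mul_add, Finset.sum_add_distrib, hp, hq, add_zero]
    have : ∀ i, PowerSeries.coeff 1 (substHom (a i) (ha i) f) =
        PowerSeries.coeff 1 (substHom (a i) (ha i) (p : MvPowerSeries (Fin n) k)) := fun i => by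
      have := hsq _ hp i
      rwa [map_sub, map_sub, sub_eq_zero] at this
    simp only [this, hpol]
  sep N := by
    refine ⟨L N, fun f hf => ?_⟩
    have key : ∀ f : MvPowerSeries (Fin n) k, f - NF N (fun i => substHom (a i) (ha i) f) ∈
        I ⊔ varIdeal k n ^ N := by
      intro f
      obtain ⟨p, hp⟩ := exists_polynomial_add (L N) f
      have hpol : ∀ p : MvPolynomial (Fin n) k, (p : MvPowerSeries (Fin n) k) -
          NF N (fun i => substHom (a i) (ha i) (p : MvPowerSeries (Fin n) k)) ∈
          I ⊔ varIdeal k n ^ N := by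
        intro p
        induction p using MvPolynomial.induction_on' with
        | monomial d r =>
          have h1 : ((MvPolynomial.monomial d r : MvPolynomial (Fin n) k) :
              MvPowerSeries (Fin n) k) = r • MvPowerSeries.monomial d 1 := by
            rw [MvPolynomial.coe_monomial, ← map_smul, smul_eq_mul, mul_one]
          have h2 : (fun i => substHom (a i) (ha i) (r • MvPowerSeries.monomial d (1 : k))) =
              r • fun i => substHom (a i) (ha i) (MvPowerSeries.monomial d (1 : k)) := by
            funext i; simp
          rw [h1, h2, map_smul, ← smul_sub, ← mul_one r, ← smul_eq_mul, smul_assoc, one_smul,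
            MvPowerSeries.smul_eq_C_mul]
          exact Ideal.mul_mem_left _ _ (hmono N d)
        | add p q hp hq =>
          have h2 : (fun i => substHom (a i) (ha i)
              (((p + q : MvPolynomial (Fin n) k)) : MvPowerSeries (Fin n) k)) =
              (fun i => substHom (a i) (ha i) (p : MvPowerSeries (Fin n) k)) +
              fun i => substHom (a i) (ha i) (q : MvPowerSeries (Fin n) k) := by
            funext i; simp
          rw [h2, map_add, MvPolynomial.coe_add, add_sub_add_comm]
          exact Ideal.add_mem _ hp hq
      have h2 : (fun i => substHom (a i) (ha i) f) =
          (fun i => substHom (a i) (ha i) (p : MvPowerSeries (Fin n) k)) +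
          fun i => substHom (a i) (ha i) (f - (p : MvPowerSeries (Fin n) k)) := by
        funext i; simp
      have h3 : NF N (fun i => substHom (a i) (ha i) (f - (p : MvPowerSeries (Fin n) k))) = 0 :=
        hz N _ fun i => substHom_varIdeal_pow (a i) (ha i) _ hp
      rw [h2, map_add, h3, add_zero]
      have h4 : f - (NF N) (fun i => substHom (a i) (ha i) (p : MvPowerSeries (Fin n) k)) =
          (f - (p : MvPowerSeries (Fin n) k)) + ((p : MvPowerSeries (Fin n) k) -
          (NF N) (fun i => substHom (a i) (ha i) (p : MvPowerSeries (Fin n) k))) := by ring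
      rw [h4]
      exact Ideal.add_mem _ (Ideal.mem_sup_right (Ideal.pow_le_pow_right (hL N) hp)) (hpol p)
    have := key f
    rwa [hz N _ hf, sub_zero] at this
  approx g h0 h1 N := ⟨NF N g, happ N g h0 h1⟩

/-- A criterion for `IsSeriesModel` when the images `bᵢ tʷ` of the monomials are monomials: `v w i`
are normal forms, and `C (M w i j) * X ^ w` is the image of `v w j` on the branch `i`. -/
lemma IsSeriesModel.of_monomials {ι : Type*} [Fintype ι] {I : Ideal (MvPowerSeries (Fin n) k)}
    (a : ι → Fin n → PowerSeries k) (ha : ∀ i j, PowerSeries.X ∣ a i j) (c : ι → k)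
    (hc : ∀ i, c i ≠ 0) (hI : ∀ i, ∀ f ∈ I, substHom (a i) (ha i) f = 0)
    (hvar : ∀ j, ∑ i, c i * PowerSeries.coeff 1 (a i j) = 0)
    (r : ℕ) (hr : 0 < r) (v : ℕ → ι → MvPowerSeries (Fin n) k) (M : ℕ → ι → ι → k)
    (hv : ∀ w i j, substHom (a i) (ha i) (v w j) = PowerSeries.monomial w (M w i j))
    (hM : ∀ g : ι → PowerSeries k,
      (∀ i j, PowerSeries.constantCoeff (g i) = PowerSeries.constantCoeff (g j)) →
      ∑ i, c i * PowerSeries.coeff 1 (g i) = 0 → ∀ w i,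
        ∑ j, PowerSeries.coeff w (g j) * M w i j = PowerSeries.coeff w (g i))
    (hmono : ∀ d : Fin n →₀ ℕ, ∃ (w : ℕ) (b : ι → k), w ≤ r * d.degree ∧
      (∀ i, substHom (a i) (ha i) (MvPowerSeries.monomial d 1) = PowerSeries.monomial w (b i)) ∧
      MvPowerSeries.monomial d (1 : k) - ∑ i, b i • v w i ∈ I) :
    IsSeriesModel I (fun i => substHom (a i) (ha i)) c := by
  refine .of_normalForm a ha c hc hI hvar (fun N => r * N) (fun N => Nat.le_mul_of_pos_left N hr)
    (fun N => ∑ w ∈ Finset.range (r * N), ∑ i,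
      ((PowerSeries.coeff w).comp (LinearMap.proj i)).smulRight (v w i)) ?_ ?_ ?_
  · intro N d
    obtain ⟨w, b, hw, hb, hbI⟩ := hmono d
    have : (∑ w' ∈ Finset.range (r * N), ∑ i,
        ((PowerSeries.coeff w').comp (LinearMap.proj i)).smulRight (v w' i))
          (fun i => substHom (a i) (ha i) (MvPowerSeries.monomial d 1)) =
        if w < r * N then ∑ i, b i • v w i else 0 := by
      simp only [LinearMap.sum_apply, LinearMap.smulRight_apply, LinearMap.comp_apply,
        LinearMap.proj_apply, hb, PowerSeries.coeff_monomial]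
      have (w' : ℕ) : ∑ i, (if w' = w then b i else 0) • v w' i =
          if w' = w then ∑ i, b i • v w i else 0 := by
        split_ifs with h
        · rw [h]
        · simp
      simp [Finset.sum_ite_eq']
    rw [this]
    split_ifs with h
    · exact Ideal.mem_sup_left hbI
    · rw [sub_zero]
      refine Ideal.mem_sup_right (monomial_mem_varIdeal_pow d ?_ 1)
      exact Nat.le_of_mul_le_mul_left (le_trans (not_lt.1 h) hw) hr
  · intro N g hg
    simp only [LinearMap.sum_apply, LinearMap.smulRight_apply, LinearMap.comp_apply,
      LinearMap.proj_apply]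
    refine Finset.sum_eq_zero fun w hw => Finset.sum_eq_zero fun i _ => ?_
    rw [PowerSeries.X_pow_dvd_iff.1 (hg i) w (Finset.mem_range.1 hw), zero_smul]
  · intro N g h0 h1 i
    rw [PowerSeries.X_pow_dvd_iff]
    intro w hw
    simp only [LinearMap.sum_apply, LinearMap.smulRight_apply, LinearMap.comp_apply,
      LinearMap.proj_apply, map_sum, map_smul, hv, map_sub, PowerSeries.coeff_monomial,
      smul_eq_mul, mul_ite, mul_zero]
    rw [Finset.sum_comm]
    have hw' : w ∈ Finset.range (r * N) :=
      Finset.mem_range.2 (lt_of_lt_of_le hw (Nat.le_mul_of_pos_left N hr))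
    simp only [Finset.sum_ite_eq, hw', if_true]
    rw [hM g h0 h1, sub_self]

end Series

section Models

variable {k : Type*} [Field k]

lemma monomial_fin_two (d : Fin 2 →₀ ℕ) : MvPowerSeries.monomial d (1 : k) =
    MvPowerSeries.X 0 ^ d 0 * MvPowerSeries.X 1 ^ d 1 := by
  rw [MvPowerSeries.monomial_one_eq, Finsupp.prod_fintype _ _ (fun i => pow_zero _),
    Fin.prod_univ_two]

lemma degree_fin_two (d : Fin 2 →₀ ℕ) : d.degree = d 0 + d 1 := by
  rw [Finsupp.degree_eq_sum, Fin.sum_univ_two]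

lemma substHom_span {n : ℕ} (a : Fin n → PowerSeries k) (ha : ∀ j, PowerSeries.X ∣ a j)
    (S : Set (MvPowerSeries (Fin n) k)) (hS : ∀ f ∈ S, substHom a ha f = 0) :
    ∀ f ∈ Ideal.span S, substHom a ha f = 0 := by
  have : Ideal.span S ≤ RingHom.ker (substHom a ha).toRingHom := Ideal.span_le.2 hS
  exact fun f hf => this hf

open MvPowerSeries in
/-- The cusp is parametrized by `(t², t³)`. -/
lemma cusp_isSeriesModel : ∃ ψ c, IsSeriesModel (ι := Fin 1)
    (Ideal.span {X 1 ^ 2 - X 0 ^ 3} : Ideal (MvPowerSeries (Fin 2) k)) ψ c := by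
  let a : Fin 1 → Fin 2 → PowerSeries k := fun _ => ![PowerSeries.X ^ 2, PowerSeries.X ^ 3]
  have ha : ∀ i j, PowerSeries.X ∣ a i j := by
    intro i j
    fin_cases j <;> exact dvd_pow_self _ (by norm_num)
  refine ⟨_, fun _ => 1, IsSeriesModel.of_monomials a ha _ (fun _ => one_ne_zero) ?_ ?_ 3
    (by norm_num) (fun w _ => if w = 1 then 0 else X 0 ^ ((w - 3 * (w % 2)) / 2) * X 1 ^ (w % 2))
    (fun w _ _ => if w = 1 then 0 else 1) ?_ ?_ ?_⟩
  · intro i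
    refine substHom_span _ _ _ ?_
    rintro f rfl
    simp only [map_sub, map_pow, substHom_X]
    change (PowerSeries.X ^ 3) ^ 2 - (PowerSeries.X ^ 2) ^ 3 = _
    ring
  · intro j
    fin_cases j <;> simp [a, PowerSeries.coeff_X_pow]
  · intro w i j
    split_ifs with h
    · simp
    · simp only [map_mul, map_pow, substHom_X]
      change (PowerSeries.X ^ 2) ^ _ * (PowerSeries.X ^ 3) ^ _ = _
      rw [← pow_mul, ← pow_mul, ← pow_add, ← PowerSeries.X_pow_eq]
      congr 1
      omega
  · intro g _ h1 w i
    fin_cases i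
    by_cases h : w = 1
    · subst h
      simpa using h1.symm
    · simp [h]
  · intro d
    refine ⟨2 * d 0 + 3 * d 1, fun _ => 1, by rw [degree_fin_two]; omega, ?_, ?_⟩
    · intro i
      rw [monomial_fin_two]
      simp only [map_mul, map_pow, substHom_X]
      change (PowerSeries.X ^ 2) ^ _ * (PowerSeries.X ^ 3) ^ _ = _
      rw [← pow_mul, ← pow_mul, ← pow_add, ← PowerSeries.X_pow_eq]
    · rw [monomial_fin_two]
      simp only [Finset.univ_unique, Finset.sum_singleton, one_smul]
      rw [if_neg (by omega), ← Ideal.Quotient.eq]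
      have h1 : (2 * d 0 + 3 * d 1 - 3 * ((2 * d 0 + 3 * d 1) % 2)) / 2 = d 0 + 3 * (d 1 / 2) := by
        omega
      have h2 : (2 * d 0 + 3 * d 1) % 2 = d 1 % 2 := by omega
      rw [h1, h2]
      have hrel : Ideal.Quotient.mk (Ideal.span {X 1 ^ 2 - X 0 ^ 3} :
          Ideal (MvPowerSeries (Fin 2) k)) (X 1) ^ 2 = Ideal.Quotient.mk _ (X 0) ^ 3 := by
        rw [← map_pow, ← map_pow]
        exact Ideal.Quotient.eq.2 (Ideal.subset_span rfl)
      simp only [map_mul, map_pow]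
      conv_lhs => rw [← Nat.div_add_mod (d 1) 2]
      rw [pow_add, pow_mul, hrel, pow_add, pow_mul]
      ring

open MvPowerSeries in
/-- The branches of the tacnode are parametrized by `(t, 0)` and `(t, t²)`. -/
lemma tacnode_isSeriesModel : ∃ ψ c, IsSeriesModel (ι := Fin 2)
    (Ideal.span {X 1 ^ 2 - X 1 * X 0 ^ 2} : Ideal (MvPowerSeries (Fin 2) k)) ψ c := by
  let a : Fin 2 → Fin 2 → PowerSeries k :=
    ![![PowerSeries.X, 0], ![PowerSeries.X, PowerSeries.X ^ 2]]
  have ha : ∀ i j, PowerSeries.X ∣ a i j := by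
    intro i j
    fin_cases i <;> fin_cases j <;> simp [a, pow_two]
  have e00 : a 0 0 = PowerSeries.X := rfl
  have e01 : a 0 1 = 0 := rfl
  have e10 : a 1 0 = PowerSeries.X := rfl
  have e11 : a 1 1 = PowerSeries.X ^ 2 := rfl
  let y : ℕ → MvPowerSeries (Fin 2) k := fun w => if 2 ≤ w then X 0 ^ (w - 2) * X 1 else 0
  have hy0 : ∀ w, substHom (a 0) (ha 0) (y w) = 0 := by
    intro w
    simp only [y]
    split_ifs <;> simp [substHom_X, e01]
  have hy1 : ∀ w, substHom (a 1) (ha 1) (y w) =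
      if 2 ≤ w then PowerSeries.monomial w 1 else 0 := by
    intro w
    simp only [y]
    split_ifs with h
    · simp only [map_mul, map_pow, substHom_X, e10, e11]
      rw [← pow_add, ← PowerSeries.X_pow_eq]
      congr 1
      omega
    · simp
  refine ⟨_, ![1, -1], IsSeriesModel.of_monomials a ha _ ?_ ?_ ?_ 2
    (by norm_num) (fun w => ![X 0 ^ w - y w, y w])
    (fun w => ![![1, 0], ![if 2 ≤ w then 0 else 1, if 2 ≤ w then 1 else 0]]) ?_ ?_ ?_⟩
  · intro i
    fin_cases i <;> simp
  · intro i
    refine substHom_span _ _ _ ?_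
    rintro f rfl
    simp only [map_sub, map_pow, map_mul, substHom_X]
    fin_cases i
    · change a 0 1 ^ 2 - a 0 1 * a 0 0 ^ 2 = 0
      rw [e01]; ring
    · change a 1 1 ^ 2 - a 1 1 * a 1 0 ^ 2 = 0
      rw [e11, e10]; ring
  · intro j
    rw [Fin.sum_univ_two]
    fin_cases j
    · change (1 : k) * PowerSeries.coeff 1 (a 0 0) + -1 * PowerSeries.coeff 1 (a 1 0) = 0
      rw [e00, e10]; ring
    · change (1 : k) * PowerSeries.coeff 1 (a 0 1) + -1 * PowerSeries.coeff 1 (a 1 1) = 0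
      rw [e01, e11, PowerSeries.coeff_X_pow]; simp
  · intro w i j
    fin_cases i <;> fin_cases j
    · change substHom (a 0) (ha 0) (X 0 ^ w - y w) = PowerSeries.monomial w 1
      rw [map_sub, hy0, map_pow, substHom_X, e00, sub_zero, PowerSeries.X_pow_eq]
    · change substHom (a 0) (ha 0) (y w) = PowerSeries.monomial w 0
      rw [hy0, map_zero]
    · change substHom (a 1) (ha 1) (X 0 ^ w - y w) =
        PowerSeries.monomial w (if 2 ≤ w then (0 : k) else 1)
      rw [map_sub, hy1, map_pow, substHom_X, e10, PowerSeries.X_pow_eq]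
      split_ifs <;> simp
    · change substHom (a 1) (ha 1) (y w) = PowerSeries.monomial w (if 2 ≤ w then (1 : k) else 0)
      rw [hy1]
      split_ifs <;> simp
  · intro g h0 h1 w i
    rw [Fin.sum_univ_two] at h1 ⊢
    have h1' : PowerSeries.coeff 1 (g 0) = PowerSeries.coeff 1 (g 1) := by
      have : (1 : k) * PowerSeries.coeff 1 (g 0) + -1 * PowerSeries.coeff 1 (g 1) = 0 := h1
      linear_combination this
    have h0' : PowerSeries.coeff 0 (g 0) = PowerSeries.coeff 0 (g 1) := by
      simpa using h0 0 1
    fin_cases i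
    · change PowerSeries.coeff w (g 0) * 1 + PowerSeries.coeff w (g 1) * 0 =
        PowerSeries.coeff w (g 0)
      ring
    · change PowerSeries.coeff w (g 0) * (if 2 ≤ w then 0 else 1) +
        PowerSeries.coeff w (g 1) * (if 2 ≤ w then 1 else 0) = PowerSeries.coeff w (g 1)
      split_ifs with h
      · ring
      · have : w = 0 ∨ w = 1 := by omega
        rcases this with rfl | rfl
        · rw [h0']; ring
        · rw [h1']; ring
  · intro d
    by_cases hd : d 1 = 0
    · refine ⟨d 0, fun _ => 1, by rw [degree_fin_two]; omega, ?_, ?_⟩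
      · intro i
        rw [monomial_fin_two, hd, pow_zero, mul_one, map_pow, substHom_X, ← PowerSeries.X_pow_eq]
        fin_cases i <;> rfl
      · rw [monomial_fin_two, hd, Fin.sum_univ_two]
        simp
    · refine ⟨d 0 + 2 * d 1, ![0, 1], by rw [degree_fin_two]; omega, ?_, ?_⟩
      · intro i
        rw [monomial_fin_two]
        simp only [map_mul, map_pow, substHom_X]
        fin_cases i
        · change a 0 0 ^ d 0 * a 0 1 ^ d 1 = PowerSeries.monomial _ 0
          rw [e01, zero_pow hd, mul_zero, map_zero]
        · change a 1 0 ^ d 0 * a 1 1 ^ d 1 = PowerSeries.monomial _ 1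
          rw [e10, e11, ← pow_mul, ← pow_add, ← PowerSeries.X_pow_eq]
      · rw [monomial_fin_two, Fin.sum_univ_two]
        simp only [Matrix.cons_val_zero, Matrix.cons_val_one, zero_smul, one_smul, zero_add]
        simp only [y]
        rw [if_pos (by omega), ← Ideal.Quotient.eq]
        obtain ⟨e, he⟩ := Nat.exists_eq_succ_of_ne_zero hd
        have h1 : d 0 + 2 * d 1 - 2 = d 0 + 2 * e := by omega
        rw [h1, he]
        have hrel : ∀ e, Ideal.Quotient.mk (Ideal.span {X 1 ^ 2 - X 1 * X 0 ^ 2} :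
            Ideal (MvPowerSeries (Fin 2) k)) (X 1) ^ (e + 1) =
            Ideal.Quotient.mk _ (X 1) * Ideal.Quotient.mk _ (X 0) ^ (2 * e) := by
          have h : Ideal.Quotient.mk (Ideal.span {X 1 ^ 2 - X 1 * X 0 ^ 2} :
              Ideal (MvPowerSeries (Fin 2) k)) (X 1) ^ 2 =
              Ideal.Quotient.mk _ (X 1) * Ideal.Quotient.mk _ (X 0) ^ 2 := by
            rw [← map_pow, ← map_pow, ← map_mul]
            exact Ideal.Quotient.eq.2 (Ideal.subset_span rfl)
          intro e
          induction e with
          | zero => simp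
          | succ e ih => linear_combination Ideal.Quotient.mk _ (X 1) * ih +
              Ideal.Quotient.mk _ (X 0) ^ (2 * e) * h
        simp only [map_mul, map_pow, Nat.succ_eq_add_one, hrel]
        ring

/-- The product of a monomial with `x i₀ * x i₁` depends only on its degree. -/
lemma prod_pow_mul_of_mixed {n : ℕ} {Q : Type*} [CommRing Q] (x : Fin n → Q) (i₀ i₁ : Fin n)
    (h3 : ∀ i, x i * (x i₀ * x i₁) = x i₀ * x i₁ ^ 2) (d : Fin n →₀ ℕ) :
    (d.prod fun i e => x i ^ e) * (x i₀ * x i₁) = x i₀ * x i₁ ^ (d.degree + 1) := by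
  induction d using Finsupp.induction_linear with
  | zero => simp
  | add f g hf hg =>
    rw [Finsupp.prod_add_index' (by simp) (fun i => pow_add _), map_add, mul_assoc, hg, pow_succ,
      mul_comm (x i₁ ^ g.degree), ← mul_assoc (x i₀), ← mul_assoc, hf]
    ring
  | single a b =>
    rw [Finsupp.prod_single_index (by simp), Finsupp.degree_single]
    induction b with
    | zero => simp
    | succ b ih =>
      rw [pow_succ', mul_assoc, ih, pow_succ', ← mul_assoc (x i₀), ← mul_assoc, h3]
      ring

open MvPowerSeries in
/-- The `n` coordinate axes together with the diagonal `(t, …, t)`: if all the products of two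
distinct variables agree modulo `I`, these lines are the branches of `k[[x]] / I`. -/
lemma lines_isSeriesModel {n : ℕ} (I : Ideal (MvPowerSeries (Fin n) k)) (i₀ i₁ : Fin n)
    (h01 : i₀ ≠ i₁)
    (h2 : ∀ i j, i ≠ j → (X i * X j - X i₀ * X i₁ : MvPowerSeries (Fin n) k) ∈ I)
    (h3 : ∀ i, (X i * (X i₀ * X i₁) - X i₀ * X i₁ ^ 2 : MvPowerSeries (Fin n) k) ∈ I)
    (S : Set (MvPowerSeries (Fin n) k)) (hS : I = Ideal.span S)
    (hkill : ∀ s ∈ S, ∀ φ : MvPowerSeries (Fin n) k →ₐ[k] PowerSeries k,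
      ((∃ i, ∀ j, φ (X j) = if i = j then PowerSeries.X else 0) ∨ ∀ j, φ (X j) = PowerSeries.X) →
      φ s = 0) :
    ∃ ψ c, IsSeriesModel (ι := Option (Fin n)) I ψ c := by
  classical
  let a : Option (Fin n) → Fin n → PowerSeries k := fun i j =>
    i.elim PowerSeries.X fun i => if i = j then PowerSeries.X else 0
  have an : ∀ j, a none j = PowerSeries.X := fun j => rfl
  have as : ∀ i j, a (some i) j = if i = j then PowerSeries.X else 0 := fun i j => rfl
  have ha : ∀ i j, PowerSeries.X ∣ a i j := by
    rintro (_ | i) j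
    · exact dvd_rfl
    · rw [as]; split_ifs <;> simp
  -- `y w` represents the monomials of degree `w` in at least two variables: it vanishes on the axes
  -- and is `t ^ w` on the diagonal
  let y : ℕ → MvPowerSeries (Fin n) k := fun w => if 2 ≤ w then X i₀ * X i₁ ^ (w - 1) else 0
  have hys : ∀ w i, substHom (a (some i)) (ha (some i)) (y w) = 0 := by
    intro w i
    simp only [y]
    split_ifs with h
    · simp only [map_mul, map_pow, substHom_X, as]
      by_cases hi : i = i₀
      · rw [if_neg (show i ≠ i₁ by rw [hi]; exact h01), zero_pow (by omega), mul_zero]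
      · rw [if_neg hi, zero_mul]
    · simp
  have hyn : ∀ w, substHom (a none) (ha none) (y w) =
      if 2 ≤ w then PowerSeries.monomial w 1 else 0 := by
    intro w
    simp only [y]
    split_ifs with h
    · simp only [map_mul, map_pow, substHom_X, an]
      rw [← pow_succ', ← PowerSeries.X_pow_eq]
      congr 1
      omega
    · simp
  -- in degree `w ≥ 2` the normal forms are `y w`, supported on the diagonal, and `x i ^ w - y w`,
  -- supported on one axis; in degree one the linear relation determines the value on the diagonal,
  -- and in degree zero all values agree, so that the axes, respectively the diagonal, suffice
  refine ⟨_, fun i => i.elim (-1) fun _ => 1, IsSeriesModel.of_monomials a ha _ ?_ ?_ ?_ 1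
    one_pos (fun w i => i.elim (y w + if w = 0 then 1 else 0)
      fun i => (if w = 0 then 0 else X i ^ w) - y w)
    (fun w i => i.elim
      (fun j => j.elim (if w = 0 ∨ 2 ≤ w then 1 else 0) fun _ => if w = 1 then 1 else 0)
      (fun i j => j.elim (if w = 0 then 1 else 0) fun j => if i = j ∧ w ≠ 0 then 1 else 0))
    ?_ ?_ ?_⟩
  · rintro (_ | i) <;> simp
  · intro i
    rw [hS]
    refine substHom_span _ _ _ fun s hs => hkill s hs _ ?_
    rcases i with _ | i
    · exact .inr fun j => substHom_X _ _ j
    · exact .inl ⟨i, fun j => substHom_X _ _ j⟩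
  · intro j
    rw [Fintype.sum_option]
    simp only [Option.elim_none, Option.elim_some, an, as]
    rw [Finset.sum_eq_single j (fun i _ hi => by rw [if_neg hi]; simp) (by simp), if_pos rfl]
    ring
  · intro w i j
    rcases i with _ | i <;> rcases j with _ | j
    · simp only [Option.elim_none, map_add, hyn]
      rcases eq_or_ne w 0 with rfl | h0
      · simp [PowerSeries.monomial_zero_eq_C_apply]
      · by_cases h : 2 ≤ w <;> simp [h0, h]
    · simp only [Option.elim_none, Option.elim_some, map_sub, hyn]
      rcases eq_or_ne w 0 with rfl | h0
      · simp
      · rw [if_neg h0, map_pow, substHom_X, an, PowerSeries.X_pow_eq]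
        by_cases h : 2 ≤ w
        · rw [if_pos h, if_neg (by omega), sub_self, map_zero]
        · rw [if_neg h, if_pos (by omega), sub_zero]
    · simp only [Option.elim_none, Option.elim_some, map_add, hys]
      rcases eq_or_ne w 0 with rfl | h0
      · simp [PowerSeries.monomial_zero_eq_C_apply]
      · simp [h0]
    · simp only [Option.elim_some, map_sub, hys]
      rcases eq_or_ne w 0 with rfl | h0
      · simp
      · rw [if_neg h0, map_pow, substHom_X, as]
        by_cases h : i = j
        · rw [if_pos h, if_pos ⟨h, h0⟩, PowerSeries.X_pow_eq, sub_zero]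
        · rw [if_neg h, if_neg (fun hh => h hh.1), zero_pow h0, map_zero, sub_zero]
  · intro g h0 h1 w i
    rw [Fintype.sum_option] at h1 ⊢
    simp only [Option.elim_none, Option.elim_some, one_mul] at h1
    have h1' : ∑ j, PowerSeries.coeff 1 (g (some j)) = PowerSeries.coeff 1 (g none) := by
      linear_combination h1
    have h0' : ∀ i, PowerSeries.coeff 0 (g none) = PowerSeries.coeff 0 (g i) := by
      intro i
      simpa using h0 none i
    rcases i with _ | i
    · simp only [Option.elim_none, Option.elim_some]
      have : w = 0 ∨ w = 1 ∨ 2 ≤ w := by omega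
      rcases this with rfl | rfl | h
      · simp
      · simp [h1']
      · simp [h, show w ≠ 1 by omega]
    · simp only [Option.elim_none, Option.elim_some]
      rcases eq_or_ne w 0 with rfl | hw
      · simpa using h0 none (some i)
      · simp [hw]
  · intro d
    by_cases hm : ∃ i j, i ≠ j ∧ d i ≠ 0 ∧ d j ≠ 0
    · -- a monomial in at least two variables
      obtain ⟨i, j, hij, hi, hj⟩ := hm
      refine ⟨d.degree, fun i => i.elim 1 fun _ => 0, by omega, ?_, ?_⟩
      · rintro (_ | l)
        · rw [substHom_monomial]
          simp only [Option.elim_none, an]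
          rw [← PowerSeries.X_pow_eq, Finsupp.prod, Finset.prod_pow_eq_pow_sum]
          rfl
        · rw [substHom_monomial]
          simp only [Option.elim_some, as, map_zero]
          obtain ⟨q, hq, hdq⟩ : ∃ q, l ≠ q ∧ d q ≠ 0 := by
            by_cases hl : l = i
            · exact ⟨j, hl ▸ hij, hj⟩
            · exact ⟨i, hl, hi⟩
          exact Finset.prod_eq_zero (i := q) (Finsupp.mem_support_iff.2 hdq)
            (by simp only [if_neg hq, zero_pow hdq])
      · have hle : Finsupp.single i 1 + Finsupp.single j 1 ≤ d := by
          intro q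
          simp only [Finsupp.add_apply, Finsupp.single_apply]
          split_ifs <;> simp_all <;> omega
        obtain ⟨e, he⟩ := exists_add_of_le hle
        have hdeg : d.degree = e.degree + 2 := by
          rw [he]; simp [map_add, Finsupp.degree_single]; omega
        rw [Fintype.sum_option]
        simp only [Option.elim_none, Option.elim_some, one_smul, zero_smul, Finset.sum_const_zero,
          add_zero]
        rw [if_neg (by omega), add_zero]
        simp only [y]
        rw [if_pos (by omega), ← Ideal.Quotient.eq, MvPowerSeries.monomial_one_eq]
        have h2' := Ideal.Quotient.eq.2 (h2 i j hij)
        have h3' := fun i => Ideal.Quotient.eq.2 (h3 i)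
        simp only [map_mul, map_pow] at h2' h3'
        have hmk : Ideal.Quotient.mk I (d.prod fun s e => X s ^ e) =
            d.prod fun s e => Ideal.Quotient.mk I (X s) ^ e := by
          simp [Finsupp.prod, map_prod]
        have := prod_pow_mul_of_mixed (fun i => Ideal.Quotient.mk I (X i)) i₀ i₁ h3' e
        rw [hmk, he, Finsupp.prod_add_index' (by simp) (fun i => pow_add _),
          Finsupp.prod_add_index' (by simp) (fun i => pow_add _),
          Finsupp.prod_single_index (by simp), Finsupp.prod_single_index (by simp), pow_one,
          pow_one, h2', mul_comm, this, ← he, hdeg]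
        simp
    · -- a power of one variable
      push Not at hm
      by_cases hd : d = 0
      · subst hd
        refine ⟨0, fun _ => 1, by simp, fun i => ?_, ?_⟩
        · rw [substHom_monomial]
          simp [PowerSeries.monomial_zero_eq_C_apply]
        · rw [Fintype.sum_option]
          simp [y]
      · obtain ⟨i, hi⟩ : ∃ i, d i ≠ 0 := by
          by_contra! hc
          exact hd (Finsupp.ext hc)
        obtain ⟨e, rfl⟩ : ∃ e, d = Finsupp.single i e := by
          refine ⟨d i, Finsupp.ext fun j => ?_⟩
          rw [Finsupp.single_apply]
          split_ifs with h
          · rw [h]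
          · exact hm i j h hi
        have he : e ≠ 0 := by simpa using hi
        refine ⟨e, fun j => j.elim 1 fun j => if i = j then 1 else 0, by simp, ?_, ?_⟩
        · rw [← MvPowerSeries.X_pow_eq]
          rintro (_ | j)
          · rw [map_pow, substHom_X, an, PowerSeries.X_pow_eq]; rfl
          · rw [map_pow, substHom_X, as]
            by_cases h : j = i
            · subst h
              simp [PowerSeries.X_pow_eq]
            · rw [if_neg h, zero_pow he]
              simp only [Option.elim_some, if_neg (Ne.symm h), map_zero]
        · rw [← MvPowerSeries.X_pow_eq, Fintype.sum_option]
          simp [he]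

lemma IsSeriesModel.reindex {n : ℕ} {ι ι' : Type*} [Fintype ι] [Fintype ι'] (σ : ι' ≃ ι)
    {I : Ideal (MvPowerSeries (Fin n) k)} {ψ : ι → MvPowerSeries (Fin n) k →ₐ[k] PowerSeries k}
    {c : ι → k} (h : IsSeriesModel I ψ c) : IsSeriesModel I (ψ ∘ σ) (c ∘ σ) where
  c_ne i := h.c_ne _
  kills i := h.kills _
  dvd i := h.dvd _
  lin f := by
    rw [← h.lin f, ← σ.sum_comp]; rfl
  sep N := by
    obtain ⟨M, hM⟩ := h.sep N
    exact ⟨M, fun f hf => hM f fun i => by simpa using hf (σ.symm i)⟩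
  approx g h0 h1 N := by
    obtain ⟨f, hf⟩ := h.approx (g ∘ σ.symm) (fun i j => h0 _ _) (by
      rw [← h1, ← σ.sum_comp]; simp) N
    exact ⟨f, fun i => by simpa using hf (σ i)⟩

open MvPowerSeries in
/-- The branches of the planar triple point are the two axes and the diagonal. -/
lemma tripleLine_isSeriesModel : ∃ ψ c, IsSeriesModel (ι := Fin 3)
    (Ideal.span {X 0 ^ 2 * X 1 - X 0 * X 1 ^ 2} : Ideal (MvPowerSeries (Fin 2) k)) ψ c := by
  obtain ⟨ψ, c, h⟩ := lines_isSeriesModel (k := k)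
    (Ideal.span {X 0 ^ 2 * X 1 - X 0 * X 1 ^ 2} : Ideal (MvPowerSeries (Fin 2) k)) 0 1
    (by decide) (by
      intro i j hij
      have : (X i * X j - X 0 * X 1 : MvPowerSeries (Fin 2) k) = 0 := by
        fin_cases i <;> fin_cases j
        · exact absurd rfl hij
        · exact sub_self _
        · exact sub_eq_zero.2 (mul_comm _ _)
        · exact absurd rfl hij
      rw [this]
      exact zero_mem _) (by
      intro i
      fin_cases i
      · have : (X 0 * (X 0 * X 1) - X 0 * X 1 ^ 2 : MvPowerSeries (Fin 2) k) =
          X 0 ^ 2 * X 1 - X 0 * X 1 ^ 2 := by ring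
        exact this ▸ Ideal.subset_span rfl
      · have : (X 1 * (X 0 * X 1) - X 0 * X 1 ^ 2 : MvPowerSeries (Fin 2) k) = 0 := by ring
        exact this ▸ zero_mem _) _ rfl (by
      rintro _ rfl φ (⟨i, hi⟩ | hφ)
      · simp only [map_sub, map_mul, map_pow, hi]
        fin_cases i <;> simp
      · simp only [map_sub, map_mul, map_pow, hφ]
        ring)
  exact ⟨_, _, h.reindex (finSuccEquiv 2)⟩

open MvPowerSeries in
/-- The branches of the cone over `m + 4` general points are the coordinate axes and the
diagonal. -/
lemma cone_isSeriesModel (m : ℕ) : ∃ ψ c, IsSeriesModel (ι := Fin (m + 4))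
    (Ideal.span {f | ∃ h i j : Fin (m + 3), h ≠ i ∧ h ≠ j ∧ i ≠ j ∧
        f = X h * X i - X h * X j} : Ideal (MvPowerSeries (Fin (m + 3)) k)) ψ c := by
  set I := (Ideal.span {f | ∃ h i j : Fin (m + 3), h ≠ i ∧ h ≠ j ∧ i ≠ j ∧
        f = X h * X i - X h * X j} : Ideal (MvPowerSeries (Fin (m + 3)) k)) with hI
  have hrel : ∀ h i j : Fin (m + 3), h ≠ i → h ≠ j →
      Ideal.Quotient.mk I (X h) * Ideal.Quotient.mk I (X i) =
      Ideal.Quotient.mk I (X h) * Ideal.Quotient.mk I (X j) := by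
    intro h i j h1 h2
    by_cases h3 : i = j
    · rw [h3]
    · rw [← map_mul, ← map_mul]
      exact Ideal.Quotient.eq.2 (Ideal.subset_span ⟨h, i, j, h1, h2, h3, rfl⟩)
  have h01 : (0 : Fin (m + 3)) ≠ 1 := by simp
  have h02 : (0 : Fin (m + 3)) ≠ 2 := by
    intro h; simp [Fin.ext_iff, Nat.mod_eq_of_lt (show 2 < m + 3 by omega)] at h
  have h12 : (1 : Fin (m + 3)) ≠ 2 := by
    intro h; simp [Fin.ext_iff, Nat.mod_eq_of_lt (show 2 < m + 3 by omega)] at h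
  have h2 : ∀ i j : Fin (m + 3), i ≠ j →
      Ideal.Quotient.mk I (X i) * Ideal.Quotient.mk I (X j) =
      Ideal.Quotient.mk I (X 0) * Ideal.Quotient.mk I (X 1) := by
    intro i j hij
    by_cases hi : i = 0
    · subst hi; exact hrel 0 j 1 hij h01
    · rw [hrel i j 0 hij hi, mul_comm]
      exact hrel 0 i 1 (Ne.symm hi) h01
  obtain ⟨ψ, c, h⟩ := lines_isSeriesModel (k := k) I 0 1 h01 (by
      intro i j hij
      rw [← Ideal.Quotient.eq, map_mul, map_mul]
      exact h2 i j hij) (by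
      intro i
      rw [← Ideal.Quotient.eq]
      simp only [map_mul, map_pow]
      by_cases hi : i = 0
      · subst hi
        -- exchange the second variable for a third one
        linear_combination (-Ideal.Quotient.mk I (X 0)) * hrel 1 2 0 h12 h01.symm +
          Ideal.Quotient.mk I (X 1) * hrel 0 2 1 h02 h01
      · rw [← mul_assoc, h2 i 0 hi]; ring) _ hI (by
      rintro _ ⟨h, i, j, hhi, hhj, hij, rfl⟩ φ (⟨l, hl⟩ | hφ)
      · simp only [map_sub, map_mul, hl]
        by_cases h1 : l = h
        · rw [if_neg (show l ≠ i from h1 ▸ hhi), if_neg (show l ≠ j from h1 ▸ hhj)]; ring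
        · rw [if_neg h1]; ring
      · simp only [map_sub, map_mul, hφ, sub_self])
  exact ⟨_, _, h.reindex (finSuccEquiv (m + 3))⟩

end Models

/-! ### Formal branches of a local ring -/

section FormalBranches

open IsLocalRing

variable {k : Type*} [Field k] {O : Type*} [CommRing O] [IsLocalRing O] {ι : Type*}

/-- The maps `φᵢ : O → k[[t]]` are the formal branches of the local `k`-algebra `O`: they are local
homomorphisms over `k`, the topology they define on `O` is finer than the adic one, and
every family of power series divisible by `t ^ e` is approximated by elements of `O`. -/
structure IsFormalBranches (c₀ : k →+* O) (φ : ι → O →+* PowerSeries k) (e : ℕ) : Prop where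
  map_c : ∀ i a, φ i (c₀ a) = PowerSeries.C a
  dvd : ∀ i, ∀ f ∈ maximalIdeal O, PowerSeries.X ∣ φ i f
  sep : ∀ N, ∃ M, ∀ f, (∀ i, PowerSeries.X ^ M ∣ φ i f) → f ∈ maximalIdeal O ^ N
  approx : ∀ g : ι → PowerSeries k, (∀ i, PowerSeries.X ^ e ∣ g i) → ∀ N, ∃ f, ∀ i,
    PowerSeries.X ^ N ∣ g i - φ i f

/-- The formal branches of an elliptic point: up to completion, `O` is the ring of those families
of power series with equal constant terms whose linear terms satisfy one relation `∑ cᵢ gᵢ'(0) = 0`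
with nonzero coefficients. -/
structure IsElliptic [Fintype ι] (c₀ : k →+* O) (φ : ι → O →+* PowerSeries k) (c : ι → k) :
    Prop where
  c_ne : ∀ i, c i ≠ 0
  map_c : ∀ i a, φ i (c₀ a) = PowerSeries.C a
  dvd : ∀ i, ∀ f ∈ maximalIdeal O, PowerSeries.X ∣ φ i f
  sep : ∀ N, ∃ M, ∀ f, (∀ i, PowerSeries.X ^ M ∣ φ i f) → f ∈ maximalIdeal O ^ N
  lin : ∀ f, ∑ i, c i * PowerSeries.coeff 1 (φ i f) = 0
  approx : ∀ g : ι → PowerSeries k,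
    (∀ i j, PowerSeries.constantCoeff (g i) = PowerSeries.constantCoeff (g j)) →
    ∑ i, c i * PowerSeries.coeff 1 (g i) = 0 → ∀ N, ∃ f, ∀ i, PowerSeries.X ^ N ∣ g i - φ i f

lemma IsElliptic.isFormalBranches [Fintype ι] {c₀ : k →+* O} {φ : ι → O →+* PowerSeries k}
    {c : ι → k} (h : IsElliptic c₀ φ c) : IsFormalBranches c₀ φ 2 where
  map_c := h.map_c
  dvd := h.dvd
  sep := h.sep
  approx g hg := by
    have h0 : ∀ i, PowerSeries.constantCoeff (g i) = 0 := fun i => by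
      simpa using PowerSeries.X_pow_dvd_iff.1 (hg i) 0 (by norm_num)
    have h1 : ∀ i, PowerSeries.coeff 1 (g i) = 0 := fun i =>
      PowerSeries.X_pow_dvd_iff.1 (hg i) 1 (by norm_num)
    exact h.approx g (fun i j => by rw [h0, h0]) (by simp [h1])

/-- The variables are mapped into the maximal ideal, as they lie in the Jacobson radical. -/
lemma map_mem_of_mem_varIdeal {n : ℕ} (N : ℕ)
    (χ : MvPowerSeries (Fin n) k →+* O ⧸ maximalIdeal O ^ N) (hsurj : Function.Surjective χ)
    {f : MvPowerSeries (Fin n) k} (hf : f ∈ varIdeal k n) :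
    χ f ∈ (maximalIdeal O).map (Ideal.Quotient.mk (maximalIdeal O ^ N)) := by
  have hf0 : MvPowerSeries.constantCoeff f = 0 := by
    have : varIdeal k n ≤ RingHom.ker (MvPowerSeries.constantCoeff (σ := Fin n) (R := k)) := by
      refine Ideal.span_le.2 ?_
      rintro _ ⟨j, rfl⟩
      simp
    exact this hf
  obtain ⟨z, hz⟩ := Ideal.Quotient.mk_surjective (χ f)
  rw [← hz]
  by_cases hzm : z ∈ maximalIdeal O
  · exact Ideal.mem_map_of_mem _ hzm
  -- otherwise a multiple of `1 + b f` would be a unit mapping to `0`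
  · have hu : IsUnit z := by simpa using hzm
    obtain ⟨w, hw⟩ := hu.exists_left_inv
    obtain ⟨b, hb⟩ := hsurj (Ideal.Quotient.mk _ (-w))
    have h1 : IsUnit (1 + b * f) := by
      rw [MvPowerSeries.isUnit_iff_constantCoeff]
      simp [hf0]
    have h2 : χ (1 + b * f) = 0 := by
      rw [map_add, map_mul, map_one, hb, ← hz, ← map_mul, neg_mul, hw]
      simp
    have h3 := h1.map χ
    rw [h2, isUnit_zero_iff] at h3
    have : Ideal.Quotient.mk (maximalIdeal O ^ N) z = 0 := by
      rw [← one_mul (Ideal.Quotient.mk (maximalIdeal O ^ N) z), ← h3, zero_mul]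
    rw [this]
    exact zero_mem _

/-- The formal branches of the model give formal branches of every local ring with that
completion. Here `T` stands for the completion, and `ev N` for reduction modulo `𝔪 ^ N`. -/
lemma IsSeriesModel.exists_isElliptic_of_eval [Fintype ι] (c₀ : k →+* O) {n : ℕ}
    {I : Ideal (MvPowerSeries (Fin n) k)}
    {ψ : ι → MvPowerSeries (Fin n) k →ₐ[k] PowerSeries k} {c : ι → k} (h : IsSeriesModel I ψ c)
    {T : Type*} [CommRing T] (α : O →+* T) (ev : ∀ N, T →+* O ⧸ maximalIdeal O ^ N)
    (hev : ∀ N, Function.Surjective (ev N))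
    (hα : ∀ N f, ev N (α f) = Ideal.Quotient.mk (maximalIdeal O ^ N) f)
    (hker : ∀ N y, ev N y = 0 → y ∈ (maximalIdeal O ^ N).map α)
    (ε : T ≃+* (MvPowerSeries (Fin n) k ⧸ I))
    (hε : ∀ a : k, ε (α (c₀ a)) = Ideal.Quotient.mk I (MvPowerSeries.C a)) :
    ∃ φ : ι → O →+* PowerSeries k, IsElliptic c₀ φ c := by
  let χ : ι → T →+* PowerSeries k := fun i =>
    (Ideal.Quotient.lift I (ψ i).toRingHom (h.kills i)).comp ε.toRingHom
  have hχ : ∀ i x s, ε x = Ideal.Quotient.mk I s → χ i x = ψ i s := by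
    intro i x s hs
    change Ideal.Quotient.lift I (ψ i).toRingHom (h.kills i) (ε x) = _
    rw [hs]
    rfl
  have hc : ∀ i a, (χ i).comp α (c₀ a) = PowerSeries.C a := by
    intro i a
    refine (hχ i _ _ (hε a)).trans ?_
    exact (ψ i).commutes a
  have hdvd : ∀ i, ∀ f ∈ maximalIdeal O, PowerSeries.X ∣ (χ i).comp α f := by
    intro i f hf
    rw [PowerSeries.X_dvd_iff]
    by_contra hne
    -- otherwise `f - a` is a unit, whose image has no constant term
    set a := PowerSeries.constantCoeff ((χ i).comp α f) with ha
    have hu : IsUnit (f - c₀ a) := by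
      by_contra hu
      have hu' : f - c₀ a ∈ maximalIdeal O := hu
      have : c₀ a ∈ maximalIdeal O := by
        have := Ideal.sub_mem _ hf hu'
        rwa [sub_sub_cancel] at this
      exact this ((IsUnit.mk0 a hne).map c₀)
    have h1 := hu.map ((χ i).comp α)
    rw [PowerSeries.isUnit_iff_constantCoeff, map_sub, hc, map_sub, ← ha] at h1
    simp at h1
  refine ⟨fun i => (χ i).comp α, h.c_ne, hc, hdvd, ?_, ?_, ?_⟩
  · intro N
    obtain ⟨M, hM⟩ := h.sep N
    refine ⟨M, fun f hf => ?_⟩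
    obtain ⟨s, hs⟩ := Ideal.Quotient.mk_surjective (ε (α f))
    obtain ⟨a, ha, b, hb, hab⟩ := Submodule.mem_sup.1 (hM s fun i => by
      rw [← hχ i _ s hs.symm]; exact hf i)
    have h1 : ε (α f) = Ideal.Quotient.mk I b := by
      rw [← hs, ← hab, map_add, Ideal.Quotient.eq_zero_iff_mem.2 ha, zero_add]
    -- modulo `𝔪 ^ N`, the element `f` is the image of `b ∈ (x) ^ N`
    let χN : MvPowerSeries (Fin n) k →+* O ⧸ maximalIdeal O ^ N :=
      ((ev N).comp (ε.symm : _ →+* T)).comp (Ideal.Quotient.mk I)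
    have hsurj : Function.Surjective χN :=
      (hev N).comp (ε.symm.surjective.comp Ideal.Quotient.mk_surjective)
    have h2 : varIdeal k n ≤
        ((maximalIdeal O).map (Ideal.Quotient.mk (maximalIdeal O ^ N))).comap χN :=
      fun f hf => map_mem_of_mem_varIdeal N χN hsurj hf
    have h3 := Ideal.le_comap_pow χN N (Ideal.pow_right_mono h2 N hb)
    rw [Ideal.mem_comap, ← Ideal.map_pow, Ideal.map_quotient_self, Ideal.mem_bot] at h3
    have h4 : ev N (ε.symm (Ideal.Quotient.mk I b)) = 0 := h3
    rw [← h1, RingEquiv.symm_apply_apply, hα] at h4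
    exact Ideal.Quotient.eq_zero_iff_mem.1 h4
  · intro f
    obtain ⟨s, hs⟩ := Ideal.Quotient.mk_surjective (ε (α f))
    rw [← h.lin s]
    exact Finset.sum_congr rfl fun i _ => by rw [← hχ i _ s hs.symm]; rfl
  · intro g h0 h1 N
    obtain ⟨s, hs⟩ := h.approx g h0 h1 N
    -- `O` and its completion agree modulo `𝔪 ^ N`
    obtain ⟨f, hf⟩ := Ideal.Quotient.mk_surjective (ev N (ε.symm (Ideal.Quotient.mk I s)))
    refine ⟨f, fun i => ?_⟩
    set y := ε.symm (Ideal.Quotient.mk I s) - α f with hy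
    have hy0 : ev N y = 0 := by rw [hy, map_sub, hα, hf, sub_self]
    have hy3 : PowerSeries.X ^ N ∣ χ i y := by
      have h5 : maximalIdeal O ≤ (Ideal.span {PowerSeries.X}).comap ((χ i).comp α) :=
        fun f hf => Ideal.mem_span_singleton.2 (hdvd i f hf)
      have h6 := (Ideal.pow_right_mono h5 N).trans (Ideal.le_comap_pow ((χ i).comp α) N)
      rw [Ideal.span_singleton_pow, ← Ideal.comap_comap, ← Ideal.map_le_iff_le_comap] at h6
      exact Ideal.mem_span_singleton.1 (h6 (hker N y hy0))
    have hy4 : χ i y = ψ i s - (χ i).comp α f := by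
      rw [hy, map_sub, hχ i (ε.symm (Ideal.Quotient.mk I s)) s (by simp)]
      rfl
    have : g i - (χ i).comp α f = (g i - ψ i s) + χ i y := by rw [hy4]; ring
    rw [this]
    exact dvd_add (hs i) hy3

lemma IsSeriesModel.exists_isElliptic [IsNoetherianRing O] [Fintype ι] (c₀ : k →+* O) {n : ℕ}
    {I : Ideal (MvPowerSeries (Fin n) k)}
    {ψ : ι → MvPowerSeries (Fin n) k →ₐ[k] PowerSeries k} {c : ι → k} (h : IsSeriesModel I ψ c)
    (ε : AdicCompletion (maximalIdeal O) O ≃+* (MvPowerSeries (Fin n) k ⧸ I))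
    (hε : ∀ a : k, ε (algebraMap O _ (c₀ a)) = Ideal.Quotient.mk I (MvPowerSeries.C a)) :
    ∃ φ : ι → O →+* PowerSeries k, IsElliptic c₀ φ c := by
  refine h.exists_isElliptic_of_eval c₀ (algebraMap O (AdicCompletion (maximalIdeal O) O))
    (fun N => (AdicCompletion.evalₐ (maximalIdeal O) N).toRingHom)
    (fun N => AdicCompletion.surjective_evalₐ _ N) (fun N f => AlgHom.commutes _ f) ?_ ε hε
  intro N y hy0
  have hy1 : AdicCompletion.eval (maximalIdeal O) O N y = 0 := by
    rw [← AdicCompletion.factor_evalₐ_eq_eval (maximalIdeal O) y (by simp)]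
    exact (congrArg _ hy0).trans (map_zero _)
  have hy2 : y ∈ (maximalIdeal O ^ N • ⊤ : Submodule O (AdicCompletion (maximalIdeal O) O)) := by
    rw [AdicCompletion.pow_smul_top_eq_ker_eval (IsNoetherian.noetherian _)]
    exact hy1
  refine Submodule.smul_induction_on hy2 (fun r hr z _ => ?_) fun a b ha hb => add_mem ha hb
  rw [Algebra.smul_def]
  exact Ideal.mul_mem_right _ _ (Ideal.mem_map_of_mem _ hr)

end FormalBranches

section LaurentOrder

variable {k : Type*} [Field k]

lemma orderTop_mul (x y : LaurentSeries k) : (x * y).orderTop = x.orderTop + y.orderTop :=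
  HahnSeries.orderTop_mul x y

lemma orderTop_pow (x : LaurentSeries k) (n : ℕ) : (x ^ n).orderTop = n • x.orderTop := by
  induction n with
  | zero => simp
  | succ n ih => rw [pow_succ, orderTop_mul, ih, succ_nsmul]

lemma orderTop_inv {x : LaurentSeries k} {n : ℤ} (h : x.orderTop = n) :
    (x⁻¹).orderTop = (-n : ℤ) := by
  have hx : x ≠ 0 := by
    rintro rfl
    simp at h
  have h1 : (x * x⁻¹).orderTop = 0 := by rw [mul_inv_cancel₀ hx, HahnSeries.orderTop_one]
  rw [orderTop_mul, h] at h1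
  have hx' : (x⁻¹).orderTop ≠ ⊤ := by
    rw [HahnSeries.orderTop_ne_top]
    exact inv_ne_zero hx
  obtain ⟨m, hm⟩ := WithTop.ne_top_iff_exists.1 hx'
  rw [← hm] at h1 ⊢
  norm_cast at h1 ⊢
  omega

lemma orderTop_eq_coe {x : LaurentSeries k} (hx : x ≠ 0) : ∃ n : ℤ, x.orderTop = n := by
  obtain ⟨m, hm⟩ := WithTop.ne_top_iff_exists.1 (HahnSeries.orderTop_ne_top.2 hx)
  exact ⟨m, hm.symm⟩

lemma le_orderTop_iff {x : LaurentSeries k} {n : ℤ} :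
    (n : WithTop ℤ) ≤ x.orderTop ↔ ∀ j < n, x.coeff j = 0 := by
  rw [HahnSeries.le_orderTop_iff_forall]
  simp only [WithTop.coe_lt_coe]

lemma le_orderTop_coe_iff {p : PowerSeries k} {n : ℕ} :
    ((n : ℤ) : WithTop ℤ) ≤ (HahnSeries.ofPowerSeries ℤ k p).orderTop ↔
      PowerSeries.X ^ n ∣ p := by
  rw [le_orderTop_iff, PowerSeries.X_pow_dvd_iff]
  constructor
  · intro h m hm
    rw [← LaurentSeries.coeff_coe_powerSeries]
    exact h m (by exact_mod_cast hm)
  · intro h j hj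
    rcases lt_or_ge j 0 with h0 | h0
    · rw [PowerSeries.coeff_coe, if_pos h0]
    · lift j to ℕ using h0
      rw [LaurentSeries.coeff_coe_powerSeries]
      exact h j (by exact_mod_cast hj)

lemma zero_le_orderTop_coe (p : PowerSeries k) :
    0 ≤ (HahnSeries.ofPowerSeries ℤ k p).orderTop := by
  have := (le_orderTop_coe_iff (p := p) (n := 0)).2 (by simp)
  simpa using this

lemma zero_le_orderTop_iff {x : LaurentSeries k} :
    0 ≤ x.orderTop ↔ ∃ p : PowerSeries k, HahnSeries.ofPowerSeries ℤ k p = x := by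
  constructor
  · intro h
    refine ⟨PowerSeries.mk fun n => x.coeff n, ?_⟩
    ext j
    rw [PowerSeries.coeff_coe]
    split_ifs with h0
    · exact ((le_orderTop_iff (n := 0)).1 h j h0).symm
    · rw [PowerSeries.coeff_mk]
      congr 1
      omega
  · rintro ⟨p, rfl⟩
    exact zero_le_orderTop_coe p

lemma orderTop_X_pow_mul {p : PowerSeries k} (n : ℕ) (hp : IsUnit p) :
    (HahnSeries.ofPowerSeries ℤ k (PowerSeries.X ^ n * p)).orderTop = (n : ℤ) := by
  refine le_antisymm ?_ (le_orderTop_coe_iff.2 (dvd_mul_right _ _))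
  refine HahnSeries.orderTop_le_of_coeff_ne_zero ?_
  rw [LaurentSeries.coeff_coe_powerSeries, PowerSeries.coeff_X_pow_mul', if_pos le_rfl,
    Nat.sub_self, PowerSeries.coeff_zero_eq_constantCoeff_apply]
  exact (PowerSeries.isUnit_iff_constantCoeff.1 hp).ne_zero

lemma ofPowerSeries_injective : Function.Injective (HahnSeries.ofPowerSeries ℤ k) :=
  HahnSeries.ofPowerSeries_injective

lemma ofPowerSeries_ne_zero {p : PowerSeries k} (hp : p ≠ 0) :
    HahnSeries.ofPowerSeries ℤ k p ≠ 0 := fun h =>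
  hp (ofPowerSeries_injective (h.trans (map_zero _).symm))

lemma dvd_iff_orderTop_le {p q : PowerSeries k} : p ∣ q ↔
    (HahnSeries.ofPowerSeries ℤ k p).orderTop ≤ (HahnSeries.ofPowerSeries ℤ k q).orderTop := by
  constructor
  · rintro ⟨r, rfl⟩
    rw [map_mul, orderTop_mul]
    exact le_add_of_nonneg_right (zero_le_orderTop_coe r)
  · intro h
    by_cases hp : p = 0
    · subst hp
      rw [map_zero, HahnSeries.orderTop_zero, top_le_iff, HahnSeries.orderTop_eq_top] at h
      rw [ofPowerSeries_injective (h.trans (map_zero _).symm)]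
    · obtain ⟨n, hn⟩ := orderTop_eq_coe (ofPowerSeries_ne_zero hp)
      have h1 : 0 ≤ (HahnSeries.ofPowerSeries ℤ k q *
          (HahnSeries.ofPowerSeries ℤ k p)⁻¹).orderTop := by
        rw [orderTop_mul, orderTop_inv hn]
        rw [hn] at h
        calc (0 : WithTop ℤ) = (n : WithTop ℤ) + (-n : ℤ) := by norm_cast; omega
          _ ≤ _ := by gcongr
      obtain ⟨r, hr⟩ := zero_le_orderTop_iff.1 h1
      refine ⟨r, ofPowerSeries_injective ?_⟩
      rw [map_mul, hr, mul_comm (HahnSeries.ofPowerSeries ℤ k q),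
        mul_inv_cancel_left₀ (ofPowerSeries_ne_zero hp)]

/-- The valuation ring of the field `K` defined by an embedding `Φ` of `K` into `k((t))`. -/
def branchRing {K : Type*} [Field K] [Algebra k K] (Φ : K →ₐ[k] LaurentSeries k) :
    ValuationSubring K where
  carrier := {x | 0 ≤ (Φ x).orderTop}
  mul_mem' {a b} ha hb := by
    change 0 ≤ (Φ (a * b)).orderTop
    rw [map_mul, orderTop_mul]
    exact add_nonneg ha hb
  one_mem' := by
    change 0 ≤ (Φ 1).orderTop
    rw [map_one, HahnSeries.orderTop_one]
  add_mem' {a b} ha hb := by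
    change 0 ≤ (Φ (a + b)).orderTop
    rw [map_add]
    exact le_trans (le_min ha hb) HahnSeries.min_orderTop_le_orderTop_add
  zero_mem' := by
    change 0 ≤ (Φ 0).orderTop
    simp
  neg_mem' {a} ha := by
    change 0 ≤ (Φ (-a)).orderTop
    rw [map_neg, HahnSeries.orderTop_neg]
    exact ha
  mem_or_inv_mem' x := by
    change 0 ≤ (Φ x).orderTop ∨ 0 ≤ (Φ x⁻¹).orderTop
    by_cases hx : Φ x = 0
    · left; simp [hx]
    obtain ⟨n, hn⟩ := orderTop_eq_coe hx
    rw [map_inv₀, orderTop_inv hn, hn]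
    norm_cast
    omega

lemma mem_branchRing {K : Type*} [Field K] [Algebra k K] {Φ : K →ₐ[k] LaurentSeries k} {x : K} :
    x ∈ branchRing Φ ↔ 0 ≤ (Φ x).orderTop := Iff.rfl

end LaurentOrder

namespace IsFormalBranches

open IsLocalRing

variable {k : Type*} [Field k] {O : Type*} [CommRing O] [IsLocalRing O] {ι : Type*}
  {c₀ : k →+* O} {φ : ι → O →+* PowerSeries k} {e : ℕ}

lemma mem_maximalIdeal_iff (H : IsFormalBranches c₀ φ e) (i : ι) (f : O) :
    f ∈ maximalIdeal O ↔ PowerSeries.constantCoeff (φ i f) = 0 := by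
  rw [← PowerSeries.X_dvd_iff]
  refine ⟨H.dvd i f, fun h => ?_⟩
  by_contra hf
  have hu : IsUnit f := by simpa using hf
  have := hu.map (φ i)
  rw [PowerSeries.isUnit_iff_constantCoeff, PowerSeries.X_dvd_iff.1 h] at this
  exact not_isUnit_zero this

lemma sub_mem (H : IsFormalBranches c₀ φ e) (i : ι) (f : O) :
    f - c₀ (PowerSeries.constantCoeff (φ i f)) ∈ maximalIdeal O := by
  rw [H.mem_maximalIdeal_iff i, map_sub, H.map_c]
  simp

lemma exists_index (H : IsFormalBranches c₀ φ e) : Nonempty ι := by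
  by_contra h
  rw [not_nonempty_iff] at h
  obtain ⟨M, hM⟩ := H.sep 1
  have := hM 1 fun i => h.elim i
  rw [pow_one] at this
  exact (Ideal.ne_top_iff_one _).1 (maximalIdeal.isMaximal O).ne_top this

/-- An element whose image in `∏ᵢ k[[t]]` lies in the closure of the ideal generated by the image
of `s` is divisible by `s`, by Krull's intersection theorem. -/
lemma dvd_of_approx [IsNoetherianRing O] (H : IsFormalBranches c₀ φ e) {a s : O}
    (g : ι → PowerSeries k) (hg : ∀ i, φ i a = φ i s * g i)
    (happ : ∀ N, ∃ f, ∀ i, PowerSeries.X ^ N ∣ g i - φ i f) : s ∣ a := by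
  have h1 : ∀ N, a ∈ Ideal.span {s} ⊔ maximalIdeal O ^ N := by
    intro N
    obtain ⟨M, hM⟩ := H.sep N
    obtain ⟨f, hf⟩ := happ M
    have h2 : a - s * f ∈ maximalIdeal O ^ N := hM _ fun i => by
      rw [map_sub, map_mul, hg, ← mul_sub]
      exact (hf i).mul_left _
    rw [← sub_add_cancel a (s * f), add_comm]
    exact Ideal.add_mem _ (Ideal.mem_sup_left (Ideal.mul_mem_right _ _
      (Ideal.mem_span_singleton_self s))) (Ideal.mem_sup_right h2)
  by_cases hs : Ideal.span {s} = ⊤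
  · rw [← Ideal.mem_span_singleton, hs]; trivial
  have h3 := Ideal.iInf_pow_smul_eq_bot_of_isLocalRing (M := O ⧸ Ideal.span {s}) (maximalIdeal O)
    (maximalIdeal.isMaximal O).ne_top
  have h4 : Ideal.Quotient.mk (Ideal.span {s}) a ∈
      (⨅ i : ℕ, maximalIdeal O ^ i • (⊤ : Submodule O (O ⧸ Ideal.span {s}))) := by
    rw [Submodule.mem_iInf]
    intro N
    obtain ⟨x, hx, y, hy, hxy⟩ := Submodule.mem_sup.1 (h1 N)
    rw [← hxy, map_add, Ideal.Quotient.eq_zero_iff_mem.2 hx, zero_add]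
    have : Ideal.Quotient.mk (Ideal.span {s}) y = y • (1 : O ⧸ Ideal.span {s}) := by
      rw [Algebra.smul_def, mul_one]; rfl
    rw [this]
    exact Submodule.smul_mem_smul hy trivial
  rw [h3, Submodule.mem_bot, Ideal.Quotient.eq_zero_iff_mem, Ideal.mem_span_singleton] at h4
  exact h4

lemma eq_zero [IsNoetherianRing O] (H : IsFormalBranches c₀ φ e) {a : O}
    (h : ∀ i, φ i a = 0) : a = 0 :=
  zero_dvd_iff.1 (H.dvd_of_approx 0 (fun i => by simp [h]) fun N => ⟨0, fun i => by simp⟩)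

/-- Elements with prescribed leading terms of large order. -/
lemma exists_leading (H : IsFormalBranches c₀ φ e) (n : ι → ℕ) (hn : ∀ i, e ≤ n i)
    [Finite ι] : ∃ f, ∀ i, ∃ u, IsUnit u ∧ φ i f = PowerSeries.X ^ n i * u := by
  obtain ⟨N, hN⟩ : ∃ N, ∀ i, n i < N := by
    obtain ⟨N, hN⟩ := (Set.finite_range n).bddAbove
    exact ⟨N + 1, fun i => Nat.lt_succ_of_le (hN ⟨i, rfl⟩)⟩
  obtain ⟨f, hf⟩ := H.approx (fun i => PowerSeries.X ^ n i) (fun i => pow_dvd_pow _ (hn i)) N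
  refine ⟨f, fun i => ?_⟩
  obtain ⟨r, hr⟩ := hf i
  refine ⟨1 - PowerSeries.X ^ (N - n i) * r, ?_, ?_⟩
  · rw [PowerSeries.isUnit_iff_constantCoeff]
    simp [(Nat.sub_pos_of_lt (hN i)).ne']
  · rw [mul_sub, ← mul_assoc, ← pow_add, Nat.add_sub_cancel' (hN i).le, ← hr]
    ring

lemma ker_ne_maximalIdeal [Finite ι] (H : IsFormalBranches c₀ φ e) (i : ι) :
    RingHom.ker (φ i) ≠ maximalIdeal O := by
  obtain ⟨f, hf⟩ := H.exists_leading (fun _ => e + 1) (fun _ => by omega)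
  obtain ⟨u, hu, hfu⟩ := hf i
  intro h
  have h1 : f ∈ maximalIdeal O := by
    rw [H.mem_maximalIdeal_iff i, hfu]; simp
  rw [← h, RingHom.mem_ker, hfu] at h1
  exact mul_ne_zero (pow_ne_zero _ PowerSeries.X_ne_zero) hu.ne_zero h1

instance ker_isPrime (i : ι) : (RingHom.ker (φ i)).IsPrime := RingHom.ker_isPrime _

lemma exists_ker_le [Finite ι] [IsNoetherianRing O] (H : IsFormalBranches c₀ φ e) (P : Ideal O)
    [hP : P.IsPrime] : ∃ i, RingHom.ker (φ i) ≤ P := by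
  have := Fintype.ofFinite ι
  have h : Finset.univ.inf (fun i => RingHom.ker (φ i)) ≤ P := by
    intro x hx
    have : x = 0 := H.eq_zero fun i => by
      have := (Finset.inf_le (Finset.mem_univ i) :
        Finset.univ.inf (fun i => RingHom.ker (φ i)) ≤ RingHom.ker (φ i)) hx
      exact this
    rw [this]
    exact zero_mem _
  obtain ⟨i, -, hi⟩ := (Ideal.IsPrime.inf_le' hP).1 h
  exact ⟨i, hi⟩

/-- The conductor: `s` divides everything of sufficiently large order. -/
lemma dvd_of_dvd [IsNoetherianRing O] (H : IsFormalBranches c₀ φ e) {a s : O}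
    (h : ∀ i, φ i s * PowerSeries.X ^ e ∣ φ i a) : s ∣ a := by
  choose g hg using h
  exact H.dvd_of_approx (fun i => PowerSeries.X ^ e * g i) (fun i => by rw [hg, mul_assoc])
    fun N => H.approx _ (fun i => dvd_mul_right _ _) N

/-- An element that is nonzero along every branch generates an ideal containing a power of the
maximal ideal. -/
lemma exists_pow_le [Finite ι] [IsNoetherianRing O] (H : IsFormalBranches c₀ φ e) {s : O}
    (h : ∀ i, φ i s ≠ 0) : ∃ N, maximalIdeal O ^ N ≤ Ideal.span {s} := by
  have h1 : ∀ i, ∃ n : ℕ, φ i s ∣ PowerSeries.X ^ n := fun i => by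
    obtain ⟨n, hn⟩ := orderTop_eq_coe (ofPowerSeries_ne_zero (h i))
    have h0 := zero_le_orderTop_coe (φ i s)
    rw [hn] at h0
    lift n to ℕ using (by exact_mod_cast h0)
    refine ⟨n, dvd_iff_orderTop_le.2 ?_⟩
    rw [hn, ← mul_one (PowerSeries.X ^ n), orderTop_X_pow_mul n isUnit_one]
  choose n hn using h1
  obtain ⟨N, hN⟩ := (Set.finite_range n).bddAbove
  refine ⟨N + e, fun a ha => ?_⟩
  rw [Ideal.mem_span_singleton]
  refine H.dvd_of_dvd fun i => ?_
  have h2 : PowerSeries.X ^ (N + e) ∣ φ i a := by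
    have h5 : maximalIdeal O ≤ (Ideal.span {PowerSeries.X}).comap (φ i) :=
      fun f hf => Ideal.mem_span_singleton.2 (H.dvd i f hf)
    have h6 := ((Ideal.pow_right_mono h5 (N + e)).trans (Ideal.le_comap_pow (φ i) (N + e))) ha
    rw [Ideal.span_singleton_pow] at h6
    exact Ideal.mem_span_singleton.1 h6
  refine dvd_trans ?_ h2
  rw [pow_add]
  exact mul_dvd_mul ((hn i).trans (pow_dvd_pow _ (hN ⟨i, rfl⟩))) dvd_rfl

lemma eq_maximalIdeal_of_mem [Finite ι] [IsNoetherianRing O] (H : IsFormalBranches c₀ φ e) {s : O}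
    (h : ∀ i, φ i s ≠ 0) (P : Ideal O) [hP : P.IsPrime] (hs : s ∈ P) : P = maximalIdeal O := by
  obtain ⟨N, hN⟩ := H.exists_pow_le h
  refine le_antisymm (le_maximalIdeal hP.ne_top) ?_
  exact hP.le_of_pow_le (hN.trans ((Ideal.span_singleton_le_iff_mem P).2 hs))

/-- The kernels of the formal branches are the minimal primes. -/
lemma ker_eq_of_le [Finite ι] [IsNoetherianRing O] (H : IsFormalBranches c₀ φ e) (P : Ideal O)
    [hP : P.IsPrime] (i : ι) (h : P ≤ RingHom.ker (φ i)) : P = RingHom.ker (φ i) := by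
  by_contra hne
  obtain ⟨s, hs⟩ := H.exists_leading (fun _ => e + 1) (fun _ => by omega)
  have hs0 : ∀ i, φ i s ≠ 0 := fun i => by
    obtain ⟨u, hu, h⟩ := hs i
    rw [h]
    exact mul_ne_zero (pow_ne_zero _ PowerSeries.X_ne_zero) hu.ne_zero
  have hsm : s ∈ maximalIdeal O := by
    obtain ⟨u, hu, h⟩ := hs i
    rw [H.mem_maximalIdeal_iff i, h]; simp
  have hmin : maximalIdeal O ∈ (Ideal.span {s}).minimalPrimes := by
    refine ⟨⟨inferInstance, (Ideal.span_singleton_le_iff_mem _).2 hsm⟩, fun Q hQ _ => ?_⟩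
    have := hQ.1
    exact (H.eq_maximalIdeal_of_mem hs0 Q ((Ideal.span_singleton_le_iff_mem _).1 hQ.2)).ge
  have hht := Ideal.height_le_one_of_isPrincipal_of_mem_minimalPrimes _ _ hmin
  -- a chain of three primes contradicts the principal ideal theorem
  have h1 : P < RingHom.ker (φ i) := lt_of_le_of_ne h hne
  have h2 : RingHom.ker (φ i) < maximalIdeal O :=
    lt_of_le_of_ne (le_maximalIdeal (ker_isPrime i).ne_top) (H.ker_ne_maximalIdeal i)
  have h3 := Ideal.height_add_one_le_of_lt_of_isPrime h1
  have h4 := Ideal.height_add_one_le_of_lt_of_isPrime h2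
  have h5 : (2 : ℕ∞) ≤ 1 := calc
    (2 : ℕ∞) = 0 + 1 + 1 := by norm_num
    _ ≤ P.height + 1 + 1 := by gcongr; exact zero_le
    _ ≤ (RingHom.ker (φ i)).height + 1 := by gcongr
    _ ≤ 1 := h4.trans hht
  exact absurd h5 (by norm_num)

lemma ker_mem_minimalPrimes [Finite ι] [IsNoetherianRing O] (H : IsFormalBranches c₀ φ e) (i : ι) :
    RingHom.ker (φ i) ∈ minimalPrimes O :=
  ⟨⟨ker_isPrime i, bot_le⟩, fun Q hQ h => by
    have := hQ.1
    exact (H.ker_eq_of_le Q i h).ge⟩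

lemma exists_ker_eq [Finite ι] [IsNoetherianRing O] (H : IsFormalBranches c₀ φ e) {P : Ideal O}
    (hP : P ∈ minimalPrimes O) : ∃ i, RingHom.ker (φ i) = P := by
  have := hP.1.1
  obtain ⟨i, hi⟩ := H.exists_ker_le P
  exact ⟨i, le_antisymm hi (hP.2 ⟨ker_isPrime i, bot_le⟩ hi)⟩

end IsFormalBranches

open IsLocalRing

section Component

variable {k : Type*} [Field k] {O : Type*} [CommRing O] {K : Type*} [Field K] [Algebra k K]

/-- `ρ : O → K` presents `K` as the field of fractions of the quotient of the `k`-algebra `O` by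
the prime ideal `ker ρ`. -/
structure IsComponent (c₀ : k →+* O) (ρ : O →+* K) : Prop where
  map_c : ∀ a, ρ (c₀ a) = algebraMap k K a
  frac : ∀ x, ∃ a s, ρ s ≠ 0 ∧ x = ρ a / ρ s

variable {c₀ : k →+* O} {ρ : O →+* K}

lemma IsComponent.exists_lift (hρ : IsComponent c₀ ρ) {ψ : O →+* PowerSeries k}
    (hψ : ∀ a, ψ (c₀ a) = PowerSeries.C a) (h : RingHom.ker ψ = RingHom.ker ρ) :
    ∃ Φ : K →ₐ[k] LaurentSeries k, ∀ f, Φ (ρ f) = HahnSeries.ofPowerSeries ℤ k (ψ f) := by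
  have hfr : IsFractionRing ρ.range K := by
    refine IsFractionRing.of_field _ _ fun z => ?_
    obtain ⟨a, s, -, h⟩ := hρ.frac z
    exact ⟨⟨ρ a, a, rfl⟩, ⟨ρ s, s, rfl⟩, h⟩
  let g₁ : O ⧸ RingHom.ker ρ →+* LaurentSeries k :=
    Ideal.Quotient.lift _ ((HahnSeries.ofPowerSeries ℤ k).comp ψ) fun a ha => by
      rw [← h, RingHom.mem_ker] at ha
      simp [ha]
  let g : ρ.range →+* LaurentSeries k := g₁.comp (RingHom.quotientKerEquivRange ρ).symm.toRingHom
  have hg₀ : ∀ f, g ⟨ρ f, f, rfl⟩ = HahnSeries.ofPowerSeries ℤ k (ψ f) := fun f => by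
    have : (RingHom.quotientKerEquivRange ρ).symm ⟨ρ f, f, rfl⟩ = Ideal.Quotient.mk _ f := by
      rw [RingEquiv.symm_apply_eq]
      rfl
    have h2 : g ⟨ρ f, f, rfl⟩ = g₁ ((RingHom.quotientKerEquivRange ρ).symm ⟨ρ f, f, rfl⟩) := rfl
    rw [h2, this]
    rfl
  have hg : Function.Injective g := by
    rw [injective_iff_map_eq_zero]
    rintro ⟨-, f, rfl⟩ hf
    rw [hg₀] at hf
    have : ψ f = 0 := ofPowerSeries_injective (hf.trans (map_zero _).symm)
    rw [← RingHom.mem_ker, h] at this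
    exact Subtype.ext this
  have hl : ∀ f, IsFractionRing.lift (K := K) hg (ρ f) =
      HahnSeries.ofPowerSeries ℤ k (ψ f) := fun f => by
    rw [← hg₀]
    exact IsFractionRing.lift_algebraMap hg ⟨ρ f, f, rfl⟩
  refine ⟨{ IsFractionRing.lift (K := K) hg with
    commutes' := fun a => ?_ }, hl⟩
  change IsFractionRing.lift (K := K) hg _ = _
  rw [← hρ.map_c, hl, hψ]
  rw [HahnSeries.ofPowerSeries_C]
  rw [HahnSeries.algebraMap_apply']
  simp

/-- The extension of a formal branch `ψ` to the field of fractions of its component. -/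
def IsComponent.lift (hρ : IsComponent c₀ ρ) {ψ : O →+* PowerSeries k}
    (hψ : ∀ a, ψ (c₀ a) = PowerSeries.C a) (h : RingHom.ker ψ = RingHom.ker ρ) :
    K →ₐ[k] LaurentSeries k := (hρ.exists_lift hψ h).choose

lemma IsComponent.lift_apply (hρ : IsComponent c₀ ρ) {ψ : O →+* PowerSeries k}
    (hψ : ∀ a, ψ (c₀ a) = PowerSeries.C a) (h : RingHom.ker ψ = RingHom.ker ρ) (f : O) :
    hρ.lift hψ h (ρ f) = HahnSeries.ofPowerSeries ℤ k (ψ f) :=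
  (hρ.exists_lift hψ h).choose_spec f

end Component

namespace IsFormalBranches

variable {k : Type*} [Field k] {O : Type*} [CommRing O] [IsLocalRing O] {ι : Type*}
  {c₀ : k →+* O} {φ : ι → O →+* PowerSeries k} {e : ℕ} {K : Type*} [Field K] [Algebra k K]
  {ρ : O →+* K}

/-- The extension of the formal branch `φ i` to the field of fractions of its component. -/
abbrev lift (H : IsFormalBranches c₀ φ e) (hρ : IsComponent c₀ ρ) (i : ι)
    (hi : RingHom.ker (φ i) = RingHom.ker ρ) : K →ₐ[k] LaurentSeries k :=
  hρ.lift (H.map_c i) hi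

lemma lift_apply (H : IsFormalBranches c₀ φ e) (hρ : IsComponent c₀ ρ) (i : ι)
    (hi : RingHom.ker (φ i) = RingHom.ker ρ) (f : O) :
    H.lift hρ i hi (ρ f) = HahnSeries.ofPowerSeries ℤ k (φ i f) := hρ.lift_apply _ _ f

variable [Finite ι] [IsNoetherianRing O]

/-- Rational functions on one component of large order along all its branches extend, by zero on
the other components, to regular functions. -/
lemma exists_of_le_orderTop (H : IsFormalBranches c₀ φ e) (hρ : IsComponent c₀ ρ)
    (hmin : ∃ i, RingHom.ker (φ i) = RingHom.ker ρ) {x : K}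
    (hx : ∀ i hi, ((e : ℤ) : WithTop ℤ) ≤ (H.lift hρ i hi x).orderTop) :
    ∃ f, ρ f = x ∧ ∀ j, RingHom.ker (φ j) ≠ RingHom.ker ρ → φ j f = 0 := by
  classical
  have := Fintype.ofFinite ι
  have hP : (RingHom.ker ρ).IsPrime := RingHom.ker_isPrime ρ
  let J' : Finset ι := Finset.univ.filter fun j => RingHom.ker (φ j) ≠ RingHom.ker ρ
  have hJ' : ∀ j, j ∈ J' ↔ RingHom.ker (φ j) ≠ RingHom.ker ρ := by simp [J']
  obtain ⟨i₀, hi₀⟩ := hmin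
  obtain ⟨z', hz', hz'0⟩ : ∃ z', (∀ j ∈ J', φ j z' = 0) ∧ ρ z' ≠ 0 := by
    by_contra! hcon
    have : J'.inf (fun j => RingHom.ker (φ j)) ≤ RingHom.ker ρ := by
      intro y hy
      exact hcon y fun j hj => (Finset.inf_le hj : J'.inf (fun j => RingHom.ker (φ j)) ≤ _) hy
    obtain ⟨j, hj, hj'⟩ := (Ideal.IsPrime.inf_le' hP).1 this
    rw [← hi₀] at hj'
    exact (hJ' j).1 hj ((H.ker_eq_of_le _ i₀ hj').trans hi₀)
  obtain ⟨z, hz, hz0⟩ : ∃ z, ρ z = 0 ∧ ∀ j ∈ J', φ j z ≠ 0 := by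
    by_contra! hcon
    have : ((RingHom.ker ρ : Ideal O) : Set O) ⊆
        ⋃ j ∈ (J' : Set ι), (RingHom.ker (φ j) : Set O) := by
      intro y hy
      obtain ⟨j, hj, hj'⟩ := hcon y hy
      exact Set.mem_biUnion hj hj'
    obtain ⟨j, hj, hj'⟩ := (Ideal.subset_union_prime i₀ i₀ fun j _ _ _ => ker_isPrime j).1 this
    exact (hJ' j).1 hj (H.ker_eq_of_le _ j hj').symm
  obtain ⟨a, s, hs, rfl⟩ := hρ.frac x
  have hker : ∀ {i}, RingHom.ker (φ i) = RingHom.ker ρ → ∀ {y}, φ i y = 0 ↔ ρ y = 0 :=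
    fun {i} hi {y} => by rw [← RingHom.mem_ker, hi, RingHom.mem_ker]
  have hdvd : (s * z' + z) ∣ a * z' := by
    refine H.dvd_of_dvd fun j => ?_
    by_cases hj : RingHom.ker (φ j) = RingHom.ker ρ
    · have h1 := hx j hj
      rw [map_div₀, H.lift_apply, H.lift_apply] at h1
      have hs0 : φ j s ≠ 0 := fun h => hs ((hker hj).1 h)
      rw [map_add, map_mul, map_mul, (hker hj).2 hz, add_zero, mul_right_comm]
      refine mul_dvd_mul_right (dvd_iff_orderTop_le.2 ?_) _
      have h2 : HahnSeries.ofPowerSeries ℤ k (φ j a) = HahnSeries.ofPowerSeries ℤ k (φ j s) *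
          (HahnSeries.ofPowerSeries ℤ k (φ j a) / HahnSeries.ofPowerSeries ℤ k (φ j s)) := by
        rw [mul_div_cancel₀ _ (ofPowerSeries_ne_zero hs0)]
      rw [h2, map_mul, orderTop_mul, orderTop_mul]
      gcongr
      rw [← mul_one (PowerSeries.X ^ e), orderTop_X_pow_mul e isUnit_one]
      exact h1
    · rw [map_mul (φ j) a, hz' j ((hJ' j).2 hj), mul_zero]
      exact dvd_zero _
  obtain ⟨f, hf⟩ := hdvd
  refine ⟨f, ?_, fun j hj => ?_⟩
  · have := congrArg ρ hf
    simp only [map_mul, map_add, hz, add_zero] at this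
    field_simp
    refine mul_right_cancel₀ hz'0 ?_
    rw [this]; ring
  · have := congrArg (φ j) hf
    simp only [map_mul, map_add, hz' j ((hJ' j).2 hj), mul_zero, zero_add] at this
    exact (mul_eq_zero.1 this.symm).resolve_left (hz0 j ((hJ' j).2 hj))

omit [IsNoetherianRing O] in
/-- Quotients of elements of the conductor have arbitrary prescribed orders along the branches of
a component. -/
lemma exists_ratio (H : IsFormalBranches c₀ φ e) (hρ : IsComponent c₀ ρ) (n : ι → ℕ) :
    ∃ x, x ≠ 0 ∧ ∀ i hi, (H.lift hρ i hi x).orderTop = (n i : ℤ) := by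
  obtain ⟨b, hb⟩ := H.exists_leading (fun i => e + n i) fun i => by omega
  obtain ⟨w, hw⟩ := H.exists_leading (fun _ => e) fun i => le_rfl
  by_cases hmin : ∃ i, RingHom.ker (φ i) = RingHom.ker ρ
  · have key : ∀ i hi, (H.lift hρ i hi (ρ b / ρ w)).orderTop = (n i : ℤ) := fun i hi => by
      obtain ⟨u, hu, hbu⟩ := hb i
      obtain ⟨v, hv, hwv⟩ := hw i
      have h2 := orderTop_X_pow_mul e hv
      rw [div_eq_mul_inv, map_mul, map_inv₀, H.lift_apply, H.lift_apply, orderTop_mul, hbu, hwv,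
        orderTop_inv h2, orderTop_X_pow_mul _ hu]
      norm_cast
      push_cast
      ring_nf
    obtain ⟨i, hi⟩ := hmin
    refine ⟨ρ b / ρ w, fun h => ?_, key⟩
    have := key i hi
    rw [h, map_zero, HahnSeries.orderTop_zero] at this
    exact absurd this (by simp)
  · exact ⟨1, one_ne_zero, fun i hi => (hmin ⟨i, hi⟩).elim⟩

omit [IsNoetherianRing O] in
lemma branchRing_injective (H : IsFormalBranches c₀ φ e) (hρ : IsComponent c₀ ρ) {i j : ι}
    (hi : RingHom.ker (φ i) = RingHom.ker ρ) (hj : RingHom.ker (φ j) = RingHom.ker ρ)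
    (h : branchRing (H.lift hρ i hi) = branchRing (H.lift hρ j hj)) : i = j := by
  classical
  by_contra hne
  obtain ⟨x, hx0, hx⟩ := H.exists_ratio hρ (fun l => if l = i then 0 else 1)
  have hi1 := hx i hi
  have hj1 := hx j hj
  simp only [if_true, if_neg (Ne.symm hne)] at hi1 hj1
  have h1 : x⁻¹ ∈ branchRing (H.lift hρ i hi) := by
    rw [mem_branchRing, map_inv₀, orderTop_inv hi1]
    norm_num
  rw [h, mem_branchRing, map_inv₀, orderTop_inv hj1] at h1
  norm_cast at h1

omit [Finite ι] [IsNoetherianRing O] in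
lemma map_mem_branchRing (H : IsFormalBranches c₀ φ e) (hρ : IsComponent c₀ ρ) (i : ι)
    (hi : RingHom.ker (φ i) = RingHom.ker ρ) (f : O) : ρ f ∈ branchRing (H.lift hρ i hi) := by
  rw [mem_branchRing, lift_apply]
  exact zero_le_orderTop_coe _

omit [Finite ι] [IsNoetherianRing O] in
lemma mem_nonunits_branchRing_iff (Φ : K →ₐ[k] LaurentSeries k) (x : K) :
    x ∈ (branchRing Φ).nonunits ↔ 1 ≤ (Φ x).orderTop := by
  rw [ValuationSubring.mem_nonunits_iff_or, mem_branchRing]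
  by_cases hx : x = 0
  · simp [hx]
  obtain ⟨n, hn⟩ := orderTop_eq_coe ((map_ne_zero Φ).2 hx)
  rw [map_inv₀, orderTop_inv hn, hn]
  norm_cast
  simp only [hx, false_or]
  omega

omit [Finite ι] [IsNoetherianRing O] in
lemma map_mem_nonunits_branchRing (H : IsFormalBranches c₀ φ e) (hρ : IsComponent c₀ ρ) (i : ι)
    (hi : RingHom.ker (φ i) = RingHom.ker ρ) {f : O} (hf : f ∈ maximalIdeal O) :
    ρ f ∈ (branchRing (H.lift hρ i hi)).nonunits := by
  rw [mem_nonunits_branchRing_iff, lift_apply]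
  have := (le_orderTop_coe_iff (p := φ i f) (n := 1)).2 (by rw [pow_one]; exact H.dvd i f hf)
  exact_mod_cast this

/-- A rational function that is regular along all the branches of its component is integral over
the local ring, hence lies in every valuation ring containing the local ring. -/
lemma mem_of_forall_mem_branchRing (H : IsFormalBranches c₀ φ e) (hρ : IsComponent c₀ ρ)
    (hmin : ∃ i, RingHom.ker (φ i) = RingHom.ker ρ) (V : ValuationSubring K)
    (hV : ∀ f, ρ f ∈ V) {x : K} (hx : ∀ i hi, x ∈ branchRing (H.lift hρ i hi)) : x ∈ V := by
  let _ : Algebra O K := ρ.toAlgebra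
  -- the conductor is a nonzero finitely generated module stable under multiplication by `x`
  let F : Submodule O K :=
    { carrier := {y | ∀ i hi, ((e : ℤ) : WithTop ℤ) ≤ (H.lift hρ i hi y).orderTop}
      add_mem' := fun {a b} ha hb i hi => by
        rw [map_add]
        exact le_trans (le_min (ha i hi) (hb i hi)) HahnSeries.min_orderTop_le_orderTop_add
      zero_mem' := fun i hi => by simp
      smul_mem' := fun f y hy i hi => by
        rw [Algebra.smul_def, map_mul, orderTop_mul]
        have h1 : 0 ≤ (H.lift hρ i hi (algebraMap O K f)).orderTop :=
          H.map_mem_branchRing hρ i hi f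
        exact le_add_of_nonneg_of_le h1 (hy i hi) }
  have hF : F ≠ ⊥ := by
    obtain ⟨y, hy0, hy⟩ := H.exists_ratio hρ (fun _ => e)
    intro h
    refine hy0 ((Submodule.mem_bot O).1 (h ▸ (?_ : y ∈ F)))
    intro i hi
    rw [hy i hi]
  have hFG : F.FG := by
    have h1 : F ≤ LinearMap.range (Algebra.linearMap O K) := fun y hy => by
      obtain ⟨f, hf, -⟩ := H.exists_of_le_orderTop hρ hmin hy
      exact ⟨f, hf⟩
    have h2 : IsNoetherian O (LinearMap.range (Algebra.linearMap O K)) := inferInstance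
    exact isNoetherian_submodule.1 h2 F h1
  have hint : IsIntegral O x := isIntegral_of_smul_mem_submodule F hF hFG x fun y hy i hi => by
    rw [smul_eq_mul, map_mul, orderTop_mul]
    exact le_add_of_nonneg_of_le (hx i hi) (hy i hi)
  have hint' : IsIntegral V x := by
    obtain ⟨p, hp, hpx⟩ := hint
    refine ⟨p.map ((ρ.codRestrict V.toSubring hV : O →+* V)), hp.map _, ?_⟩
    rw [Polynomial.eval₂_map]
    exact hpx
  obtain ⟨y, rfl⟩ := (IsIntegrallyClosed.isIntegral_iff (R := V)).1 hint'
  exact y.2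

/-- A valuation ring dominating the local ring is the valuation ring of a formal branch. -/
lemma exists_eq_branchRing (H : IsFormalBranches c₀ φ e) (hρ : IsComponent c₀ ρ)
    (hmin : ∃ i, RingHom.ker (φ i) = RingHom.ker ρ) (V : ValuationSubring K)
    (hV : ∀ f, ρ f ∈ V) (hV' : ∀ f ∈ maximalIdeal O, ρ f ∈ V.nonunits) :
    ∃ i hi, V = branchRing (H.lift hρ i hi) := by
  classical
  have hB := fun {x} => H.mem_of_forall_mem_branchRing hρ hmin V hV (x := x)
  -- an element of the maximal ideal of the integral closure on all branches, outside `ker ρ`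
  obtain ⟨i₀, hi₀⟩ := hmin
  obtain ⟨i, hi, hle⟩ : ∃ i hi, branchRing (H.lift hρ i hi) ≤ V := by
    by_contra! hcon
    -- choose `x i` integral along the branch `i` with inverse in the maximal ideal of `V`
    have h1 : ∀ i, ∃ u : K, (∀ hi : RingHom.ker (φ i) = RingHom.ker ρ, u ∈ V.nonunits) ∧
        ∀ j hj, (H.lift hρ j hj u).orderTop = (if j = i then (0 : ℕ) else (1 : ℕ) : ℤ) ∨
          j ≠ i ∧ 1 ≤ (H.lift hρ j hj u).orderTop := by
      intro i
      by_cases hi : RingHom.ker (φ i) = RingHom.ker ρ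
      swap
      · exact ⟨0, fun h => (hi h).elim, fun j hj => Or.inr ⟨fun h => hi (h ▸ hj), by simp⟩⟩
      obtain ⟨x, hx, hxV⟩ := SetLike.not_le_iff_exists.1 (hcon i hi)
      have hx0 : x ≠ 0 := fun h => hxV (h ▸ V.zero_mem)
      have hor : ∀ j, ∃ n : ℕ, ∀ hj, ((-n : ℤ) : WithTop ℤ) ≤ (H.lift hρ j hj x).orderTop := by
        intro j
        by_cases hj : RingHom.ker (φ j) = RingHom.ker ρ
        · obtain ⟨n, hn⟩ := orderTop_eq_coe ((map_ne_zero (H.lift hρ j hj)).2 hx0)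
          refine ⟨(-n).toNat, fun _ => ?_⟩
          rw [hn]
          norm_cast
          omega
        · exact ⟨0, fun h => (hj h).elim⟩
      choose n hn using hor
      obtain ⟨u, hu0, hu⟩ := H.exists_ratio hρ (fun j => if j = i then 0 else n j + 1)
      have huV : u * x ∈ V := hB fun j hj => by
        rw [mem_branchRing, map_mul, orderTop_mul, hu]
        by_cases hji : j = i
        · subst hji
          simp only [if_true]
          exact add_nonneg le_rfl hx
        · rw [if_neg hji]
          calc (0 : WithTop ℤ) ≤ ((n j + 1 : ℕ) : ℤ) + ((-n j : ℤ) : WithTop ℤ) := by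
                norm_cast; push_cast; omega
            _ ≤ _ := by gcongr; exact hn j hj
      refine ⟨u, fun _ => ?_, fun j hj => ?_⟩
      · rw [ValuationSubring.mem_nonunits_iff_or]
        right
        intro hu'
        refine hxV ?_
        have := V.mul_mem _ _ hu' huV
        rwa [inv_mul_cancel_left₀ hu0] at this
      · by_cases hji : j = i
        · left
          rw [hu, if_pos hji, if_pos hji]
        · right
          refine ⟨hji, ?_⟩
          rw [hu, if_neg hji]
          norm_cast
          omega
    choose u huV hu using h1
    have := Fintype.ofFinite ι
    let J : Finset ι := Finset.univ.filter fun i => RingHom.ker (φ i) = RingHom.ker ρ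
    -- the sum is a unit along every branch, yet lies in the maximal ideal of `V`
    let v := ∑ i ∈ J, u i
    have hv : v ∈ V.nonunits := sum_mem fun i hi => huV i (by simpa [J] using hi)
    have hv0 : ∀ j hj, (H.lift hρ j hj v).orderTop = (0 : ℤ) := by
      intro j hj
      have hjJ : j ∈ J := by simpa [J] using hj
      have h1 : (H.lift hρ j hj (u j)).orderTop = 0 := by
        rcases hu j j hj with h | h
        · simpa using h
        · exact (h.1 rfl).elim
      have h2 : 1 ≤ (H.lift hρ j hj (∑ i ∈ J.erase j, u i)).orderTop := by
        rw [← mem_nonunits_branchRing_iff]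
        refine sum_mem fun i hi => ?_
        rw [mem_nonunits_branchRing_iff]
        have hji : j ≠ i := (Finset.ne_of_mem_erase hi).symm
        rcases hu i j hj with h | h
        · rw [h, if_neg hji]; norm_cast
        · exact h.2
      have h3 : v = u j + ∑ i ∈ J.erase j, u i := (Finset.add_sum_erase J u hjJ).symm
      rw [h3, map_add, HahnSeries.orderTop_add_eq_left, h1]
      · rfl
      · rw [h1]
        exact lt_of_lt_of_le (by norm_num) h2
    have hvi : v⁻¹ ∈ V := hB fun j hj => by
      rw [mem_branchRing, map_inv₀, orderTop_inv (hv0 j hj)]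
      norm_num
    rw [ValuationSubring.mem_nonunits_iff_or] at hv
    rcases hv with hv | hv
    · have := hv0 i₀ hi₀
      rw [hv, map_zero, HahnSeries.orderTop_zero] at this
      exact absurd this (by simp)
    · exact hv hvi
  refine ⟨i, hi, le_antisymm (fun y hy => ?_) hle⟩
  -- `V` is not the whole field, so it is not larger than a discrete valuation ring
  by_contra hyB
  have hy0 : y ≠ 0 := fun h => hyB (h ▸ zero_mem _)
  obtain ⟨w, hw⟩ := H.exists_leading (fun _ => e + 1) (fun i => by omega)
  obtain ⟨a, ha, hwa⟩ := hw i
  have hwm : w ∈ maximalIdeal O := by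
    rw [H.mem_maximalIdeal_iff i, hwa]; simp
  have hw1 : (H.lift hρ i hi (ρ w)).orderTop = ((e + 1 : ℕ) : ℤ) := by
    rw [H.lift_apply, hwa, orderTop_X_pow_mul _ ha]
  have hw0 : ρ w ≠ 0 := fun h => by
    rw [h, map_zero, HahnSeries.orderTop_zero] at hw1
    exact WithTop.coe_ne_top hw1.symm
  obtain ⟨n, hn⟩ := orderTop_eq_coe ((map_ne_zero (H.lift hρ i hi)).2 hy0)
  rw [mem_branchRing, hn] at hyB
  norm_cast at hyB
  have h1 : (y ^ (e + 1) * ρ w)⁻¹ ∈ V := hle (by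
    have h2 : (H.lift hρ i hi (y ^ (e + 1) * ρ w)).orderTop =
        (((e + 1 : ℕ) * n + (e + 1 : ℕ) : ℤ)) := by
      rw [map_mul, orderTop_mul, map_pow, orderTop_pow, hw1, hn]
      norm_cast
    rw [mem_branchRing, map_inv₀, orderTop_inv h2]
    norm_cast
    push_cast
    nlinarith)
  have h2 := V.mul_mem _ _ (pow_mem hy (e + 1)) h1
  rw [mul_inv_rev, mul_comm, mul_assoc, inv_mul_cancel₀ (pow_ne_zero _ hy0), mul_one] at h2
  rcases V.mem_nonunits_iff_or.1 (hV' w hwm) with h | h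
  · exact hw0 h
  · exact h h2

end IsFormalBranches

/-! ### Expansion of differentials and residues -/

section Theta

variable {k : Type u} [Field k]

/-- The derivation `t d/dt` of `k((t))`. -/
def theta (x : LaurentSeries k) : LaurentSeries k where
  coeff n := (n : k) * x.coeff n
  isPWO_support' := x.isPWO_support.mono fun n hn h => hn (by simp [h])

lemma coeff_theta (x : LaurentSeries k) (n : ℤ) : (theta x).coeff n = n * x.coeff n := rfl

lemma theta_add (x y : LaurentSeries k) : theta (x + y) = theta x + theta y := by
  ext n
  simp [coeff_theta, mul_add]

lemma theta_C (a : k) : theta (HahnSeries.C a : LaurentSeries k) = 0 := by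
  ext n
  rw [coeff_theta, HahnSeries.C_apply]
  by_cases h : n = 0
  · simp [h]
  · rw [HahnSeries.coeff_single_of_ne h]; simp

lemma theta_mul (x y : LaurentSeries k) : theta (x * y) = x * theta y + y * theta x := by
  have h : ∀ z : LaurentSeries k, (theta z).support ⊆ z.support := fun z n hn h0 => hn (by
    rw [coeff_theta, h0, mul_zero])
  ext n
  rw [HahnSeries.coeff_add, mul_comm y, coeff_theta, HahnSeries.coeff_mul,
    HahnSeries.coeff_mul_right' y.isPWO_support (h y),
    HahnSeries.coeff_mul_left' x.isPWO_support (h x), Finset.mul_sum, ← Finset.sum_add_distrib]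
  refine Finset.sum_congr rfl fun ij hij => ?_
  rw [coeff_theta, coeff_theta, ← (Finset.mem_antidiagonal.1 hij).2.2]
  push_cast
  ring

lemma coeff_zero_theta (x : LaurentSeries k) : (theta x).coeff 0 = 0 := by
  simp [coeff_theta]

lemma orderTop_le_theta (x : LaurentSeries k) : x.orderTop ≤ (theta x).orderTop := by
  rw [HahnSeries.le_orderTop_iff_forall]
  intro j hj
  rw [coeff_theta, HahnSeries.coeff_eq_zero_of_lt_orderTop hj, mul_zero]

lemma theta_one : theta (1 : LaurentSeries k) = 0 := by
  simpa using theta_C (1 : k)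

lemma theta_inv {x : LaurentSeries k} (hx : x ≠ 0) : theta x⁻¹ = -(x⁻¹ ^ 2 * theta x) := by
  have h := theta_mul x x⁻¹
  rw [mul_inv_cancel₀ hx, theta_one] at h
  have h2 : x * theta x⁻¹ = -(x⁻¹ * theta x) := by linear_combination -h
  calc theta x⁻¹ = x⁻¹ * (x * theta x⁻¹) := by rw [inv_mul_cancel_left₀ hx]
    _ = _ := by rw [h2]; ring

lemma orderTop_add_one_le {x : LaurentSeries k} {n : ℤ} (hx : (n : WithTop ℤ) ≤ x.orderTop)
    (h : x.coeff n = 0) : ((n + 1 : ℤ) : WithTop ℤ) ≤ x.orderTop := by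
  rw [le_orderTop_iff] at hx ⊢
  intro j hj
  rcases eq_or_ne j n with rfl | h'
  · exact h
  · exact hx j (by omega)

/-- A Laurent series of order one has logarithmic derivative `1 + O(t)`. -/
lemma orderTop_theta_sub_self {x : LaurentSeries k} (hx : x.orderTop = 1) :
    2 ≤ (theta x - x).orderTop := by
  have h1 : ((1 : ℤ) : WithTop ℤ) ≤ (theta x - x).orderTop := by
    refine le_trans (le_min ?_ ?_) HahnSeries.min_orderTop_le_orderTop_sub
    · exact le_trans (by rw [hx]; rfl) (orderTop_le_theta x)
    · rw [hx]; rfl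
  have := orderTop_add_one_le h1 (by simp [coeff_theta])
  exact_mod_cast this

lemma orderTop_theta {x : LaurentSeries k} (hx : x.orderTop = 1) : (theta x).orderTop = 1 := by
  have h : theta x = x + (theta x - x) := by ring
  rw [h, HahnSeries.orderTop_add_eq_left, hx]
  rw [hx]
  exact lt_of_lt_of_le (by norm_num) (orderTop_theta_sub_self hx)

variable {K : Type u} [Field K] [Algebra k K]

lemma map_algebraMap (Φ : K →ₐ[k] LaurentSeries k) (a : k) :
    Φ (algebraMap k K a) = HahnSeries.C a := by
  rw [Φ.commutes, HahnSeries.algebraMap_apply']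
  simp

/-- The field `k((t))` as a vector space over `K` by means of `Φ`. -/
def ViaLaurent (_Φ : K →ₐ[k] LaurentSeries k) : Type _ := LaurentSeries k

variable (Φ : K →ₐ[k] LaurentSeries k)

instance : AddCommGroup (ViaLaurent Φ) := inferInstanceAs (AddCommGroup (LaurentSeries k))

instance : Module K (ViaLaurent Φ) :=
  letI : Module (LaurentSeries k) (ViaLaurent Φ) :=
    inferInstanceAs (Module (LaurentSeries k) (LaurentSeries k))
  Module.compHom (ViaLaurent Φ) Φ.toRingHom

instance : Module k (ViaLaurent Φ) := Module.compHom (ViaLaurent Φ) (algebraMap k K)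

instance : IsScalarTower k K (ViaLaurent Φ) where
  smul_assoc a x y := by
    rw [Algebra.smul_def, mul_smul]
    rfl

/-- The derivation `t d/dt` along `Φ`. -/
def thetaDerivation : Derivation k K (ViaLaurent Φ) where
  toFun x := theta (Φ x)
  map_add' x y := by rw [map_add, theta_add]; rfl
  map_smul' a x := by
    rw [Algebra.smul_def, map_mul, theta_mul, map_algebraMap, theta_C, mul_zero, add_zero]
    rw [← map_algebraMap Φ]
    rfl
  map_one_eq_zero' := by
    change theta (Φ 1) = 0
    rw [map_one, theta_one]
  leibniz' x y := by
    change theta (Φ (x * y)) = _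
    rw [map_mul, theta_mul]
    rfl

/-- The expansion of a differential of `K` along `Φ : K → k((t))`: its coefficient with respect to
`dt / t`. The residue is the constant coefficient of this expansion. -/
def expand : Ω[K⁄k] →+ LaurentSeries k :=
  (thetaDerivation Φ).liftKaehlerDifferential.toAddMonoidHom

lemma expand_D (x : K) : expand Φ (KaehlerDifferential.D k K x) = theta (Φ x) :=
  (thetaDerivation Φ).liftKaehlerDifferential_comp_D x

lemma expand_smul (x : K) (ω : Ω[K⁄k]) : expand Φ (x • ω) = Φ x * expand Φ ω :=
  (thetaDerivation Φ).liftKaehlerDifferential.map_smul x ω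

/-- A rational function with an expansion along `Φ` of order at least `n` is, up to higher order,
a constant multiple of the `n`-th power of a uniformizer. -/
lemma exists_sub_mul_pow {t : K} (ht : (Φ t).orderTop = 1) {x : K} {n : ℤ}
    (hx : (n : WithTop ℤ) ≤ (Φ x).orderTop) :
    ∃ a : k, ((n + 1 : ℤ) : WithTop ℤ) ≤ (Φ (x - algebraMap k K a * t ^ n)).orderTop := by
  have ht0 : t ≠ 0 := by rintro rfl; simp at ht
  have htn : (Φ (t ^ n)).orderTop = n := by
    have h1 : ∀ m : ℕ, (Φ (t ^ m)).orderTop = (m : ℤ) := fun m => by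
      rw [map_pow, orderTop_pow, ht]
      norm_cast
      simp
    obtain ⟨m, rfl | rfl⟩ := n.eq_nat_or_neg
    · rw [zpow_natCast, h1]
    · rw [zpow_neg, map_inv₀, orderTop_inv (n := m)]
      rw [zpow_natCast, h1]
  have hc : (Φ (t ^ n)).coeff n ≠ 0 := by
    intro h
    have := orderTop_add_one_le htn.ge h
    rw [htn] at this
    norm_cast at this
    omega
  refine ⟨(Φ x).coeff n / (Φ (t ^ n)).coeff n, orderTop_add_one_le ?_ ?_⟩
  · rw [map_sub, map_mul, map_algebraMap]
    refine le_trans (le_min hx ?_) HahnSeries.min_orderTop_le_orderTop_sub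
    rw [HahnSeries.C_mul_eq_smul, le_orderTop_iff]
    intro j hj
    rw [HahnSeries.coeff_smul, le_orderTop_iff.1 htn.ge j hj, smul_zero]
  · rw [map_sub, map_mul, map_algebraMap, HahnSeries.C_mul_eq_smul, HahnSeries.coeff_sub,
      HahnSeries.coeff_smul, smul_eq_mul, div_mul_cancel₀ _ hc, sub_self]

variable {Φ}

/-- The differentials of `K` are one-dimensional, spanned by an exact one. -/
def IsExactSpan (k K : Type*) [Field k] [Field K] [Algebra k K] : Prop :=
  ∃ s : K, ∀ ω : Ω[K⁄k], ∃ h : K, ω = h • KaehlerDifferential.D k K s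

lemma D_ne_zero {t : K} (ht : (Φ t).orderTop = 1) : KaehlerDifferential.D k K t ≠ 0 := by
  intro h
  have h1 := orderTop_theta ht
  rw [← expand_D, h, map_zero, HahnSeries.orderTop_zero] at h1
  exact absurd h1 (by simp)

/-- The differential of a uniformizer spans. -/
lemma IsExactSpan.exists_eq (hΩ : IsExactSpan k K) {t : K} (ht : (Φ t).orderTop = 1)
    (ω : Ω[K⁄k]) : ∃ h : K, ω = h • KaehlerDifferential.D k K t := by
  obtain ⟨s, hs⟩ := hΩ
  obtain ⟨a, ha⟩ := hs (KaehlerDifferential.D k K t)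
  obtain ⟨b, rfl⟩ := hs ω
  have ha0 : a ≠ 0 := by
    rintro rfl
    exact D_ne_zero ht (by rw [ha, zero_smul])
  exact ⟨b * a⁻¹, by rw [ha, smul_smul, inv_mul_cancel_right₀ ha0]⟩

lemma orderTop_expand_smul_D {t : K} (ht : (Φ t).orderTop = 1) (h : K) :
    (expand Φ (h • KaehlerDifferential.D k K t)).orderTop = (Φ h).orderTop + 1 := by
  rw [expand_smul, orderTop_mul, expand_D, orderTop_theta ht]

lemma orderTop_eq_one_of_span {g : K} (hg : (Φ g).orderTop = 1) {t : branchRing Φ}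
    (ht : IsLocalRing.maximalIdeal (branchRing Φ) = Ideal.span {t}) :
    (Φ (t : K)).orderTop = 1 := by
  refine le_antisymm ?_ ?_
  · have h1 : g ∈ (branchRing Φ).nonunits := by
      rw [IsFormalBranches.mem_nonunits_branchRing_iff, hg]
    obtain ⟨h2, h3⟩ := ValuationSubring.mem_nonunits_iff_exists_mem_maximalIdeal.1 h1
    rw [ht] at h3
    obtain ⟨a, ha⟩ := Ideal.mem_span_singleton'.1 h3
    have h4 : g = a * t := congrArg Subtype.val ha.symm
    rw [h4, map_mul, orderTop_mul] at hg
    rw [← hg]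
    exact le_add_of_nonneg_left a.2
  · rw [← IsFormalBranches.mem_nonunits_branchRing_iff,
      ValuationSubring.mem_nonunits_iff_exists_mem_maximalIdeal]
    refine ⟨t.2, ?_⟩
    rw [ht]
    exact Ideal.mem_span_singleton_self t

/-- The residue of a differential with at most a double pole is the constant coefficient of its
expansion with respect to `dt / t`. -/
lemma residue_eq_coeff_zero (hΩ : IsExactSpan k K) {g : K} (hg : (Φ g).orderTop = 1)
    {r : Ω[K⁄k] →ₗ[k] k} (hr : IsResidue (branchRing Φ) r) {ω : Ω[K⁄k]}
    (hω : ((-1 : ℤ) : WithTop ℤ) ≤ (expand Φ ω).orderTop) : r ω = (expand Φ ω).coeff 0 := by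
  obtain ⟨t, ht, hr0, hr1, hr2⟩ := hr
  have ht1 := orderTop_eq_one_of_span hg ht
  have ht0 : (t : K) ≠ 0 := by intro h; rw [h] at ht1; simp at ht1
  obtain ⟨h, rfl⟩ := hΩ.exists_eq ht1 ω
  have hh : ((-2 : ℤ) : WithTop ℤ) ≤ (Φ h).orderTop := by
    rw [orderTop_expand_smul_D ht1] at hω
    by_cases h0 : Φ h = 0
    · rw [h0]; simp
    obtain ⟨n, hn⟩ := orderTop_eq_coe h0
    rw [hn] at hω ⊢
    norm_cast at hω ⊢
    omega
  obtain ⟨α, hα⟩ := exists_sub_mul_pow Φ ht1 hh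
  obtain ⟨β, hβ⟩ := exists_sub_mul_pow Φ ht1 hα
  set a := h - algebraMap k K α * (t : K) ^ (-2 : ℤ) -
    algebraMap k K β * (t : K) ^ (-2 + 1 : ℤ) with ha
  have hdec : h • KaehlerDifferential.D k K (t : K) =
      α • (((t : K)⁻¹) ^ 2 • KaehlerDifferential.D k K (t : K)) +
      β • ((t : K)⁻¹ • KaehlerDifferential.D k K (t : K)) +
      a • KaehlerDifferential.D k K (t : K) := by
    have h1 : h = algebraMap k K α * ((t : K)⁻¹) ^ 2 + algebraMap k K β * (t : K)⁻¹ + a := by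
      have e1 : (t : K) ^ (-2 : ℤ) = ((t : K)⁻¹) ^ 2 := by
        rw [zpow_neg, inv_pow, ← zpow_natCast]; rfl
      have e2 : (t : K) ^ (-2 + 1 : ℤ) = (t : K)⁻¹ := by norm_num
      rw [ha, e1, e2]
      ring
    rw [← algebraMap_smul K α, ← algebraMap_smul K β, smul_smul, smul_smul, ← add_smul,
      ← add_smul, ← h1]
  have haA : 0 ≤ (Φ a).orderTop := by simpa using hβ
  have htne : Φ (t : K) ≠ 0 := (map_ne_zero Φ).2 ht0
  -- `t⁻² dt` is exact, and `t⁻¹ dt` has constant coefficient one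
  have e2 : (expand Φ (((t : K)⁻¹) ^ 2 • KaehlerDifferential.D k K (t : K))).coeff 0 = 0 := by
    have : expand Φ (((t : K)⁻¹) ^ 2 • KaehlerDifferential.D k K (t : K)) =
        -theta (Φ (t : K))⁻¹ := by
      rw [expand_smul, expand_D, theta_inv htne, neg_neg, map_pow, map_inv₀]
    rw [this, HahnSeries.coeff_neg, coeff_zero_theta, neg_zero]
  have e1 : (expand Φ ((t : K)⁻¹ • KaehlerDifferential.D k K (t : K))).coeff 0 = 1 := by
    have h1 : expand Φ ((t : K)⁻¹ • KaehlerDifferential.D k K (t : K)) =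
        1 + (Φ (t : K))⁻¹ * (theta (Φ (t : K)) - Φ (t : K)) := by
      rw [expand_smul, expand_D, map_inv₀, mul_sub, inv_mul_cancel₀ htne]
      ring
    have h2 : (1 : WithTop ℤ) ≤
        ((Φ (t : K))⁻¹ * (theta (Φ (t : K)) - Φ (t : K))).orderTop := by
      rw [orderTop_mul, orderTop_inv (n := 1) (by rw [ht1]; rfl)]
      calc (1 : WithTop ℤ) = ((-1 : ℤ) : WithTop ℤ) + ((2 : ℤ) : WithTop ℤ) := by
            norm_cast
        _ ≤ _ := by gcongr; exact orderTop_theta_sub_self ht1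
    rw [h1, HahnSeries.coeff_add,
      HahnSeries.coeff_eq_zero_of_lt_orderTop (lt_of_lt_of_le (by norm_num) h2), add_zero]
    simp
  have e0 : (expand Φ (a • KaehlerDifferential.D k K (t : K))).coeff 0 = 0 := by
    refine HahnSeries.coeff_eq_zero_of_lt_orderTop ?_
    rw [orderTop_expand_smul_D ht1]
    exact lt_of_lt_of_le (by norm_num) (le_add_of_nonneg_left haA)
  have hk : ∀ (c : k) (η : Ω[K⁄k]), (expand Φ (c • η)).coeff 0 = c * (expand Φ η).coeff 0 := by
    intro c η
    rw [← algebraMap_smul K c, expand_smul, map_algebraMap, HahnSeries.C_mul_eq_smul,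
      HahnSeries.coeff_smul, smul_eq_mul]
  rw [hdec, map_add, map_add, r.map_smul α, r.map_smul β, hr1, hr2 2 le_rfl, hr0 a haA, map_add,
    map_add, HahnSeries.coeff_add, HahnSeries.coeff_add, hk, hk, e0, e1, e2]
  simp

lemma orderTop_aeval {g : K} (hg : (Φ g).orderTop = 1) {P : Polynomial k} (hP : P ≠ 0) :
    (Φ (Polynomial.aeval (R := k) g⁻¹ P)).orderTop = (-(P.natDegree : ℤ) : ℤ) := by
  have hg0 : g ≠ 0 := by rintro rfl; simp at hg
  let _ : Invertible g⁻¹ := invertibleOfNonzero (inv_ne_zero hg0)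
  have h1 := Polynomial.eval₂_reverse_mul_pow (algebraMap k K) g⁻¹ P
  rw [invOf_eq_inv, inv_inv] at h1
  have h2 : (Φ (Polynomial.eval₂ (algebraMap k K) g P.reverse)).orderTop = 0 := by
    rw [← Polynomial.divX_mul_X_add P.reverse, Polynomial.eval₂_add, Polynomial.eval₂_mul,
      Polynomial.eval₂_X, Polynomial.eval₂_C, map_add, map_mul, map_algebraMap, add_comm,
      Polynomial.coeff_zero_reverse, HahnSeries.orderTop_add_eq_left]
    · rw [HahnSeries.C_apply, HahnSeries.orderTop_single (by simpa using hP)]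
      rfl
    · rw [HahnSeries.C_apply, HahnSeries.orderTop_single (by simpa using hP), orderTop_mul, hg]
      have h3 : Polynomial.eval₂ (algebraMap k K) g P.reverse.divX ∈ branchRing Φ := by
        rw [Polynomial.eval₂_eq_sum_range]
        refine sum_mem fun i _ => mul_mem ?_ (pow_mem ?_ _)
        · rw [mem_branchRing, map_algebraMap, ← HahnSeries.ofPowerSeries_C]
          exact zero_le_orderTop_coe _
        · rw [mem_branchRing, hg]; norm_num
      exact lt_of_lt_of_le (by norm_num) (le_add_of_nonneg_left h3)
  have h4 : Polynomial.aeval g⁻¹ P = Polynomial.eval₂ (algebraMap k K) g⁻¹ P := rfl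
  rw [h4, ← h1, map_mul, orderTop_mul, h2, zero_add, map_pow, map_inv₀, orderTop_pow,
    orderTop_inv (n := 1) (by rw [hg]; rfl)]
  norm_cast
  simp

/-- The residue exists, since `g⁻¹` is not a linear combination of regular functions and the powers
`g⁻ⁿ` with `n ≥ 2`. -/
lemma exists_isResidue (hΩ : IsExactSpan k K) {g : K} (hg : (Φ g).orderTop = 1) :
    ∃ r : Ω[K⁄k] →ₗ[k] k, IsResidue (branchRing Φ) r := by
  have hg0 : g ≠ 0 := by rintro rfl; simp at hg
  -- the span of the valuation ring and of the powers `g⁻ⁿ` with `n ≥ 2`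
  let S : Submodule k K :=
    { carrier := {x | ∃ P : Polynomial k, x - g⁻¹ ^ 2 * Polynomial.aeval g⁻¹ P ∈ branchRing Φ}
      add_mem' := by
        rintro x y ⟨P, hP⟩ ⟨Q, hQ⟩
        refine ⟨P + Q, ?_⟩
        have := add_mem hP hQ
        rw [map_add]
        convert this using 1
        ring
      zero_mem' := ⟨0, by simp⟩
      smul_mem' := by
        rintro c x ⟨P, hP⟩
        refine ⟨c • P, ?_⟩
        have : algebraMap k K c ∈ branchRing Φ := by
          rw [mem_branchRing, map_algebraMap, ← HahnSeries.ofPowerSeries_C]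
          exact zero_le_orderTop_coe _
        have := mul_mem this hP
        rw [map_smul, Algebra.smul_def, Algebra.smul_def]
        convert this using 1
        ring }
  have hS : g⁻¹ ∉ S := by
    rintro ⟨P, hP⟩
    rw [mem_branchRing, map_sub] at hP
    have h1 : (Φ g⁻¹).orderTop = (-1 : ℤ) := by
      rw [map_inv₀, orderTop_inv (n := 1) (by rw [hg]; rfl)]
    by_cases hP0 : P = 0
    · subst hP0
      rw [map_zero, mul_zero, map_zero, sub_zero, h1] at hP
      norm_cast at hP
    · have h2 : (Φ (g⁻¹ ^ 2 * Polynomial.aeval g⁻¹ P)).orderTop =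
          (-2 - (P.natDegree : ℤ) : ℤ) := by
        rw [map_mul, orderTop_mul, orderTop_aeval hg hP0, map_pow, orderTop_pow, h1]
        norm_cast
      have h3 : (Φ g⁻¹ - Φ (g⁻¹ ^ 2 * Polynomial.aeval g⁻¹ P)).orderTop =
          (-2 - (P.natDegree : ℤ) : ℤ) := by
        rw [sub_eq_neg_add, HahnSeries.orderTop_add_eq_left, HahnSeries.orderTop_neg, h2]
        rw [HahnSeries.orderTop_neg, h2, h1]
        norm_cast
        omega
      rw [h3] at hP
      norm_cast at hP
      omega
  obtain ⟨l, hl, hSl⟩ := Submodule.exists_le_ker_of_notMem hS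
  have hinj : Function.Injective
      (LinearMap.toSpanSingleton K Ω[K⁄k] (KaehlerDifferential.D k K g)) := by
    rw [injective_iff_map_eq_zero]
    intro a ha
    rw [LinearMap.toSpanSingleton_apply] at ha
    exact (smul_eq_zero.1 ha).resolve_right (D_ne_zero hg)
  let E : K ≃ₗ[K] Ω[K⁄k] := LinearEquiv.ofBijective
    (LinearMap.toSpanSingleton K Ω[K⁄k] (KaehlerDifferential.D k K g))
    ⟨hinj, fun ω => by
      obtain ⟨h, rfl⟩ := hΩ.exists_eq hg ω
      exact ⟨h, rfl⟩⟩
  have hE : ∀ h : K, E.symm (h • KaehlerDifferential.D k K g) = h := fun h => by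
    rw [LinearEquiv.symm_apply_eq]
    rfl
  let r : Ω[K⁄k] →ₗ[k] k := (l g⁻¹)⁻¹ • (l ∘ₗ (E.symm.restrictScalars k).toLinearMap)
  have hr : ∀ h : K, r (h • KaehlerDifferential.D k K g) = (l g⁻¹)⁻¹ * l h := fun h => by
    change (l g⁻¹)⁻¹ * l (E.symm (h • KaehlerDifferential.D k K g)) = _
    rw [hE]
  have hgA : g ∈ branchRing Φ := by rw [mem_branchRing, hg]; norm_num
  refine ⟨r, ⟨g, hgA⟩, ?_, fun h hh => ?_, ?_, fun n hn => ?_⟩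
  · ext x
    rw [← ValuationSubring.coe_mem_nonunits_iff, IsFormalBranches.mem_nonunits_branchRing_iff,
      Ideal.mem_span_singleton']
    constructor
    · intro hx
      refine ⟨⟨x * g⁻¹, ?_⟩, Subtype.ext (by simp [hg0])⟩
      rw [mem_branchRing, map_mul, orderTop_mul, map_inv₀,
        orderTop_inv (n := 1) (by rw [hg]; rfl)]
      calc (0 : WithTop ℤ) = 1 + ((-1 : ℤ) : WithTop ℤ) := by norm_cast
        _ ≤ _ := by gcongr
    · rintro ⟨a, rfl⟩
      have h1 : Φ ((a * ⟨g, hgA⟩ : branchRing Φ) : K) = Φ (a : K) * Φ g := map_mul _ _ _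
      rw [h1, orderTop_mul, hg]
      exact le_add_of_nonneg_left a.2
  · have h0 : l h = 0 := hSl (show h ∈ S from ⟨0, by simpa using hh⟩)
    rw [hr, h0, mul_zero]
  · rw [hr, inv_mul_cancel₀ hl]
  · have h0 : l (g⁻¹ ^ n) = 0 := by
      refine hSl (show g⁻¹ ^ n ∈ S from ⟨Polynomial.X ^ (n - 2), ?_⟩)
      rw [map_pow, Polynomial.aeval_X, ← pow_add, Nat.add_sub_cancel' hn, sub_self]
      exact zero_mem _
    rw [hr, h0, mul_zero]

end Theta

/-! ### Branches of a curve at a point -/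

section Components

variable {X : Scheme.{u}} {x η : X}

lemma toBranch_germ {U : X.Opens} (hx : x ∈ U) (h : η ⤳ x) (f : Γ(X, U)) :
    toBranch X h ((X.presheaf.germ U x hx).hom f) =
      (X.evaluation U η (h.mem_open U.isOpen hx)).hom f := by
  change (X.presheaf.germ U x hx ≫ X.presheaf.stalkSpecializes h ≫ X.residue η).hom f = _
  rw [TopCat.Presheaf.germ_stalkSpecializes_assoc]
  rfl

lemma toBranch_toStalk (k : Type u) [Field k] [X.Over (Spec (.of k))] (h : η ⤳ x) (a : k) :
    toBranch X h (toStalk k X x a) = algebraMap k (X.residueField η) a :=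
  toBranch_germ (Opens.mem_top x) h _

lemma exists_toBranch_div (h : η ⤳ x) (z : X.residueField η) :
    ∃ a s, toBranch X h s ≠ 0 ∧ z = toBranch X h a / toBranch X h s := by
  obtain ⟨U, hU, hxU, -⟩ := exists_isAffineOpen_mem_and_subset (x := x) (U := ⊤) trivial
  have hη : η ∈ U := h.mem_open U.isOpen hxU
  obtain ⟨z, rfl⟩ := X.residue_surjective η z
  have hloc := hU.isLocalization_stalk ⟨η, hη⟩
  let _ := TopCat.Presheaf.algebra_section_stalk X.presheaf (⟨η, hη⟩ : U)
  obtain ⟨a, s, hs⟩ := IsLocalization.exists_mk'_eq (hU.primeIdealOf ⟨η, hη⟩).asIdeal.primeCompl z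
  have hu := IsLocalization.map_units (X.presheaf.stalk η) s
  have hspec := IsLocalization.mk'_spec (X.presheaf.stalk η) a s
  rw [hs] at hspec
  have hs0 : (X.evaluation U η hη).hom s ≠ 0 := (hu.map (X.residue η).hom).ne_zero
  refine ⟨(X.presheaf.germ U x hxU).hom a, (X.presheaf.germ U x hxU).hom s, ?_, ?_⟩
  · rw [toBranch_germ]; exact hs0
  · rw [toBranch_germ, toBranch_germ, eq_div_iff hs0]
    have := congrArg (X.residue η).hom hspec
    rw [map_mul] at this
    exact this

lemma isComponent_toBranch (k : Type u) [Field k] [X.Over (Spec (.of k))] (h : η ⤳ x) :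
    IsComponent (toStalk k X x) (toBranch X h) :=
  ⟨toBranch_toStalk k h, exists_toBranch_div h⟩

/-- The prime ideal of functions vanishing on the closure of `η`. -/
def kerPoint (h : η ⤳ x) : PrimeSpectrum (X.presheaf.stalk x) :=
  ⟨RingHom.ker (toBranch X h), RingHom.ker_isPrime _⟩

lemma fromSpecStalk_kerPoint (h : η ⤳ x) : X.fromSpecStalk x (kerPoint h) = η := by
  have h1 : kerPoint h = Spec.map (X.presheaf.stalkSpecializes h)
      (IsLocalRing.closedPoint (X.presheaf.stalk η)) := by
    apply PrimeSpectrum.ext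
    ext f
    change X.residue η ((X.presheaf.stalkSpecializes h).hom f) = 0 ↔
      (X.presheaf.stalkSpecializes h).hom f ∈ IsLocalRing.maximalIdeal _
    exact IsLocalRing.residue_eq_zero_iff _
  have h2 : (Spec.map (X.presheaf.stalkSpecializes h) ≫ X.fromSpecStalk x)
      (IsLocalRing.closedPoint (X.presheaf.stalk η)) = η := by
    rw [Scheme.SpecMap_stalkSpecializes_fromSpecStalk]
    exact Scheme.fromSpecStalk_closedPoint
  rw [h1]
  exact h2

lemma fromSpecStalk_specializes (P : PrimeSpectrum (X.presheaf.stalk x)) :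
    X.fromSpecStalk x P ⤳ x := by
  have := Set.mem_range_self (f := X.fromSpecStalk x) P
  rw [Scheme.range_fromSpecStalk] at this
  exact this

lemma kerPoint_fromSpecStalk (P : PrimeSpectrum (X.presheaf.stalk x)) :
    kerPoint (fromSpecStalk_specializes P) = P :=
  (X.fromSpecStalk x).isEmbedding.injective (fromSpecStalk_kerPoint _)

lemma eq_of_ker_toBranch_eq {η' : X} (h : η ⤳ x) (h' : η' ⤳ x)
    (he : RingHom.ker (toBranch X h) = RingHom.ker (toBranch X h')) : η = η' := by
  rw [← fromSpecStalk_kerPoint h, ← fromSpecStalk_kerPoint h']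
  congr 1
  exact PrimeSpectrum.ext he

lemma eq_of_specializes_of_generic {y : X} (hη : η ∈ genericPoints X) (h : y ⤳ η) : y = η := by
  have h1 : closure {y} ⊆ closure {η} :=
    hη.2 isIrreducible_singleton.closure (specializes_iff_closure_subset.1 h)
  exact (h.antisymm (specializes_iff_closure_subset.2 h1)).eq

lemma exists_generic_specializes (y : X) : ∃ η ∈ genericPoints X, η ⤳ y := by
  obtain ⟨Z, hZ, hyZ⟩ := exists_mem_irreducibleComponents_subset_of_isIrreducible ({y} : Set X)
    isIrreducible_singleton
  obtain ⟨η, hη⟩ := QuasiSober.sober hZ.1 (isClosed_of_mem_irreducibleComponents Z hZ)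
  refine ⟨η, ?_, ?_⟩
  · change closure {η} ∈ irreducibleComponents X
    rwa [hη.def]
  · rw [specializes_iff_mem_closure, hη.def]
    exact hyZ rfl

lemma generic_iff : η ∈ genericPoints X ↔ ∀ y, y ⤳ η → y = η := by
  refine ⟨fun h y => eq_of_specializes_of_generic h, fun h => ?_⟩
  obtain ⟨y, hy, hyη⟩ := exists_generic_specializes η
  rw [← h y hyη]
  exact hy

lemma ker_toBranch_mem_minimalPrimes (hη : η ∈ genericPoints X) (h : η ⤳ x) :
    RingHom.ker (toBranch X h) ∈ minimalPrimes (X.presheaf.stalk x) := by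
  refine ⟨⟨RingHom.ker_isPrime _, bot_le⟩, fun Q hQ hle => ?_⟩
  let Q' : PrimeSpectrum (X.presheaf.stalk x) := ⟨Q, hQ.1⟩
  have h1 : Q' ⤳ kerPoint h := (PrimeSpectrum.le_iff_specializes _ _).1 hle
  have h2 := h1.map (X.fromSpecStalk x).continuous
  rw [fromSpecStalk_kerPoint] at h2
  have h3 := eq_of_specializes_of_generic hη h2
  have h4 : Q' = kerPoint h := (X.fromSpecStalk x).isEmbedding.injective
    (h3.trans (fromSpecStalk_kerPoint h).symm)
  exact (congrArg PrimeSpectrum.asIdeal h4).ge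

lemma exists_ker_toBranch_eq {P : Ideal (X.presheaf.stalk x)} (hP : P ∈ minimalPrimes _) :
    ∃ η ∈ genericPoints X, ∃ h : η ⤳ x, RingHom.ker (toBranch X h) = P := by
  let P' : PrimeSpectrum (X.presheaf.stalk x) := ⟨P, hP.1.1⟩
  refine ⟨X.fromSpecStalk x P', generic_iff.2 fun y hy => ?_, fromSpecStalk_specializes P', ?_⟩
  · have hyx := hy.trans (fromSpecStalk_specializes P')
    rw [← fromSpecStalk_kerPoint hyx] at hy ⊢
    have h1 := (X.fromSpecStalk x).isEmbedding.isInducing.specializes_iff.1 hy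
    have h2 : (kerPoint hyx).asIdeal ≤ P := (PrimeSpectrum.le_iff_specializes _ _).2 h1
    have h3 := hP.2 ⟨(kerPoint hyx).isPrime, bot_le⟩ h2
    congr 1
    exact PrimeSpectrum.ext (le_antisymm h2 h3)
  · exact congrArg PrimeSpectrum.asIdeal (kerPoint_fromSpecStalk P')

end Components

namespace IsFormalBranches

variable {k : Type u} [Field k] {X : Scheme.{u}} [X.Over (Spec (.of k))] {x : X}
  {ι : Type*} {φ : ι → X.presheaf.stalk x →+* PowerSeries k} {e : ℕ}

/-- The branch `b` of the curve is the one given by the formal branch `φ i`. -/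
def Represents (H : IsFormalBranches (toStalk k X x) φ e) (b : Branch X x) (i : ι) : Prop :=
  ∃ hi : RingHom.ker (φ i) = RingHom.ker (toBranch X b.specializes),
    b.ring = branchRing (H.lift (isComponent_toBranch k b.specializes) i hi)

variable [Finite ι] [IsNoetherianRing (X.presheaf.stalk x)]

lemma exists_represents (H : IsFormalBranches (toStalk k X x) φ e) (b : Branch X x) :
    ∃ i, H.Represents b i := by
  obtain ⟨i, hi, h⟩ := H.exists_eq_branchRing (isComponent_toBranch k b.specializes)
    (H.exists_ker_eq (ker_toBranch_mem_minimalPrimes b.generic b.specializes)) b.ring b.le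
    b.dominates
  exact ⟨i, hi, h⟩

omit [IsNoetherianRing (X.presheaf.stalk x)] in
lemma Represents.index_eq {H : IsFormalBranches (toStalk k X x) φ e} {b : Branch X x} {i j : ι}
    (hi : H.Represents b i) (hj : H.Represents b j) : i = j := by
  obtain ⟨hi, hi'⟩ := hi
  obtain ⟨hj, hj'⟩ := hj
  exact H.branchRing_injective _ hi hj (hi'.symm.trans hj')

lemma exists_branch (H : IsFormalBranches (toStalk k X x) φ e) (i : ι) :
    ∃ b, H.Represents b i := by
  obtain ⟨η, hη, h, hker⟩ := exists_ker_toBranch_eq (H.ker_mem_minimalPrimes i)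
  exact ⟨⟨η, hη, h, branchRing (H.lift (isComponent_toBranch k h) i hker.symm),
    H.map_mem_branchRing _ _ _, fun f hf => H.map_mem_nonunits_branchRing _ _ _ hf⟩,
    hker.symm, rfl⟩

omit [Finite ι] [IsNoetherianRing (X.presheaf.stalk x)] in
lemma Represents.branch_eq {H : IsFormalBranches (toStalk k X x) φ e} {b b' : Branch X x} {i : ι}
    (h : H.Represents b i) (h' : H.Represents b' i) : b = b' := by
  obtain ⟨h1, h2⟩ := h
  obtain ⟨h1', h2'⟩ := h'
  obtain ⟨η, _, hs, A, _, _⟩ := b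
  obtain ⟨η', _, hs', A', _, _⟩ := b'
  obtain rfl : η = η' := eq_of_ker_toBranch_eq hs hs' (h1.symm.trans h1')
  dsimp only at h2 h2'
  obtain rfl : A = A' := h2.trans h2'.symm
  rfl

/-- The branches of a curve at a point correspond to the formal branches of the local ring. -/
def branchEquiv (H : IsFormalBranches (toStalk k X x) φ e) : Branch X x ≃ ι :=
  Equiv.ofBijective (fun b => (H.exists_represents b).choose)
    ⟨fun b b' h => (H.exists_represents b).choose_spec.branch_eq (by
      have h : (H.exists_represents b).choose = (H.exists_represents b').choose := h
      rw [h]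
      exact (H.exists_represents b').choose_spec), fun i => by
      obtain ⟨b, hb⟩ := H.exists_branch i
      exact ⟨b, (H.exists_represents b).choose_spec.index_eq hb⟩⟩

lemma represents_branchEquiv (H : IsFormalBranches (toStalk k X x) φ e) (b : Branch X x) :
    H.Represents b (H.branchEquiv b) := (H.exists_represents b).choose_spec

/-- The expansion of rational functions along the branch `b`. -/
def branchMap (H : IsFormalBranches (toStalk k X x) φ e) (b : Branch X x) :
    X.residueField b.η →ₐ[k] LaurentSeries k :=
  H.lift (isComponent_toBranch k b.specializes) _ (H.represents_branchEquiv b).choose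

lemma branchMap_toBranch (H : IsFormalBranches (toStalk k X x) φ e) (b : Branch X x)
    (f : X.presheaf.stalk x) : H.branchMap b (toBranch X b.specializes f) =
      HahnSeries.ofPowerSeries ℤ k (φ (H.branchEquiv b) f) :=
  H.lift_apply (isComponent_toBranch k b.specializes) _ (H.represents_branchEquiv b).choose f

lemma ring_eq (H : IsFormalBranches (toStalk k X x) φ e) (b : Branch X x) :
    b.ring = branchRing (H.branchMap b) := (H.represents_branchEquiv b).choose_spec

lemma exists_orderTop_branchMap_eq (H : IsFormalBranches (toStalk k X x) φ e) (b : Branch X x)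
    (n : ℕ) : ∃ g, (H.branchMap b g).orderTop = (n : ℤ) := by
  obtain ⟨g, -, hg⟩ := H.exists_ratio (isComponent_toBranch k b.specializes) (fun _ => n)
  exact ⟨g, hg _ (H.represents_branchEquiv b).choose⟩

/-- The expansion of a rational differential along the branch `b`. -/
def expansion (H : IsFormalBranches (toStalk k X x) φ e) {U : X.Opens} (ω : RatDiff k X U)
    (hx : x ∈ U) (b : Branch X x) : LaurentSeries k :=
  expand (H.branchMap b) (ω.atBranch hx b)

/-- The residue condition at `x` in terms of expansions, for differentials whose coefficients with
respect to `dt / t` have at most simple poles. -/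
lemma residueSumVanishes_iff [Fintype ι] (H : IsFormalBranches (toStalk k X x) φ e)
    (hΩ : ∀ η ∈ genericPoints X, η ⤳ x → IsExactSpan k (X.residueField η))
    {U : X.Opens} {ω : RatDiff k X U} {hx : x ∈ U} {f : X.presheaf.stalk x}
    (hω : ∀ b, ((-1 : ℤ) : WithTop ℤ) ≤
      (HahnSeries.ofPowerSeries ℤ k (φ (H.branchEquiv b) f) * H.expansion ω hx b).orderTop) :
    ResidueSumVanishes ω hx f ↔ ∑ i, (HahnSeries.ofPowerSeries ℤ k (φ i f) *
      H.expansion ω hx (H.branchEquiv.symm i)).coeff 0 = 0 := by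
  have hg : ∀ b : Branch X x, ∃ g, (H.branchMap b g).orderTop = 1 := fun b => by
    obtain ⟨g, hg⟩ := H.exists_orderTop_branchMap_eq b 1
    exact ⟨g, by rw [hg]; rfl⟩
  have key : ∀ (b : Branch X x) (r : Ω[X.residueField b.η⁄k] →ₗ[k] k), IsResidue b.ring r →
      r (toBranch X b.specializes f • ω.atBranch hx b) =
      (HahnSeries.ofPowerSeries ℤ k (φ (H.branchEquiv b) f) * H.expansion ω hx b).coeff 0 := by
    intro b r hr
    rw [H.ring_eq b] at hr
    obtain ⟨g, hg⟩ := hg b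
    have h1 : expand (H.branchMap b) (toBranch X b.specializes f • ω.atBranch hx b) =
        HahnSeries.ofPowerSeries ℤ k (φ (H.branchEquiv b) f) * H.expansion ω hx b := by
      rw [expand_smul, branchMap_toBranch]
      rfl
    rw [residue_eq_coeff_zero (hΩ _ b.generic b.specializes) hg hr (by rw [h1]; exact hω b), h1]
  have hsum : ∀ [Fintype (Branch X x)], ∑ b, (HahnSeries.ofPowerSeries ℤ k
      (φ (H.branchEquiv b) f) * H.expansion ω hx b).coeff 0 =
      ∑ i, (HahnSeries.ofPowerSeries ℤ k (φ i f) *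
        H.expansion ω hx (H.branchEquiv.symm i)).coeff 0 := by
    intro _
    exact Fintype.sum_equiv H.branchEquiv _ _ fun b => by simp
  constructor
  · intro h
    let _ : Fintype (Branch X x) := Fintype.ofEquiv ι H.branchEquiv.symm
    have hr : ∀ b : Branch X x, ∃ r : Ω[X.residueField b.η⁄k] →ₗ[k] k, IsResidue b.ring r :=
      fun b => by
        obtain ⟨g, hg⟩ := hg b
        rw [H.ring_eq b]
        exact exists_isResidue (hΩ _ b.generic b.specializes) hg
    choose r hr using hr
    rw [← h r hr, ← hsum]
    exact Finset.sum_congr rfl fun b _ => (key b (r b) (hr b)).symm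
  · intro h _ r hr
    rw [Finset.sum_congr rfl fun b _ => key b (r b) (hr b), hsum, h]

/-- A family of rational functions of large order along all branches at `x` comes from a function
regular at `x`. -/
lemma exists_toBranch_eq (H : IsFormalBranches (toStalk k X x) φ e)
    (g : ∀ η : X, X.residueField η)
    (hg : ∀ b : Branch X x, ((e : ℤ) : WithTop ℤ) ≤ (H.branchMap b (g b.η)).orderTop) :
    ∃ f : X.presheaf.stalk x, ∀ η ∈ genericPoints X, ∀ h : η ⤳ x, toBranch X h f = g η := by
  classical
  have := Fintype.ofFinite ι
  let S : Finset X := Finset.univ.image fun i : ι => (H.branchEquiv.symm i).η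
  have hS : ∀ η, η ∈ genericPoints X → η ⤳ x → η ∈ S := by
    intro η hη h
    obtain ⟨i, hi⟩ := H.exists_ker_eq (ker_toBranch_mem_minimalPrimes hη h)
    refine Finset.mem_image.2 ⟨i, Finset.mem_univ i, ?_⟩
    refine eq_of_ker_toBranch_eq (H.branchEquiv.symm i).specializes h ?_
    rw [← hi, ← (H.represents_branchEquiv (H.branchEquiv.symm i)).choose, Equiv.apply_symm_apply]
  have h1 : ∀ η, ∃ f, (∀ (_ : η ∈ genericPoints X) (h : η ⤳ x), toBranch X h f = g η) ∧
      ∀ η' ∈ genericPoints X, ∀ h' : η' ⤳ x, η' ≠ η → toBranch X h' f = 0 := by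
    intro η
    by_cases hη : η ∈ genericPoints X ∧ η ⤳ x
    swap
    · exact ⟨0, fun h h' => (hη ⟨h, h'⟩).elim, fun _ _ _ _ => map_zero _⟩
    obtain ⟨hη, h⟩ := hη
    obtain ⟨f, hf, hf'⟩ := H.exists_of_le_orderTop (isComponent_toBranch k h)
      (H.exists_ker_eq (ker_toBranch_mem_minimalPrimes hη h)) (x := g η) fun i hi => by
        let b : Branch X x := ⟨η, hη, h, branchRing (H.lift (isComponent_toBranch k h) i hi),
          H.map_mem_branchRing _ _ _, fun f hf => H.map_mem_nonunits_branchRing _ _ _ hf⟩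
        have hb : H.Represents b i := ⟨hi, rfl⟩
        have key : ∀ j hj, i = j → H.lift (isComponent_toBranch k h) i hi =
            H.lift (isComponent_toBranch k h) j hj := by
          rintro j hj rfl
          rfl
        rw [key _ (H.represents_branchEquiv b).choose (hb.index_eq (H.represents_branchEquiv b))]
        exact hg b
    refine ⟨f, fun _ _ => hf, fun η' hη' h' hne => ?_⟩
    obtain ⟨j, hj⟩ := H.exists_ker_eq (ker_toBranch_mem_minimalPrimes hη' h')
    rw [← RingHom.mem_ker, ← hj]
    exact hf' j fun hj' => hne (eq_of_ker_toBranch_eq h' h (hj.symm.trans hj'))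
  choose f hf hf' using h1
  refine ⟨∑ η ∈ S, f η, fun η hη h => ?_⟩
  rw [map_sum, Finset.sum_eq_single_of_mem η (hS η hη h), hf η hη h]
  intro η' _ hne
  exact hf' η' η hη h hne.symm

end IsFormalBranches

/-! ### Local structure of the dualizing sheaf -/

namespace IsFormalBranches

open IsLocalRing

section

variable {k : Type*} [Field k] {O : Type*} [CommRing O] [IsLocalRing O] {ι : Type*}
  {c₀ : k →+* O} {φ : ι → O →+* PowerSeries k} {e : ℕ}

lemma X_pow_dvd_of_mem_pow (H : IsFormalBranches c₀ φ e) {n : ℕ} {a : O}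
    (ha : a ∈ maximalIdeal O ^ n) (i : ι) : PowerSeries.X ^ n ∣ φ i a := by
  have h5 : maximalIdeal O ≤ (Ideal.span {PowerSeries.X}).comap (φ i) :=
    fun f hf => Ideal.mem_span_singleton.2 (H.dvd i f hf)
  have h6 := ((Ideal.pow_right_mono h5 n).trans (Ideal.le_comap_pow (φ i) n)) ha
  rw [Ideal.span_singleton_pow] at h6
  exact Ideal.mem_span_singleton.1 h6

lemma exists_uniformizer [Unique ι] [IsNoetherianRing O] (H : IsFormalBranches c₀ φ 0) :
    ∃ t u, IsUnit u ∧ φ default t = PowerSeries.X * u ∧ maximalIdeal O = Ideal.span {t} := by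
  obtain ⟨t, ht⟩ := H.exists_leading (fun _ => 1) (fun _ => by omega)
  obtain ⟨u, hu, htu⟩ := ht default
  rw [pow_one] at htu
  refine ⟨t, u, hu, htu, le_antisymm (fun a ha => ?_) ?_⟩
  · rw [Ideal.mem_span_singleton]
    refine H.dvd_of_dvd fun i => ?_
    rw [Unique.eq_default i, htu, pow_zero, mul_one]
    exact hu.mul_right_dvd.2 (H.dvd _ a ha)
  · rw [Ideal.span_singleton_le_iff_mem, H.mem_maximalIdeal_iff default, htu]
    simp

lemma mem_pow_of_X_pow_dvd [Unique ι] [IsNoetherianRing O] (H : IsFormalBranches c₀ φ 0) {n : ℕ}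
    {a : O} (ha : PowerSeries.X ^ n ∣ φ default a) : a ∈ maximalIdeal O ^ n := by
  obtain ⟨t, u, hu, htu, ht⟩ := H.exists_uniformizer
  rw [ht, Ideal.span_singleton_pow, Ideal.mem_span_singleton]
  refine H.dvd_of_dvd fun i => ?_
  rw [Unique.eq_default i, map_pow, htu, pow_zero, mul_one, mul_pow]
  exact (hu.pow n).mul_right_dvd.2 ha

end

variable {k : Type u} [Field k] {X : Scheme.{u}} [X.Over (Spec (.of k))] {x : X}
  {ι : Type*} {φ : ι → X.presheaf.stalk x →+* PowerSeries k} {e : ℕ}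
  [Fintype ι] [IsNoetherianRing (X.presheaf.stalk x)]

/-- Testing against all functions of order at least `N ≥ e` bounds the pole orders. -/
lemma le_orderTop_expansion (H : IsFormalBranches (toStalk k X x) φ e)
    (hΩ : ∀ η ∈ genericPoints X, η ⤳ x → IsExactSpan k (X.residueField η))
    {U : X.Opens} {ω : RatDiff k X U} {hx : x ∈ U} {N : ℕ} (hN : e ≤ N)
    (hω : ∀ f, (∀ i, PowerSeries.X ^ N ∣ φ i f) → ResidueSumVanishes ω hx f) (b : Branch X x) :
    ((1 - N : ℤ) : WithTop ℤ) ≤ (H.expansion ω hx b).orderTop := by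
  classical
  by_contra hlt
  obtain ⟨n, hn⟩ := WithTop.ne_top_iff_exists.1 (ne_top_of_lt (not_le.1 hlt))
  rw [← hn] at hlt
  have hlt' : n ≤ -(N : ℤ) := by
    by_contra h
    exact hlt (WithTop.coe_le_coe.2 (by omega))
  have hm : ∀ b', ∃ m : ℕ, N ≤ m ∧
      ((1 - (m : ℤ) : ℤ) : WithTop ℤ) ≤ (H.expansion ω hx b').orderTop := by
    intro b'
    by_cases h0 : H.expansion ω hx b' = 0
    · exact ⟨N, le_rfl, by rw [h0]; simp⟩
    · obtain ⟨n', hn'⟩ := orderTop_eq_coe h0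
      refine ⟨N + (1 - n').toNat, by omega, ?_⟩
      rw [hn']
      exact WithTop.coe_le_coe.2 (by omega)
  choose m hmN hm using hm
  obtain ⟨f, hf⟩ := H.exists_leading
    (fun i => if i = H.branchEquiv b then (-n).toNat else m (H.branchEquiv.symm i)) (fun i => by
      split_ifs
      · omega
      · exact hN.trans (hmN _))
  have hordb : (HahnSeries.ofPowerSeries ℤ k (φ (H.branchEquiv b) f) *
      H.expansion ω hx b).orderTop = (0 : ℤ) := by
    obtain ⟨u, hu, hfu⟩ := hf (H.branchEquiv b)
    rw [if_pos rfl] at hfu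
    rw [hfu, orderTop_mul, orderTop_X_pow_mul _ hu, ← hn]
    exact congrArg WithTop.some (by omega : ((-n).toNat : ℤ) + n = 0)
  have hord : ∀ b' ≠ b, ((1 : ℤ) : WithTop ℤ) ≤
      (HahnSeries.ofPowerSeries ℤ k (φ (H.branchEquiv b') f) *
      H.expansion ω hx b').orderTop := by
    intro b' hb'
    obtain ⟨u, hu, hfu⟩ := hf (H.branchEquiv b')
    rw [if_neg (fun h => hb' (H.branchEquiv.injective h)), Equiv.symm_apply_apply] at hfu
    rw [hfu, orderTop_mul, orderTop_X_pow_mul _ hu]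
    calc ((1 : ℤ) : WithTop ℤ) = ((m b' : ℤ) : WithTop ℤ) + ((1 - (m b' : ℤ) : ℤ) : WithTop ℤ) :=
          congrArg WithTop.some (by omega : (1 : ℤ) = (m b' : ℤ) + (1 - (m b' : ℤ)))
      _ ≤ _ := by gcongr; exact hm b'
  have hdvd : ∀ i, PowerSeries.X ^ N ∣ φ i f := by
    intro i
    obtain ⟨u, hu, hfu⟩ := hf i
    rw [hfu]
    refine Dvd.dvd.mul_right (pow_dvd_pow _ ?_) _
    split_ifs
    · omega
    · exact hmN _
  have hres := (H.residueSumVanishes_iff hΩ (fun b' => by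
    by_cases hb : b' = b
    · rw [hb, hordb]
      exact WithTop.coe_le_coe.2 (by norm_num)
    · exact le_trans (WithTop.coe_le_coe.2 (by norm_num)) (hord b' hb))).1 (hω f hdvd)
  rw [Finset.sum_eq_single (H.branchEquiv b), Equiv.symm_apply_apply] at hres
  · have h2 := orderTop_add_one_le hordb.ge hres
    rw [hordb] at h2
    exact absurd (WithTop.coe_le_coe.1 h2) (by norm_num)
  · intro i _ hi
    have h2 := hord (H.branchEquiv.symm i) (fun h => hi (by rw [← h, Equiv.apply_symm_apply]))
    rw [Equiv.apply_symm_apply] at h2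
    exact le_orderTop_iff.1 h2 0 (by norm_num)
  · intro h
    exact (h (Finset.mem_univ _)).elim

/-- Two rational differentials near `x`, the second nonzero on each component, differ by a family of
rational functions. -/
lemma exists_eq_smul_of_expansion_ne_zero (H : IsFormalBranches (toStalk k X x) φ e)
    (hΩ : ∀ η ∈ genericPoints X, η ⤳ x → IsExactSpan k (X.residueField η)) {U V : X.Opens}
    {σ : RatDiff k X U} {hx : x ∈ U} (hσ0 : ∀ b, H.expansion σ hx b ≠ 0) (τ : RatDiff k X V)
    (hx' : x ∈ V) (η : X) : ∃ g : X.residueField η, ∀ (hη : η ∈ genericPoints X) (h : η ⤳ x),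
      τ ⟨η, hη, h.mem_open V.isOpen hx'⟩ = g • σ ⟨η, hη, h.mem_open U.isOpen hx⟩ := by
  by_cases hη : η ∈ genericPoints X ∧ η ⤳ x
  swap
  · exact ⟨0, fun h h' => (hη ⟨h, h'⟩).elim⟩
  obtain ⟨hη, h⟩ := hη
  obtain ⟨i, hi⟩ := H.exists_ker_eq (ker_toBranch_mem_minimalPrimes hη h)
  obtain ⟨b, hb⟩ : ∃ b : Branch X x, b.η = η := by
    refine ⟨H.branchEquiv.symm i, eq_of_ker_toBranch_eq (H.branchEquiv.symm i).specializes h ?_⟩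
    rw [← hi, ← (H.represents_branchEquiv (H.branchEquiv.symm i)).choose, Equiv.apply_symm_apply]
  subst hb
  obtain ⟨s, hs⟩ := hΩ b.η hη h
  obtain ⟨p, hp⟩ := hs (σ ⟨b.η, hη, h.mem_open U.isOpen hx⟩)
  obtain ⟨q, hq⟩ := hs (τ ⟨b.η, hη, h.mem_open V.isOpen hx'⟩)
  have hp0 : p ≠ 0 := by
    rintro rfl
    rw [zero_smul] at hp
    refine hσ0 b ?_
    have h0 : σ.atBranch hx b = 0 := hp
    unfold expansion
    rw [h0, map_zero]
  exact ⟨q * p⁻¹, fun _ _ => by rw [hp, hq, smul_smul, inv_mul_cancel_right₀ hp0]⟩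

lemma expansion_eq_mul (H : IsFormalBranches (toStalk k X x) φ e) {U V : X.Opens}
    {σ : RatDiff k X U} {hx : x ∈ U} {τ : RatDiff k X V} {hx' : x ∈ V} {b : Branch X x}
    {g : X.residueField b.η} (h : τ.atBranch hx' b = g • σ.atBranch hx b) :
    H.expansion τ hx' b = H.branchMap b g * H.expansion σ hx b := by
  unfold expansion
  rw [h, expand_smul]

/-- At a regular point, the twisted dualizing sheaf is described by the pole order. -/
lemma forall_residueSumVanishes_iff [Unique ι] (H : IsFormalBranches (toStalk k X x) φ 0)
    (hΩ : ∀ η ∈ genericPoints X, η ⤳ x → IsExactSpan k (X.residueField η))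
    {U : X.Opens} {ω : RatDiff k X U} {hx : x ∈ U} (d : ℕ) :
    (∀ f ∈ maximalIdeal (X.presheaf.stalk x) ^ d, ResidueSumVanishes ω hx f) ↔
      ∀ b, ((1 - d : ℤ) : WithTop ℤ) ≤ (H.expansion ω hx b).orderTop := by
  constructor
  · intro h
    exact H.le_orderTop_expansion hΩ (zero_le) fun f hf => h f (H.mem_pow_of_X_pow_dvd (hf _))
  · intro h f hf
    have h1 : ∀ b, ((1 : ℤ) : WithTop ℤ) ≤ (HahnSeries.ofPowerSeries ℤ k
        (φ (H.branchEquiv b) f) * H.expansion ω hx b).orderTop := fun b => by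
      rw [orderTop_mul]
      calc ((1 : ℤ) : WithTop ℤ) = ((d : ℤ) : WithTop ℤ) + ((1 - (d : ℤ) : ℤ) : WithTop ℤ) :=
          congrArg WithTop.some (by omega : (1 : ℤ) = (d : ℤ) + (1 - (d : ℤ)))
        _ ≤ _ := add_le_add (le_orderTop_coe_iff.2 (H.X_pow_dvd_of_mem_pow hf _)) (h b)
    rw [H.residueSumVanishes_iff hΩ]
    · refine Finset.sum_eq_zero fun i _ => ?_
      have h2 := h1 (H.branchEquiv.symm i)
      rw [Equiv.apply_symm_apply] at h2
      exact le_orderTop_iff.1 h2 0 (by norm_num)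
    · exact fun b => le_trans (WithTop.coe_le_coe.2 (by norm_num)) (h1 b)

end IsFormalBranches

section Elliptic

variable {k : Type u} [Field k] {X : Scheme.{u}} [X.Over (Spec (.of k))] {x : X}
  {ι : Type*} {φ : ι → X.presheaf.stalk x →+* PowerSeries k}
  [Fintype ι] [IsNoetherianRing (X.presheaf.stalk x)] {c : ι → k}

/-- The rational differential `σ` has the expansion `(cᵢ t⁻¹ + O(t)) dt / t` on each branch at the
elliptic point. -/
def IsElliptic.IsAdapted (E : IsElliptic (toStalk k X x) φ c) {U : X.Opens} (σ : RatDiff k X U)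
    (hx : x ∈ U) : Prop :=
  ∀ b, ((-1 : ℤ) : WithTop ℤ) ≤ (E.isFormalBranches.expansion σ hx b).orderTop ∧
    (E.isFormalBranches.expansion σ hx b).coeff (-1) = c (E.isFormalBranches.branchEquiv b) ∧
    (E.isFormalBranches.expansion σ hx b).coeff 0 = 0

lemma coeff_ofPowerSeries_mul {x : LaurentSeries k} (p : PowerSeries k)
    (hx : ((-1 : ℤ) : WithTop ℤ) ≤ x.orderTop) :
    (HahnSeries.ofPowerSeries ℤ k p * x).coeff (-1) =
      PowerSeries.constantCoeff p * x.coeff (-1) ∧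
    (HahnSeries.ofPowerSeries ℤ k p * x).coeff 0 =
      PowerSeries.constantCoeff p * x.coeff 0 + PowerSeries.coeff 1 p * x.coeff (-1) := by
  obtain ⟨q, hq⟩ : ∃ q : PowerSeries k, HahnSeries.ofPowerSeries ℤ k q =
      HahnSeries.single 1 1 * x := by
    rw [← zero_le_orderTop_iff, orderTop_mul, HahnSeries.orderTop_single one_ne_zero]
    calc (0 : WithTop ℤ) = ((1 : ℤ) : WithTop ℤ) + ((-1 : ℤ) : WithTop ℤ) := rfl
      _ ≤ _ := by gcongr
  have h1 : ∀ y : LaurentSeries k, ∀ n : ℤ, (HahnSeries.single 1 1 * y).coeff (n + 1) =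
      y.coeff n := fun y n => by
    rw [HahnSeries.coeff_single_mul_add, one_mul]
  have h2 := h1 (HahnSeries.ofPowerSeries ℤ k p * x) 0
  have h3 := h1 (HahnSeries.ofPowerSeries ℤ k p * x) (-1)
  rw [mul_left_comm, ← hq, ← map_mul] at h2 h3
  have e0 := h1 x (-1)
  have e1 := h1 x 0
  rw [← hq] at e0 e1
  have l : ∀ (r : PowerSeries k), (HahnSeries.ofPowerSeries ℤ k r).coeff (-1 + 1) =
      PowerSeries.coeff 0 r ∧ (HahnSeries.ofPowerSeries ℤ k r).coeff (0 + 1) =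
      PowerSeries.coeff 1 r := fun r =>
    ⟨LaurentSeries.coeff_coe_powerSeries r 0, LaurentSeries.coeff_coe_powerSeries r 1⟩
  rw [← h2, ← h3, ← e0, ← e1, (l _).1, (l _).1, (l _).2, (l _).2]
  constructor
  · simp
  · rw [PowerSeries.coeff_mul, Finset.Nat.antidiagonal_succ]
    simp

lemma coeff_zero_mul {x : LaurentSeries k} (p : PowerSeries k)
    (hx : ((-1 : ℤ) : WithTop ℤ) ≤ x.orderTop) :
    (HahnSeries.ofPowerSeries ℤ k p * x).coeff 0 =
      PowerSeries.constantCoeff p * x.coeff 0 + PowerSeries.coeff 1 p * x.coeff (-1) :=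
  (coeff_ofPowerSeries_mul p hx).2

omit [IsNoetherianRing (X.presheaf.stalk x)] in
/-- Functionals on `1`-jets along the branches that kill the local ring: their parts on linear terms
are proportional to the defining relation. -/
lemma IsElliptic.eq_of_forall_sum_eq_zero (E : IsElliptic (toStalk k X x) φ c) (T₀ T₁ : ι → k)
    (h : ∀ f, ∑ i, (PowerSeries.constantCoeff (φ i f) * T₀ i +
      PowerSeries.coeff 1 (φ i f) * T₁ i) = 0) :
    ∑ i, T₀ i = 0 ∧ ∀ i j, c j * T₁ i = c i * T₁ j := by
  classical
  refine ⟨by simpa [PowerSeries.coeff_one] using h 1, fun i j => ?_⟩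
  by_cases hij : i = j
  · rw [hij]
  -- test against a function with prescribed linear terms on the branches `i` and `j`
  let a : ι → k := fun l => (if l = i then c j else 0) + if l = j then -c i else 0
  have hsum : ∀ T : ι → k, ∑ l, a l * T l = c j * T i - c i * T j := fun T => by
    simp only [a, add_mul, ite_mul, zero_mul, Finset.sum_add_distrib, Finset.sum_ite_eq',
      Finset.mem_univ, if_true]
    ring
  obtain ⟨f, hf⟩ := E.approx (fun l => PowerSeries.C (a l) * PowerSeries.X) (by simp) (by
    rw [← sub_eq_zero.2 (mul_comm (c j) (c i)), ← hsum c]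
    refine Finset.sum_congr rfl fun l _ => ?_
    rw [PowerSeries.coeff_C_mul, PowerSeries.coeff_one_X, mul_one, mul_comm]) 2
  have hco : ∀ l, PowerSeries.constantCoeff (φ l f) = 0 ∧ PowerSeries.coeff 1 (φ l f) = a l := by
    intro l
    have h1 := PowerSeries.X_pow_dvd_iff.1 (hf l)
    have h2 := h1 0 (by norm_num)
    have h3 := h1 1 (by norm_num)
    rw [map_sub, sub_eq_zero] at h2 h3
    rw [← PowerSeries.coeff_zero_eq_constantCoeff_apply, ← h2, ← h3]
    constructor
    · simp
    · rw [PowerSeries.coeff_C_mul, PowerSeries.coeff_one_X, mul_one]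
  have h4 := h f
  simp only [hco, zero_mul, zero_add] at h4
  rw [hsum] at h4
  exact sub_eq_zero.1 h4

/-- An adapted differential is a section of the dualizing sheaf at the elliptic point. -/
lemma IsElliptic.residueSumVanishes (E : IsElliptic (toStalk k X x) φ c)
    (hΩ : ∀ η ∈ genericPoints X, η ⤳ x → IsExactSpan k (X.residueField η)) {U : X.Opens}
    {σ : RatDiff k X U} {hx : x ∈ U} (hσ : E.IsAdapted σ hx) (f : X.presheaf.stalk x) :
    ResidueSumVanishes σ hx f := by
  rw [E.isFormalBranches.residueSumVanishes_iff hΩ]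
  · rw [← E.lin f]
    refine Finset.sum_congr rfl fun i _ => ?_
    obtain ⟨h1, h2, h3⟩ := hσ (E.isFormalBranches.branchEquiv.symm i)
    rw [coeff_zero_mul _ h1, h2, h3, Equiv.apply_symm_apply, mul_zero, zero_add, mul_comm]
  · intro b
    rw [orderTop_mul]
    exact le_add_of_nonneg_of_le (zero_le_orderTop_coe _) (hσ b).1

/-- At the elliptic point, the stalk of the dualizing sheaf is generated by an adapted differential
`σ`. A section `τ` has at most the poles of `σ`, hence `τ = g σ` for functions `g` regular along
each branch. The residue conditions on `τ` say precisely that the `g` have equal values and satisfy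
the relation defining the local ring, so that they come from a function regular at the point. -/
lemma IsElliptic.exists_eq_smul (E : IsElliptic (toStalk k X x) φ c)
    (hΩ : ∀ η ∈ genericPoints X, η ⤳ x → IsExactSpan k (X.residueField η)) {U V : X.Opens}
    {σ : RatDiff k X U} {hx : x ∈ U} (hσ : E.IsAdapted σ hx) {τ : RatDiff k X V} {hx' : x ∈ V}
    (hτ : ∀ f, ResidueSumVanishes τ hx' f) :
    ∃ f : X.presheaf.stalk x, ∀ (η : X) (hη : η ∈ genericPoints X) (h : η ⤳ x),
      τ ⟨η, hη, h.mem_open V.isOpen hx'⟩ =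
        toBranch X h f • σ ⟨η, hη, h.mem_open U.isOpen hx⟩ := by
  classical
  set H := E.isFormalBranches with hH
  have hord : ∀ b, ((-1 : ℤ) : WithTop ℤ) ≤ (H.expansion τ hx' b).orderTop :=
    H.le_orderTop_expansion hΩ (N := 2) le_rfl fun f _ => hτ f
  obtain ⟨hcond0, hprop⟩ := E.eq_of_forall_sum_eq_zero
    (fun i => (H.expansion τ hx' (H.branchEquiv.symm i)).coeff 0)
    (fun i => (H.expansion τ hx' (H.branchEquiv.symm i)).coeff (-1)) fun f => by
      rw [← (H.residueSumVanishes_iff hΩ fun b => by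
        rw [orderTop_mul]
        exact le_add_of_nonneg_of_le (zero_le_orderTop_coe _) (hord b)).1 (hτ f)]
      exact Finset.sum_congr rfl fun i _ => (coeff_zero_mul _ (hord _)).symm
  have hσ0 : ∀ b, H.expansion σ hx b ≠ 0 := fun b h => by
    have := (hσ b).2.1
    rw [h] at this
    exact E.c_ne _ this.symm
  have hσord : ∀ b, (H.expansion σ hx b).orderTop = (-1 : ℤ) := fun b => by
    refine le_antisymm ?_ (hσ b).1
    refine HahnSeries.orderTop_le_of_coeff_ne_zero ?_
    rw [(hσ b).2.1]
    exact E.c_ne _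
  choose g hg using fun η => H.exists_eq_smul_of_expansion_ne_zero hΩ hσ0 τ hx' η
  have hexp : ∀ b, H.expansion τ hx' b = H.branchMap b (g b.η) * H.expansion σ hx b :=
    fun b => H.expansion_eq_mul (hg b.η b.generic b.specializes)
  have hgord : ∀ b, 0 ≤ (H.branchMap b (g b.η)).orderTop := by
    intro b
    have h1 := hord b
    rw [hexp, orderTop_mul, hσord] at h1
    by_cases h0 : H.branchMap b (g b.η) = 0
    · rw [h0]; simp
    obtain ⟨n, hn⟩ := orderTop_eq_coe h0
    rw [hn] at h1 ⊢
    have h2 : (-1 : ℤ) ≤ n + -1 := WithTop.coe_le_coe.1 h1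
    exact WithTop.coe_le_coe.2 (by omega)
  choose G hG using fun b => zero_le_orderTop_iff.1 (hgord b)
  have hG0 : ∀ b, (H.expansion τ hx' b).coeff (-1) =
      PowerSeries.constantCoeff (G b) * c (H.branchEquiv b) := fun b => by
    obtain ⟨h1, h2, -⟩ := hσ b
    rw [hexp, ← hG, (coeff_ofPowerSeries_mul _ h1).1, h2]
  have hG1 : ∀ b, (H.expansion τ hx' b).coeff 0 =
      c (H.branchEquiv b) * PowerSeries.coeff 1 (G b) := by
    intro b
    obtain ⟨h1, h2, h3⟩ := hσ b
    rw [hexp, ← hG, coeff_zero_mul _ h1, h2, h3, mul_zero, zero_add, mul_comm]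
  -- correct an approximation by functions of order two, which belong to the conductor
  obtain ⟨f₀, hf₀⟩ := E.approx (fun i => G (H.branchEquiv.symm i)) (fun i j => by
    have h1 := hprop i j
    rw [hG0, hG0, Equiv.apply_symm_apply, Equiv.apply_symm_apply] at h1
    refine mul_right_cancel₀ (mul_ne_zero (E.c_ne i) (E.c_ne j)) ?_
    linear_combination h1) (by
    rw [← hcond0]
    refine Finset.sum_congr rfl fun i _ => ?_
    rw [hG1, Equiv.apply_symm_apply]) 2
  obtain ⟨f₁, hf₁⟩ := H.exists_toBranch_eq
    (fun η => if h : η ⤳ x then g η - toBranch X h f₀ else 0) fun b => by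
      rw [dif_pos b.specializes, map_sub, H.branchMap_toBranch, ← hG, ← map_sub,
        le_orderTop_coe_iff]
      have := hf₀ (H.branchEquiv b)
      rwa [Equiv.symm_apply_apply] at this
  refine ⟨f₀ + f₁, fun η hη h => ?_⟩
  rw [hg η hη h, map_add, hf₁ η hη h, dif_pos h]
  congr 1
  ring

end Elliptic

open IsLocalRing

/-! ### Differentials of a function field with a formal branch -/

/-- The `k`-algebra `O` is generated by finitely many elements and inverses. -/
def IsEssFinite {k O : Type*} [Field k] [CommRing O] (c₀ : k →+* O) : Prop :=
  ∃ T : Finset O, ∀ S : Subring O, (∀ a, c₀ a ∈ S) → (∀ t ∈ T, t ∈ S) →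
    (∀ u v, u * v = 1 → u ∈ S → v ∈ S) → S = ⊤

section Span

variable {k : Type u} [Field k] {K : Type u} [Field K] [Algebra k K]

instance isNoetherianRing_branchRing (Φ : K →ₐ[k] LaurentSeries k) :
    IsNoetherianRing (branchRing Φ) := by
  rw [isNoetherianRing_iff_ideal_fg]
  intro I
  by_cases hI : I = ⊥
  · rw [hI]; exact Submodule.fg_bot
  obtain ⟨x₀, hx₀, hx₀0⟩ := Submodule.exists_mem_ne_zero_of_ne_bot hI
  have hex : ∃ n : ℕ, ∃ x ∈ I, (Φ (x : K)).orderTop = (n : ℤ) := by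
    obtain ⟨n, hn⟩ := orderTop_eq_coe ((map_ne_zero Φ).2 (fun h => hx₀0 (Subtype.ext h)))
    have h0 : 0 ≤ (Φ (x₀ : K)).orderTop := x₀.2
    rw [hn] at h0
    lift n to ℕ using (WithTop.coe_le_coe.1 h0)
    exact ⟨n, x₀, hx₀, hn⟩
  classical
  obtain ⟨x, hx, hn⟩ := Nat.find_spec hex
  have hmin := fun m => Nat.find_min' hex (m := m)
  refine ⟨{x}, le_antisymm ?_ fun y hy => ?_⟩
  · rw [Finset.coe_singleton, Submodule.span_le, Set.singleton_subset_iff]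
    exact hx
  rw [Finset.coe_singleton]
  refine Ideal.mem_span_singleton'.2 ?_
  have hx0 : (x : K) ≠ 0 := fun h => by rw [h] at hn; simp at hn
  by_cases hy0 : (y : K) = 0
  · exact ⟨0, Subtype.ext (by simp [hy0])⟩
  obtain ⟨m, hm⟩ := orderTop_eq_coe ((map_ne_zero Φ).2 hy0)
  have h0 : 0 ≤ (Φ (y : K)).orderTop := y.2
  rw [hm] at h0
  lift m to ℕ using (WithTop.coe_le_coe.1 h0)
  have h1 := hmin m ⟨y, hy, hm⟩
  refine ⟨⟨y * (x : K)⁻¹, ?_⟩, Subtype.ext (by simp [hx0])⟩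
  rw [mem_branchRing, map_mul, map_inv₀, orderTop_mul, orderTop_inv hn, hm]
  norm_cast
  omega

/-- If the differentials of the valuation ring of a branch form a finitely generated module, then by
Nakayama's lemma they are generated by the differential of a uniformizer. -/
lemma isExactSpan_of_fg {Φ : K →ₐ[k] LaurentSeries k} {s : K} (hs1 : (Φ s).orderTop = 1)
    (N : Submodule (branchRing Φ) Ω[K⁄k]) (hNfg : N.FG)
    (hN : ∀ x ∈ branchRing Φ, KaehlerDifferential.D k K x ∈ N) : IsExactSpan k K := by
  let D := KaehlerDifferential.D k K
  have hs0 : s ≠ 0 := by rintro rfl; simp at hs1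
  have hsA : s ∈ branchRing Φ := by rw [mem_branchRing, hs1]; norm_num
  let M : Submodule (branchRing Φ) Ω[K⁄k] :=
    Submodule.span _ (Set.range fun x : branchRing Φ => D (x : K))
  have hMN : M ≤ N := by
    rw [Submodule.span_le]
    rintro - ⟨x, rfl⟩
    exact hN x x.2
  have hM : M.FG := by
    have : IsNoetherian (branchRing Φ) N := isNoetherian_of_fg_of_noetherian N hNfg
    exact isNoetherian_submodule.1 this M hMN
  have hsm : (⟨s, hsA⟩ : branchRing Φ) ∈ maximalIdeal (branchRing Φ) := by
    rw [← ValuationSubring.coe_mem_nonunits_iff, IsFormalBranches.mem_nonunits_branchRing_iff, hs1]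
  have hle : M ≤ Submodule.span _ {D s} ⊔ maximalIdeal (branchRing Φ) • M := by
    rw [Submodule.span_le]
    rintro - ⟨x, rfl⟩
    obtain ⟨c, hc⟩ := exists_sub_mul_pow Φ hs1 (x := (x : K)) (n := 0) x.2
    rw [zpow_zero, mul_one, zero_add] at hc
    let g : branchRing Φ := ⟨((x : K) - algebraMap k K c) * s⁻¹, by
      rw [mem_branchRing, map_mul, orderTop_mul, map_inv₀, orderTop_inv (n := 1) (by rw [hs1]; rfl)]
      calc (0 : WithTop ℤ) = ((1 : ℤ) : WithTop ℤ) + ((-1 : ℤ) : WithTop ℤ) := rfl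
        _ ≤ _ := by gcongr⟩
    have hx : (x : K) = algebraMap k K c + g * s := by
      simp [g, hs0]
    have h1 : D (x : K) = s • D g + (g : K) • D s := by
      rw [hx, map_add, D.map_algebraMap, zero_add, D.leibniz, add_comm]
    have hgM : D (g : K) ∈ M := Submodule.subset_span (Set.mem_range_self g)
    have h2 : s • D (g : K) ∈ maximalIdeal (branchRing Φ) • M := by
      have := Submodule.smul_mem_smul hsm hgM
      rwa [← algebraMap_smul K (⟨s, hsA⟩ : branchRing Φ) (D (g : K))] at this
    have h3 : (g : K) • D s ∈ Submodule.span (branchRing Φ) {D s} := by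
      have := Submodule.smul_mem _ g (Submodule.mem_span_singleton_self (R := branchRing Φ) (D s))
      rwa [← algebraMap_smul K g (D s)] at this
    have h4 := Submodule.add_mem_sup h3 h2
    rw [add_comm, ← h1] at h4
    exact h4
  have hspan := Submodule.le_of_le_smul_of_le_jacobson_bot hM
    (IsLocalRing.maximalIdeal_le_jacobson ⊥) hle
  have hA : ∀ x ∈ branchRing Φ, ∃ h : K, D x = h • D s := fun x hx => by
    obtain ⟨a, ha⟩ := Submodule.mem_span_singleton.1
      (hspan (Submodule.subset_span ⟨⟨x, hx⟩, rfl⟩))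
    exact ⟨a, ha.symm⟩
  have hK : ∀ x, ∃ h : K, D x = h • D s := fun x => by
    rcases (branchRing Φ).mem_or_inv_mem x with hx | hx
    · exact hA x hx
    · obtain ⟨h, hh⟩ := hA _ hx
      refine ⟨-x ^ 2 * h, ?_⟩
      conv_lhs => rw [← inv_inv x]
      rw [D.leibniz_inv, hh, smul_smul, inv_inv]
  refine ⟨s, fun ω => ?_⟩
  have hω : ω ∈ Submodule.span K (Set.range D) := by
    rw [KaehlerDifferential.span_range_derivation]; trivial
  have h2 : Submodule.span K (Set.range D) ≤ Submodule.span K {D s} := by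
    rw [Submodule.span_le]
    rintro - ⟨x, rfl⟩
    obtain ⟨h, hh⟩ := hK x
    exact Submodule.mem_span_singleton.2 ⟨h, hh.symm⟩
  obtain ⟨h, hh⟩ := Submodule.mem_span_singleton.1 (h2 hω)
  exact ⟨h, hh.symm⟩

end Span

namespace IsFormalBranches

variable {k : Type u} [Field k] {O : Type*} [CommRing O] [IsLocalRing O] {ι : Type*}
  {c₀ : k →+* O} {φ : ι → O →+* PowerSeries k} {e : ℕ} {K : Type u} [Field K] [Algebra k K]
  {ρ : O →+* K} [Finite ι] [IsNoetherianRing O]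

/-- The differentials of the valuation ring of a branch have bounded denominators with respect to
those of the local ring. -/
lemma exists_fg_forall_D_mem (H : IsFormalBranches c₀ φ e) (hρ : IsComponent c₀ ρ) (i : ι)
    (hi : RingHom.ker (φ i) = RingHom.ker ρ) (hfin : IsEssFinite c₀) :
    ∃ N : Submodule (branchRing (H.lift hρ i hi)) Ω[K⁄k], N.FG ∧
      ∀ x ∈ branchRing (H.lift hρ i hi), KaehlerDifferential.D k K x ∈ N := by
  classical
  obtain ⟨T, hT⟩ := hfin
  set Φ := H.lift hρ i hi with hΦ
  set D := KaehlerDifferential.D k K with hD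
  have hsmul : ∀ (N : Submodule (branchRing Φ) Ω[K⁄k]) (a : K), a ∈ branchRing Φ → ∀ ω ∈ N,
      a • ω ∈ N := fun N a ha ω hω => N.smul_mem ⟨a, ha⟩ hω
  have hO : ∀ f, ρ f ∈ branchRing Φ := H.map_mem_branchRing hρ i hi
  let N₀ : Submodule (branchRing Φ) Ω[K⁄k] :=
    Submodule.span _ (T.image fun t => D (ρ t) : Finset _)
  have hN₀ : ∀ f, D (ρ f) ∈ N₀ := by
    let S : Subring O :=
      { carrier := {f | D (ρ f) ∈ N₀}
        mul_mem' := fun {a b} ha hb => by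
          change D (ρ (a * b)) ∈ N₀
          rw [map_mul, D.leibniz]
          exact add_mem (hsmul _ _ (hO a) _ hb) (hsmul _ _ (hO b) _ ha)
        one_mem' := by
          change D (ρ 1) ∈ N₀
          rw [map_one, D.map_one_eq_zero]
          exact zero_mem _
        add_mem' := fun {a b} ha hb => by
          change D (ρ (a + b)) ∈ N₀
          rw [map_add, map_add]
          exact add_mem ha hb
        zero_mem' := by
          change D (ρ 0) ∈ N₀
          rw [map_zero, map_zero]
          exact zero_mem _
        neg_mem' := fun {a} ha => by
          change D (ρ (-a)) ∈ N₀
          rw [map_neg, map_neg]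
          exact neg_mem ha }
    have hS : S = ⊤ := by
      refine hT S (fun a => ?_) (fun t ht => ?_) (fun u v huv hu => ?_)
      · change D (ρ (c₀ a)) ∈ N₀
        rw [hρ.map_c, D.map_algebraMap]
        exact zero_mem _
      · exact Submodule.subset_span (Finset.mem_coe.2 (Finset.mem_image_of_mem _ ht))
      · change D (ρ v) ∈ N₀
        have h1 : ρ u * ρ v = 1 := by rw [← map_mul, huv, map_one]
        have h2 : ρ v = (ρ u)⁻¹ := eq_inv_of_mul_eq_one_right h1
        rw [h2, D.leibniz_inv, ← h2]
        refine hsmul _ _ (neg_mem (pow_mem (hO v) 2)) _ hu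
    intro f
    have : f ∈ S := hS ▸ Subring.mem_top f
    exact this
  -- the denominator `w ^ 2` comes from the quotient rule, `w` having the order of the conductor
  obtain ⟨w, hw0, hw⟩ := H.exists_ratio hρ (fun _ => e)
  refine ⟨Submodule.span _ (T.image fun t => (w⁻¹ ^ 2) • D (ρ t) : Finset _),
    Submodule.fg_span (Finset.finite_toSet _), fun x hx => ?_⟩
  have hN : ∀ ω ∈ N₀, (w⁻¹ ^ 2) • ω ∈ Submodule.span (branchRing Φ)
      ((T.image fun t => (w⁻¹ ^ 2) • D (ρ t) : Finset _) : Set Ω[K⁄k]) := by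
    intro ω hω
    induction hω using Submodule.span_induction with
    | mem ω hω =>
      obtain ⟨t, ht, rfl⟩ := Finset.mem_image.1 (Finset.mem_coe.1 hω)
      exact Submodule.subset_span (Finset.mem_coe.2 (Finset.mem_image_of_mem _ ht))
    | zero => rw [smul_zero]; exact zero_mem _
    | add a b _ _ ha hb => rw [smul_add]; exact add_mem ha hb
    | smul a b _ hb =>
      have : (w⁻¹ ^ 2) • a • b = (a : K) • ((w⁻¹ ^ 2) • b) := smul_comm _ (a : K) b
      rw [this]
      exact hsmul _ _ a.2 _ hb
  by_cases hx0 : x = 0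
  · rw [hx0, map_zero]; exact zero_mem _
  -- write `x` as a fraction of elements of the conductor with fixed order of the denominator
  have hor : ∀ j, ∃ n : ℕ, ∀ hj, ((-n : ℤ) : WithTop ℤ) ≤ (H.lift hρ j hj x).orderTop := by
    intro j
    by_cases hj : RingHom.ker (φ j) = RingHom.ker ρ
    · obtain ⟨n, hn⟩ := orderTop_eq_coe ((map_ne_zero (H.lift hρ j hj)).2 hx0)
      refine ⟨(-n).toNat, fun _ => ?_⟩
      rw [hn]
      exact WithTop.coe_le_coe.2 (by omega)
    · exact ⟨0, fun h => (hj h).elim⟩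
  choose n hn using hor
  obtain ⟨v, hv0, hv⟩ := H.exists_ratio hρ (fun j => if j = i then 0 else n j)
  obtain ⟨s, hs, -⟩ := H.exists_of_le_orderTop hρ ⟨i, hi⟩ (x := w * v) fun j hj => by
    rw [map_mul, orderTop_mul, hw, hv]
    exact le_add_of_nonneg_right (by exact_mod_cast Nat.zero_le _)
  obtain ⟨a, ha, -⟩ := H.exists_of_le_orderTop hρ ⟨i, hi⟩ (x := w * v * x) fun j hj => by
    rw [map_mul, map_mul, orderTop_mul, orderTop_mul, hw, hv]
    by_cases hji : j = i
    · subst hji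
      simp only [if_true]
      calc ((e : ℤ) : WithTop ℤ) = (e : ℤ) + ((0 : ℕ) : ℤ) + 0 := by simp
        _ ≤ _ := by gcongr; exact hx
    · rw [if_neg hji]
      calc ((e : ℤ) : WithTop ℤ) = ((e : ℤ) : WithTop ℤ) + (n j : ℤ) + (-n j : ℤ) :=
            congrArg WithTop.some (by omega : (e : ℤ) = e + n j + -n j)
        _ ≤ _ := by gcongr; exact hn j hj
  have hvu : v⁻¹ ∈ branchRing Φ := by
    have h1 := hv i hi
    rw [if_pos rfl] at h1
    rw [mem_branchRing, map_inv₀, orderTop_inv h1]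
    simp
  have h1 : D x = (v⁻¹ ^ 2) • ((w⁻¹ ^ 2) • (ρ s • D (ρ a) - ρ a • D (ρ s))) := by
    have h2 : x = ρ a * (ρ s)⁻¹ := by
      rw [hs, ha]
      field_simp
    conv_lhs => rw [h2]
    rw [D.leibniz, D.leibniz_inv, smul_smul, hs, smul_sub, smul_sub, smul_smul, smul_smul,
      smul_smul, smul_smul, add_comm, sub_eq_add_neg, ← neg_smul]
    congr 2 <;> field_simp
  rw [h1]
  refine hsmul _ _ (pow_mem hvu 2) _ (hN _ (_root_.sub_mem ?_ ?_))
  · exact hsmul _ _ (hO s) _ (hN₀ a)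
  · exact hsmul _ _ (hO a) _ (hN₀ s)

/-- The differentials of the function field of a branch are spanned by the differential of a
uniformizer. -/
lemma isExactSpan (H : IsFormalBranches c₀ φ e) (hρ : IsComponent c₀ ρ) (i : ι)
    (hi : RingHom.ker (φ i) = RingHom.ker ρ) (hfin : IsEssFinite c₀) : IsExactSpan k K := by
  obtain ⟨N, hNfg, hN⟩ := H.exists_fg_forall_D_mem hρ i hi hfin
  obtain ⟨s, -, hs⟩ := H.exists_ratio hρ (fun _ => 1)
  exact isExactSpan_of_fg (by rw [hs i hi]; rfl) N hNfg hN

end IsFormalBranches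

/-! ### Formal branches of discrete valuation rings -/

section Regular

variable {k : Type u} [Field k] {O : Type*} [CommRing O] [IsLocalRing O]

/-- A local ring identified with the valuation ring of an embedding of `K` in `k((t))` has this
embedding as its only formal branch. -/
lemma exists_isFormalBranches_of_range_eq {K : Type u} [Field K] [Algebra k K] {c₀ : k →+* O}
    {ρ : O →+* K} (hc : ∀ a, ρ (c₀ a) = algebraMap k K a) (hinj : Function.Injective ρ)
    (Φ : K →ₐ[k] LaurentSeries k) (hρ : ∀ x, x ∈ branchRing Φ ↔ ∃ f, ρ f = x)
    {g : K} (hg : (Φ g).orderTop = 1) :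
    ∃ φ : Unit → O →+* PowerSeries k, IsFormalBranches c₀ φ 0 ∧
      ∀ f, HahnSeries.ofPowerSeries ℤ k (φ () f) = Φ (ρ f) := by
  have hex : ∀ f, ∃ p, HahnSeries.ofPowerSeries ℤ k p = Φ (ρ f) := fun f =>
    zero_le_orderTop_iff.1 ((hρ _).2 ⟨f, rfl⟩)
  choose ψ hψ using hex
  let φ : O →+* PowerSeries k :=
    { toFun := ψ
      map_one' := ofPowerSeries_injective (by rw [hψ]; simp)
      map_zero' := ofPowerSeries_injective (by rw [hψ]; simp)
      map_mul' := fun a b => ofPowerSeries_injective (by rw [map_mul, hψ, hψ, hψ]; simp)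
      map_add' := fun a b => ofPowerSeries_injective (by rw [map_add, hψ, hψ, hψ]; simp) }
  have hφ : ∀ f, HahnSeries.ofPowerSeries ℤ k (φ f) = Φ (ρ f) := hψ
  have hg0 : g ≠ 0 := by rintro rfl; simp at hg
  obtain ⟨t, ht⟩ := (hρ g).1 (by rw [mem_branchRing, hg]; norm_num)
  have ht1 : (HahnSeries.ofPowerSeries ℤ k (φ t)).orderTop = 1 := by rw [hφ, ht, hg]
  have hXt : PowerSeries.X ∣ φ t := by
    have := (le_orderTop_coe_iff (n := 1) (p := φ t)).1 (by rw [ht1]; rfl)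
    rwa [pow_one] at this
  have hu : ∀ f, IsUnit (φ f) → IsUnit f := by
    intro f hf
    have h1 : (HahnSeries.ofPowerSeries ℤ k (φ f)).orderTop = (0 : ℤ) := by
      have := orderTop_X_pow_mul 0 hf
      simpa using this
    have h0 : ρ f ≠ 0 := fun h => by
      rw [hφ, h, map_zero, HahnSeries.orderTop_zero] at h1
      exact WithTop.coe_ne_top h1.symm
    obtain ⟨v, hv⟩ := (hρ (ρ f)⁻¹).1 (by
      rw [mem_branchRing, map_inv₀, ← hφ, orderTop_inv h1]; simp)
    refine IsUnit.of_mul_eq_one v (hinj ?_)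
    rw [map_mul, hv, mul_inv_cancel₀ h0, map_one]
  have htm : t ∈ maximalIdeal O := by
    rw [mem_maximalIdeal, mem_nonunits_iff]
    intro h
    have := h.map φ
    rw [PowerSeries.isUnit_iff_constantCoeff, PowerSeries.X_dvd_iff.1 hXt] at this
    exact not_isUnit_zero this
  have hφc : ∀ a, φ (c₀ a) = PowerSeries.C a := fun a =>
    ofPowerSeries_injective (by rw [hφ, hc, map_algebraMap, HahnSeries.ofPowerSeries_C])
  have hdiv : ∀ (n : ℕ) f, PowerSeries.X ^ n ∣ φ f → ∃ q, f = t ^ n * q := by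
    intro n f hf
    obtain ⟨q, hq⟩ := (hρ (ρ f * (g⁻¹) ^ n)).1 (by
      rw [mem_branchRing, map_mul, orderTop_mul, map_pow, orderTop_pow, map_inv₀,
        orderTop_inv (n := 1) (by rw [hg]; rfl), ← hφ]
      calc (0 : WithTop ℤ) = ((n : ℤ) : WithTop ℤ) + n • ((-1 : ℤ) : WithTop ℤ) := by
            norm_cast; simp
        _ ≤ _ := by gcongr; exact le_orderTop_coe_iff.2 hf)
    refine ⟨q, hinj ?_⟩
    rw [map_mul, map_pow, ht, hq, inv_pow, mul_comm, inv_mul_cancel_right₀ (pow_ne_zero _ hg0)]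
  refine ⟨fun _ => φ, ⟨fun _ => hφc, fun _ f hf => ?_, fun N => ⟨N, fun f hf => ?_⟩,
    fun p _ N => ?_⟩, hφ⟩
  · rw [PowerSeries.X_dvd_iff]
    by_contra h
    exact hf (hu f (PowerSeries.isUnit_iff_constantCoeff.2 (isUnit_iff_ne_zero.2 h)))
  · obtain ⟨q, rfl⟩ := hdiv N f (hf ())
    exact Ideal.mul_mem_right _ _ (Ideal.pow_mem_pow htm N)
  · -- approximate `p` successively by polynomials in `t`
    suffices ∃ f, PowerSeries.X ^ N ∣ p () - φ f by
      obtain ⟨f, hf⟩ := this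
      exact ⟨f, fun _ => hf⟩
    induction N with
    | zero => exact ⟨0, by simp⟩
    | succ N ih =>
      obtain ⟨f, hf⟩ := ih
      have h1 : ((N : ℤ) : WithTop ℤ) ≤ (HahnSeries.ofPowerSeries ℤ k (p () - φ f)).orderTop :=
        le_orderTop_coe_iff.2 hf
      have h2 : (HahnSeries.ofPowerSeries ℤ k (φ t ^ N)).orderTop = (N : ℤ) := by
        rw [map_pow, orderTop_pow, ht1]; norm_cast; simp
      have h3 : PowerSeries.coeff N (φ t ^ N) ≠ 0 := by
        intro h
        have := orderTop_add_one_le h2.ge (by rw [LaurentSeries.coeff_coe_powerSeries]; exact h)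
        rw [h2] at this
        have := WithTop.coe_le_coe.1 this
        omega
      refine ⟨f + c₀ (PowerSeries.coeff N (p () - φ f) / PowerSeries.coeff N (φ t ^ N)) * t ^ N,
        ?_⟩
      rw [map_add, ← sub_sub, map_mul, hφc, map_pow φ, PowerSeries.X_pow_dvd_iff]
      intro j hj
      rw [map_sub, PowerSeries.coeff_C_mul]
      rcases (Nat.lt_succ_iff_lt_or_eq.1 hj) with hj | rfl
      · rw [PowerSeries.X_pow_dvd_iff.1 hf j hj,
          PowerSeries.X_pow_dvd_iff.1 (pow_dvd_pow_of_dvd hXt N) j hj, mul_zero, sub_zero]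
      · rw [div_mul_cancel₀ _ h3, sub_self]

end Regular

open IsLocalRing

section Digits

variable {k : Type*} [Field k] {O : Type*} [CommRing O] [IsLocalRing O]

/-- A local `k`-algebra with residue field `k` and principal, non-nilpotent maximal ideal `(t)` has
a formal branch, given by expansion in powers of `t`. -/
lemma exists_isFormalBranches_of_principal {c₀ : k →+* O}
    (hres : ∀ f, ∃ a, f - c₀ a ∈ maximalIdeal O) {t : O} (ht : maximalIdeal O = Ideal.span {t})
    (hnil : ∀ n : ℕ, t ^ n ≠ 0) :
    ∃ φ : Unit → O →+* PowerSeries k, IsFormalBranches c₀ φ 0 ∧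
      φ () t = PowerSeries.X := by
  have htm : t ∈ maximalIdeal O := ht ▸ Ideal.mem_span_singleton_self t
  -- `p` is the expansion of `f` if it is so modulo every power of `t`
  let R : O → PowerSeries k → Prop := fun f p => ∀ N, t ^ N ∣ f - (p.trunc N).eval₂ c₀ t
  have hsum : ∀ (p : PowerSeries k) N, (p.trunc N).eval₂ c₀ t =
      ∑ i ∈ Finset.range N, c₀ (PowerSeries.coeff i p) * t ^ i := fun p N =>
    PowerSeries.eval₂_trunc_eq_sum_range t c₀ N p
  have hex : ∀ f, ∃ p, R f p := by
    -- split off one digit at a time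
    have h1 : ∀ f, ∃ a q, f = c₀ a + t * q := fun f => by
      obtain ⟨a, ha⟩ := hres f
      rw [ht, Ideal.mem_span_singleton'] at ha
      obtain ⟨q, hq⟩ := ha
      exact ⟨a, q, by rw [mul_comm t, hq]; ring⟩
    choose a q haq using h1
    intro f
    refine ⟨PowerSeries.mk fun n => a (q^[n] f), fun N => ?_⟩
    have : f - ∑ i ∈ Finset.range N, c₀ (a (q^[i] f)) * t ^ i = t ^ N * q^[N] f := by
      induction N with
      | zero => simp
      | succ N ih =>
        rw [Finset.sum_range_succ, ← sub_sub, ih, Function.iterate_succ_apply', pow_succ]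
        linear_combination t ^ N * haq (q^[N] f)
    rw [hsum]
    simp only [PowerSeries.coeff_mk]
    rw [this]
    exact dvd_mul_right _ _
  have huniq : ∀ f p q, R f p → R f q → p = q := by
    intro f p q hp hq
    ext n
    induction n using Nat.strong_induction_on with
    | _ n ih =>
      by_contra hne
      have h1 := dvd_sub (hq (n + 1)) (hp (n + 1))
      have hs : ∑ i ∈ Finset.range n, c₀ (PowerSeries.coeff i p) * t ^ i =
          ∑ i ∈ Finset.range n, c₀ (PowerSeries.coeff i q) * t ^ i :=
        Finset.sum_congr rfl fun i hi => by rw [ih i (Finset.mem_range.1 hi)]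
      rw [hsum, hsum, Finset.sum_range_succ, Finset.sum_range_succ, hs] at h1
      obtain ⟨y, hy⟩ := h1
      have hu : IsUnit (c₀ (PowerSeries.coeff n p - PowerSeries.coeff n q)) :=
        (isUnit_iff_ne_zero.2 (sub_ne_zero.2 hne)).map c₀
      have hu2 : IsUnit (c₀ (PowerSeries.coeff n p - PowerSeries.coeff n q) - t * y) := by
        by_contra hcon
        refine (mem_maximalIdeal _).1 ?_ hu
        have h2 : c₀ (PowerSeries.coeff n p - PowerSeries.coeff n q) - t * y ∈ maximalIdeal O :=
          hcon
        have := add_mem h2 (Ideal.mul_mem_right y _ htm)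
        rwa [sub_add_cancel] at this
      refine hnil n ((hu2.mul_left_eq_zero).1 ?_)
      rw [map_sub]
      rw [pow_succ] at hy
      linear_combination hy
  have hadd : ∀ f g p q, R f p → R g q → R (f + g) (p + q) := by
    intro f g p q hp hq N
    have := dvd_add (hp N) (hq N)
    rw [map_add, Polynomial.eval₂_add]
    convert this using 1
    ring
  have hmul : ∀ f g p q, R f p → R g q → R (f * g) (p * q) := by
    intro f g p q hp hq N
    obtain ⟨r, hr⟩ : Polynomial.X ^ N ∣ p.trunc N * q.trunc N - (p * q).trunc N := by
      rw [Polynomial.X_pow_dvd_iff]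
      intro d hd
      rw [Polynomial.coeff_sub, PowerSeries.coeff_trunc, if_pos hd,
        PowerSeries.coeff_mul_eq_coeff_trunc_mul_trunc p q hd, ← Polynomial.coe_mul,
        Polynomial.coeff_coe, sub_self]
    have h1 := congrArg (Polynomial.eval₂ c₀ t) hr
    rw [Polynomial.eval₂_sub, Polynomial.eval₂_mul, Polynomial.eval₂_mul, Polynomial.eval₂_X_pow]
      at h1
    have h2 : f * g - ((p * q).trunc N).eval₂ c₀ t = f * (g - (q.trunc N).eval₂ c₀ t) +
        (q.trunc N).eval₂ c₀ t * (f - (p.trunc N).eval₂ c₀ t) + t ^ N * r.eval₂ c₀ t := by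
      linear_combination h1
    rw [h2]
    exact dvd_add (dvd_add ((hq N).mul_left _) ((hp N).mul_left _)) (dvd_mul_right _ _)
  have hC : ∀ a, R (c₀ a) (PowerSeries.C a) := by
    rintro a (_ | N)
    · simp
    · rw [hsum, Finset.sum_eq_single 0]
      · simp
      · intro i _ hi
        rw [PowerSeries.coeff_C, if_neg hi, map_zero, zero_mul]
      · simp
  have hX : R t PowerSeries.X := by
    rintro (_ | _ | N)
    · simp
    · rw [hsum]; simp
    · rw [hsum, Finset.sum_eq_single 1]
      · simp
      · intro i _ hi
        rw [PowerSeries.coeff_X, if_neg hi, map_zero, zero_mul]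
      · simp
  choose ψ hψ using hex
  have hψ' : ∀ f p, R f p → ψ f = p := fun f p h => huniq f _ _ (hψ f) h
  let φ : O →+* PowerSeries k :=
    { toFun := ψ
      map_one' := hψ' _ _ (by simpa using hC 1)
      map_zero' := hψ' _ _ (by simpa using hC 0)
      map_mul' := fun f g => hψ' _ _ (hmul _ _ _ _ (hψ f) (hψ g))
      map_add' := fun f g => hψ' _ _ (hadd _ _ _ _ (hψ f) (hψ g)) }
  have hφ : ∀ f p, R f p → φ f = p := hψ'
  have hφX : φ t = PowerSeries.X := hφ _ _ hX
  have hφC : ∀ a, φ (c₀ a) = PowerSeries.C a := fun a => hφ _ _ (hC a)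
  refine ⟨fun _ => φ, ⟨fun _ => hφC, fun _ f hf => ?_, fun N => ⟨N, fun f hf => ?_⟩,
    fun p _ N => ?_⟩, hφX⟩
  · rw [ht, Ideal.mem_span_singleton'] at hf
    obtain ⟨q, rfl⟩ := hf
    rw [map_mul, hφX]
    exact dvd_mul_left _ _
  · have h1 : t ^ N ∣ f - ((φ f).trunc N).eval₂ c₀ t := hψ f N
    have h2 : (φ f).trunc N = 0 := by
      ext i
      rw [PowerSeries.coeff_trunc]
      split_ifs with hi
      · rw [PowerSeries.X_pow_dvd_iff.1 (hf ()) i hi, Polynomial.coeff_zero]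
      · rw [Polynomial.coeff_zero]
    rw [h2, Polynomial.eval₂_zero, sub_zero] at h1
    rw [ht, Ideal.span_singleton_pow]
    exact Ideal.mem_span_singleton.2 h1
  · refine ⟨((p ()).trunc N).eval₂ c₀ t, fun _ => ?_⟩
    rw [hsum, map_sum, PowerSeries.X_pow_dvd_iff]
    intro i hi
    rw [map_sub, map_sum, Finset.sum_eq_single i]
    · rw [map_mul, map_pow, hφC, hφX, PowerSeries.coeff_C_mul, PowerSeries.coeff_X_pow, if_pos rfl,
        mul_one, sub_self]
    · intro j _ hj
      rw [map_mul, map_pow, hφC, hφX, PowerSeries.coeff_C_mul, PowerSeries.coeff_X_pow,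
        if_neg hj.symm, mul_zero]
    · intro h
      exact (h (Finset.mem_range.2 hi)).elim

end Digits

/-! ### Points near the generic point of a component -/

section Chart

variable {k : Type u} [Field k]

/-- If the differentials of the localization `K` of `B` are one-dimensional, then up to a
denominator the differentials of `B` are generated by the differential of one element. -/
lemma exists_smul_D_eq {B K : Type u} [CommRing B] [Field K] [Algebra k B] [Algebra k K]
    [Algebra B K] [IsScalarTower k B K] [Algebra.FiniteType k B] (M : Submonoid B)
    [IsLocalization M K] (hΩ : IsExactSpan k K) {ω : Ω[K⁄k]} (hω : ω ≠ 0) :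
    ∃ s : B, ∃ h : K, ω = h • KaehlerDifferential.D k K (algebraMap B K s) ∧
      ∃ g ∈ M, ∀ f : B, ∃ h : B,
        g • KaehlerDifferential.D k B f = h • KaehlerDifferential.D k B s := by
  obtain ⟨s₀, hs₀⟩ := hΩ
  obtain ⟨s, hs⟩ : ∃ s : B, KaehlerDifferential.D k K (algebraMap B K s) ≠ 0 := by
    by_contra! hcon
    have h1 := KaehlerDifferential.span_range_map_derivation_of_isLocalization k B K M
    have h2 : Submodule.span K (Set.range
        (KaehlerDifferential.map k k B K ∘ KaehlerDifferential.D k B)) ≤ ⊥ := by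
      rw [Submodule.span_le]
      rintro - ⟨b, rfl⟩
      rw [Function.comp_apply, KaehlerDifferential.map_D, hcon b]
      exact zero_mem _
    rw [h1] at h2
    exact hω ((Submodule.mem_bot K).1 (h2 trivial))
  obtain ⟨a, ha⟩ := hs₀ (KaehlerDifferential.D k K (algebraMap B K s))
  have ha0 : a ≠ 0 := by
    rintro rfl
    rw [zero_smul] at ha
    exact hs ha
  have hspan : ∀ ω : Ω[K⁄k], ∃ h : K, ω = h • KaehlerDifferential.D k K (algebraMap B K s) := by
    intro ω
    obtain ⟨b, rfl⟩ := hs₀ ω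
    exact ⟨b * a⁻¹, by rw [ha, smul_smul, inv_mul_cancel_right₀ ha0]⟩
  obtain ⟨h, hh⟩ := hspan ω
  refine ⟨s, h, hh, ?_⟩
  have h1 : ∀ f : B, ∃ g ∈ M, ∃ h : B,
      g • KaehlerDifferential.D k B f = h • KaehlerDifferential.D k B s := by
    intro f
    obtain ⟨y, hy⟩ := hspan (KaehlerDifferential.D k K (algebraMap B K f))
    obtain ⟨b, m, rfl⟩ := IsLocalization.exists_mk'_eq M y
    have h2 : KaehlerDifferential.map k k B K ((m : B) • KaehlerDifferential.D k B f) =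
        KaehlerDifferential.map k k B K (b • KaehlerDifferential.D k B s) := by
      rw [map_smul, map_smul, KaehlerDifferential.map_D, KaehlerDifferential.map_D, hy,
        ← algebraMap_smul K (m : B), smul_smul, mul_comm, IsLocalization.mk'_spec,
        algebraMap_smul]
    obtain ⟨c, hc⟩ := (IsLocalizedModule.eq_iff_exists M (KaehlerDifferential.map k k B K)).1 h2
    refine ⟨c * m, mul_mem c.2 m.2, c * b, ?_⟩
    rw [mul_smul, mul_smul]
    exact hc
  obtain ⟨T, hT⟩ := Algebra.FiniteType.out (R := k) (A := B)
  choose g hg h hh using h1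
  refine ⟨∏ t ∈ T, g t, prod_mem fun t _ => hg t, fun f => ?_⟩
  have hf : f ∈ Algebra.adjoin k (T : Set B) := hT ▸ Algebra.mem_top
  induction hf using Algebra.adjoin_induction with
  | mem t ht =>
    classical
    refine ⟨(∏ t ∈ T.erase t, g t) * h t, ?_⟩
    rw [← Finset.prod_erase_mul T g ht, mul_smul, mul_smul, hh]
  | algebraMap r => exact ⟨0, by rw [Derivation.map_algebraMap, smul_zero, zero_smul]⟩
  | add x y _ _ hx hy =>
    obtain ⟨a, ha⟩ := hx
    obtain ⟨b, hb⟩ := hy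
    exact ⟨a + b, by rw [map_add, smul_add, ha, hb, add_smul]⟩
  | mul x y _ _ hx hy =>
    obtain ⟨a, ha⟩ := hx
    obtain ⟨b, hb⟩ := hy
    refine ⟨x * b + y * a, ?_⟩
    rw [Derivation.leibniz, smul_add, smul_comm _ x, smul_comm _ y, ha, hb, add_smul, mul_smul,
      mul_smul]

/-- At a point with residue field `k` where the differentials are generated by `ds`, the maximal
ideal is generated by `s - s(x)`. -/
lemma maximalIdeal_eq_span_sub {B O : Type u} [CommRing B] [Algebra k B] [CommRing O]
    [IsLocalRing O] [IsNoetherianRing O] (γ : B →+* O)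
    (hres : ∀ f, ∃ a, f - γ (algebraMap k B a) ∈ maximalIdeal O)
    (hγ : ∀ f, ∃ a b, IsUnit (γ b) ∧ f * γ b = γ a) {s g : B} (hg : IsUnit (γ g))
    (hs : ∀ f : B, ∃ h : B, g • KaehlerDifferential.D k B f = h • KaehlerDifferential.D k B s) :
    ∃ a, maximalIdeal O = Ideal.span {γ (s - algebraMap k B a)} := by
  choose v hv using fun f : B => hres (γ f)
  have hvu : ∀ f a, γ f - γ (algebraMap k B a) ∈ maximalIdeal O → v f = a := by
    intro f a h
    by_contra hne
    have h1 := sub_mem h (hv f)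
    rw [sub_sub_sub_cancel_left, ← map_sub, ← map_sub] at h1
    exact h1 (((isUnit_iff_ne_zero.2 (sub_ne_zero.2 hne)).map (algebraMap k B)).map γ)
  have hv_mul : ∀ f f', v (f * f') = v f * v f' := fun f f' => hvu _ _ (by
    have := add_mem (Ideal.mul_mem_left _ (γ f) (hv f'))
      (Ideal.mul_mem_left _ (γ (algebraMap k B (v f'))) (hv f))
    simp only [map_mul] at this ⊢
    convert this using 1
    ring)
  have hv_add : ∀ f f', v (f + f') = v f + v f' := fun f f' => hvu _ _ (by
    have := add_mem (hv f) (hv f')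
    simp only [map_add] at this ⊢
    convert this using 1
    ring)
  have hv_c : ∀ a, v (algebraMap k B a) = a := fun a => hvu _ _ (by simp)
  let _ : Algebra B (O ⧸ maximalIdeal O ^ 2) :=
    ((Ideal.Quotient.mk (maximalIdeal O ^ 2)).comp γ).toAlgebra
  let _ : Algebra k (O ⧸ maximalIdeal O ^ 2) :=
    ((algebraMap B (O ⧸ maximalIdeal O ^ 2)).comp (algebraMap k B)).toAlgebra
  have : IsScalarTower k B (O ⧸ maximalIdeal O ^ 2) := .of_algebraMap_eq fun _ => rfl
  -- the derivation `f ↦ f - f(x)` with values in the cotangent space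
  let δ : Derivation k B (O ⧸ maximalIdeal O ^ 2) := Derivation.mk'
    { toFun := fun f => Ideal.Quotient.mk _ (γ f - γ (algebraMap k B (v f)))
      map_add' := fun f f' => by
        rw [hv_add, ← map_add]
        congr 1
        simp only [map_add]
        ring
      map_smul' := fun a f => by
        rw [RingHom.id_apply, Algebra.smul_def, Algebra.smul_def, hv_mul, hv_c]
        change _ = Ideal.Quotient.mk _ (γ (algebraMap k B a)) * _
        rw [← map_mul]
        congr 1
        simp only [map_mul]
        ring } fun f f' => by
      change Ideal.Quotient.mk _ (γ (f * f') - γ (algebraMap k B (v (f * f')))) =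
        Ideal.Quotient.mk _ (γ f) * Ideal.Quotient.mk _ (γ f' - γ (algebraMap k B (v f'))) +
        Ideal.Quotient.mk _ (γ f') * Ideal.Quotient.mk _ (γ f - γ (algebraMap k B (v f)))
      rw [hv_mul, ← map_mul, ← map_mul, ← map_add, Ideal.Quotient.eq, ← neg_mem_iff]
      have := Ideal.mul_mem_mul (hv f) (hv f')
      rw [← pow_two] at this
      convert this using 1
      simp only [map_mul]
      ring
  have hδ : ∀ f, δ f = Ideal.Quotient.mk _ (γ f - γ (algebraMap k B (v f))) := fun _ => rfl
  have hmem : ∀ f : B, γ f - γ (algebraMap k B (v f)) ∈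
      Ideal.span {γ (s - algebraMap k B (v s))} ⊔ maximalIdeal O ^ 2 := by
    intro f
    obtain ⟨h, hh⟩ := hs f
    have h1 := congrArg δ.liftKaehlerDifferential hh
    rw [map_smul, map_smul, Derivation.liftKaehlerDifferential_comp_D,
      Derivation.liftKaehlerDifferential_comp_D, hδ, hδ] at h1
    change Ideal.Quotient.mk _ (γ g) * _ = Ideal.Quotient.mk _ (γ h) * _ at h1
    rw [← map_mul, ← map_mul, Ideal.Quotient.eq] at h1
    obtain ⟨u, hu⟩ := hg
    have h2 : γ f - γ (algebraMap k B (v f)) =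
        (↑u⁻¹ * γ h) * γ (s - algebraMap k B (v s)) +
        ↑u⁻¹ * (γ g * (γ f - γ (algebraMap k B (v f))) -
          γ h * (γ s - γ (algebraMap k B (v s)))) := by
      rw [← hu, map_sub]
      linear_combination (-(γ f - γ (algebraMap k B (v f)))) * u.inv_mul
    rw [h2]
    exact Submodule.add_mem_sup (Ideal.mul_mem_left _ _ (Ideal.mem_span_singleton_self _))
      (Ideal.mul_mem_left _ _ h1)
  refine ⟨v s, le_antisymm ?_ ?_⟩
  · refine Submodule.le_of_le_smul_of_le_jacobson_bot (I := maximalIdeal O)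
      (IsNoetherian.noetherian _) (maximalIdeal_le_jacobson ⊥) ?_
    rw [smul_eq_mul, ← pow_two]
    intro y hy
    obtain ⟨a, b, hb, hab⟩ := hγ y
    have h0 : v a = 0 := hvu _ _ (by
      rw [map_zero, map_zero, sub_zero, ← hab]
      exact Ideal.mul_mem_right _ _ hy)
    have h1 := hmem a
    rw [h0, map_zero, map_zero, sub_zero, ← hab] at h1
    obtain ⟨u, hu⟩ := hb
    rw [← hu] at h1
    have := Ideal.mul_mem_right (↑u⁻¹) _ h1
    rwa [Units.mul_inv_cancel_right] at this
  · rw [Ideal.span_singleton_le_iff_mem, map_sub]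
    exact hv s

end Chart

/-! ### Schemes of finite type over an algebraically closed field -/

section FiniteType

open IsLocalRing

variable (k : Type u) [Field k] {X : Scheme.{u}} [X.Over (Spec (.of k))]

variable (X) in
/-- The structure map `k → 𝒪_X(U)`. -/
def structSection (U : X.Opens) : k →+* Γ(X, U) :=
  ((Scheme.ΓSpecIso (.of k)).inv ≫ (X ↘ Spec (.of k)).appLE ⊤ U le_top).hom

lemma germ_structSection {U : X.Opens} {x : X} (hx : x ∈ U) (a : k) :
    (X.presheaf.germ U x hx).hom (structSection k X U a) = toStalk k X x a := by
  have h : (X ↘ Spec (.of k)).appLE ⊤ U le_top ≫ X.presheaf.germ U x hx =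
      (X ↘ Spec (.of k)).appTop ≫ X.presheaf.germ ⊤ x (Opens.mem_top x) := by
    exact (Category.assoc _ _ _).trans (congrArg _ (X.presheaf.germ_res _ _ _))
  exact congrArg (fun φ => φ.hom ((Scheme.ΓSpecIso (.of k)).inv.hom a)) h

lemma fromSpecStalk_over (x : X) :
    X.fromSpecStalk x ≫ (X ↘ Spec (.of k)) = Spec.map (CommRingCat.ofHom (toStalk k X x)) := by
  have h1 := Scheme.toSpecΓ_naturality (X ↘ Spec (.of k))
  rw [← SpecMap_ΓSpecIso_hom] at h1
  have h2 : (X ↘ Spec (.of k)) = X.toSpecΓ ≫ Spec.map (X ↘ Spec (.of k)).appTop ≫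
      Spec.map (Scheme.ΓSpecIso (.of k)).inv := by
    rw [← reassoc_of% h1, ← Spec.map_comp, Iso.inv_hom_id, Spec.map_id, Category.comp_id]
  rw [h2, Scheme.fromSpecStalk_toSpecΓ_assoc, ← Spec.map_comp, ← Spec.map_comp]
  rfl

lemma fromSpecResidueField_over (x : X) : X.fromSpecResidueField x ≫ (X ↘ Spec (.of k)) =
    Spec.map (CommRingCat.ofHom ((X.residue x).hom.comp (toStalk k X x))) := by
  rw [Scheme.fromSpecResidueField, Category.assoc, fromSpecStalk_over, ← Spec.map_comp]
  rfl

lemma evaluation_structSection {U : X.Opens} {η : X} (hη : η ∈ U) (a : k) :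
    (X.evaluation U η hη).hom (structSection k X U a) = algebraMap k (X.residueField η) a :=
  congrArg (X.residue η).hom (germ_structSection k hη a)

lemma finiteType_structSection [LocallyOfFiniteType (X ↘ Spec (.of k))] {U : X.Opens}
    (hU : IsAffineOpen U) : (structSection k X U).FiniteType := by
  refine RingHom.FiniteType.comp
    ((X ↘ Spec (.of k)).finiteType_appLE (isAffineOpen_top _) hU le_top) ?_
  exact RingHom.FiniteType.of_surjective _
    (Scheme.ΓSpecIso (.of k)).commRingCatIsoToRingEquiv.symm.surjective

lemma isEssFinite_toStalk [LocallyOfFiniteType (X ↘ Spec (.of k))] (x : X) :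
    IsEssFinite (toStalk k X x) := by
  classical
  obtain ⟨U, hU, hxU, -⟩ := exists_isAffineOpen_mem_and_subset (x := x) (U := ⊤) trivial
  let _ : Algebra k Γ(X, U) := (structSection k X U).toAlgebra
  have hft : Algebra.FiniteType k Γ(X, U) := finiteType_structSection k hU
  obtain ⟨T, hT⟩ := hft.out
  have hloc := hU.isLocalization_stalk ⟨x, hxU⟩
  let _ := TopCat.Presheaf.algebra_section_stalk X.presheaf (⟨x, hxU⟩ : U)
  refine ⟨T.image (X.presheaf.germ U x hxU).hom, fun S hS hTS hinv => ?_⟩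
  have hB : ∀ b : Γ(X, U), (X.presheaf.germ U x hxU).hom b ∈ S := by
    intro b
    have hb : b ∈ Algebra.adjoin k (T : Set Γ(X, U)) := hT ▸ Algebra.mem_top
    induction hb using Algebra.adjoin_induction with
    | mem t ht => exact hTS _ (Finset.mem_image_of_mem _ ht)
    | algebraMap r =>
      have := germ_structSection k hxU r
      rw [show algebraMap k Γ(X, U) r = structSection k X U r from rfl, this]
      exact hS r
    | add a b _ _ ha hb => rw [map_add]; exact add_mem ha hb
    | mul a b _ _ ha hb => rw [map_mul]; exact mul_mem ha hb
  rw [eq_top_iff]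
  intro f _
  obtain ⟨a, s, rfl⟩ := IsLocalization.exists_mk'_eq
    (hU.primeIdealOf ⟨x, hxU⟩).asIdeal.primeCompl f
  obtain ⟨u, hu⟩ := IsLocalization.map_units (X.presheaf.stalk x) s
  rw [IsLocalization.mk'_eq_mul_mk'_one]
  refine mul_mem (hB a) (hinv ((X.presheaf.germ U x hxU).hom s) _ ?_ (hB s))
  exact IsLocalization.mk'_spec' (X.presheaf.stalk x) 1 s |>.trans (map_one _)

/-- At a closed point, every function differs from its value by a function vanishing there. -/
lemma exists_sub_mem_maximalIdeal [IsAlgClosed k] [LocallyOfFiniteType (X ↘ Spec (.of k))] {x : X}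
    (hx : IsClosed {x}) (f : X.presheaf.stalk x) :
    ∃ a, f - toStalk k X x a ∈ maximalIdeal (X.presheaf.stalk x) := by
  have h1 := SpecMap_residueFieldIsoBase_inv (X ↘ Spec (.of k)) x hx
  have h2 : (residueFieldIsoBase (X ↘ Spec (.of k)) x hx).inv.hom =
      (X.residue x).hom.comp (toStalk k X x) := by
    have h3 : Spec.map (residueFieldIsoBase (X ↘ Spec (.of k)) x hx).inv =
        Spec.map (CommRingCat.ofHom ((X.residue x).hom.comp (toStalk k X x))) := by
      rw [h1, fromSpecResidueField_over]
    have := Spec.map_injective h3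
    rw [this]
    rfl
  have h4 : Function.Surjective ((X.residue x).hom.comp (toStalk k X x)) := by
    rw [← h2]
    exact (residueFieldIsoBase (X ↘ Spec (.of k)) x hx).commRingCatIsoToRingEquiv.symm.surjective
  obtain ⟨a, ha⟩ := h4 ((X.residue x).hom f)
  refine ⟨a, ?_⟩
  rw [← IsLocalRing.residue_eq_zero_iff, map_sub, sub_eq_zero]
  exact ha.symm

lemma isClosed_singleton_of_sub_mem [LocallyOfFiniteType (X ↘ Spec (.of k))] {x : X}
    (h : ∀ f, ∃ a, f - toStalk k X x a ∈ maximalIdeal (X.presheaf.stalk x)) :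
    IsClosed ({x} : Set X) := by
  have : JacobsonSpace X := LocallyOfFiniteType.jacobsonSpace (X ↘ Spec (.of k))
  rw [isClosed_singleton_iff_locallyOfFiniteType]
  have h4 : LocallyOfFiniteType (X.fromSpecResidueField x ≫ (X ↘ Spec (.of k))) := by
    rw [fromSpecResidueField_over, HasRingHomProperty.Spec_iff (P := @LocallyOfFiniteType)]
    refine RingHom.FiniteType.of_surjective _ fun z => ?_
    obtain ⟨f, rfl⟩ := X.residue_surjective x z
    obtain ⟨a, ha⟩ := h f
    refine ⟨a, ?_⟩
    rw [← IsLocalRing.residue_eq_zero_iff, map_sub, sub_eq_zero] at ha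
    exact ha.symm
  exact locallyOfFiniteType_of_comp _ (X ↘ Spec (.of k))

end FiniteType

/-! ### Local generators of the dualizing sheaf -/

open IsLocalRing

section GeneratesAt

variable {k : Type u} [Field k] {X : Scheme.{u}} [X.Over (Spec (.of k))]

/-- The rational differential `σ` generates the stalk of `ω_X(d x)` at `x`. -/
def GeneratesAt (d : ℕ) {U : X.Opens} (σ : RatDiff k X U) {x : X} (hx : x ∈ U) : Prop :=
  (∀ f ∈ maximalIdeal (X.presheaf.stalk x) ^ d, ResidueSumVanishes σ hx f) ∧
    ∀ (V : X.Opens) (hx' : x ∈ V) (τ : RatDiff k X V),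
      (∀ f ∈ maximalIdeal (X.presheaf.stalk x) ^ d, ResidueSumVanishes τ hx' f) →
      ∃ f : X.presheaf.stalk x, ∀ (η : X) (hη : η ∈ genericPoints X) (h : η ⤳ x),
        τ ⟨η, hη, h.mem_open V.isOpen hx'⟩ =
          toBranch X h f • σ ⟨η, hη, h.mem_open U.isOpen hx⟩

lemma IsElliptic.generatesAt {ι : Type*} [Fintype ι] {x : X} [IsNoetherianRing (X.presheaf.stalk x)]
    {φ : ι → X.presheaf.stalk x →+* PowerSeries k} {c : ι → k}
    (E : IsElliptic (toStalk k X x) φ c)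
    (hΩ : ∀ η ∈ genericPoints X, η ⤳ x → IsExactSpan k (X.residueField η)) {U : X.Opens}
    {σ : RatDiff k X U} {hx : x ∈ U} (hσ : E.IsAdapted σ hx) : GeneratesAt 0 σ hx :=
  ⟨fun f _ => E.residueSumVanishes hΩ hσ f, fun _ _ _ hτ =>
    E.exists_eq_smul hΩ hσ fun f => hτ f (by rw [pow_zero, Ideal.one_eq_top]; trivial)⟩

lemma IsFormalBranches.generatesAt {ι : Type*} [Unique ι] {x : X}
    [IsNoetherianRing (X.presheaf.stalk x)]
    {φ : ι → X.presheaf.stalk x →+* PowerSeries k} (H : IsFormalBranches (toStalk k X x) φ 0)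
    (hΩ : ∀ η ∈ genericPoints X, η ⤳ x → IsExactSpan k (X.residueField η)) {U : X.Opens}
    {σ : RatDiff k X U} {hx : x ∈ U} (d : ℕ)
    (hσ : ∀ b, (H.expansion σ hx b).orderTop = ((1 - d : ℤ) : WithTop ℤ)) :
    GeneratesAt d σ hx := by
  refine ⟨(H.forall_residueSumVanishes_iff hΩ d).2 fun b => (hσ b).ge, fun V hx' τ hτ => ?_⟩
  have hτ := (H.forall_residueSumVanishes_iff hΩ d).1 hτ
  have hσ0 : ∀ b, H.expansion σ hx b ≠ 0 := fun b h => by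
    have := hσ b
    rw [h, HahnSeries.orderTop_zero] at this
    exact WithTop.top_ne_coe this
  choose g hg using fun η => H.exists_eq_smul_of_expansion_ne_zero hΩ hσ0 τ hx' η
  obtain ⟨f, hf⟩ := H.exists_toBranch_eq g fun b => by
    have h1 := hτ b
    rw [H.expansion_eq_mul (hx := hx) (hg b.η b.generic b.specializes), orderTop_mul, hσ] at h1
    by_cases h0 : H.branchMap b (g b.η) = 0
    · rw [h0]; simp
    obtain ⟨n, hn⟩ := orderTop_eq_coe h0
    rw [hn] at h1 ⊢
    have h2 : (1 - d : ℤ) ≤ n + (1 - d) := WithTop.coe_le_coe.1 h1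
    exact WithTop.coe_le_coe.2 (by push_cast; omega)
  exact ⟨f, fun η hη h => by rw [hf η hη h]; exact hg η hη h⟩

end GeneratesAt

/-! ### Points near the generic points of a reduced curve -/

section Generic

variable (k : Type u) [Field k] {X : Scheme.{u}}

lemma residue_injective_of_generic [IsReduced X] {η : X} (hη : η ∈ genericPoints X) :
    Function.Injective (X.residue η).hom := by
  rw [injective_iff_map_eq_zero]
  intro f hf
  have hf : f ∈ maximalIdeal (X.presheaf.stalk η) := (IsLocalRing.residue_eq_zero_iff f).1 hf
  have : IsNilpotent f := by
    rw [nilpotent_iff_mem_prime]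
    intro P hP
    let P' : PrimeSpectrum (X.presheaf.stalk η) := ⟨P, hP⟩
    have h1 := eq_of_specializes_of_generic hη (fromSpecStalk_specializes P')
    have h2 : P' = closedPoint _ := (X.fromSpecStalk η).isEmbedding.injective
      (h1.trans Scheme.fromSpecStalk_closedPoint.symm)
    have h3 : P = maximalIdeal (X.presheaf.stalk η) := congrArg PrimeSpectrum.asIdeal h2
    rwa [h3]
  exact this.eq_zero

variable [X.Over (Spec (.of k))]

lemma isLocalization_evaluation [IsReduced X] {η : X} (hη : η ∈ genericPoints X) {U : X.Opens}
    (hU : IsAffineOpen U) (hηU : η ∈ U) :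
    letI : Algebra Γ(X, U) (X.residueField η) := (X.evaluation U η hηU).hom.toAlgebra
    IsLocalization (hU.primeIdealOf ⟨η, hηU⟩).asIdeal.primeCompl (X.residueField η) := by
  let _ : Algebra Γ(X, U) (X.residueField η) := (X.evaluation U η hηU).hom.toAlgebra
  have hloc := hU.isLocalization_stalk ⟨η, hηU⟩
  let _ := TopCat.Presheaf.algebra_section_stalk X.presheaf (⟨η, hηU⟩ : U)
  exact IsLocalization.isLocalization_of_algEquiv _ (S := X.presheaf.stalk η)
    (AlgEquiv.ofBijective (⟨(X.residue η).hom, fun _ => rfl⟩ :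
      X.presheaf.stalk η →ₐ[Γ(X, U)] X.residueField η)
      ⟨residue_injective_of_generic hη, X.residue_surjective η⟩)

/-- Around the generic point `η` of a component, a nonzero rational differential on this component
is `u dt` at each closed point, for a unit `u` and a function `t` generating the maximal ideal. -/
lemma exists_opens_forall_eq_smul_D [IsAlgClosed k] [IsReduced X] [IsNoetherian X]
    [LocallyOfFiniteType (X ↘ Spec (.of k))] {η : X} (hη : η ∈ genericPoints X)
    (hΩ : IsExactSpan k (X.residueField η)) {ω : Ω[X.residueField η⁄k]} (hω : ω ≠ 0) :
    ∃ W : X.Opens, η ∈ W ∧ (∀ x ∈ W, ∀ η' ∈ genericPoints X, η' ⤳ x → η' = η) ∧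
      ∀ x ∈ W, IsClosed {x} → ∃ t u : X.presheaf.stalk x,
        maximalIdeal (X.presheaf.stalk x) = Ideal.span {t} ∧ IsUnit u ∧
        ∀ h : η ⤳ x, ω = toBranch X h u • KaehlerDifferential.D k _ (toBranch X h t) := by
  obtain ⟨V, hV, hηV, -⟩ := exists_isAffineOpen_mem_and_subset (x := η) (U := ⊤) trivial
  let _ : Algebra Γ(X, V) (X.residueField η) := (X.evaluation V η hηV).hom.toAlgebra
  have hloc := isLocalization_evaluation hη hV hηV
  let _ : Algebra k Γ(X, V) := (structSection k X V).toAlgebra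
  have : Algebra.FiniteType k Γ(X, V) := finiteType_structSection k hV
  have : IsScalarTower k Γ(X, V) (X.residueField η) :=
    .of_algebraMap_eq fun a => (evaluation_structSection k hηV a).symm
  obtain ⟨s, h, rfl, g, hg, hgs⟩ := exists_smul_D_eq (hV.primeIdealOf ⟨η, hηV⟩).asIdeal.primeCompl
    hΩ hω
  have hprime : ∀ b ∈ (hV.primeIdealOf ⟨η, hηV⟩).asIdeal.primeCompl,
      (X.evaluation V η hηV).hom b ≠ 0 := fun b hb =>
    (IsLocalization.map_units (X.residueField η) (⟨b, hb⟩ :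
      (hV.primeIdealOf ⟨η, hηV⟩).asIdeal.primeCompl)).ne_zero
  obtain ⟨a, ⟨b, hb⟩, hab⟩ := IsLocalization.exists_mk'_eq
    (hV.primeIdealOf ⟨η, hηV⟩).asIdeal.primeCompl h
  have hab' : h * (X.evaluation V η hηV).hom b = (X.evaluation V η hηV).hom a := by
    rw [← hab]
    exact IsLocalization.mk'_spec _ _ _
  have hh0 : h ≠ 0 := by
    rintro rfl
    exact hω (zero_smul _ _)
  have ha0 : (X.evaluation V η hηV).hom a ≠ 0 := hab' ▸ mul_ne_zero hh0 (hprime b hb)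
  have hfin : (genericPoints X).Finite := genericPoints.finite
    (NoetherianSpace.finite_irreducibleComponents)
  let Z : Set X := ⋃ η' ∈ genericPoints X \ {η}, closure {η'}
  have hZ : IsClosed Z := (hfin.sdiff).isClosed_biUnion fun _ _ => isClosed_closure
  refine ⟨X.basicOpen (g * a * b) ⊓ ⟨Zᶜ, hZ.isOpen_compl⟩, ⟨?_, ?_⟩, ?_, ?_⟩
  · rw [SetLike.mem_coe, ← Scheme.evaluation_ne_zero_iff_mem_basicOpen _ _ hηV, map_mul, map_mul]
    exact mul_ne_zero (mul_ne_zero (hprime g hg) ha0) (hprime b hb)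
  · intro hη'
    obtain ⟨η', ⟨h1, h2⟩, h3⟩ := Set.mem_iUnion₂.1 hη'
    exact h2 (eq_of_specializes_of_generic hη (specializes_iff_mem_closure.2 h3))
  · intro x hx η' hη' h'
    by_contra hne
    exact hx.2 (Set.mem_iUnion₂.2 ⟨η', ⟨hη', hne⟩, specializes_iff_mem_closure.1 h'⟩)
  intro x hx hxc
  have hxV : x ∈ V := X.basicOpen_le _ hx.1
  have hunit : IsUnit ((X.presheaf.germ V x hxV).hom (g * a * b)) :=
    (X.mem_basicOpen _ x hxV).1 hx.1
  rw [map_mul, map_mul, IsUnit.mul_iff, IsUnit.mul_iff] at hunit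
  obtain ⟨⟨hug, hua⟩, hub⟩ := hunit
  have hlocx := hV.isLocalization_stalk ⟨x, hxV⟩
  let _ := TopCat.Presheaf.algebra_section_stalk X.presheaf (⟨x, hxV⟩ : V)
  obtain ⟨c, hc⟩ := maximalIdeal_eq_span_sub (X.presheaf.germ V x hxV).hom (k := k) (fun f => by
    obtain ⟨a, ha⟩ := exists_sub_mem_maximalIdeal k hxc f
    exact ⟨a, by rwa [show algebraMap k Γ(X, V) a = structSection k X V a from rfl,
      germ_structSection]⟩) (fun f => by
    obtain ⟨a, b, h⟩ := IsLocalization.exists_mk'_eq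
      (hV.primeIdealOf ⟨x, hxV⟩).asIdeal.primeCompl f
    exact ⟨a, b, IsLocalization.map_units _ b, by rw [← h]; exact IsLocalization.mk'_spec _ _ _⟩)
    hug hgs
  obtain ⟨v, hv⟩ := hub
  refine ⟨_, (X.presheaf.germ V x hxV).hom a * ↑v⁻¹, hc, hua.mul v⁻¹.isUnit, fun h' => ?_⟩
  have h1 : toBranch X h' ((X.presheaf.germ V x hxV).hom a * ↑v⁻¹) = h := by
    refine mul_right_cancel₀ (hprime b hb) ?_
    rw [hab', ← toBranch_germ hxV h', ← toBranch_germ hxV h', ← hv, ← map_mul, mul_assoc,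
      Units.inv_mul, mul_one]
  rw [h1, toBranch_germ, map_sub, map_sub]
  have h2 : (X.evaluation V η hηV).hom (algebraMap k Γ(X, V) c) =
    algebraMap k (X.residueField η) c := evaluation_structSection k hηV c
  rw [h2, Derivation.map_algebraMap, sub_zero]
  rfl

/-- A differential that is `u dt` at a closed point `x` of a single component, with `t` generating
the maximal ideal and `u` a unit, generates the dualizing sheaf at `x`. -/
lemma generatesAt_of_eq_smul_D [IsAlgClosed k] [IsReduced X] [IsNoetherian X]
    [LocallyOfFiniteType (X ↘ Spec (.of k))] {x : X} (hxc : IsClosed {x})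
    (hxg : x ∉ genericPoints X)
    (hΩ : ∀ η ∈ genericPoints X, η ⤳ x → IsExactSpan k (X.residueField η))
    {U : X.Opens} {σ : RatDiff k X U} {hx : x ∈ U} {t u : X.presheaf.stalk x}
    (ht : maximalIdeal (X.presheaf.stalk x) = Ideal.span {t}) (hu : IsUnit u)
    (hσ : ∀ η (hη : η ∈ genericPoints X) (h : η ⤳ x), σ ⟨η, hη, h.mem_open U.isOpen hx⟩ =
      toBranch X h u • KaehlerDifferential.D k _ (toBranch X h t)) : GeneratesAt 0 σ hx := by
  have hnil : ∀ n : ℕ, t ^ n ≠ 0 := by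
    intro n hn
    have ht0 : t = 0 := IsNilpotent.eq_zero ⟨n, hn⟩
    rw [ht0, Ideal.span_singleton_eq_bot.2 rfl] at ht
    refine hxg (generic_iff.2 fun y hy => ?_)
    have h1 : kerPoint hy = kerPoint (specializes_refl x) := PrimeSpectrum.ext (by
      have h2 : ∀ P : PrimeSpectrum (X.presheaf.stalk x), P.asIdeal = ⊥ := fun P =>
        le_bot_iff.1 (ht ▸ le_maximalIdeal P.isPrime.ne_top)
      rw [h2, h2])
    rw [← fromSpecStalk_kerPoint hy, h1, fromSpecStalk_kerPoint]
  obtain ⟨φ, H, hφ⟩ := exists_isFormalBranches_of_principal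
    (fun f => exists_sub_mem_maximalIdeal k hxc f) ht hnil
  refine H.generatesAt hΩ 0 fun b => ?_
  have h1 : σ.atBranch hx b = _ := hσ b.η b.generic b.specializes
  have ht1 : (H.branchMap b (toBranch X b.specializes t)).orderTop = 1 := by
    rw [H.branchMap_toBranch, show H.branchEquiv b = () from rfl, hφ]
    have := orderTop_X_pow_mul (k := k) 1 isUnit_one
    rwa [pow_one, mul_one] at this
  have hu1 : (H.branchMap b (toBranch X b.specializes u)).orderTop = 0 := by
    rw [H.branchMap_toBranch]
    have := orderTop_X_pow_mul (k := k) 0 (hu.map (φ (H.branchEquiv b)))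
    rwa [pow_zero, one_mul] at this
  unfold IsFormalBranches.expansion
  rw [h1, orderTop_expand_smul_D ht1, hu1]
  rfl

end Generic

open IsLocalRing

/-! ### Passing from stalks to open sets -/

section Gluing

variable {k : Type u} [Field k] {X : Scheme.{u}} [X.Over (Spec (.of k))]

lemma RatDiff.smul_res {U V : X.Opens} (h : V ≤ U) (g : Γ(X, U)) (σ : RatDiff k X U) :
    RatDiff.res h (g • σ) = (X.presheaf.map (homOfLE h).op).hom g • RatDiff.res h σ := by
  funext η
  have h1 : (X.evaluation U η.1 (h η.2.2)).hom g =
      (X.evaluation V η.1 η.2.2).hom ((X.presheaf.map (homOfLE h).op).hom g) := by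
    change _ = (X.presheaf.map (homOfLE h).op ≫ X.evaluation V η.1 η.2.2).hom g
    rw [Scheme.evaluation, Scheme.evaluation, X.presheaf.germ_res_assoc]
  exact congrArg (· • σ ⟨η.1, η.2.1, h η.2.2⟩) h1

lemma eq_of_evaluation_eq [IsReduced X] {U : X.Opens} {g g' : Γ(X, U)}
    (h : ∀ η : GenericIn X U,
      (X.evaluation U η.1 η.2.2).hom g = (X.evaluation U η.1 η.2.2).hom g') :
    g = g' := by
  rw [← sub_eq_zero, ← AlgebraicGeometry.basicOpen_eq_bot_iff, eq_bot_iff]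
  intro y hy
  obtain ⟨η, hη, hηy⟩ := exists_generic_specializes y
  have h1 := hηy.mem_open (X.basicOpen (g - g')).isOpen hy
  have h2 := X.basicOpen_le _ h1
  rw [SetLike.mem_coe, ← Scheme.evaluation_ne_zero_iff_mem_basicOpen _ _ h2] at h1
  refine (h1 ?_).elim
  rw [map_sub, sub_eq_zero]
  exact h ⟨η, hη, h2⟩

lemma eq_of_smul_eq [IsReduced X] {U : X.Opens} {σ : RatDiff k X U} (hσ : ∀ η, σ η ≠ 0)
    {g g' : Γ(X, U)} (h : g • σ = g' • σ) : g = g' :=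
  eq_of_evaluation_eq fun η => smul_left_injective _ (hσ η) (congrFun h η)

/-- A multiple over the stalk at `x` is a multiple in a neighbourhood of `x`. -/
lemma exists_opens_res_eq_smul (hfin : (genericPoints X).Finite) {U V : X.Opens}
    {σ : RatDiff k X U} {τ : RatDiff k X V} {x : X} (hx : x ∈ U) (hx' : x ∈ V)
    (h : ∃ f : X.presheaf.stalk x, ∀ (η : X) (hη : η ∈ genericPoints X) (h : η ⤳ x),
        τ ⟨η, hη, h.mem_open V.isOpen hx'⟩ =
          toBranch X h f • σ ⟨η, hη, h.mem_open U.isOpen hx⟩) :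
    ∃ (W : X.Opens) (hU : W ≤ U) (hV : W ≤ V) (g : Γ(X, W)), x ∈ W ∧
      τ.res hV = g • σ.res hU := by
  obtain ⟨f, hf⟩ := h
  obtain ⟨W₀, hxW₀, g, rfl⟩ := X.presheaf.exists_germ_eq f
  let Z : Set X := ⋃ η ∈ {η ∈ genericPoints X | ¬ η ⤳ x}, closure {η}
  have hZ : IsClosed Z := (hfin.subset (Set.sep_subset _ _)).isClosed_biUnion
    fun _ _ => isClosed_closure
  have hxZ : x ∉ Z := fun hx => by
    obtain ⟨η, ⟨-, h1⟩, h2⟩ := Set.mem_iUnion₂.1 hx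
    exact h1 (specializes_iff_mem_closure.2 h2)
  let W : X.Opens := W₀ ⊓ (U ⊓ (V ⊓ ⟨Zᶜ, hZ.isOpen_compl⟩))
  have hW : ∀ η ∈ genericPoints X, η ∈ W → η ⤳ x := fun η hη hηW => by
    by_contra hne
    exact hηW.2.2.2 (Set.mem_iUnion₂.2 ⟨η, ⟨hη, hne⟩, subset_closure rfl⟩)
  refine ⟨W, inf_le_right.trans inf_le_left, inf_le_right.trans (inf_le_right.trans inf_le_left),
    (X.presheaf.map (homOfLE inf_le_left).op).hom g, ⟨hxW₀, hx, hx', hxZ⟩, ?_⟩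
  funext η
  have h1 := hf η.1 η.2.1 (hW η.1 η.2.1 η.2.2)
  rw [toBranch_germ hxW₀] at h1
  refine h1.trans ?_
  have h2 : (X.evaluation W₀ η.1 η.2.2.1).hom g = (X.evaluation W η.1 η.2.2).hom
      ((X.presheaf.map (homOfLE (inf_le_left : W ≤ W₀)).op).hom g) := by
    change _ = (X.presheaf.map (homOfLE (inf_le_left : W ≤ W₀)).op ≫
      X.evaluation W η.1 η.2.2).hom g
    rw [Scheme.evaluation, Scheme.evaluation, X.presheaf.germ_res_assoc]
  exact congrArg (· • _) h2

/-- A rational differential generating the dualizing sheaf at all closed points generates it. -/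
lemma isGenerator_of_generatesAt [IsReduced X] [JacobsonSpace X] [IsNoetherian X] {U : X.Opens}
    {σ : RatDiff k X U} (hσ : ∀ η, σ η ≠ 0)
    (h : ∀ x (hx : x ∈ U), IsClosed {x} → GeneratesAt 0 σ hx) : IsGenerator σ := by
  have hfin : (genericPoints X).Finite := genericPoints.finite
    (NoetherianSpace.finite_irreducibleComponents)
  refine ⟨fun x hx hxc f hf => (h x hx hxc).1 f hf, fun V hVU τ hτ => ?_⟩
  have h1 : ∀ x : {x : X // x ∈ V ∧ IsClosed {x}}, ∃ (W : X.Opens) (hU : W ≤ U) (hV : W ≤ V)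
      (g : Γ(X, W)), x.1 ∈ W ∧ τ.res hV = g • σ.res hU := fun x =>
    exists_opens_res_eq_smul hfin (hVU x.2.1) x.2.1
      ((h x.1 (hVU x.2.1) x.2.2).2 V x.2.1 τ fun f hf => hτ x.1 x.2.1 x.2.2 f hf)
  choose W hWU hWV g hxW hg using h1
  -- a nonempty locally closed subset of a Jacobson space contains a closed point
  have hcover : V ≤ iSup W := by
    by_contra hcon
    have hne : ((V : Set X) \ (iSup W : X.Opens)).Nonempty := Set.sdiff_nonempty.2 hcon
    obtain ⟨x, hx, hxc⟩ := nonempty_inter_closedPoints hne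
      (V.isOpen.isLocallyClosed.inter (iSup W).isOpen.isClosed_compl.isLocallyClosed)
    exact hx.2 (Opens.mem_iSup.2 ⟨⟨x, hx.1, hxc⟩, hxW ⟨x, hx.1, hxc⟩⟩)
  have hres : ∀ {V' : X.Opens} (h : V' ≤ U) η, σ.res h η ≠ 0 := fun h η => hσ _
  obtain ⟨G, hG, -⟩ := X.sheaf.existsUnique_gluing' W V (fun x => homOfLE (hWV x)) hcover g
    (fun x y => by
      refine eq_of_smul_eq (k := k) (hres (inf_le_left.trans (hWU x))) ?_
      have hx := congrArg (RatDiff.res (inf_le_left : W x ⊓ W y ≤ W x)) (hg x)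
      have hy := congrArg (RatDiff.res (inf_le_right : W x ⊓ W y ≤ W y)) (hg y)
      rw [RatDiff.smul_res] at hx hy
      exact hx.symm.trans hy)
  refine ⟨G, ?_, fun G' hG' => eq_of_smul_eq (hres hVU) (hG'.symm.trans ?_)⟩
  all_goals
    funext η
    obtain ⟨x, hx⟩ := Opens.mem_iSup.1 (hcover η.2.2)
    have h2 := congrFun (hg x) ⟨η.1, η.2.1, hx⟩
    have h3 := RatDiff.smul_res (hWV x) G (σ.res hVU)
    rw [show (X.presheaf.map (homOfLE (hWV x)).op).hom G = g x from hG x] at h3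
    exact h2.trans (congrFun h3 ⟨η.1, η.2.1, hx⟩).symm

end Gluing

open IsLocalRing

/-! ### A generator at the elliptic point -/

namespace IsFormalBranches

section

variable {k : Type*} [Field k] {O : Type*} [CommRing O] [IsLocalRing O] {ι : Type*} [Finite ι]
  [IsNoetherianRing O] {c₀ : k →+* O} {φ : ι → O →+* PowerSeries k} {e : ℕ}

lemma eq_maximalIdeal_or_eq_ker (H : IsFormalBranches c₀ φ e) (P : Ideal O) [P.IsPrime] :
    P = maximalIdeal O ∨ ∃ i, P = RingHom.ker (φ i) := by
  have := Fintype.ofFinite ι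
  by_cases h : ∃ i, P ≤ RingHom.ker (φ i)
  · obtain ⟨i, hi⟩ := h
    exact Or.inr ⟨i, H.ker_eq_of_le P i hi⟩
  · left
    have h1 : ¬ (P : Set O) ⊆ ⋃ i ∈ (Finset.univ : Finset ι), (RingHom.ker (φ i) : Set O) := by
      have hp : ∀ i ∈ (Finset.univ : Finset ι), (RingHom.ker (φ i)).IsPrime := fun i _ =>
        RingHom.ker_isPrime _
      by_cases hne : (Finset.univ : Finset ι).Nonempty
      · obtain ⟨i₀, -⟩ := hne
        have h2 := Ideal.subset_union_prime (s := Finset.univ) (f := fun i => RingHom.ker (φ i))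
          (I := P) i₀ i₀ fun i hi _ _ => hp i hi
        rw [Finset.coe_univ] at h2
        simp only [Finset.mem_univ, Set.iUnion_true]
        simp only [Set.mem_univ, Set.iUnion_true] at h2
        rw [h2]
        rintro ⟨i, -, hi⟩
        exact h ⟨i, hi⟩
      · obtain ⟨i⟩ := H.exists_index
        exact (hne ⟨i, Finset.mem_univ i⟩).elim
    obtain ⟨s, hs, hs'⟩ := Set.not_subset.1 h1
    refine H.eq_maximalIdeal_of_mem (s := s) (fun i hi => hs' ?_) P hs
    exact Set.mem_iUnion₂.2 ⟨i, Finset.mem_univ i, hi⟩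

omit [IsNoetherianRing O] in
/-- Approximation of Laurent series along the branches of one component by rational functions. -/
lemma exists_le_orderTop_sub (H : IsFormalBranches c₀ φ e) {K : Type*} [Field K] [Algebra k K]
    {ρ : O →+* K} (hρ : IsComponent c₀ ρ) (n : ℕ) (y : ι → LaurentSeries k)
    (hy : ∀ i, ((-n : ℤ) : WithTop ℤ) ≤ (y i).orderTop) :
    ∃ h : K, ∀ i hi, 0 ≤ (H.lift hρ i hi h - y i).orderTop := by
  obtain ⟨w, hw⟩ := H.exists_leading (fun _ => e + n) fun _ => by omega
  have hword : ∀ i, (HahnSeries.ofPowerSeries ℤ k (φ i w)).orderTop = ((e + n : ℕ) : ℤ) := by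
    intro i
    obtain ⟨u, hu, h⟩ := hw i
    rw [h, orderTop_X_pow_mul _ hu]
  have hz : ∀ i, ∃ z : PowerSeries k, HahnSeries.ofPowerSeries ℤ k z =
      HahnSeries.ofPowerSeries ℤ k (φ i w) * y i ∧ PowerSeries.X ^ e ∣ z := by
    intro i
    have h1 : ((e : ℤ) : WithTop ℤ) ≤
        (HahnSeries.ofPowerSeries ℤ k (φ i w) * y i).orderTop := by
      rw [orderTop_mul, hword]
      calc ((e : ℤ) : WithTop ℤ) = (((e + n : ℕ) : ℤ) : WithTop ℤ) + ((-n : ℤ) : WithTop ℤ) :=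
          congrArg WithTop.some (by push_cast; ring : (e : ℤ) = ((e + n : ℕ) : ℤ) + (-n : ℤ))
        _ ≤ _ := by gcongr; exact hy i
    obtain ⟨z, hz⟩ := zero_le_orderTop_iff.1
      (le_trans (WithTop.coe_le_coe.2 (by omega : (0 : ℤ) ≤ e)) h1)
    exact ⟨z, hz, le_orderTop_coe_iff.1 (by rw [hz]; exact h1)⟩
  choose z hz hze using hz
  obtain ⟨f, hf⟩ := H.approx z hze (e + n)
  refine ⟨ρ f / ρ w, fun i hi => ?_⟩
  have hw0 : HahnSeries.ofPowerSeries ℤ k (φ i w) ≠ 0 := by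
    intro h0
    have := hword i
    rw [h0, HahnSeries.orderTop_zero] at this
    exact WithTop.top_ne_coe this
  have h1 : HahnSeries.ofPowerSeries ℤ k (φ i w) * (H.lift hρ i hi (ρ f / ρ w) - y i) =
      -HahnSeries.ofPowerSeries ℤ k (z i - φ i f) := by
    rw [map_div₀, H.lift_apply, H.lift_apply, mul_sub, mul_div_cancel₀ _ hw0, ← hz, map_sub]
    ring
  have h2 : (((e + n : ℕ) : ℤ) : WithTop ℤ) ≤ (HahnSeries.ofPowerSeries ℤ k (φ i w) *
      (H.lift hρ i hi (ρ f / ρ w) - y i)).orderTop := by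
    rw [h1, HahnSeries.orderTop_neg]
    exact le_orderTop_coe_iff.2 (hf i)
  rw [orderTop_mul, hword] at h2
  by_cases h0 : H.lift hρ i hi (ρ f / ρ w) - y i = 0
  · rw [h0]; simp
  obtain ⟨N, hN⟩ := orderTop_eq_coe h0
  rw [hN] at h2 ⊢
  have h3 : ((e + n : ℕ) : ℤ) ≤ ((e + n : ℕ) : ℤ) + N := WithTop.coe_le_coe.1 h2
  exact WithTop.coe_le_coe.2 (by omega)

end

variable {k : Type u} [Field k] {X : Scheme.{u}} [X.Over (Spec (.of k))] {x : X}
  {ι : Type*} {φ : ι → X.presheaf.stalk x →+* PowerSeries k} {e : ℕ} [Finite ι]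
  [IsNoetherianRing (X.presheaf.stalk x)]

lemma eq_or_mem_genericPoints (H : IsFormalBranches (toStalk k X x) φ e) {z : X} (h : z ⤳ x) :
    z = x ∨ z ∈ genericPoints X := by
  rcases H.eq_maximalIdeal_or_eq_ker (kerPoint h).asIdeal with h1 | ⟨i, h1⟩
  · left
    have h2 : kerPoint h = closedPoint _ := PrimeSpectrum.ext h1
    rw [← fromSpecStalk_kerPoint h, h2, Scheme.fromSpecStalk_closedPoint]
  · right
    have h2 := H.ker_mem_minimalPrimes i
    rw [← h1] at h2
    obtain ⟨η, hη, h', h3⟩ := exists_ker_toBranch_eq h2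
    rwa [eq_of_ker_toBranch_eq h h' h3.symm]

lemma notMem_genericPoints (H : IsFormalBranches (toStalk k X x) φ e) : x ∉ genericPoints X := by
  intro hx
  obtain ⟨i, hi⟩ := H.exists_ker_eq (ker_toBranch_mem_minimalPrimes hx (specializes_refl x))
  refine H.ker_ne_maximalIdeal i (hi.trans ?_)
  ext f
  change toBranch X _ f = 0 ↔ _
  have : toBranch X (specializes_refl x) = (X.residue x).hom := by
    rw [toBranch, TopCat.Presheaf.stalkSpecializes_refl, Category.id_comp]
  rw [this]
  exact IsLocalRing.residue_eq_zero_iff f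

lemma exists_branch_η_eq (H : IsFormalBranches (toStalk k X x) φ e) {η : X}
    (hη : η ∈ genericPoints X) (h : η ⤳ x) : ∃ b : Branch X x, b.η = η := by
  obtain ⟨i, hi⟩ := H.exists_ker_eq (ker_toBranch_mem_minimalPrimes hη h)
  refine ⟨H.branchEquiv.symm i, eq_of_ker_toBranch_eq (H.branchEquiv.symm i).specializes h ?_⟩
  rw [← hi, ← (H.represents_branchEquiv (H.branchEquiv.symm i)).choose, Equiv.apply_symm_apply]

lemma isExactSpan_residueField [LocallyOfFiniteType (X ↘ Spec (.of k))]
    (H : IsFormalBranches (toStalk k X x) φ e) (η : X) (hη : η ∈ genericPoints X)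
    (h : η ⤳ x) : IsExactSpan k (X.residueField η) := by
  obtain ⟨i, hi⟩ := H.exists_ker_eq (ker_toBranch_mem_minimalPrimes hη h)
  exact H.isExactSpan (isComponent_toBranch k h) i hi (isEssFinite_toStalk k x)

/-- Opens around the generic points of the components through `x` cover a punctured neighbourhood
of `x`. -/
lemma exists_opens_subset_iUnion [NoetherianSpace X] (H : IsFormalBranches (toStalk k X x) φ e)
    (hx : IsClosed {x}) (W : X → X.Opens)
    (hW : ∀ η ∈ genericPoints X, η ⤳ x → η ∈ W η) :
    ∃ U : X.Opens, x ∈ U ∧ ∀ y ∈ U, y ≠ x → ∃ η ∈ genericPoints X, η ⤳ x ∧ y ∈ W η := by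
  let V : Set X := ⋃ η ∈ {η ∈ genericPoints X | η ⤳ x}, (W η : Set X)
  have hV : IsOpen V := isOpen_biUnion fun η _ => (W η).isOpen
  obtain ⟨S, hS, hSc, hSirr, hSV⟩ :=
    NoetherianSpace.exists_finite_set_isClosed_irreducible hV.isClosed_compl
  let Z : Set X := ⋃₀ {C ∈ S | x ∉ C}
  have hZ : IsClosed Z := by
    rw [show Z = _ from Set.sUnion_eq_biUnion]
    exact (hS.subset (Set.sep_subset _ _)).isClosed_biUnion fun C hC => hSc C hC.1
  refine ⟨⟨Zᶜ, hZ.isOpen_compl⟩, fun h => ?_, fun y hy hyx => ?_⟩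
  · obtain ⟨C, ⟨-, h1⟩, h2⟩ := h
    exact h1 h2
  by_contra! hcon
  have hyV : y ∈ Vᶜ := fun h => by
    obtain ⟨η, ⟨h1, h2⟩, h3⟩ := Set.mem_iUnion₂.1 h
    exact hcon η h1 h2 h3
  rw [hSV] at hyV
  obtain ⟨C, hC, hyC⟩ := hyV
  have hxC : x ∈ C := by
    by_contra hxC
    exact hy ⟨C, ⟨hC, hxC⟩, hyC⟩
  obtain ⟨z, hz⟩ := QuasiSober.sober (hSirr C hC) (hSc C hC)
  have hzx : z ⤳ x := specializes_iff_mem_closure.2 (by rwa [hz.def])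
  have hzy : z ⤳ y := specializes_iff_mem_closure.2 (by rwa [hz.def])
  rcases H.eq_or_mem_genericPoints hzx with rfl | hzg
  · rw [specializes_iff_mem_closure, hx.closure_eq] at hzy
    exact hyx hzy
  · have hzV : z ∈ Vᶜ := by
      rw [hSV]
      exact ⟨C, hC, hz.mem⟩
    exact hzV (Set.mem_iUnion₂.2 ⟨z, ⟨hzg, hzx⟩, hW z hzg hzx⟩)

end IsFormalBranches

namespace IsElliptic

variable {k : Type u} [Field k] {X : Scheme.{u}} [X.Over (Spec (.of k))] {x : X}
  {ι : Type*} {φ : ι → X.presheaf.stalk x →+* PowerSeries k} {c : ι → k} [Fintype ι]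
  [IsNoetherianRing (X.presheaf.stalk x)]

/-- Adapted differentials exist: on each component take `g dt`, where `g` approximates suitable
Laurent series along all the branches of that component. -/
lemma exists_isAdapted (E : IsElliptic (toStalk k X x) φ c) :
    ∃ ω : ∀ η : X, Ω[X.residueField η⁄k], ∀ (U : X.Opens) (hx : x ∈ U),
      E.IsAdapted (fun η => ω η.1 : RatDiff k X U) hx := by
  classical
  set H := E.isFormalBranches with hH
  have h1 : ∀ η : X, ∃ ω : Ω[X.residueField η⁄k], ∀ (_ : η ∈ genericPoints X) (h : η ⤳ x) i hi,
      ((1 : ℤ) : WithTop ℤ) ≤ (expand (H.lift (isComponent_toBranch k h) i hi) ω -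
        HahnSeries.single (-1) (c i)).orderTop := by
    intro η
    by_cases hη : η ∈ genericPoints X ∧ η ⤳ x
    swap
    · exact ⟨0, fun h h' => (hη ⟨h, h'⟩).elim⟩
    obtain ⟨hη, h⟩ := hη
    obtain ⟨t, ht0, ht⟩ := H.exists_ratio (isComponent_toBranch k h) (fun _ => 1)
    have hθ : ∀ i hi, (theta (H.lift (isComponent_toBranch k h) i hi t)).orderTop = (1 : ℤ) :=
      fun i hi => orderTop_theta (by rw [ht i hi]; rfl)
    obtain ⟨g, hg⟩ := H.exists_le_orderTop_sub (isComponent_toBranch k h) 2 (fun i =>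
      if hi : RingHom.ker (φ i) = RingHom.ker (toBranch X h) then HahnSeries.single (-1) (c i) *
        (theta (H.lift (isComponent_toBranch k h) i hi t))⁻¹ else 0) (fun i => by
      split_ifs with hi
      · rw [orderTop_mul, HahnSeries.orderTop_single (E.c_ne i), orderTop_inv (hθ i hi)]
        exact WithTop.coe_le_coe.2 (by norm_num)
      · simp)
    refine ⟨g • KaehlerDifferential.D k _ t, fun _ _ i hi => ?_⟩
    have h2 := hg i hi
    rw [dif_pos hi] at h2
    have hne : theta (H.lift (isComponent_toBranch k h) i hi t) ≠ 0 := fun h0 => by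
      have := hθ i hi
      rw [h0, HahnSeries.orderTop_zero] at this
      exact WithTop.top_ne_coe this
    have h3 : expand (H.lift (isComponent_toBranch k h) i hi) (g • KaehlerDifferential.D k _ t) -
        HahnSeries.single (-1) (c i) = (H.lift (isComponent_toBranch k h) i hi g -
          HahnSeries.single (-1) (c i) * (theta (H.lift (isComponent_toBranch k h) i hi t))⁻¹) *
          theta (H.lift (isComponent_toBranch k h) i hi t) := by
      rw [expand_smul, expand_D, sub_mul, mul_assoc (HahnSeries.single _ _), inv_mul_cancel₀ hne,
        mul_one]
    rw [h3, orderTop_mul, hθ]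
    exact le_add_of_nonneg_left h2
  choose ω hω using h1
  refine ⟨ω, fun U hx b => ?_⟩
  have h2 := hω b.η b.generic b.specializes _ (H.represents_branchEquiv b).choose
  have h3 : ∀ n : ℤ, n < 1 → (H.expansion (fun η => ω η.1 : RatDiff k X U) hx b).coeff n =
      (HahnSeries.single (-1 : ℤ) (c (H.branchEquiv b))).coeff n := fun n hn => by
    rw [← sub_eq_zero, ← HahnSeries.coeff_sub]
    exact le_orderTop_iff.1 h2 n hn
  refine ⟨le_orderTop_iff.2 fun n hn => ?_, ?_, ?_⟩
  · rw [h3 n (by omega), HahnSeries.coeff_single_of_ne (by omega)]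
  · rw [h3 _ (by norm_num), HahnSeries.coeff_single_same]
  · rw [h3 _ (by norm_num), HahnSeries.coeff_single_of_ne (by norm_num)]

lemma IsAdapted.orderTop_eq {E : IsElliptic (toStalk k X x) φ c} {U : X.Opens} {σ : RatDiff k X U}
    {hx : x ∈ U} (hσ : E.IsAdapted σ hx) (b : Branch X x) :
    (E.isFormalBranches.expansion σ hx b).orderTop = (-1 : ℤ) := by
  refine le_antisymm ?_ (hσ b).1
  refine HahnSeries.orderTop_le_of_coeff_ne_zero ?_
  rw [(hσ b).2.1]
  exact E.c_ne _

/-- An adapted differential generates the dualizing sheaf in a neighbourhood of the elliptic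
point. -/
lemma exists_isGenerator [IsAlgClosed k] [IsReduced X] [IsNoetherian X]
    [LocallyOfFiniteType (X ↘ Spec (.of k))] (E : IsElliptic (toStalk k X x) φ c) :
    ∃ (U : X.Opens) (hx : x ∈ U) (σ : RatDiff k X U), IsGenerator σ ∧ E.IsAdapted σ hx ∧
      ∀ η, σ η ≠ 0 := by
  have H := E.isFormalBranches
  have hΩ := H.isExactSpan_residueField
  have hxc : IsClosed {x} := isClosed_singleton_of_sub_mem k fun f =>
    ⟨_, H.sub_mem H.exists_index.some f⟩
  have : JacobsonSpace X := LocallyOfFiniteType.jacobsonSpace (X ↘ Spec (.of k))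
  obtain ⟨ω, hω⟩ := E.exists_isAdapted
  have hω0 : ∀ η ∈ genericPoints X, η ⤳ x → ω η ≠ 0 := by
    intro η hη h h0
    obtain ⟨b, rfl⟩ := H.exists_branch_η_eq hη h
    have h1 := (hω ⊤ trivial).orderTop_eq b
    unfold IsFormalBranches.expansion at h1
    rw [show RatDiff.atBranch (fun η => ω η.1 : RatDiff k X ⊤) trivial b = 0 from h0, map_zero,
      HahnSeries.orderTop_zero] at h1
    exact WithTop.top_ne_coe h1
  -- around the generic points, the differential is `u dt` at every closed point
  have hchart : ∀ η : X, ∃ W : X.Opens, ∀ (_ : η ∈ genericPoints X) (_ : η ⤳ x),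
      η ∈ W ∧ (∀ x ∈ W, ∀ η' ∈ genericPoints X, η' ⤳ x → η' = η) ∧
      ∀ x ∈ W, IsClosed {x} → ∃ t u : X.presheaf.stalk x,
        maximalIdeal (X.presheaf.stalk x) = Ideal.span {t} ∧ IsUnit u ∧
        ∀ h : η ⤳ x, ω η = toBranch X h u • KaehlerDifferential.D k _ (toBranch X h t) := by
    intro η
    by_cases hη : η ∈ genericPoints X ∧ η ⤳ x
    · obtain ⟨W, hW⟩ := exists_opens_forall_eq_smul_D k hη.1 (hΩ η hη.1 hη.2) (hω0 η hη.1 hη.2)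
      exact ⟨W, fun _ _ => hW⟩
    · exact ⟨⊤, fun h h' => (hη ⟨h, h'⟩).elim⟩
  choose W hW using hchart
  obtain ⟨U, hxU, hU⟩ := H.exists_opens_subset_iUnion hxc W fun η hη h => (hW η hη h).1
  -- all the components meeting `U` pass through `x`, so `ω` vanishes on none of them
  have hgen : ∀ η ∈ genericPoints X, η ∈ U → η ⤳ x := by
    intro η hη hηU
    by_cases hne : η = x
    · rw [hne]
    obtain ⟨η', hη', h', hW'⟩ := hU η hηU hne
    rwa [(hW η' hη' h').2.1 η hW' η hη (specializes_refl η)]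
  have hσ0 : ∀ η : GenericIn X U, (fun η => ω η.1 : RatDiff k X U) η ≠ 0 := fun η =>
    hω0 η.1 η.2.1 (hgen η.1 η.2.1 η.2.2)
  refine ⟨U, hxU, fun η => ω η.1, isGenerator_of_generatesAt hσ0 fun y hy hyc => ?_,
    hω U hxU, hσ0⟩
  by_cases hyx : y = x
  · subst hyx
    exact E.generatesAt hΩ (hω U hy)
  obtain ⟨η, hη, hηx, hyW⟩ := hU y hy hyx
  obtain ⟨-, hW1, hW2⟩ := hW η hη hηx
  obtain ⟨t, u, ht, hu, htu⟩ := hW2 y hyW hyc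
  refine generatesAt_of_eq_smul_D k hyc (fun hyg => hyx ?_) (fun η' hη' h' => ?_) ht hu ?_
  · have h1 := hgen y hyg hy
    rw [specializes_iff_mem_closure, hyc.closure_eq] at h1
    exact h1.symm
  · rw [hW1 y hyW η' hη' h']
    exact hΩ η hη hηx
  · intro η' hη' h'
    obtain rfl := hW1 y hyW η' hη' h'
    exact htu h'

end IsElliptic

/-! ### Sheaves of modules -/

section Gorenstein

variable {k : Type u} [Field k] {X : Scheme.{u}} [X.Over (Spec (.of k))]

/-- Multiplication by a section `σ` of the dualizing sheaf over `U`. -/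
def mulSection {U : X.Opens} (σ : RatDiff k X U) (hσ : σ ∈ omegaSections k X 0 U) :
    SheafOfModules.unit U.toScheme.ringCatSheaf ⟶ (omega k X).restrict U.ι where
  val := PresheafOfModules.homMk
    { app V := AddCommGrpCat.ofHom (X := Γ(U, V.unop)) (Y := omegaSections k X 0 (U.ι ''ᵁ V.unop))
        { toFun := fun g => ((U.ι.appIso V.unop).inv.hom g : Γ(X, U.ι ''ᵁ V.unop)) •
            (⟨σ.res (U.ι_image_le V.unop), res_mem_omegaSections k X 0 _ hσ⟩ :
              omegaSections k X 0 (U.ι ''ᵁ V.unop))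
          map_zero' := by rw [map_zero, zero_smul]
          map_add' := fun g g' => by rw [map_add, add_smul] }
      naturality := fun V V' i => by
        ext g
        have h := congrArg (fun φ => φ.hom g) (U.ι.appIso_inv_naturality i)
        refine Subtype.ext ?_
        refine Eq.trans ?_ (RatDiff.smul_res (U.ι.image_mono i.unop.le) _ _).symm
        exact congrArg (fun a : Γ(X, U.ι ''ᵁ V'.unop) => a • σ.res (U.ι_image_le V'.unop)) h }
    fun V (r : Γ(U, V.unop)) (g : Γ(U, V.unop)) => by
      have h1 : (U.ι.appIso V.unop).inv.hom (r * g) =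
        (U.ι.appIso V.unop).inv.hom r * (U.ι.appIso V.unop).inv.hom g := map_mul _ _ _
      exact (congrArg (fun a : Γ(X, U.ι ''ᵁ V.unop) => a •
        (⟨σ.res (U.ι_image_le V.unop), res_mem_omegaSections k X 0 _ hσ⟩ :
              omegaSections k X 0 (U.ι ''ᵁ V.unop))) h1).trans (mul_smul _ _ _)

lemma isIso_mulSection {U : X.Opens} {σ : RatDiff k X U} (h : IsGenerator σ) :
    IsIso (mulSection σ h.1) := by
  refine (Scheme.Modules.Hom.isIso_iff_isIso_app (φ := mulSection σ h.1)).2 fun V => ?_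
  rw [ConcreteCategory.isIso_iff_bijective]
  have hbij : Function.Bijective (U.ι.appIso V).inv.hom :=
    (U.ι.appIso V).commRingCatIsoToRingEquiv.symm.bijective
  constructor
  · intro g g' hgg
    refine hbij.1 ?_
    have h1 : (U.ι.appIso V).inv.hom g • σ.res (U.ι_image_le V) =
        (U.ι.appIso V).inv.hom g' • σ.res (U.ι_image_le V) := congrArg Subtype.val hgg
    exact (h.2 _ (U.ι_image_le V) _ (Submodule.smul_mem _ _
      (res_mem_omegaSections k X 0 (U.ι_image_le V) h.1))).unique h1 rfl |>.symm
  · rintro ⟨τ, hτ⟩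
    obtain ⟨a, ha, -⟩ := h.2 _ (U.ι_image_le V) τ hτ
    obtain ⟨g, rfl⟩ := hbij.2 a
    exact ⟨g, Subtype.ext ha.symm⟩

lemma isGorensteinAt_of_isGenerator {U : X.Opens} {σ : RatDiff k X U} (h : IsGenerator σ) {p : X}
    (hp : p ∈ U) : IsGorensteinAt k X p :=
  have := isIso_mulSection h
  ⟨U, hp, ⟨(asIso (mulSection σ h.1)).symm⟩⟩

end Gorenstein

section Pullback

open Scheme.Modules

variable {X Y : Scheme.{u}}

/-- Restriction of sections of a sheaf of modules. -/
def resM (M : X.Modules) {U V : X.Opens} (h : V ≤ U) : Γ(M, U) →+ Γ(M, V) :=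
  (M.presheaf.map (homOfLE h).op).hom

lemma resM_resM (M : X.Modules) {U V W : X.Opens} (h : V ≤ U) (h' : W ≤ V) (s : Γ(M, U)) :
    resM M h' (resM M h s) = resM M (h'.trans h) s := by
  have := M.presheaf.map_comp (homOfLE h).op (homOfLE h').op
  exact (congrArg (fun φ => φ.hom s) this).symm

lemma resM_self (M : X.Modules) {U : X.Opens} (s : Γ(M, U)) : resM M le_rfl s = s :=
  congrArg (fun φ => φ.hom s) (M.presheaf.map_id (.op U))

lemma resM_smul (M : X.Modules) {U V : X.Opens} (h : V ≤ U) (g : Γ(X, U)) (s : Γ(M, U)) :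
    resM M h (g • s) = (X.presheaf.map (homOfLE h).op).hom g • resM M h s :=
  M.map_smul (homOfLE h) g s

lemma app_resM {M N : X.Modules} (φ : M ⟶ N) {U V : X.Opens} (h : V ≤ U) (s : Γ(M, U)) :
    (φ.app V).hom (resM M h s) = resM N h ((φ.app U).hom s) :=
  congrArg (fun ψ => ψ.hom s) (φ.mapPresheaf.naturality (homOfLE h).op)

lemma resM_ext (M : X.Modules) {U : X.Opens} {s t : Γ(M, U)}
    (h : ∀ x ∈ U, ∃ (V : X.Opens) (hV : V ≤ U), x ∈ V ∧ resM M hV s = resM M hV t) : s = t := by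
  choose V hV hx hst using h
  refine TopCat.Sheaf.eq_of_locally_eq' ⟨M.presheaf, M.isSheaf⟩ (fun x : U => V x.1 x.2) U
    (fun x => homOfLE (hV x.1 x.2)) (fun x hxU => Opens.mem_iSup.2 ⟨⟨x, hxU⟩, hx x hxU⟩) s t
    fun x => hst x.1 x.2

variable (f : Y ⟶ X) {F : X.Modules} {G : Y.Modules}

/-- The map on sections of a morphism to a direct image. -/
def appTo (θ : F ⟶ (pushforward f).obj G) (V : X.Opens) : Γ(F, V) →+ Γ(G, f ⁻¹ᵁ V) :=
  (θ.app V).hom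

lemma appTo_resM (θ : F ⟶ (pushforward f).obj G) {U V : X.Opens} (h : V ≤ U) (s : Γ(F, U)) :
    appTo f θ V (resM F h s) = resM G (f.preimage_mono h) (appTo f θ U s) :=
  app_resM θ h s

variable (θ : F ⟶ (pushforward f).obj G)

/-- If the sections of `G` are locally multiples of sections coming from `F`, and the relations
between such sections hold already in `f^* F`, then `f^* F ⟶ G` is an isomorphism. -/
lemma isIso_of_locally_smul
    (hgen : ∀ (W : Y.Opens) (τ : Γ(G, W)), ∀ y ∈ W, ∃ (V : X.Opens) (W' : Y.Opens) (h : W' ≤ W)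
      (h' : W' ≤ f ⁻¹ᵁ V) (g : Γ(Y, W')) (s : Γ(F, V)), y ∈ W' ∧
      resM G h τ = g • resM G h' (appTo f θ V s))
    (hrel : ∀ (M : Y.Modules) (ψ : F ⟶ (pushforward f).obj M) (V : X.Opens) (W : Y.Opens)
      (h : W ≤ f ⁻¹ᵁ V) (g₁ g₂ g₃ : Γ(Y, W)) (s₁ s₂ s₃ : Γ(F, V)),
      g₁ • resM G h (appTo f θ V s₁) + g₂ • resM G h (appTo f θ V s₂) =
        g₃ • resM G h (appTo f θ V s₃) → ∀ y ∈ W, ∃ (W' : Y.Opens) (h' : W' ≤ W), y ∈ W' ∧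
        resM M h' (g₁ • resM M h (appTo f ψ V s₁) + g₂ • resM M h (appTo f ψ V s₂)) =
        resM M h' (g₃ • resM M h (appTo f ψ V s₃))) :
    IsIso (((pullbackPushforwardAdjunction f).homEquiv F G).symm θ) := by
  -- relations for sections over different open sets
  have hrel3 : ∀ (M : Y.Modules) (ψ : F ⟶ (pushforward f).obj M) (V₁ V₂ V₃ : X.Opens) (W : Y.Opens)
      (h₁ : W ≤ f ⁻¹ᵁ V₁) (h₂ : W ≤ f ⁻¹ᵁ V₂) (h₃ : W ≤ f ⁻¹ᵁ V₃) (g₁ g₂ g₃ : Γ(Y, W))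
      (s₁ : Γ(F, V₁)) (s₂ : Γ(F, V₂)) (s₃ : Γ(F, V₃)),
      g₁ • resM G h₁ (appTo f θ V₁ s₁) + g₂ • resM G h₂ (appTo f θ V₂ s₂) =
        g₃ • resM G h₃ (appTo f θ V₃ s₃) →
      g₁ • resM M h₁ (appTo f ψ V₁ s₁) + g₂ • resM M h₂ (appTo f ψ V₂ s₂) =
        g₃ • resM M h₃ (appTo f ψ V₃ s₃) := by
    intro M ψ V₁ V₂ V₃ W h₁ h₂ h₃ g₁ g₂ g₃ s₁ s₂ s₃ h
    have hW : W ≤ f ⁻¹ᵁ (V₁ ⊓ (V₂ ⊓ V₃)) := le_inf h₁ (le_inf h₂ h₃)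
    have key : ∀ (N : Y.Modules) (χ : F ⟶ (pushforward f).obj N) (V : X.Opens)
        (hV : V₁ ⊓ (V₂ ⊓ V₃) ≤ V) (h' : W ≤ f ⁻¹ᵁ V) (s : Γ(F, V)),
        resM N h' (appTo f χ V s) =
          resM N hW (appTo f χ (V₁ ⊓ (V₂ ⊓ V₃)) (resM F hV s)) := by
      intro N χ V hV h' s
      rw [appTo_resM, resM_resM]
    rw [key G θ V₁ inf_le_left h₁, key G θ V₂ (inf_le_right.trans inf_le_left) h₂,
      key G θ V₃ (inf_le_right.trans inf_le_right) h₃] at h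
    rw [key M ψ V₁ inf_le_left h₁, key M ψ V₂ (inf_le_right.trans inf_le_left) h₂,
      key M ψ V₃ (inf_le_right.trans inf_le_right) h₃]
    refine resM_ext M fun y hy => ?_
    obtain ⟨W', h', hy', h''⟩ := hrel M ψ _ W hW g₁ g₂ g₃ _ _ _ h y hy
    exact ⟨W', h', hy', h''⟩
  set M := (pullback f).obj F
  let ψ : F ⟶ (pushforward f).obj M := (pullbackPushforwardAdjunction f).unit.app F
  have hrel2 : ∀ (V₁ V₂ : X.Opens) (W : Y.Opens) (h₁ : W ≤ f ⁻¹ᵁ V₁) (h₂ : W ≤ f ⁻¹ᵁ V₂)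
      (g₁ g₂ : Γ(Y, W)) (s₁ : Γ(F, V₁)) (s₂ : Γ(F, V₂)),
      g₁ • resM G h₁ (appTo f θ V₁ s₁) = g₂ • resM G h₂ (appTo f θ V₂ s₂) →
      g₁ • resM M h₁ (appTo f ψ V₁ s₁) = g₂ • resM M h₂ (appTo f ψ V₂ s₂) := by
    intro V₁ V₂ W h₁ h₂ g₁ g₂ s₁ s₂ h
    have := hrel3 M ψ V₁ V₁ V₂ W h₁ h₁ h₂ g₁ 0 g₂ s₁ s₁ s₂
    rw [zero_smul, zero_smul, add_zero, add_zero] at this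
    exact this h
  -- the inverse sends `τ` to the section `m` with `R W τ m`
  let R : ∀ W : Y.Opens, Γ(G, W) → Γ(M, W) → Prop := fun W τ m =>
    ∀ (V : X.Opens) (W' : Y.Opens) (h : W' ≤ W) (h' : W' ≤ f ⁻¹ᵁ V) (g : Γ(Y, W')) (s : Γ(F, V)),
      resM G h τ = g • resM G h' (appTo f θ V s) → resM M h m = g • resM M h' (appTo f ψ V s)
  have hR : ∀ W τ m, (∀ y ∈ W, ∃ (V : X.Opens) (W' : Y.Opens) (h : W' ≤ W) (h' : W' ≤ f ⁻¹ᵁ V)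
      (g : Γ(Y, W')) (s : Γ(F, V)), y ∈ W' ∧ resM G h τ = g • resM G h' (appTo f θ V s) ∧
      resM M h m = g • resM M h' (appTo f ψ V s)) → R W τ m := by
    intro W τ m hloc V W' h h' g s hτ
    refine resM_ext M fun y hy => ?_
    obtain ⟨V₁, W₁, h₁, h₁', g₁, s₁, hy₁, hτ₁, hm₁⟩ := hloc y (h hy)
    refine ⟨W' ⊓ W₁, inf_le_left, ⟨hy, hy₁⟩, ?_⟩
    have hτ' := congrArg (resM G (inf_le_left : W' ⊓ W₁ ≤ W')) hτ
    have hτ₁' := congrArg (resM G (inf_le_right : W' ⊓ W₁ ≤ W₁)) hτ₁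
    have hm₁' := congrArg (resM M (inf_le_right : W' ⊓ W₁ ≤ W₁)) hm₁
    rw [resM_smul, resM_resM, resM_resM] at hτ' hτ₁' hm₁'
    rw [resM_smul, resM_resM, resM_resM, hm₁']
    exact hrel2 _ _ _ _ _ _ _ _ _ (hτ₁'.symm.trans hτ')
  have huniq : ∀ W τ m m', R W τ m → R W τ m' → m = m' := by
    intro W τ m m' h h'
    refine resM_ext M fun y hy => ?_
    obtain ⟨V, W₁, h₁, h₁', g, s, hy₁, hτ⟩ := hgen W τ y hy
    exact ⟨W₁, h₁, hy₁, (h V W₁ h₁ h₁' g s hτ).trans (h' V W₁ h₁ h₁' g s hτ).symm⟩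
  have hex : ∀ W τ, ∃ m, R W τ m := by
    intro W τ
    have h1 := fun y : W => hgen W τ y.1 y.2
    choose V W₁ h₁ h₁' g s hy hτ using h1
    obtain ⟨m, hm, -⟩ := TopCat.Sheaf.existsUnique_gluing' ⟨M.presheaf, M.isSheaf⟩ W₁ W
      (fun y => homOfLE (h₁ y)) (fun y hyW => Opens.mem_iSup.2 ⟨⟨y, hyW⟩, hy ⟨y, hyW⟩⟩)
      (fun y => (g y • resM M (h₁' y) (appTo f ψ (V y) (s y)) : Γ(M, W₁ y))) (fun y z => by
        change resM M inf_le_left (g y • resM M (h₁' y) (appTo f ψ (V y) (s y))) =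
          resM M inf_le_right (g z • resM M (h₁' z) (appTo f ψ (V z) (s z)))
        have hy' := congrArg (resM G (inf_le_left : W₁ y ⊓ W₁ z ≤ W₁ y)) (hτ y)
        have hz' := congrArg (resM G (inf_le_right : W₁ y ⊓ W₁ z ≤ W₁ z)) (hτ z)
        rw [resM_smul, resM_resM, resM_resM] at hy' hz'
        rw [resM_smul, resM_resM, resM_smul, resM_resM]
        exact hrel2 _ _ _ _ _ _ _ _ _ (hy'.symm.trans hz'))
    exact ⟨m, hR W τ m fun y hyW => ⟨_, _, h₁ ⟨y, hyW⟩, h₁' ⟨y, hyW⟩, _, _, hy ⟨y, hyW⟩,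
      hτ ⟨y, hyW⟩, hm ⟨y, hyW⟩⟩⟩
  choose m hm using hex
  have hres : ∀ W W' (h : W' ≤ W) τ, resM M h (m W τ) = m W' (resM G h τ) := by
    intro W W' h τ
    refine huniq W' _ _ _ (fun V W₁ h₁ h₁' g s hτ => ?_) (hm W' _)
    rw [resM_resM] at hτ ⊢
    exact hm W τ V W₁ (h₁.trans h) h₁' g s hτ
  have hsmul : ∀ W (a : Γ(Y, W)) τ, m W (a • τ) = a • m W τ := by
    intro W a τ
    refine huniq W _ _ _ (hm W _) (hR _ _ _ fun y hy => ?_)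
    obtain ⟨V, W₁, h₁, h₁', g, s, hy₁, hτ⟩ := hgen W τ y hy
    refine ⟨V, W₁, h₁, h₁', (Y.presheaf.map (homOfLE h₁).op).hom a * g, s, hy₁, ?_, ?_⟩
    · rw [resM_smul, hτ, mul_smul]
    · rw [resM_smul, hm W τ V W₁ h₁ h₁' g s hτ, mul_smul]
  have hadd : ∀ W τ τ', m W (τ + τ') = m W τ + m W τ' := by
    intro W τ τ'
    refine resM_ext M fun y hy => ?_
    obtain ⟨V₁, W₁, h₁, h₁', g₁, s₁, hy₁, hτ₁⟩ := hgen W τ y hy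
    obtain ⟨V₂, W₂, h₂, h₂', g₂, s₂, hy₂, hτ₂⟩ := hgen W₁ (resM G h₁ τ') y hy₁
    obtain ⟨V₃, W₃, h₃, h₃', g₃, s₃, hy₃, hτ₃⟩ := hgen W₂ (resM G (h₂.trans h₁) (τ + τ')) y hy₂
    refine ⟨W₃, h₃.trans (h₂.trans h₁), hy₃, ?_⟩
    have e₁ := congrArg (resM G (h₃.trans h₂)) hτ₁
    have e₂ := congrArg (resM G h₃) hτ₂
    rw [resM_smul, resM_resM, resM_resM] at e₁
    rw [resM_resM, resM_resM, resM_smul, resM_resM] at e₂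
    rw [resM_resM] at hτ₃
    rw [map_add, hm W _ V₁ W₃ _ _ _ s₁ e₁, hm W _ V₂ W₃ _ _ _ s₂ e₂, hm W _ V₃ W₃ _ _ _ s₃ hτ₃]
    refine (hrel3 M ψ V₁ V₂ V₃ W₃ _ _ _ _ _ _ _ _ _ ?_).symm
    rw [← e₁, ← e₂, ← map_add]
    exact hτ₃
  let χ : G ⟶ M := ⟨PresheafOfModules.homMk
    { app W := AddCommGrpCat.ofHom
        { toFun := m W.unop
          map_add' := hadd W.unop
          map_zero' := by
            have := hadd W.unop 0 0
            rwa [add_zero, left_eq_add] at this }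
      naturality := fun W W' i => by
        ext τ
        exact (hres W.unop W'.unop i.unop.le τ).symm }
    fun W a τ => hsmul W.unop a τ⟩
  have hθχ : θ ≫ (pushforward f).map χ = ψ := by
    refine Scheme.Modules.hom_ext _ _ fun V => ?_
    ext s
    have h1 := hm (f ⁻¹ᵁ V) (appTo f θ V s) V (f ⁻¹ᵁ V) le_rfl le_rfl 1 s (one_smul _ _).symm
    rw [one_smul, resM_self, resM_self] at h1
    exact h1
  refine ⟨χ, ?_, ?_⟩
  · refine ((pullbackPushforwardAdjunction f).homEquiv F M).injective ?_
    rw [Adjunction.homEquiv_naturality_right, Equiv.apply_symm_apply, Adjunction.homEquiv_id]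
    exact hθχ
  · have h1 : θ ≫ (pushforward f).map
        (χ ≫ ((pullbackPushforwardAdjunction f).homEquiv F G).symm θ) = θ := by
      rw [Functor.map_comp, reassoc_of% hθχ]
      refine (Adjunction.homEquiv_unit _ _ _ _).symm.trans ?_
      rw [Equiv.apply_symm_apply]
    set ε := χ ≫ ((pullbackPushforwardAdjunction f).homEquiv F G).symm θ
    have h2 : ∀ V s, (ε.app (f ⁻¹ᵁ V)).hom (appTo f θ V s) = appTo f θ V s := fun V s =>
      congrArg (fun φ : F ⟶ (pushforward f).obj G => appTo f φ V s) h1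
    refine Scheme.Modules.hom_ext _ _ fun W => ?_
    ext τ
    change (ε.app W).hom τ = τ
    refine resM_ext G fun y hy => ?_
    obtain ⟨V, W₁, h₁, h₁', g, s, hy₁, hτ⟩ := hgen W τ y hy
    refine ⟨W₁, h₁, hy₁, ?_⟩
    rw [← app_resM, hτ]
    refine (Scheme.Modules.Hom.app_smul ε g _).trans ?_
    congr 1
    refine (app_resM ε h₁' _).trans ?_
    rw [h2]

lemma appTo_pullback_unit (V : X.Opens) (s : Γ(F, V)) :
    ((((pullbackPushforwardAdjunction f).homEquiv F G).symm θ).app (f ⁻¹ᵁ V)).hom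
      ((((pullbackPushforwardAdjunction f).unit.app F).app V).hom s) = appTo f θ V s := by
  have h := ((pullbackPushforwardAdjunction f).homEquiv F G).apply_symm_apply θ
  rw [Adjunction.homEquiv_unit] at h
  exact congrArg (fun φ : F ⟶ (pushforward f).obj G => appTo f φ V s) h

end Pullback

/-! ### Morphisms that are isomorphisms over an open set -/

section LocalIso

variable {X Y : Scheme.{u}} (f : Y ⟶ X) (V : X.Opens) [IsIso (f ∣_ V)]

lemma injOn_of_isIso_restrict {y y' : Y} (hy : f y ∈ V) (h : f y = f y') : y = y' := by
  have hy' : f y' ∈ V := h ▸ hy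
  have hinj : Function.Injective (f ∣_ V) := (f ∣_ V).homeomorph.injective
  have := @hinj ⟨y, hy⟩ ⟨y', hy'⟩ (Subtype.ext ((morphismRestrict_base_coe f V ⟨y, hy⟩).trans
    (h.trans (morphismRestrict_base_coe f V ⟨y', hy'⟩).symm)))
  exact congrArg Subtype.val this

lemma exists_map_eq_of_isIso_restrict {x : X} (hx : x ∈ V) : ∃ y, f y = x := by
  have hsurj : Function.Surjective (f ∣_ V) := (f ∣_ V).homeomorph.surjective
  obtain ⟨y, hy⟩ := hsurj ⟨x, hx⟩
  exact ⟨y.1, by rw [← morphismRestrict_base_coe, hy]⟩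

lemma isOpen_image_of_isIso_restrict {W : Set Y} (hW : IsOpen W) (hWV : W ⊆ f ⁻¹' V) :
    IsOpen (f '' W) := by
  have h : IsOpen ((f ∣_ V) '' (Subtype.val ⁻¹' W)) :=
    (f ∣_ V).homeomorph.isOpenMap _ (hW.preimage continuous_subtype_val)
  have h2 := V.isOpen.isOpenMap_subtype_val _ h
  convert h2 using 1
  ext x
  constructor
  · rintro ⟨y, hy, rfl⟩
    exact ⟨_, ⟨⟨y, hWV hy⟩, hy, rfl⟩, morphismRestrict_base_coe f V ⟨y, hWV hy⟩⟩
  · rintro ⟨_, ⟨y, hy, rfl⟩, rfl⟩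
    exact ⟨y.1, hy, (morphismRestrict_base_coe f V y).symm⟩

lemma specializes_of_isIso_restrict {y y' : Y} (hy : f y ∈ V) (h : f y' ⤳ f y) : y' ⤳ y := by
  rw [specializes_iff_forall_open]
  intro W hW hyW
  have h1 := isOpen_image_of_isIso_restrict f V (hW.inter (V.isOpen.preimage f.continuous))
    Set.inter_subset_right
  obtain ⟨z, hz, hzy⟩ := h.mem_open h1 ⟨y, ⟨hyW, hy⟩, rfl⟩
  exact injOn_of_isIso_restrict f V hz.2 hzy ▸ hz.1

lemma stalkMap_bijective_of_isIso_restrict {y : Y} (hy : f y ∈ V) :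
    Function.Bijective (f.stalkMap y).hom := by
  let y' : (f ⁻¹ᵁ V).toScheme := ⟨y, hy⟩
  have h : MorphismProperty.isomorphisms CommRingCat ((f ∣_ V).stalkMap y') :=
    inferInstanceAs (IsIso ((f ∣_ V).stalkMap y'))
  have h' : IsIso (f.stalkMap y) :=
    (MorphismProperty.arrow_mk_iso_iff (MorphismProperty.isomorphisms CommRingCat)
      (morphismRestrictStalkMap f V y')).1 h
  exact (ConcreteCategory.isIso_iff_bijective _).1 h'

lemma residueFieldMap_bijective_of_isIso_restrict {y : Y} (hy : f y ∈ V) :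
    Function.Bijective (f.residueFieldMap y).hom := by
  refine ⟨(f.residueFieldMap y).hom.injective, fun z => ?_⟩
  obtain ⟨a, rfl⟩ := Y.residue_surjective y z
  obtain ⟨b, rfl⟩ := (stalkMap_bijective_of_isIso_restrict f V hy).2 a
  exact ⟨X.residue (f y) b, congrArg (fun g => g.hom b) (Scheme.residue_residueFieldMap f y)⟩

lemma app_bijective_of_isIso_restrict {W : X.Opens} (hW : W ≤ V) :
    Function.Bijective (f.app W).hom := by
  have h := morphismRestrict_app f V (V.ι ⁻¹ᵁ W)
  have h1 : IsIso (f.app (V.ι ''ᵁ (V.ι ⁻¹ᵁ W))) := by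
    have : IsIso (f.app (V.ι ''ᵁ (V.ι ⁻¹ᵁ W)) ≫
        Y.presheaf.map (eqToHom (image_morphismRestrict_preimage f V (V.ι ⁻¹ᵁ W))).op) :=
      h ▸ inferInstanceAs (IsIso ((f ∣_ V).app (V.ι ⁻¹ᵁ W)))
    exact IsIso.of_isIso_comp_right _
      (Y.presheaf.map (eqToHom (image_morphismRestrict_preimage f V (V.ι ⁻¹ᵁ W))).op)
  have h2 : V.ι ''ᵁ (V.ι ⁻¹ᵁ W) = W := by
    rw [Scheme.Hom.image_preimage_eq_opensRange_inf, Scheme.Opens.opensRange_ι]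
    exact inf_eq_right.2 hW
  rw [h2] at h1
  exact (ConcreteCategory.isIso_iff_bijective _).1 h1

end LocalIso

/-! ### The normalization at a point -/

/-- The properties of the normalization `π : Y ⟶ X` of a reduced scheme at `p` that determine it:
`Y` is integral over `X`, agrees with `X` away from `p`, and contains every function on a punctured
neighbourhood of `p` which is integral over `𝒪_X`. -/
structure IsNormalizationAt {X Y : Scheme.{u}} (π : Y ⟶ X) (p : X) : Prop where
  isIntegralHom : IsIntegralHom π
  isReduced : IsReduced Y
  isIso_restrict : IsIso (π ∣_ complement X p)
  dense : Dense (π ⁻¹' (complement X p : Set X))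
  exists_extension : ∀ U : X.Opens, IsAffineOpen U → ∀ x : Γ(X, U ⊓ complement X p),
    (X.presheaf.map (homOfLE (inf_le_left : U ⊓ complement X p ≤ U)).op).hom.IsIntegralElem x →
    ∃ b : Γ(Y, π ⁻¹ᵁ U),
      (Y.presheaf.map (homOfLE (π.preimage_mono (inf_le_left : U ⊓ complement X p ≤ U))).op).hom b =
        (π.app _).hom x

section

variable {X : Scheme.{u}} (V : X.Opens) [QuasiCompact V.ι]

lemma isIso_fromNormalization_restrict : IsIso (V.ι.fromNormalization ∣_ V) := by
  have key : ∀ W : X.Opens, IsAffineOpen W → W ≤ V → IsIso (V.ι.fromNormalization ∣_ W) := by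
    intro W hW hWV
    rw [isIso_morphismRestrict_iff_isIso_app _ hW, Scheme.Hom.fromNormalization_app _ hW]
    let := (V.ι.app W).hom.toAlgebra
    have h1 : IsIso (V.ι.app W) := Scheme.Hom.isIso_app _ _ (by simpa using hWV)
    have h2 : Function.Bijective (algebraMap Γ(X, W) Γ(V, V.ι ⁻¹ᵁ W)) :=
      (ConcreteCategory.isIso_iff_bijective _).1 h1
    have h3 : IsIso (CommRingCat.ofHom
        (algebraMap Γ(X, W) (integralClosure Γ(X, W) Γ(V, V.ι ⁻¹ᵁ W)))) := by
      rw [ConcreteCategory.isIso_iff_bijective]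
      refine ⟨fun a b h => h2.1 (congrArg Subtype.val h), fun b => ?_⟩
      obtain ⟨a, ha⟩ := h2.2 b.1
      exact ⟨a, Subtype.ext ha⟩
    exact IsIso.comp_isIso
  refine (IsZariskiLocalAtTarget.iff_of_iSup_eq_top (P := .isomorphisms Scheme)
    (fun W : V.toScheme.affineOpens => (W : V.toScheme.Opens))
    (iSup_affineOpens_eq_top _)).2 fun W => ?_
  have h := key (V.ι ''ᵁ W.1) (W.2.image_of_isOpenImmersion V.ι) (V.ι_image_le W.1)
  have h' : MorphismProperty.isomorphisms _ (V.ι.fromNormalization ∣_ (V.ι ''ᵁ W.1)) := h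
  exact (MorphismProperty.arrow_mk_iso_iff _
    (morphismRestrictRestrict V.ι.fromNormalization V W.1)).2 h'

lemma toNormalization_preimage_ι (U : X.Opens) :
    V.ι.toNormalization ⁻¹ᵁ (V.ι.fromNormalization ⁻¹ᵁ U) = V.ι ⁻¹ᵁ U := by
  rw [← Scheme.Hom.comp_preimage, Scheme.Hom.toNormalization_fromNormalization]

lemma exists_extension_fromNormalization {U : X.Opens} (hU : IsAffineOpen U) {x : Γ(X, U ⊓ V)}
    (hx : (X.presheaf.map (homOfLE (inf_le_left : U ⊓ V ≤ U)).op).hom.IsIntegralElem x) :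
    ∃ b : Γ(V.ι.normalization, V.ι.fromNormalization ⁻¹ᵁ U),
      (V.ι.normalization.presheaf.map (homOfLE (V.ι.fromNormalization.preimage_mono
        (inf_le_left : U ⊓ V ≤ U))).op).hom b = (V.ι.fromNormalization.app _).hom x := by
  have := isIso_fromNormalization_restrict V
  let := (V.ι.app U).hom.toAlgebra
  have hle : V.ι ⁻¹ᵁ U ≤ V.ι ⁻¹ᵁ (U ⊓ V) := fun y hy => ⟨hy, y.2⟩
  let s : Γ(V, V.ι ⁻¹ᵁ U) := (V.ι.appLE (U ⊓ V) (V.ι ⁻¹ᵁ U) hle).hom x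
  have hs : IsIntegral Γ(X, U) s := by
    have h1 : (V.ι.app U).hom = (V.ι.appLE (U ⊓ V) (V.ι ⁻¹ᵁ U) hle).hom.comp
        (X.presheaf.map (homOfLE (inf_le_left : U ⊓ V ≤ U)).op).hom := by
      rw [← CommRingCat.hom_comp, Scheme.Hom.map_appLE, Scheme.Hom.app_eq_appLE]
    change (V.ι.app U).hom.IsIntegralElem s
    rw [h1]
    obtain ⟨P, hP, hx⟩ := hx
    exact ⟨P, hP, by rw [← Polynomial.hom_eval₂, hx, map_zero]⟩
  let c : integralClosure Γ(X, U) Γ(V, V.ι ⁻¹ᵁ U) := ⟨s, hs⟩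
  refine ⟨(V.ι.normalizationObjIso hU).inv.hom c, ?_⟩
  let π := V.ι.fromNormalization
  let j := V.ι.toNormalization
  have hj1 : V.ι ⁻¹ᵁ U ≤ j ⁻¹ᵁ (π ⁻¹ᵁ (U ⊓ V)) := by
    rw [toNormalization_preimage_ι]; exact hle
  have hj2 : V.ι ⁻¹ᵁ U ≤ j ⁻¹ᵁ (π ⁻¹ᵁ U) := by rw [toNormalization_preimage_ι]
  have hcomp : π.app (U ⊓ V) ≫ j.appLE _ _ hj1 = V.ι.appLE (U ⊓ V) (V.ι ⁻¹ᵁ U) hle := by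
    rw [Scheme.Hom.app_eq_appLE, Scheme.Hom.appLE_comp_appLE]
    congr 1
    exact V.ι.toNormalization_fromNormalization
  have hιbij : Function.Bijective (V.ι.appLE (U ⊓ V) (V.ι ⁻¹ᵁ U) hle).hom := by
    have h2 : IsIso (V.ι.app (U ⊓ V)) := Scheme.Hom.isIso_app _ _ (by simp)
    have h3 : V.ι ⁻¹ᵁ U = V.ι ⁻¹ᵁ (U ⊓ V) := le_antisymm hle fun y hy => hy.1
    have h4 : IsIso (V.ι.appLE (U ⊓ V) (V.ι ⁻¹ᵁ U) hle) := by
      rw [Scheme.Hom.appLE]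
      have : IsIso (V.toScheme.presheaf.map (homOfLE hle).op) := by
        rw [show homOfLE hle = eqToHom h3 from rfl, eqToHom_op]
        infer_instance
      infer_instance
    exact (ConcreteCategory.isIso_iff_bijective _).1 h4
  have hπbij : Function.Bijective (π.app (U ⊓ V)).hom :=
    app_bijective_of_isIso_restrict π V inf_le_right
  have hjinj : Function.Injective (j.appLE _ _ hj1).hom := by
    have h5 : (j.appLE _ _ hj1).hom ∘ (π.app (U ⊓ V)).hom =
        (V.ι.appLE (U ⊓ V) (V.ι ⁻¹ᵁ U) hle).hom :=
      congrArg (fun g => (g.hom : _ → _)) hcomp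
    intro a b hab
    obtain ⟨a, rfl⟩ := hπbij.2 a
    obtain ⟨b, rfl⟩ := hπbij.2 b
    rw [hιbij.1 ((congrFun h5 a).symm.trans (hab.trans (congrFun h5 b)))]
  refine hjinj ?_
  have e1 := congrArg (fun g => g.hom ((V.ι.normalizationObjIso hU).inv.hom c))
    (V.ι.normalizationObjIso_hom_val hU)
  have e2 : (V.ι.normalizationObjIso hU).hom.hom ((V.ι.normalizationObjIso hU).inv.hom c) = c :=
    congrArg (fun g => g.hom c) (V.ι.normalizationObjIso hU).inv_hom_id
  have e3 := congrArg (fun g => g.hom ((V.ι.normalizationObjIso hU).inv.hom c))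
    (Scheme.Hom.map_appLE j hj1 (homOfLE (π.preimage_mono (inf_le_left : U ⊓ V ≤ U))).op)
  have e4 := congrArg (fun g => g.hom x) hcomp
  refine e3.trans (Eq.trans (e1.symm.trans ?_) e4.symm)
  exact congrArg Subtype.val e2

lemma isNormalizationAt_fromNormalization [IsReduced X] (p : X) [QuasiCompact (complement X p).ι] :
    IsNormalizationAt (complement X p).ι.fromNormalization p where
  isIntegralHom := inferInstance
  isReduced := inferInstance
  isIso_restrict := isIso_fromNormalization_restrict _
  dense := by
    refine (complement X p).ι.toNormalization.denseRange.mono ?_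
    rintro _ ⟨y, rfl⟩
    change (complement X p).ι.fromNormalization ((complement X p).ι.toNormalization y) ∈
      complement X p
    rw [← Scheme.Hom.comp_apply, Scheme.Hom.toNormalization_fromNormalization]
    exact y.2
  exists_extension _ hU _ hx := exists_extension_fromNormalization _ hU hx

end

lemma isNormalizationAt_normalizationMap (k : Type u) [Field k] (C : Scheme.{u})
    [C.Over (Spec (.of k))] [IsCurve k C] (p : C) :
    IsNormalizationAt (normalizationMap k C p) p :=
  have := quasiCompact_complement_ι k C p
  have := IsCurve.isReduced (k := k) (C := C)
  isNormalizationAt_fromNormalization p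

/-! ### Pullback of differentials along local isomorphisms -/

lemma toBranch_stalkMap {X Y : Scheme.{u}} (f : Y ⟶ X) {y η : Y} (h : η ⤳ y)
    (a : X.presheaf.stalk (f y)) : toBranch Y h ((f.stalkMap y).hom a) =
      (f.residueFieldMap η).hom (toBranch X (h.map f.continuous) a) := by
  have h1 := Scheme.Hom.stalkSpecializes_stalkMap f η y h
  have h2 := Scheme.residue_residueFieldMap f η
  have h3 : f.stalkMap y ≫ Y.presheaf.stalkSpecializes h ≫ Y.residue η =
      (X.presheaf.stalkSpecializes (h.map f.continuous) ≫ X.residue (f η)) ≫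
        f.residueFieldMap η := by
    rw [Category.assoc, h2, ← Category.assoc, ← Category.assoc, h1]
  exact congrArg (fun g => g.hom a) h3

section Pullback

variable (k : Type u) [Field k] {X Y : Scheme.{u}} [X.Over (Spec (.of k))] [Y.Over (Spec (.of k))]
  (f : Y ⟶ X) [f.IsOver (Spec (.of k))]

/-- The map of residue fields `κ(f(y)) → κ(y)` as a map of `k`-algebras. -/
def residueAlgHom (y : Y) : X.residueField (f y) →ₐ[k] Y.residueField y :=
  { (f.residueFieldMap y).hom with commutes' := residueFieldMap_algebraMap k f y }

lemma kaehlerPullback_smul (y : Y) (a : X.residueField (f y)) (ω : Ω[X.residueField (f y)⁄k]) :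
    kaehlerPullback k f y (a • ω) = residueAlgHom k f y a • kaehlerPullback k f y ω := by
  let : Algebra (X.residueField (f y)) (Y.residueField y) := (f.residueFieldMap y).hom.toAlgebra
  have : IsScalarTower k (X.residueField (f y)) (Y.residueField y) :=
    .of_algebraMap_eq fun a => (residueFieldMap_algebraMap k f y a).symm
  refine (map_smul (KaehlerDifferential.map k k (X.residueField (f y)) (Y.residueField y)) a
    ω).trans ?_
  exact algebraMap_smul (Y.residueField y) a _ |>.symm

lemma kaehlerPullback_D (y : Y) (a : X.residueField (f y)) :
    kaehlerPullback k f y (KaehlerDifferential.D k _ a) =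
      KaehlerDifferential.D k _ (residueAlgHom k f y a) := by
  let : Algebra (X.residueField (f y)) (Y.residueField y) := (f.residueFieldMap y).hom.toAlgebra
  have : IsScalarTower k (X.residueField (f y)) (Y.residueField y) :=
    .of_algebraMap_eq fun a => (residueFieldMap_algebraMap k f y a).symm
  exact KaehlerDifferential.map_D k k _ _ a

lemma kaehlerPullback_algebraMap_smul (y : Y) (a : k) (ω : Ω[X.residueField (f y)⁄k]) :
    kaehlerPullback k f y (a • ω) = a • kaehlerPullback k f y ω := by
  rw [← algebraMap_smul (X.residueField (f y)) a ω, kaehlerPullback_smul, AlgHom.commutes,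
    algebraMap_smul]

lemma kaehlerPullback_bijective {y : Y} (h : Function.Bijective (f.residueFieldMap y).hom) :
    Function.Bijective (kaehlerPullback k f y) := by
  let e : X.residueField (f y) ≃ₐ[k] Y.residueField y :=
    AlgEquiv.ofBijective (residueAlgHom k f y) h
  let : Algebra (Y.residueField y) (X.residueField (f y)) := (e.symm : _ →+* _).toAlgebra
  have : IsScalarTower k (Y.residueField y) (X.residueField (f y)) :=
    .of_algebraMap_eq fun a => (e.symm.commutes a).symm
  let g := KaehlerDifferential.map k k (Y.residueField y) (X.residueField (f y))
  have hg : ∀ (a : Y.residueField y) (ω : Ω[Y.residueField y⁄k]), g (a • ω) = e.symm a • g ω :=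
    fun a ω => (map_smul g a ω).trans (algebraMap_smul (X.residueField (f y)) a _).symm
  have hgD : ∀ a, g (KaehlerDifferential.D k _ a) = KaehlerDifferential.D k _ (e.symm a) := fun a =>
    KaehlerDifferential.map_D k k _ _ a
  refine Function.bijective_iff_has_inverse.2 ⟨g, fun ω => ?_, fun ω => ?_⟩
  · have hω : ω ∈ Submodule.span (X.residueField (f y))
        (Set.range (KaehlerDifferential.D k _)) := by
      rw [KaehlerDifferential.span_range_derivation]; trivial
    induction hω using Submodule.span_induction with
    | mem ω h =>
      obtain ⟨a, rfl⟩ := h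
      rw [kaehlerPullback_D, hgD]
      exact congrArg _ (e.symm_apply_apply a)
    | zero => rw [map_zero, map_zero]
    | add a b _ _ ha hb => rw [map_add, map_add, ha, hb]
    | smul a ω _ h =>
      rw [kaehlerPullback_smul, hg, h]
      exact congrArg (· • ω) (e.symm_apply_apply a)
  · have hω : ω ∈ Submodule.span (Y.residueField y) (Set.range (KaehlerDifferential.D k _)) := by
      rw [KaehlerDifferential.span_range_derivation]; trivial
    induction hω using Submodule.span_induction with
    | mem ω h =>
      obtain ⟨a, rfl⟩ := h
      rw [hgD, kaehlerPullback_D]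
      exact congrArg _ (e.apply_symm_apply a)
    | zero => rw [map_zero, map_zero]
    | add a b _ _ ha hb => rw [map_add, map_add, ha, hb]
    | smul a ω _ h =>
      rw [hg, kaehlerPullback_smul, h]
      exact congrArg (· • ω) (e.apply_symm_apply a)

lemma isExactSpan_of_residueFieldMap {y : Y} (h : Function.Bijective (f.residueFieldMap y).hom)
    (hΩ : IsExactSpan k (X.residueField (f y))) : IsExactSpan k (Y.residueField y) := by
  obtain ⟨s, hs⟩ := hΩ
  refine ⟨residueAlgHom k f y s, fun ω => ?_⟩
  obtain ⟨ω, rfl⟩ := (kaehlerPullback_bijective k f h).2 ω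
  obtain ⟨a, rfl⟩ := hs ω
  exact ⟨residueAlgHom k f y a, by rw [kaehlerPullback_smul, kaehlerPullback_D]⟩

/-- Expansions are compatible with pullback. -/
lemma expand_kaehlerPullback (y : Y) (Φ : Y.residueField y →ₐ[k] LaurentSeries k)
    (Ψ : X.residueField (f y) →ₐ[k] LaurentSeries k) (h : ∀ a, Φ (residueAlgHom k f y a) = Ψ a)
    (ω : Ω[X.residueField (f y)⁄k]) :
    expand Φ (kaehlerPullback k f y ω) = expand Ψ ω := by
  have hω : ω ∈ Submodule.span (X.residueField (f y)) (Set.range (KaehlerDifferential.D k _)) := by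
    rw [KaehlerDifferential.span_range_derivation]; trivial
  induction hω using Submodule.span_induction with
  | mem ω h' =>
    obtain ⟨a, rfl⟩ := h'
    rw [kaehlerPullback_D, expand_D, expand_D, h]
  | zero => rw [map_zero, map_zero, map_zero]
  | add a b _ _ ha hb => rw [map_add, map_add, map_add, ha, hb]
  | smul a ω _ h' => rw [kaehlerPullback_smul, expand_smul, expand_smul, h', h]

end Pullback

section

variable {X Y : Scheme.{u}} (f : Y ⟶ X) (V : X.Opens) [IsIso (f ∣_ V)]

lemma generic_iff_of_isIso_restrict {y : Y} (hy : f y ∈ V) :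
    y ∈ genericPoints Y ↔ f y ∈ genericPoints X := by
  rw [generic_iff, generic_iff]
  constructor
  · intro h x hx
    obtain ⟨z, rfl⟩ := exists_map_eq_of_isIso_restrict f V (hx.mem_open V.isOpen hy)
    rw [h z (specializes_of_isIso_restrict f V hy hx)]
  · intro h z hz
    exact injOn_of_isIso_restrict f V ((hz.map f.continuous).mem_open V.isOpen hy)
      (h _ (hz.map f.continuous))

lemma mem_nonunits_comap {K L : Type*} [Field K] [Field L] (A : ValuationSubring L) (r : K →+* L)
    (x : K) : x ∈ (A.comap r).nonunits ↔ r x ∈ A.nonunits := by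
  rw [ValuationSubring.mem_nonunits_iff_or, ValuationSubring.mem_nonunits_iff_or,
    ValuationSubring.mem_comap, map_inv₀, map_eq_zero]

/-- The image of a branch under a local isomorphism. -/
def mapBranch {y : Y} (hy : f y ∈ V) (b : Branch Y y) : Branch X (f y) where
  η := f b.η
  generic := (generic_iff_of_isIso_restrict f V
    ((b.specializes.map f.continuous).mem_open V.isOpen hy)).1 b.generic
  specializes := b.specializes.map f.continuous
  ring := b.ring.comap (f.residueFieldMap b.η).hom
  le a := by
    rw [ValuationSubring.mem_comap, ← toBranch_stalkMap]
    exact b.le _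
  dominates a ha := by
    rw [mem_nonunits_comap, ← toBranch_stalkMap]
    refine b.dominates _ fun hu => ha ?_
    exact (isUnit_map_iff (f.stalkMap y).hom a).1 hu

lemma mapBranch_bijective {y : Y} (hy : f y ∈ V) : Function.Bijective (mapBranch f V hy) := by
  constructor
  · rintro ⟨η, h1, h2, R, h3, h4⟩ ⟨η', h1', h2', R', h3', h4'⟩ h
    have hη : η = η' := injOn_of_isIso_restrict f V
      ((h2.map f.continuous).mem_open V.isOpen hy) (congrArg Branch.η h)
    subst hη
    have hR : R.comap (f.residueFieldMap η).hom = R'.comap (f.residueFieldMap η).hom := by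
      injection h with _ h
    have : R = R' := by
      ext x
      obtain ⟨a, rfl⟩ := (residueFieldMap_bijective_of_isIso_restrict f V
        ((h2.map f.continuous).mem_open V.isOpen hy)).2 x
      rw [← ValuationSubring.mem_comap, hR, ValuationSubring.mem_comap]
    subst this
    rfl
  · rintro ⟨ξ, h1, h2, R, h3, h4⟩
    have hξ := h2.mem_open V.isOpen hy
    obtain ⟨η, rfl⟩ := exists_map_eq_of_isIso_restrict f V hξ
    have h2' := specializes_of_isIso_restrict f V hy h2
    let e := RingEquiv.ofBijective (f.residueFieldMap η).hom
      (residueFieldMap_bijective_of_isIso_restrict f V hξ)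
    have key : ∀ a : Y.presheaf.stalk y, ∃ a', (f.stalkMap y).hom a' = a ∧
        e.symm (toBranch Y h2' a) = toBranch X h2 a' := by
      intro a
      obtain ⟨a, rfl⟩ := (stalkMap_bijective_of_isIso_restrict f V hy).2 a
      refine ⟨a, rfl, ?_⟩
      rw [toBranch_stalkMap]
      exact e.symm_apply_apply (toBranch X h2 a)
    refine ⟨⟨η, (generic_iff_of_isIso_restrict f V hξ).2 h1, h2', R.comap (e.symm : _ →+* _),
      fun a => ?_, fun a ha => ?_⟩, ?_⟩
    · obtain ⟨a, rfl, h⟩ := key a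
      rw [ValuationSubring.mem_comap]
      exact h ▸ h3 a
    · obtain ⟨a, rfl, h⟩ := key a
      rw [mem_nonunits_comap]
      refine h ▸ h4 a fun hu => ?_
      exact ha (hu.map _)
    · have : (R.comap (e.symm : _ →+* _)).comap (f.residueFieldMap η).hom = R := by
        ext x
        rw [ValuationSubring.mem_comap, ValuationSubring.mem_comap]
        exact iff_of_eq (congrArg (· ∈ R) (e.symm_apply_apply x))
      simp only [mapBranch, this]

end

lemma maximalIdeal_eq_span_iff {K : Type*} [Field K] (A : ValuationSubring K) (t : A) :
    IsLocalRing.maximalIdeal A = Ideal.span {t} ↔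
      ∀ x : K, x ∈ A.nonunits ↔ ∃ y ∈ A, x = y * t := by
  constructor
  · intro h x
    constructor
    · intro hx
      have hxA : x ∈ A := ValuationSubring.nonunits_le hx
      have h1 : (⟨x, hxA⟩ : A) ∈ IsLocalRing.maximalIdeal A :=
        ValuationSubring.coe_mem_nonunits_iff.1 hx
      rw [h, Ideal.mem_span_singleton'] at h1
      obtain ⟨y, hy⟩ := h1
      exact ⟨y, y.2, (congrArg Subtype.val hy).symm⟩
    · rintro ⟨y, hy, rfl⟩
      have h1 : (⟨y, hy⟩ * t : A) ∈ IsLocalRing.maximalIdeal A := by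
        rw [h, Ideal.mem_span_singleton']
        exact ⟨_, rfl⟩
      exact ValuationSubring.coe_mem_nonunits_iff.2 h1
  · intro h
    ext x
    rw [← ValuationSubring.coe_mem_nonunits_iff, h, Ideal.mem_span_singleton']
    exact ⟨fun ⟨y, hy, hxy⟩ => ⟨⟨y, hy⟩, Subtype.ext hxy.symm⟩,
      fun ⟨y, hy⟩ => ⟨y, y.2, (congrArg Subtype.val hy).symm⟩⟩

/-- Residues are transported by isomorphisms of function fields. -/
lemma isResidue_iff_of_equiv {k K L : Type u} [Field k] [Field K] [Field L] [Algebra k K]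
    [Algebra k L] (r : K →ₐ[k] L) (hr : Function.Bijective r) (A : ValuationSubring L)
    (g : Ω[K⁄k] →+ Ω[L⁄k]) (hg : ∀ a ω, g (a • ω) = r a • g ω)
    (hgD : ∀ a, g (KaehlerDifferential.D k K a) = KaehlerDifferential.D k L (r a))
    (ρ : Ω[L⁄k] →ₗ[k] k) (ρ' : Ω[K⁄k] →ₗ[k] k) (h : ∀ ω, ρ (g ω) = ρ' ω) :
    IsResidue A ρ ↔ IsResidue (A.comap (r : K →+* L)) ρ' := by
  have hmax : ∀ (t : K) (ht : t ∈ A.comap (r : K →+* L)),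
      IsLocalRing.maximalIdeal A = Ideal.span {⟨r t, ht⟩} ↔
      IsLocalRing.maximalIdeal (A.comap (r : K →+* L)) = Ideal.span {⟨t, ht⟩} := by
    intro t ht
    rw [maximalIdeal_eq_span_iff, maximalIdeal_eq_span_iff, hr.2.forall]
    refine forall_congr' fun x => ?_
    rw [mem_nonunits_comap]
    refine iff_congr Iff.rfl ?_
    rw [hr.2.exists]
    refine exists_congr fun y => and_congr Iff.rfl ?_
    rw [← map_mul]
    exact hr.1.eq_iff
  have hrest : ∀ t : K, ((∀ h ∈ A, ρ (h • KaehlerDifferential.D k L (r t)) = 0) ∧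
      ρ ((r t)⁻¹ • KaehlerDifferential.D k L (r t)) = 1 ∧
      ∀ n : ℕ, 2 ≤ n → ρ (((r t)⁻¹) ^ n • KaehlerDifferential.D k L (r t)) = 0) ↔
      ((∀ h ∈ A.comap (r : K →+* L), ρ' (h • KaehlerDifferential.D k K t) = 0) ∧
      ρ' (t⁻¹ • KaehlerDifferential.D k K t) = 1 ∧
      ∀ n : ℕ, 2 ≤ n → ρ' ((t⁻¹) ^ n • KaehlerDifferential.D k K t) = 0) := by
    intro t
    have h1 : ∀ a, ρ' (a • KaehlerDifferential.D k K t) =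
        ρ (r a • KaehlerDifferential.D k L (r t)) := fun a => by rw [← h, hg, hgD]
    simp only [h1, map_inv₀, map_pow]
    rw [hr.2.forall]
    rfl
  constructor
  · rintro ⟨⟨t, ht⟩, h1, h2⟩
    obtain ⟨t, rfl⟩ := hr.2 t
    exact ⟨⟨t, ht⟩, (hmax t ht).1 h1, (hrest t).1 h2⟩
  · rintro ⟨⟨t, ht⟩, h1, h2⟩
    exact ⟨⟨r t, ht⟩, (hmax t ht).2 h1, (hrest t).2 h2⟩

section

variable (k : Type u) [Field k] {X Y : Scheme.{u}} [X.Over (Spec (.of k))] [Y.Over (Spec (.of k))]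
  (f : Y ⟶ X) [f.IsOver (Spec (.of k))] (V : X.Opens) [IsIso (f ∣_ V)]

lemma pullbackRatDiff_apply {U : X.Opens} (ω : RatDiff k X U) (η : GenericIn Y (f ⁻¹ᵁ U))
    (h : f η.1 ∈ genericPoints X) : pullbackRatDiff k f ω η =
      kaehlerPullback k f η.1 (ω ⟨f η.1, h, η.2.2⟩) := dif_pos h

/-- The residue condition is invariant under local isomorphisms. -/
lemma residueSumVanishes_pullback_iff {U : X.Opens} (ω : RatDiff k X U) {W : Y.Opens}
    (τ : RatDiff k Y W) {y : Y} (hyU : f y ∈ U) (hyW : y ∈ W) (hy : f y ∈ V)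
    (hτ : ∀ b : Branch Y y, τ.atBranch hyW b =
      kaehlerPullback k f b.η (ω.atBranch hyU (mapBranch f V hy b)))
    (a : X.presheaf.stalk (f y)) :
    ResidueSumVanishes τ hyW ((f.stalkMap y).hom a) ↔ ResidueSumVanishes ω hyU a := by
  have hη : ∀ b : Branch Y y, f b.η ∈ V := fun b =>
    (b.specializes.map f.continuous).mem_open V.isOpen hy
  have hbij : ∀ b : Branch Y y, Function.Bijective (f.residueFieldMap b.η).hom := fun b =>
    residueFieldMap_bijective_of_isIso_restrict f V (hη b)
  have hterm : ∀ b : Branch Y y, toBranch Y b.specializes ((f.stalkMap y).hom a) •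
      τ.atBranch hyW b = kaehlerPullback k f b.η
        (toBranch X (mapBranch f V hy b).specializes a • ω.atBranch hyU (mapBranch f V hy b)) := by
    intro b
    rw [toBranch_stalkMap, hτ]
    exact (kaehlerPullback_smul k f b.η _ _).symm
  let kp : ∀ b : Branch Y y, Ω[X.residueField (f b.η)⁄k] ≃ₗ[k] Ω[Y.residueField b.η⁄k] := fun b =>
    LinearEquiv.ofBijective
      { toFun := kaehlerPullback k f b.η
        map_add' := map_add _
        map_smul' := kaehlerPullback_algebraMap_smul k f b.η }
      (kaehlerPullback_bijective k f (hbij b))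
  have hres : ∀ (b : Branch Y y) (ρ : Ω[Y.residueField b.η⁄k] →ₗ[k] k)
      (ρ' : Ω[X.residueField (f b.η)⁄k] →ₗ[k] k) (_ : ∀ ω, ρ (kaehlerPullback k f b.η ω) = ρ' ω),
      IsResidue b.ring ρ ↔ IsResidue (mapBranch f V hy b).ring ρ' := fun b ρ ρ' h =>
    isResidue_iff_of_equiv (residueAlgHom k f b.η) (hbij b) b.ring (kaehlerPullback k f b.η)
      (kaehlerPullback_smul k f b.η) (kaehlerPullback_D k f b.η) ρ ρ' h
  let E := Equiv.ofBijective _ (mapBranch_bijective f V hy)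
  constructor
  · intro h _ r hr
    have : Fintype (Branch Y y) := Fintype.ofEquiv _ E.symm
    have h1 := h (fun b => (r (E b)).comp (kp b).symm.toLinearMap) fun b =>
      (hres b _ (r (E b)) fun ω => congrArg (r (E b)) ((kp b).symm_apply_apply ω)).2 (hr _)
    rw [← h1]
    refine (Fintype.sum_equiv E _ _ fun b => ?_).symm
    rw [hterm]
    exact congrArg (r (E b)) ((kp b).symm_apply_apply _)
  · intro h _ r hr
    have : Fintype (Branch X (f y)) := Fintype.ofEquiv _ E
    have h1 : ∀ b' : Branch X (f y), ∃ ρ : Ω[X.residueField b'.η⁄k] →ₗ[k] k,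
        IsResidue b'.ring ρ ∧ ∀ b, E b = b' →
          r b (toBranch Y b.specializes ((f.stalkMap y).hom a) • τ.atBranch hyW b) =
            ρ (toBranch X b'.specializes a • ω.atBranch hyU b') := by
      intro b'
      obtain ⟨b, rfl⟩ := E.surjective b'
      refine ⟨(r b).comp (kp b).toLinearMap, (hres b (r b) _ fun _ => rfl).1 (hr b), ?_⟩
      intro b₂ hb
      obtain rfl := E.injective hb
      rw [hterm]
      rfl
    choose ρ hρ hρ' using h1
    have h2 := h ρ hρ
    rw [← h2]
    exact Fintype.sum_equiv E _ _ fun b => hρ' _ b rfl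

end

/-! ### Functions on the normalization -/

open IsLocalRing

/-- If a nonzero-divisor `w` of the Noetherian ring `A` multiplies the algebra `E` into `A`, then
`E` is integral over `A`. -/
lemma isIntegral_of_smul_mem {A S : Type*} [CommRing A] [CommRing S] [Algebra A S]
    [IsNoetherianRing A] (E : Subalgebra A S) {w : A} (hw : IsUnit (algebraMap A S w))
    (hE : ∀ x ∈ E, ∃ a, algebraMap A S a = algebraMap A S w * x) {x : S} (hx : x ∈ E) :
    IsIntegral A x := by
  let L : S →ₗ[A] S := LinearMap.mulLeft A (algebraMap A S w)
  have hL : Function.Injective L := fun a b h => hw.mul_left_cancel h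
  have hle : (Subalgebra.toSubmodule E).map L ≤ LinearMap.range (Algebra.linearMap A S) := by
    rintro _ ⟨x, hx, rfl⟩
    exact hE x hx
  have hnoeth : IsNoetherian A (LinearMap.range (Algebra.linearMap A S)) :=
    isNoetherian_of_surjective (Algebra.linearMap A S).rangeRestrict
      (LinearMap.range_eq_top.2 (LinearMap.surjective_rangeRestrict _))
  have hfg : ((Subalgebra.toSubmodule E).map L).FG := by
    have := isNoetherian_submodule.1 hnoeth _ hle
    exact this
  exact IsIntegral.of_mem_of_fg E (Submodule.fg_of_fg_map_injective L hL hfg) x hx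

lemma evaluation_res {X : Scheme.{u}} {U V : X.Opens} (h : V ≤ U) {x : X} (hx : x ∈ V)
    (a : Γ(X, U)) : (X.evaluation V x hx).hom ((X.presheaf.map (homOfLE h).op).hom a) =
      (X.evaluation U x (h hx)).hom a := by
  change (X.presheaf.map (homOfLE h).op ≫ X.evaluation V x hx).hom a = _
  rw [Scheme.evaluation, Scheme.evaluation, X.presheaf.germ_res_assoc]

lemma mem_complement_iff {X : Scheme.{u}} {p : X} (hp : IsClosed {p}) {x : X} :
    x ∈ complement X p ↔ x ≠ p := by
  change x ∈ (closure {p})ᶜ ↔ _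
  rw [hp.closure_eq]
  rfl

namespace IsFormalBranches

variable {k : Type u} [Field k] {X : Scheme.{u}} [X.Over (Spec (.of k))] {p : X}
  {ι : Type*} {φ : ι → X.presheaf.stalk p →+* PowerSeries k} {e : ℕ} [Finite ι]
  [IsNoetherianRing (X.presheaf.stalk p)]

lemma toBranch_ne_zero (H : IsFormalBranches (toStalk k X p) φ e) {w : X.presheaf.stalk p}
    (hw : ∀ i, φ i w ≠ 0) {η : X} (hη : η ∈ genericPoints X) (h : η ⤳ p) :
    toBranch X h w ≠ 0 := by
  obtain ⟨b, rfl⟩ := H.exists_branch_η_eq hη h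
  intro h0
  have := H.branchMap_toBranch b w
  rw [h0, map_zero] at this
  exact ofPowerSeries_ne_zero (hw _) this.symm

/-- A neighbourhood of `p` on which two given germs are defined, the first being invertible away
from `p`, and all of whose components pass through `p`. -/
lemma exists_isAffineOpen_nhd [IsNoetherian X] (H : IsFormalBranches (toStalk k X p) φ e)
    (hp : IsClosed {p}) {w f : X.presheaf.stalk p} (hw : ∀ i, φ i w ≠ 0) :
    ∃ (U : X.Opens) (hpU : p ∈ U) (w' f' : Γ(X, U)), IsAffineOpen U ∧
      (X.presheaf.germ U p hpU).hom w' = w ∧ (X.presheaf.germ U p hpU).hom f' = f ∧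
      U ⊓ complement X p ≤ X.basicOpen w' ∧ ∀ η ∈ genericPoints X, η ∈ U → η ⤳ p := by
  have hfin : (genericPoints X).Finite := genericPoints.finite
    (NoetherianSpace.finite_irreducibleComponents)
  obtain ⟨U₁, hp1, w₁, rfl⟩ := X.presheaf.exists_germ_eq w
  obtain ⟨U₂, hp2, f₂, rfl⟩ := X.presheaf.exists_germ_eq f
  obtain ⟨U₃, hp3, hU₃⟩ := H.exists_opens_subset_iUnion hp (fun _ => X.basicOpen w₁) (by
    intro η hη h
    have h1 := H.toBranch_ne_zero hw hη h
    rw [toBranch_germ hp1] at h1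
    exact (X.evaluation_ne_zero_iff_mem_basicOpen η _ w₁).1 h1)
  let Z : Set X := ⋃ η ∈ {η ∈ genericPoints X | ¬ η ⤳ p}, closure {η}
  have hZ : IsClosed Z := (hfin.subset (Set.sep_subset _ _)).isClosed_biUnion
    fun _ _ => isClosed_closure
  have hpZ : p ∉ Z := fun hx => by
    obtain ⟨η, ⟨-, h1⟩, h2⟩ := Set.mem_iUnion₂.1 hx
    exact h1 (specializes_iff_mem_closure.2 h2)
  obtain ⟨U, hU, hpU, hle⟩ := exists_isAffineOpen_mem_and_subset (X := X) (x := p)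
    (U := U₁ ⊓ (U₂ ⊓ (U₃ ⊓ ⟨Zᶜ, hZ.isOpen_compl⟩))) ⟨hp1, hp2, hp3, hpZ⟩
  have h1 : U ≤ U₁ := fun x hx => (hle hx).1
  have h2 : U ≤ U₂ := fun x hx => (hle hx).2.1
  refine ⟨U, hpU, (X.presheaf.map (homOfLE h1).op).hom w₁, (X.presheaf.map (homOfLE h2).op).hom f₂,
    hU, X.presheaf.germ_res_apply _ _ _ _, X.presheaf.germ_res_apply _ _ _ _, ?_, ?_⟩
  · rintro x ⟨hxU, hx⟩
    obtain ⟨-, -, -, hx'⟩ := hU₃ x (hle hxU).2.2.1 ((mem_complement_iff hp).1 hx)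
    rw [Scheme.basicOpen_res]
    exact ⟨hxU, hx'⟩
  · intro η hη hηU
    by_contra hne
    exact (hle hηU).2.2.2 (Set.mem_iUnion₂.2 ⟨η, ⟨hη, hne⟩, subset_closure rfl⟩)

/-- A function on a punctured neighbourhood of `p` with expansions of large order at all branches
extends to `p`. -/
lemma exists_section_eq [IsReduced X] (H : IsFormalBranches (toStalk k X p) φ e)
    (hp : IsClosed {p}) {U : X.Opens}
    (hU : ∀ η ∈ genericPoints X, η ∈ U → η ⤳ p) (x : Γ(X, U ⊓ complement X p))
    (F : ∀ η : X, X.residueField η)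
    (hF : ∀ (η : X) (hη : η ∈ U ⊓ complement X p), η ∈ genericPoints X →
      (X.evaluation _ η hη).hom x = F η)
    (hord : ∀ b : Branch X p, ((e : ℤ) : WithTop ℤ) ≤ (H.branchMap b (F b.η)).orderTop) :
    ∃ a : Γ(X, U), (X.presheaf.map (homOfLE inf_le_left).op).hom a = x := by
  obtain ⟨f, hf⟩ := H.exists_toBranch_eq F hord
  obtain ⟨V, hpV, g, rfl⟩ := X.presheaf.exists_germ_eq f
  let W : Bool → X.Opens := fun c => bif c then V ⊓ U else U ⊓ complement X p
  let s : ∀ c, Γ(X, W c) := fun c => match c with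
    | true => (X.presheaf.map (homOfLE inf_le_left).op).hom g
    | false => x
  have hWU : ∀ c, W c ≤ U := fun c => match c with
    | true => inf_le_right
    | false => inf_le_left
  have hs : ∀ c (η : X) (hη : η ∈ W c), η ∈ genericPoints X →
      (X.evaluation _ η hη).hom (s c) = F η := by
    intro c η hη hg
    match c with
    | true =>
      have h := hU η hg (hWU true hη)
      have h1 := hf η hg h
      rw [toBranch_germ hpV] at h1
      rw [← h1]
      exact evaluation_res (inf_le_left : V ⊓ U ≤ V) hη g
    | false => exact hF η hη hg
  obtain ⟨a, ha, -⟩ := X.sheaf.existsUnique_gluing' W U (fun c => homOfLE (hWU c)) (by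
    intro y hy
    by_cases hyp : y = p
    · exact Opens.mem_iSup.2 ⟨true, ⟨hyp ▸ hpV, hy⟩⟩
    · exact Opens.mem_iSup.2 ⟨false, ⟨hy, (mem_complement_iff hp).2 hyp⟩⟩) s (by
    intro c d
    refine eq_of_evaluation_eq fun η => ?_
    refine (evaluation_res inf_le_left η.2.2 (s c)).trans
      (Eq.trans ?_ (evaluation_res inf_le_right η.2.2 (s d)).symm)
    rw [hs c η.1 _ η.2.1, hs d η.1 _ η.2.1])
  exact ⟨a, ha false⟩

end IsFormalBranches

namespace IsNormalizationAt

variable {X Y : Scheme.{u}} {π : Y ⟶ X} {p : X}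

/-- No component of the normalization is contracted to `p`: a function on `X` vanishing near `p`
only at `p` would vanish on a neighbourhood of its generic point, although the preimage of `X ∖ p`
is dense. -/
lemma generic_map_mem {k : Type u} [Field k] [X.Over (Spec (.of k))]
  {ι : Type*} {φ : ι → X.presheaf.stalk p →+* PowerSeries k} {e : ℕ} [Finite ι] [IsNoetherian X]
    (N : IsNormalizationAt π p) (H : IsFormalBranches (toStalk k X p) φ e) (hp : IsClosed {p})
    {η : Y} (hη : η ∈ genericPoints Y) : π η ∈ complement X p := by
  have := N.isReduced
  by_contra hηp
  have hηp : π η = p := not_not.1 fun h => hηp ((mem_complement_iff hp).2 h)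
  obtain ⟨w, hw⟩ := H.exists_leading (fun _ => e + 1) (fun _ => Nat.le_succ e)
  obtain ⟨i⟩ := H.exists_index
  have hwm : w ∈ maximalIdeal (X.presheaf.stalk p) := by
    rw [H.mem_maximalIdeal_iff i]
    obtain ⟨u, -, hu⟩ := hw i
    rw [hu, pow_succ]
    simp
  obtain ⟨U, hpU, w', -, hU, hw', -, hUw, -⟩ := H.exists_isAffineOpen_nhd hp (w := w) (f := 0)
    (fun i => by
      obtain ⟨u, hu, h⟩ := hw i
      rw [h]
      exact mul_ne_zero (pow_ne_zero _ PowerSeries.X_ne_zero) hu.ne_zero)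
  have hηU : η ∈ π ⁻¹ᵁ U := show π η ∈ U from hηp ▸ hpU
  have hnot : η ∉ Y.basicOpen ((π.app U).hom w') := by
    intro h
    have h1 : π η ∈ X.basicOpen w' := by
      rw [← Scheme.preimage_basicOpen] at h
      exact h
    rw [hηp, X.mem_basicOpen _ p hpU, hw'] at h1
    exact hwm h1
  have h0 : (Y.presheaf.germ _ η hηU).hom ((π.app U).hom w') = 0 := by
    refine residue_injective_of_generic hη ?_
    rw [map_zero]
    exact (Y.evaluation_eq_zero_iff_notMem_basicOpen η hηU _).2 hnot
  obtain ⟨V, hηV, i₁, i₂, h1⟩ := Y.presheaf.germ_eq η hηU hηU _ 0 (h0.trans (map_zero _).symm)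
  obtain ⟨z, hz, hzV⟩ := N.dense.inter_open_nonempty V V.isOpen ⟨η, hηV⟩
  have hzU : z ∈ π ⁻¹ᵁ U := i₁.le hz
  have h2 : z ∈ Y.basicOpen ((π.app U).hom w') := by
    rw [← Scheme.preimage_basicOpen]
    exact hUw ⟨hzU, hzV⟩
  have h3 : (Y.presheaf.germ _ z hzU).hom ((π.app U).hom w') = 0 := by
    rw [← Y.presheaf.germ_res_apply i₁ z hz, h1, map_zero, map_zero]
  rw [Y.mem_basicOpen _ z hzU, h3] at h2
  exact not_isUnit_zero h2

/-- Every family of rational functions which is regular along all branches at `p` comes from a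
function on the normalization. -/
lemma exists_section {k : Type u} [Field k] [X.Over (Spec (.of k))]
    {ι : Type*} {φ : ι → X.presheaf.stalk p →+* PowerSeries k} {e : ℕ} [Finite ι]
    [IsNoetherian X] [IsReduced X] (N : IsNormalizationAt π p)
    (H : IsFormalBranches (toStalk k X p) φ e) (hp : IsClosed {p}) (F : ∀ η : X, X.residueField η)
    (hF : ∀ b : Branch X p, 0 ≤ (H.branchMap b (F b.η)).orderTop) :
    ∃ (U : X.Opens) (_ : p ∈ U) (β : Γ(Y, π ⁻¹ᵁ U)), IsAffineOpen U ∧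
      ∀ (η : Y) (_ : η ∈ genericPoints Y) (hηU : η ∈ π ⁻¹ᵁ U),
        (Y.evaluation _ η hηU).hom β = (π.residueFieldMap η).hom (F (π η)) := by
  classical
  obtain ⟨w, hw⟩ := H.exists_leading (fun _ => e) (fun _ => le_rfl)
  have hw0 : ∀ i, φ i w ≠ 0 := fun i => by
    obtain ⟨u, hu, h⟩ := hw i
    rw [h]
    exact mul_ne_zero (pow_ne_zero _ PowerSeries.X_ne_zero) hu.ne_zero
  have hwo : ∀ b : Branch X p, (H.branchMap b (toBranch X b.specializes w)).orderTop = (e : ℤ) :=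
    fun b => by
      obtain ⟨u, hu, h⟩ := hw (H.branchEquiv b)
      rw [H.branchMap_toBranch, h, orderTop_X_pow_mul e hu]
  -- `w` belongs to the conductor, so `w F` is regular at `p`
  obtain ⟨f, hf⟩ := H.exists_toBranch_eq
    (fun η => if h : η ⤳ p then toBranch X h w * F η else 0) (fun b => by
      rw [dif_pos b.specializes, map_mul, orderTop_mul, hwo]
      exact le_add_of_nonneg_right (hF b))
  obtain ⟨U, hpU, w', f', hU, rfl, rfl, hUw, hUg⟩ := H.exists_isAffineOpen_nhd hp hw0 (f := f)
  let A := Γ(X, U)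
  let S := Γ(X, U ⊓ complement X p)
  let r : A →+* S := (X.presheaf.map (homOfLE inf_le_left).op).hom
  let : Algebra A S := r.toAlgebra
  have : IsNoetherianRing A := IsLocallyNoetherian.component_noetherian ⟨U, hU⟩
  have hev : ∀ (a : A) (η : X) (hη : η ∈ U ⊓ complement X p),
      (X.evaluation _ η hη).hom (r a) = (X.evaluation U η hη.1).hom a := fun a η hη =>
    evaluation_res inf_le_left hη a
  have hunit : IsUnit (r w') := by
    have h := (RingedSpace.isUnit_res_basicOpen (X := X.toRingedSpace) w').map
      (X.presheaf.map (homOfLE hUw).op).hom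
    have h1 : X.presheaf.map (homOfLE (X.basicOpen_le w')).op ≫ X.presheaf.map (homOfLE hUw).op =
        X.presheaf.map (homOfLE (inf_le_left : U ⊓ complement X p ≤ U)).op :=
      (X.presheaf.map_comp _ _).symm
    exact (congrArg (fun g => IsUnit (g.hom w')) h1).mp h
  have hb : ∀ b : Branch X p, b.η ∈ U ⊓ complement X p := fun b =>
    ⟨b.specializes.mem_open U.isOpen hpU, (mem_complement_iff hp).2 fun h =>
      H.notMem_genericPoints (h ▸ b.generic)⟩
  -- the functions on the punctured neighbourhood that are regular along all branches; they are
  -- integral over `A` because `w' E ⊆ A`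
  let E : Subalgebra A S :=
    { carrier := {x | ∀ b, 0 ≤ (H.branchMap b ((X.evaluation _ b.η (hb b)).hom x)).orderTop}
      mul_mem' := fun {x y} hx hy b => by
        rw [map_mul, map_mul, orderTop_mul]
        exact add_nonneg (hx b) (hy b)
      add_mem' := fun {x y} hx hy b => by
        rw [map_add, map_add]
        exact (le_min (hx b) (hy b)).trans HahnSeries.min_orderTop_le_orderTop_add
      algebraMap_mem' := fun a b => by
        change 0 ≤ (H.branchMap b ((X.evaluation _ b.η (hb b)).hom (r a))).orderTop
        rw [hev, ← toBranch_germ hpU b.specializes, H.branchMap_toBranch]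
        exact zero_le_orderTop_coe _ }
  have hE : ∀ x ∈ E, ∃ a, algebraMap A S a = algebraMap A S w' * x := by
    intro x hx
    refine H.exists_section_eq hp hUg (r w' * x) (fun η => if h : η ∈ U ⊓ complement X p then
      (X.evaluation _ η h).hom (r w' * x) else 0)
      (fun η hη _ => by rw [dif_pos hη]) fun b => ?_
    rw [dif_pos (hb b), map_mul, map_mul, orderTop_mul, hev, ← toBranch_germ hpU b.specializes,
      hwo]
    exact le_add_of_nonneg_right (hx b)
  let x : S := r f' * hunit.unit⁻¹
  have hx : ∀ η ∈ genericPoints X, ∀ (hη : η ∈ U ⊓ complement X p),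
      (X.evaluation _ η hη).hom x = F η := by
    intro η hg hη
    have h := hUg η hg hη.1
    have h1 := hf η hg h
    rw [dif_pos h, toBranch_germ, toBranch_germ, ← hev f' η hη, ← hev w' η hη] at h1
    have h2 : (X.evaluation _ η hη).hom (r w') ≠ 0 := (hunit.map _).ne_zero
    refine mul_left_cancel₀ h2 ?_
    rw [← h1, ← map_mul]
    congr 1
    change r w' * (r f' * _) = r f'
    rw [mul_left_comm, IsUnit.mul_val_inv, mul_one]
  have hxE : x ∈ E := fun b => by
    rw [hx b.η b.generic (hb b)]
    exact hF b
  obtain ⟨β, hβ⟩ := N.exists_extension U hU x (isIntegral_of_smul_mem E hunit hE hxE)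
  refine ⟨U, hpU, β, hU, fun η hη hηU => ?_⟩
  have hηc := N.generic_map_mem H hp hη
  have hη' : η ∈ π ⁻¹ᵁ (U ⊓ complement X p) := ⟨hηU, hηc⟩
  have := N.isIso_restrict
  have hg := (generic_iff_of_isIso_restrict π (complement X p) hηc).1 hη
  rw [← hx (π η) hg ⟨hηU, hηc⟩,
    ← evaluation_res (π.preimage_mono (inf_le_left : U ⊓ complement X p ≤ U)) hη' β, hβ]
  exact (Scheme.evaluation_naturality_apply π η _ x).symm

end IsNormalizationAt

/-! ### The points of the normalization above `p` -/

open IsLocalRing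

lemma eq_of_toBranch_eq {X : Scheme.{u}} [IsReduced X] {x : X} {f g : X.presheaf.stalk x}
    (h : ∀ η ∈ genericPoints X, ∀ h : η ⤳ x, toBranch X h f = toBranch X h g) : f = g := by
  rw [← sub_eq_zero]
  have h1 : f - g ∈ nilradical (X.presheaf.stalk x) := by
    rw [nilradical, ← Ideal.sInf_minimalPrimes, Ideal.mem_sInf]
    intro P hP
    obtain ⟨η, hη, hs, rfl⟩ := exists_ker_toBranch_eq hP
    rw [RingHom.mem_ker, map_sub, h η hη hs, sub_self]
  exact (mem_nilradical.1 h1).eq_zero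

lemma eq_of_forall_mem_basicOpen_iff {X : Scheme.{u}} {U : X.Opens} (hU : IsAffineOpen U) {x y : X}
    (hx : x ∈ U) (hy : y ∈ U) (h : ∀ s : Γ(X, U), x ∈ X.basicOpen s ↔ y ∈ X.basicOpen s) :
    x = y := by
  have key : ∀ {x y : X}, x ∈ U → (∀ s : Γ(X, U), x ∈ X.basicOpen s → y ∈ X.basicOpen s) →
      y ⤳ x := by
    intro x y hx h
    rw [specializes_iff_forall_open]
    intro W hW hxW
    obtain ⟨s, hs, hxs⟩ := hU.exists_basicOpen_le (V := ⟨W, hW⟩) ⟨x, hxW⟩ hx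
    exact hs (h s hxs)
  exact ((key hy fun s => (h s).2).antisymm (key hx fun s => (h s).1)).eq

lemma exists_mem_basicOpen_iff {X : Scheme.{u}} {U : X.Opens} (hU : IsAffineOpen U)
    (M : Ideal Γ(X, U)) [M.IsPrime] : ∃ x ∈ U, ∀ s, x ∈ X.basicOpen s ↔ s ∉ M := by
  refine ⟨hU.fromSpec ⟨M, inferInstance⟩, ?_, fun s => ?_⟩
  · rw [← SetLike.mem_coe, ← hU.range_fromSpec]
    exact ⟨_, rfl⟩
  · change (⟨M, inferInstance⟩ : PrimeSpectrum Γ(X, U)) ∈ hU.fromSpec ⁻¹ᵁ X.basicOpen s ↔ _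
    rw [hU.fromSpec_preimage_basicOpen]
    rfl

section

variable {k : Type u} [Field k] {X Y : Scheme.{u}} [X.Over (Spec (.of k))]
  {π : Y ⟶ X} {p : X}
  {ι : Type*} {φ : ι → X.presheaf.stalk p →+* PowerSeries k} {e : ℕ} [Finite ι]
  [IsNoetherian X]

namespace IsFormalBranches

/-- Rational functions with prescribed orders at all branches. -/
lemma exists_orderTop_eq (H : IsFormalBranches (toStalk k X p) φ e) (n : Branch X p → ℕ) :
    ∃ F : ∀ ξ : X, X.residueField ξ, ∀ b, (H.branchMap b (F b.η)).orderTop = (n b : ℤ) := by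
  classical
  have h1 : ∀ ξ : X, ∃ x : X.residueField ξ, ∀ (h : ξ ⤳ p) i hi,
      (H.lift (isComponent_toBranch k h) i hi x).orderTop = (n (H.branchEquiv.symm i) : ℤ) := by
    intro ξ
    by_cases h : ξ ⤳ p
    · obtain ⟨x, -, hx⟩ := H.exists_ratio (isComponent_toBranch k h)
        (fun i => n (H.branchEquiv.symm i))
      exact ⟨x, fun _ => hx⟩
    · exact ⟨0, fun h' => (h h').elim⟩
  choose F hF using h1
  refine ⟨F, fun b => ?_⟩
  have := hF b.η b.specializes (H.branchEquiv b) (H.represents_branchEquiv b).choose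
  rwa [Equiv.symm_apply_apply] at this

/-- Rational functions separating one branch from all others. -/
lemma exists_separating (H : IsFormalBranches (toStalk k X p) φ e) (b : Branch X p) :
    ∃ F : ∀ ξ : X, X.residueField ξ, (H.branchMap b (F b.η)).orderTop = (0 : ℤ) ∧
      (∀ b', b' ≠ b → ((1 : ℤ) : WithTop ℤ) ≤ (H.branchMap b' (F b'.η)).orderTop) ∧
      ∀ ξ, ξ ≠ b.η → F ξ = 0 := by
  classical
  obtain ⟨F, hF⟩ := H.exists_orderTop_eq (fun b' => if b' = b then 0 else 1)
  refine ⟨fun ξ => if ξ = b.η then F ξ else 0, ?_, fun b' hb' => ?_, fun ξ hξ => if_neg hξ⟩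
  · dsimp only
    rw [if_pos rfl, hF, if_pos rfl]
    rfl
  · dsimp only
    split_ifs with h
    · rw [hF, if_neg hb']
      exact le_rfl
    · rw [map_zero, HahnSeries.orderTop_zero]
      exact le_top

lemma zero_le_of_separating {H : IsFormalBranches (toStalk k X p) φ e} {b : Branch X p}
    {F : ∀ ξ : X, X.residueField ξ} (h0 : (H.branchMap b (F b.η)).orderTop = (0 : ℤ))
    (h1 : ∀ b', b' ≠ b → ((1 : ℤ) : WithTop ℤ) ≤ (H.branchMap b' (F b'.η)).orderTop)
    (b' : Branch X p) : 0 ≤ (H.branchMap b' (F b'.η)).orderTop := by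
  by_cases h : b' = b
  · rw [h, h0]
    exact le_rfl
  · exact le_trans (WithTop.coe_le_coe.2 zero_le_one) (h1 b' h)

lemma eventually_le_orderTop_pow_mul (H : IsFormalBranches (toStalk k X p) φ e) {b : Branch X p}
    {F : ∀ ξ : X, X.residueField ξ}
    (hF : ∀ b', b' ≠ b → ((1 : ℤ) : WithTop ℤ) ≤ (H.branchMap b' (F b'.η)).orderTop)
    (Z : ∀ ξ : X, X.residueField ξ) : ∃ N : ℕ, ∀ b', b' ≠ b →
      ((1 : ℤ) : WithTop ℤ) ≤ (H.branchMap b' (F b'.η ^ N * Z b'.η)).orderTop := by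
  have : Finite (Branch X p) := Finite.of_equiv _ H.branchEquiv.symm
  have h1 : ∀ b' : Branch X p, ∀ᶠ N : ℕ in Filter.atTop, b' ≠ b →
      ((1 : ℤ) : WithTop ℤ) ≤ (H.branchMap b' (F b'.η ^ N * Z b'.η)).orderTop := by
    intro b'
    by_cases hZ : H.branchMap b' (Z b'.η) = 0
    · refine Filter.Eventually.of_forall fun N _ => ?_
      rw [map_mul, hZ, mul_zero, HahnSeries.orderTop_zero]
      exact le_top
    obtain ⟨n, hn⟩ := orderTop_eq_coe hZ
    filter_upwards [Filter.eventually_ge_atTop (1 - n).toNat] with N hN hb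
    rw [map_mul, map_pow, orderTop_mul, orderTop_pow, hn]
    have h2 : ((N : ℤ) : WithTop ℤ) ≤ N • (H.branchMap b' (F b'.η)).orderTop := by
      refine le_trans ?_ (nsmul_le_nsmul_right (hF b' hb) N)
      rw [← WithTop.coe_nsmul]
      exact WithTop.coe_le_coe.2 (by simp)
    refine le_trans ?_ (add_le_add_left h2 _)
    rw [← WithTop.coe_add]
    exact WithTop.coe_le_coe.2 (by omega)
  obtain ⟨N, hN⟩ := (Filter.eventually_all.2 h1).exists
  exact ⟨N, hN⟩

end IsFormalBranches

namespace IsNormalizationAt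

lemma mem_complement_η (H : IsFormalBranches (toStalk k X p) φ e) (hp : IsClosed {p})
    (b : Branch X p) : b.η ∈ complement X p :=
  (mem_complement_iff hp).2 fun h => H.notMem_genericPoints (h ▸ b.generic)

/-- Every family of rational functions which is regular along all branches at `p` comes from a germ
at each point of the normalization above `p`. -/
lemma exists_stalk [IsReduced X] (N : IsNormalizationAt π p)
    (H : IsFormalBranches (toStalk k X p) φ e) (hp : IsClosed {p}) {y : Y} (hy : π y = p)
    (F : ∀ ξ : X, X.residueField ξ)
    (hF : ∀ b : Branch X p, 0 ≤ (H.branchMap b (F b.η)).orderTop) :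
    ∃ f : Y.presheaf.stalk y, ∀ η ∈ genericPoints Y, ∀ h : η ⤳ y,
      toBranch Y h f = (π.residueFieldMap η).hom (F (π η)) := by
  obtain ⟨U, hpU, β, -, hβ⟩ := N.exists_section H hp F hF
  have hyU : y ∈ π ⁻¹ᵁ U := show π y ∈ U from hy ▸ hpU
  refine ⟨(Y.presheaf.germ _ y hyU).hom β, fun η hη h => ?_⟩
  rw [toBranch_germ, hβ η hη]

lemma exists_branch_map_eq (N : IsNormalizationAt π p)
    (H : IsFormalBranches (toStalk k X p) φ e) (hp : IsClosed {p}) {y : Y} (hy : π y = p) {η : Y}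
    (hη : η ∈ genericPoints Y) (h : η ⤳ y) :
    ∃ b : Branch X p, b.η = π η := by
  have := N.isIso_restrict
  exact H.exists_branch_η_eq
    ((generic_iff_of_isIso_restrict π (complement X p) (N.generic_map_mem H hp hη)).1 hη)
    (hy ▸ h.map π.continuous)

/-- A germ vanishing along all branches vanishes at every point above `p`, since one of its powers
comes from a function on `X` vanishing at `p`. -/
lemma mem_maximalIdeal_of_le_orderTop (N : IsNormalizationAt π p)
    (H : IsFormalBranches (toStalk k X p) φ e) (hp : IsClosed {p}) {y : Y} (hy : π y = p)
    {f : Y.presheaf.stalk y} {F : ∀ ξ : X, X.residueField ξ}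
    (hf : ∀ η ∈ genericPoints Y, ∀ h : η ⤳ y,
      toBranch Y h f = (π.residueFieldMap η).hom (F (π η)))
    (hF : ∀ b : Branch X p, ((1 : ℤ) : WithTop ℤ) ≤ (H.branchMap b (F b.η)).orderTop) :
    f ∈ maximalIdeal (Y.presheaf.stalk y) := by
  have := N.isReduced
  have hpow : ∀ b : Branch X p, ((e + 1 : ℤ) : WithTop ℤ) ≤
      (H.branchMap b (F b.η ^ (e + 1))).orderTop := by
    intro b
    rw [map_pow, orderTop_pow]
    refine le_trans ?_ (nsmul_le_nsmul_right (hF b) (e + 1))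
    rw [← WithTop.coe_nsmul]
    exact WithTop.coe_le_coe.2 (by simp)
  obtain ⟨g, hg⟩ := H.exists_toBranch_eq (fun ξ => F ξ ^ (e + 1)) fun b =>
    le_trans (WithTop.coe_le_coe.2 (by omega)) (hpow b)
  have hgm : g ∈ maximalIdeal (X.presheaf.stalk p) := by
    obtain ⟨i⟩ := H.exists_index
    rw [H.mem_maximalIdeal_iff i, ← PowerSeries.X_dvd_iff, ← pow_one PowerSeries.X,
      ← le_orderTop_coe_iff]
    have h1 := hpow (H.branchEquiv.symm i)
    rw [← hg _ (H.branchEquiv.symm i).generic (H.branchEquiv.symm i).specializes,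
      H.branchMap_toBranch, Equiv.apply_symm_apply] at h1
    exact le_trans (WithTop.coe_le_coe.2 (by push_cast; omega)) h1
  have hfg : f ^ (e + 1) ∈ maximalIdeal (Y.presheaf.stalk y) := by
    subst hy
    have := N.isIso_restrict
    have h2 : f ^ (e + 1) = (π.stalkMap y).hom g := by
      refine eq_of_toBranch_eq fun η hη h => ?_
      have hg' := (generic_iff_of_isIso_restrict π (complement X (π y))
        (N.generic_map_mem H hp hη)).1 hη
      rw [toBranch_stalkMap, map_pow, hf η hη h, hg _ hg', map_pow]
    rw [h2]
    intro hu
    exact hgm ((isUnit_map_iff (π.stalkMap y).hom g).1 hu)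
  exact Ideal.IsPrime.mem_of_pow_mem inferInstance _ hfg

end IsNormalizationAt

variable [Y.Over (Spec (.of k))] [π.IsOver (Spec (.of k))]

namespace IsFormalBranches

/-- The expansion `Φ` of functions on the component of `Y` with generic point `η` is the expansion
along the branch `b` of `X`. -/
structure IsLiftOf (H : IsFormalBranches (toStalk k X p) φ e) (π : Y ⟶ X)
    [π.IsOver (Spec (.of k))] (b : Branch X p) (η : Y)
    (Φ : Y.residueField η →ₐ[k] LaurentSeries k) : Prop where
  generic : η ∈ genericPoints Y
  map_eq : π η = b.η
  apply : ∀ F : ∀ ξ : X, X.residueField ξ,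
    Φ ((π.residueFieldMap η).hom (F (π η))) = H.branchMap b (F b.η)
  expand_apply : ∀ ω : ∀ ξ : X, Ω[X.residueField ξ⁄k],
    expand Φ (kaehlerPullback k π η (ω (π η))) = expand (H.branchMap b) (ω b.η)
  exists_eq : ∀ z, ∃ F : ∀ ξ : X, X.residueField ξ, z = (π.residueFieldMap η).hom (F (π η))

lemma IsLiftOf.apply_app {H : IsFormalBranches (toStalk k X p) φ e} {b : Branch X p} {η : Y}
    {Φ : Y.residueField η →ₐ[k] LaurentSeries k} (hl : H.IsLiftOf π b η Φ) {U : X.Opens}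
    (hpU : p ∈ U) (hηU : η ∈ π ⁻¹ᵁ U) (a : Γ(X, U)) :
    Φ ((Y.evaluation _ η hηU).hom ((π.app U).hom a)) = HahnSeries.ofPowerSeries ℤ k
      (φ (H.branchEquiv b) ((X.presheaf.germ U p hpU).hom a)) := by
  classical
  have h1 : (Y.evaluation _ η hηU).hom ((π.app U).hom a) =
      (π.residueFieldMap η).hom ((X.evaluation U (π η) hηU).hom a) :=
    (Scheme.evaluation_naturality_apply π η hηU a).symm
  let F : ∀ ξ : X, X.residueField ξ := fun ξ => if h : ξ ∈ U then (X.evaluation U ξ h).hom a else 0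
  have h2 := hl.apply F
  have hbU : b.η ∈ U := b.specializes.mem_open U.isOpen hpU
  rwa [show F (π η) = (X.evaluation U (π η) hηU).hom a from dif_pos hηU,
    show F b.η = (X.evaluation U b.η hbU).hom a from dif_pos hbU,
    ← toBranch_germ hpU b.specializes, H.branchMap_toBranch, ← h1] at h2

/-- The point `y` lies on exactly one component of `Y`, and its local ring is the valuation ring of
the branch `b` of `X`. -/
structure IsCenter (H : IsFormalBranches (toStalk k X p) φ e) (π : Y ⟶ X)
    [π.IsOver (Spec (.of k))] (b : Branch X p) {y η : Y} (h : η ⤳ y)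
    (Φ : Y.residueField η →ₐ[k] LaurentSeries k) : Prop where
  isLiftOf : H.IsLiftOf π b η Φ
  eq_of_specializes : ∀ η' ∈ genericPoints Y, η' ⤳ y → η' = η
  injective : Function.Injective (toBranch Y h)
  mem_iff : ∀ z, z ∈ branchRing Φ ↔ ∃ f, toBranch Y h f = z

lemma IsCenter.isUnit_iff {H : IsFormalBranches (toStalk k X p) φ e} {b : Branch X p} {y η : Y}
    {h : η ⤳ y} {Φ : Y.residueField η →ₐ[k] LaurentSeries k} (hc : H.IsCenter π b h Φ)
    (f : Y.presheaf.stalk y) : IsUnit f ↔ (Φ (toBranch Y h f)).orderTop = (0 : ℤ) := by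
  have hge : ∀ f, 0 ≤ (Φ (toBranch Y h f)).orderTop := fun f => (hc.mem_iff _).2 ⟨f, rfl⟩
  constructor
  · rintro hu
    obtain ⟨g, hg⟩ := hu.exists_right_inv
    refine le_antisymm ?_ (hge f)
    have h1 : (Φ (toBranch Y h f)).orderTop + (Φ (toBranch Y h g)).orderTop = 0 := by
      rw [← orderTop_mul, ← map_mul, ← map_mul, hg, map_one, map_one, HahnSeries.orderTop_one]
    calc (Φ (toBranch Y h f)).orderTop ≤ _ := le_add_of_nonneg_right (hge g)
      _ = 0 := h1
  · intro h0
    have hne : toBranch Y h f ≠ 0 := by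
      intro h1
      rw [h1, map_zero, HahnSeries.orderTop_zero] at h0
      exact WithTop.top_ne_coe h0
    have h1 : (toBranch Y h f)⁻¹ ∈ branchRing Φ := by
      rw [mem_branchRing, map_inv₀, orderTop_inv h0]
      exact le_rfl
    obtain ⟨g, hg⟩ := (hc.mem_iff _).1 h1
    refine IsUnit.of_mul_eq_one g (hc.injective ?_)
    rw [map_mul, hg, mul_inv_cancel₀ hne, map_one]

end IsFormalBranches

namespace IsNormalizationAt

/-- The component of a branch of `X` is dominated by a component of `Y` with the same function
field, to which the expansion along the branch is transported. -/
lemma exists_isLiftOf (N : IsNormalizationAt π p) (H : IsFormalBranches (toStalk k X p) φ e)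
    (hp : IsClosed {p}) (b : Branch X p) : ∃ η Φ, H.IsLiftOf π b η Φ := by
  classical
  have := N.isIso_restrict
  have hc := mem_complement_η H hp b
  obtain ⟨η, hη⟩ := exists_map_eq_of_isIso_restrict π _ hc
  have hg : η ∈ genericPoints Y := (generic_iff_of_isIso_restrict π (complement X p)
    (hη ▸ hc)).2 (hη ▸ b.generic)
  have hbij : Function.Bijective (π.residueFieldMap η).hom :=
    residueFieldMap_bijective_of_isIso_restrict π (complement X p) (hη ▸ hc)
  have hex : ∀ z, ∃ F : ∀ ξ : X, X.residueField ξ, z = (π.residueFieldMap η).hom (F (π η)) := by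
    intro z
    obtain ⟨a, rfl⟩ := hbij.2 z
    exact ⟨Function.update (fun _ => 0) (π η) a, by rw [Function.update_self]⟩
  have hΨ : ∃ Ψ : X.residueField (π η) →ₐ[k] LaurentSeries k,
      (∀ F : ∀ ξ : X, X.residueField ξ, Ψ (F (π η)) = H.branchMap b (F b.η)) ∧
      ∀ ω : ∀ ξ : X, Ω[X.residueField ξ⁄k],
        expand Ψ (ω (π η)) = expand (H.branchMap b) (ω b.η) := by
    generalize π η = ξ at hη
    subst hη
    exact ⟨H.branchMap b, fun _ => rfl, fun _ => rfl⟩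
  obtain ⟨Ψ, hΨ, hΨ'⟩ := hΨ
  let e : X.residueField (π η) ≃ₐ[k] Y.residueField η :=
    AlgEquiv.ofBijective (residueAlgHom k π η) hbij
  have he : ∀ a, Ψ (e.symm (residueAlgHom k π η a)) = Ψ a := fun a =>
    congrArg Ψ (e.symm_apply_apply a)
  refine ⟨η, Ψ.comp e.symm.toAlgHom, hg, hη, fun F => (he _).trans (hΨ F), fun ω => ?_, hex⟩
  rw [expand_kaehlerPullback k π η _ Ψ he, hΨ']

/-- Every point of the normalization above `p` is the center of a branch. -/
lemma exists_isCenter [IsReduced X] (N : IsNormalizationAt π p)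
    (H : IsFormalBranches (toStalk k X p) φ e) (hp : IsClosed {p}) {y : Y} (hy : π y = p) :
    ∃ (b : Branch X p) (η : Y) (h : η ⤳ y) (Φ : _), H.IsCenter π b h Φ := by
  have := N.isReduced
  have := N.isIso_restrict
  have : Finite (Branch X p) := Finite.of_equiv _ H.branchEquiv.symm
  have := Fintype.ofFinite (Branch X p)
  choose F hF0 hF1 hF using H.exists_separating
  choose f hf using fun b => N.exists_stalk H hp hy (F b)
    (IsFormalBranches.zero_le_of_separating (hF0 b) (hF1 b))
  -- the separating functions add up to a unit, so one of them is a unit at `y`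
  have hsum : ∀ b', (H.branchMap b' (∑ b, F b b'.η)).orderTop = (0 : ℤ) := by
    classical
    intro b'
    rw [map_sum, ← Finset.add_sum_erase _ _ (Finset.mem_univ b')]
    have h1 : ((1 : ℤ) : WithTop ℤ) ≤
        (∑ b ∈ Finset.univ.erase b', H.branchMap b' (F b b'.η)).orderTop := by
      refine le_orderTop_iff.2 fun j hj => ?_
      rw [HahnSeries.coeff_sum]
      exact Finset.sum_eq_zero fun b hb => le_orderTop_iff.1
        (hF1 b b' (Finset.ne_of_mem_erase hb).symm) j hj
    rw [HahnSeries.orderTop_add_eq_left, hF0]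
    rw [hF0]
    exact lt_of_lt_of_le (WithTop.coe_lt_coe.2 zero_lt_one) h1
  obtain ⟨g, hg⟩ := N.exists_stalk H hp hy (fun ξ => (∑ b, F b ξ)⁻¹) fun b => by
    rw [map_inv₀, orderTop_inv (hsum b)]
    exact le_rfl
  have hunit : IsUnit (∑ b, f b) := by
    refine IsUnit.of_mul_eq_one g (eq_of_toBranch_eq fun η hη h => ?_)
    obtain ⟨b', hb'⟩ := N.exists_branch_map_eq H hp hy hη h
    have h1 : (∑ b, F b (π η)) ≠ 0 := by
      rw [← hb']
      intro h0
      have := hsum b'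
      rw [h0, map_zero, HahnSeries.orderTop_zero] at this
      exact WithTop.top_ne_coe this
    rw [map_mul, map_sum, hg η hη, Finset.sum_congr rfl fun b _ => hf b η hη h, ← map_sum,
      ← map_mul, mul_inv_cancel₀ h1, map_one, map_one]
  obtain ⟨b, hb⟩ : ∃ b, IsUnit (f b) := by
    by_contra! hcon
    exact (Ideal.sum_mem (maximalIdeal (Y.presheaf.stalk y)) fun b _ => hcon b) hunit
  have hne : ∀ η ∈ genericPoints Y, ∀ h : η ⤳ y, π η = b.η := by
    intro η hη h
    by_contra hne
    have h1 := hf b η hη h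
    rw [hF b _ hne, map_zero] at h1
    exact (hb.map (toBranch Y h)).ne_zero h1
  obtain ⟨η, Φ, hl⟩ := N.exists_isLiftOf H hp b
  have huniq : ∀ η' ∈ genericPoints Y, η' ⤳ y → η' = η := fun η' hη' h' =>
    injOn_of_isIso_restrict π (complement X p) (N.generic_map_mem H hp hη')
      ((hne η' hη' h').trans hl.map_eq.symm)
  obtain ⟨η', hη', h⟩ := exists_generic_specializes y
  obtain rfl := huniq η' hη' h
  have hinj : Function.Injective (toBranch Y h) := fun a a' haa =>
    eq_of_toBranch_eq fun η₁ hη₁ h₁ => by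
      obtain rfl := huniq η₁ hη₁ h₁
      exact haa
  refine ⟨b, η', h, Φ, hl, huniq, hinj, fun z => ⟨fun hz => ?_, ?_⟩⟩
  · -- a power of the separating function clears the poles along the other branches
    obtain ⟨Z, rfl⟩ := hl.exists_eq z
    obtain ⟨n, hn⟩ := H.eventually_le_orderTop_pow_mul (hF1 b) Z
    rw [mem_branchRing, hl.apply] at hz
    obtain ⟨a, ha⟩ := N.exists_stalk H hp hy (fun ξ => F b ξ ^ n * Z ξ) fun b' => by
      by_cases hb' : b' = b
      · subst hb'
        rw [map_mul, map_pow, orderTop_mul, orderTop_pow, hF0, WithTop.coe_zero, nsmul_zero,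
          zero_add]
        exact hz
      · exact le_trans (WithTop.coe_le_coe.2 zero_le_one) (hn b' hb')
    obtain ⟨v, hv⟩ := (hb.pow n).exists_right_inv
    refine ⟨a * v, ?_⟩
    rw [map_mul, ha _ hη', map_mul, map_pow, ← hf b _ hη' h, ← map_pow, mul_right_comm, ← map_mul,
      hv, map_one, one_mul]
  · rintro ⟨a, rfl⟩
    by_contra hz
    rw [mem_branchRing, not_le] at hz
    obtain ⟨Z, hZ⟩ := hl.exists_eq (toBranch Y h a)
    have hZ0 : toBranch Y h a ≠ 0 := by
      intro h0
      rw [h0, map_zero, HahnSeries.orderTop_zero] at hz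
      exact not_top_lt hz
    rw [hZ, hl.apply] at hz
    obtain ⟨n, hn⟩ := H.eventually_le_orderTop_pow_mul (hF1 b) fun ξ => (Z ξ)⁻¹
    -- the inverse of a function with a pole would be a non-unit dividing a unit
    have hord : ∀ b', ((1 : ℤ) : WithTop ℤ) ≤
        (H.branchMap b' (F b b'.η ^ n * (Z b'.η)⁻¹)).orderTop := by
      intro b'
      by_cases hb' : b' = b
      · subst hb'
        obtain ⟨j, hj⟩ := WithTop.ne_top_iff_exists.1 hz.ne_top
        rw [map_mul, map_pow, orderTop_mul, orderTop_pow, hF0, WithTop.coe_zero, nsmul_zero,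
          zero_add, map_inv₀, orderTop_inv hj.symm]
        rw [← hj] at hz
        have : j < 0 := WithTop.coe_lt_coe.1 hz
        exact WithTop.coe_le_coe.2 (by omega)
      · exact hn b' hb'
    obtain ⟨v, hv⟩ := N.exists_stalk H hp hy (fun ξ => F b ξ ^ n * (Z ξ)⁻¹) fun b' =>
      le_trans (WithTop.coe_le_coe.2 zero_le_one) (hord b')
    have hvm := N.mem_maximalIdeal_of_le_orderTop H hp hy
      (F := fun ξ => F b ξ ^ n * (Z ξ)⁻¹) hv hord
    refine hvm (isUnit_of_mul_isUnit_left (y := a) ?_)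
    have h1 : v * a = f b ^ n := by
      refine hinj ?_
      rw [map_mul, hv _ hη', map_mul, map_inv₀, ← hZ, inv_mul_cancel_right₀ hZ0, map_pow, map_pow,
        hf b _ hη' h]
    rw [h1]
    exact hb.pow n

/-- A branch has only one center: the same functions are invertible at two centers. -/
lemma eq_of_isCenter (N : IsNormalizationAt π p) {H : IsFormalBranches (toStalk k X p) φ e}
    (hp : IsClosed {p}) {b : Branch X p} {y y' η η' : Y} (hy : π y = p) (hy' : π y' = p)
    {h : η ⤳ y} {h' : η' ⤳ y'} {Φ Φ'} (hc : H.IsCenter π b h Φ) (hc' : H.IsCenter π b h' Φ') :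
    y = y' := by
  have := N.isIso_restrict
  have := N.isIntegralHom
  obtain rfl : η = η' := injOn_of_isIso_restrict π (complement X p)
    (N.generic_map_mem H hp hc.isLiftOf.generic)
    (hc.isLiftOf.map_eq.trans hc'.isLiftOf.map_eq.symm)
  have hΦ : ∀ z, Φ z = Φ' z := fun z => by
    obtain ⟨F, rfl⟩ := hc.isLiftOf.exists_eq z
    rw [hc.isLiftOf.apply, hc'.isLiftOf.apply]
  obtain ⟨U, hU, hpU, -⟩ := exists_isAffineOpen_mem_and_subset (X := X) (x := p) (U := ⊤) trivial
  have hyU : y ∈ π ⁻¹ᵁ U := show π y ∈ U from hy ▸ hpU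
  have hyU' : y' ∈ π ⁻¹ᵁ U := show π y' ∈ U from hy' ▸ hpU
  refine eq_of_forall_mem_basicOpen_iff (hU.preimage π) hyU hyU' fun s => ?_
  rw [Y.mem_basicOpen _ y hyU, Y.mem_basicOpen _ y' hyU', hc.isUnit_iff, hc'.isUnit_iff,
    toBranch_germ, toBranch_germ, hΦ]

/-- A function on the normalization has no poles along the branches at `p`, being integral. -/
lemma zero_le_orderTop (N : IsNormalizationAt π p) {H : IsFormalBranches (toStalk k X p) φ e}
    {b : Branch X p} {η : Y} {Φ} (hl : H.IsLiftOf π b η Φ) {U : X.Opens} (hU : IsAffineOpen U)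
    (hpU : p ∈ U) (hηU : η ∈ π ⁻¹ᵁ U) (s : Γ(Y, π ⁻¹ᵁ U)) :
    0 ≤ (Φ ((Y.evaluation _ η hηU).hom s)).orderTop := by
  have := N.isIntegralHom
  obtain ⟨P, hP, hs⟩ := π.isIntegral_app U hU s
  let ψ : Γ(X, U) →+* PowerSeries k := (φ (H.branchEquiv b)).comp (X.presheaf.germ U p hpU).hom
  have hψ : (algebraMap (PowerSeries k) (LaurentSeries k)).comp ψ =
      ((Φ : _ →+* LaurentSeries k).comp (Y.evaluation _ η hηU).hom).comp (π.app U).hom := by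
    exact RingHom.ext fun a => (hl.apply_app hpU hηU a).symm
  have hint : IsIntegral (PowerSeries k) (Φ ((Y.evaluation _ η hηU).hom s)) := by
    refine ⟨P.map ψ, hP.map ψ, ?_⟩
    rw [Polynomial.eval₂_map, hψ]
    exact (Polynomial.hom_eval₂ P (π.app U).hom
      ((Φ : _ →+* LaurentSeries k).comp (Y.evaluation _ η hηU).hom) s).symm.trans (by
        rw [hs, map_zero])
  obtain ⟨q, hq⟩ := IsIntegrallyClosed.isIntegral_iff.1 hint
  exact zero_le_orderTop_iff.2 ⟨q, hq⟩

/-- Every branch at `p` has a center on the normalization. -/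
lemma exists_point [IsReduced X] (N : IsNormalizationAt π p)
    (H : IsFormalBranches (toStalk k X p) φ e) (hp : IsClosed {p}) (b : Branch X p) :
    ∃ (y η : Y) (h : η ⤳ y) (Φ : _), π y = p ∧ H.IsCenter π b h Φ := by
  have := N.isIntegralHom
  have := N.isReduced
  obtain ⟨F, hF0, hF1, hF⟩ := H.exists_separating b
  obtain ⟨U, hpU, β, hU, hβ⟩ := N.exists_section H hp F
    (IsFormalBranches.zero_le_of_separating hF0 hF1)
  obtain ⟨η, Φ, hl⟩ := N.exists_isLiftOf H hp b
  have hbU : b.η ∈ U := b.specializes.mem_open U.isOpen hpU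
  have hηU : η ∈ π ⁻¹ᵁ U := show π η ∈ U from hl.map_eq ▸ hbU
  have hnn := N.zero_le_orderTop hl hU hpU hηU
  have hiff : ∀ x : LaurentSeries k, ((1 : ℤ) : WithTop ℤ) ≤ x.orderTop ↔ 0 < x.orderTop := by
    intro x
    rcases eq_or_ne x 0 with rfl | hx
    · simp
    · obtain ⟨n, hn⟩ := orderTop_eq_coe hx
      rw [hn, WithTop.coe_le_coe, ← WithTop.coe_zero, WithTop.coe_lt_coe]
      omega
  -- the center is the prime ideal of the functions vanishing along `b`
  let M : Ideal Γ(Y, π ⁻¹ᵁ U) :=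
    { carrier := {s | 0 < (Φ ((Y.evaluation _ η hηU).hom s)).orderTop}
      add_mem' := fun {s t} hs ht => by
        rw [Set.mem_ofPred_eq, map_add, map_add]
        exact lt_of_lt_of_le (lt_min hs ht) HahnSeries.min_orderTop_le_orderTop_add
      zero_mem' := by simp
      smul_mem' := fun c s hs => by
        rw [Set.mem_ofPred_eq, smul_eq_mul, map_mul, map_mul, orderTop_mul]
        exact lt_of_lt_of_le hs (le_add_of_nonneg_left (hnn c)) }
  have hMmem : ∀ s, s ∈ M ↔ 0 < (Φ ((Y.evaluation _ η hηU).hom s)).orderTop := fun _ => Iff.rfl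
  have hMp : M.IsPrime := by
    refine ⟨fun h => ?_, fun {s t} hst => ?_⟩
    · have h1 : (1 : Γ(Y, π ⁻¹ᵁ U)) ∈ M := h ▸ trivial
      rw [hMmem, map_one, map_one, HahnSeries.orderTop_one] at h1
      exact lt_irrefl _ h1
    · by_contra! hcon
      rw [hMmem, hMmem, not_lt, not_lt] at hcon
      rw [hMmem, map_mul, map_mul, orderTop_mul, le_antisymm hcon.1 (hnn s),
        le_antisymm hcon.2 (hnn t), add_zero] at hst
      exact lt_irrefl _ hst
  obtain ⟨y, hyU, hy⟩ := exists_mem_basicOpen_iff (hU.preimage π) M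
  have hyp : π y = p := by
    refine eq_of_forall_mem_basicOpen_iff hU hyU hpU fun a => ?_
    have h1 : π y ∈ X.basicOpen a ↔ y ∈ Y.basicOpen ((π.app U).hom a) := by
      rw [← Scheme.preimage_basicOpen]
      rfl
    rw [h1, hy, hMmem, hl.apply_app hpU hηU, ← hiff, ← Nat.cast_one, le_orderTop_coe_iff, pow_one,
      PowerSeries.X_dvd_iff, ← H.mem_maximalIdeal_iff, X.mem_basicOpen _ p hpU, mem_maximalIdeal,
      mem_nonunits_iff, not_not]
  obtain ⟨b', η', h', Φ', hc⟩ := N.exists_isCenter H hp hyp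
  have hηU' : η' ∈ π ⁻¹ᵁ U := h'.mem_open (π ⁻¹ᵁ U).isOpen hyU
  have hunit : IsUnit ((Y.presheaf.germ _ y hyU).hom β) := by
    rw [← Y.mem_basicOpen _ y hyU, hy, hMmem, hβ η hl.generic, hl.apply, hF0]
    exact lt_irrefl _
  -- the function separating `b` from the other branches is a unit at `y`
  obtain rfl : b' = b := by
    by_contra hne
    rw [hc.isUnit_iff, toBranch_germ, hβ η' hc.isLiftOf.generic, hc.isLiftOf.apply] at hunit
    have := hF1 b' hne
    rw [hunit] at this
    exact absurd (WithTop.coe_le_coe.1 this) (by norm_num)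
  exact ⟨y, η', h', Φ', hyp, hc⟩

end IsNormalizationAt

end

/-! ### Differentials at the points above `p` -/

open IsLocalRing

section

variable {k : Type u} [Field k] {X Y : Scheme.{u}} [X.Over (Spec (.of k))] [Y.Over (Spec (.of k))]
  {π : Y ⟶ X} [π.IsOver (Spec (.of k))] {p : X}
  {ι : Type*} {φ : ι → X.presheaf.stalk p →+* PowerSeries k} {e : ℕ} [Finite ι]
  [IsNoetherian X]

lemma IsNormalizationAt.isClosed_of_isCenter [IsReduced X] (N : IsNormalizationAt π p)
    {H : IsFormalBranches (toStalk k X p) φ e} (hp : IsClosed {p}) {b : Branch X p} {y η : Y}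
    (hy : π y = p) {h : η ⤳ y} {Φ} (hc : H.IsCenter π b h Φ) : IsClosed {y} := by
  rw [← closure_subset_iff_isClosed]
  intro z hz
  have hyz : y ⤳ z := specializes_iff_mem_closure.2 hz
  have hzp : π z = p := by
    have h1 : p ⤳ π z := hy ▸ hyz.map π.continuous
    rw [specializes_iff_mem_closure, hp.closure_eq] at h1
    exact h1
  obtain ⟨b', η', h', Φ', hc'⟩ := N.exists_isCenter H hp hzp
  obtain ⟨F, hF0, hF1, -⟩ := H.exists_separating b'
  obtain ⟨U, hpU, β, -, hβ⟩ := N.exists_section H hp F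
    (IsFormalBranches.zero_le_of_separating hF0 hF1)
  have hyU : y ∈ π ⁻¹ᵁ U := show π y ∈ U from hy ▸ hpU
  have hzU : z ∈ π ⁻¹ᵁ U := show π z ∈ U from hzp ▸ hpU
  have h1 : z ∈ Y.basicOpen β := by
    rw [Y.mem_basicOpen _ z hzU, hc'.isUnit_iff, toBranch_germ, hβ _ hc'.isLiftOf.generic,
      hc'.isLiftOf.apply, hF0]
  have h2 := hyz.mem_open (Y.basicOpen β).isOpen h1
  rw [SetLike.mem_coe, Y.mem_basicOpen _ y hyU, hc.isUnit_iff, toBranch_germ,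
    hβ _ hc.isLiftOf.generic, hc.isLiftOf.apply] at h2
  obtain rfl : b = b' := by
    by_contra hne
    have h3 := hF1 b hne
    rw [h2] at h3
    exact absurd (WithTop.coe_le_coe.1 h3) (by norm_num)
  exact (N.eq_of_isCenter hp hy hzp hc hc').symm

lemma IsFormalBranches.IsLiftOf.expand_pullbackRatDiff {H : IsFormalBranches (toStalk k X p) φ e}
    {b : Branch X p} {η : Y} {Φ : Y.residueField η →ₐ[k] LaurentSeries k} (hc : H.IsLiftOf π b η Φ)
    {U : X.Opens} (ω : RatDiff k X U) (hpU : p ∈ U) (hηU : η ∈ π ⁻¹ᵁ U) :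
    expand Φ (pullbackRatDiff k π ω ⟨η, hc.generic, hηU⟩) = H.expansion ω hpU b := by
  classical
  have hg : π η ∈ genericPoints X := hc.map_eq ▸ b.generic
  rw [pullbackRatDiff_apply k π ω ⟨η, hc.generic, hηU⟩ hg]
  let F : ∀ ξ : X, Ω[X.residueField ξ⁄k] := fun ξ =>
    if h : ξ ∈ genericPoints X ∧ ξ ∈ U then ω ⟨ξ, h⟩ else 0
  have h1 := hc.expand_apply F
  have hbU : b.η ∈ U := b.specializes.mem_open U.isOpen hpU
  rwa [show F (π η) = ω ⟨π η, hg, hηU⟩ from dif_pos ⟨hg, hηU⟩,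
    show F b.η = ω ⟨b.η, b.generic, hbU⟩ from dif_pos ⟨b.generic, hbU⟩] at h1

namespace IsFormalBranches.IsCenter

variable {H : IsFormalBranches (toStalk k X p) φ e} {b : Branch X p} {y η : Y} {h : η ⤳ y}
  {Φ : Y.residueField η →ₐ[k] LaurentSeries k}

/-- A point above `p` is the center of only one branch. -/
lemma eq_branch (hc : H.IsCenter π b h Φ) {b' : Branch X p} {h' : η ⤳ y} {Φ'}
    [IsReduced X] (N : IsNormalizationAt π p) (hp : IsClosed {p}) (hy : π y = p)
    (hc' : H.IsCenter π b' h' Φ') : b = b' := by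
  obtain ⟨F, hF0, hF1, -⟩ := H.exists_separating b'
  obtain ⟨f, hf⟩ := N.exists_stalk H hp hy F
    (IsFormalBranches.zero_le_of_separating hF0 hF1)
  have h1 := hc.isUnit_iff f
  rw [hc'.isUnit_iff, hf _ hc.isLiftOf.generic h, hc.isLiftOf.apply, hc'.isLiftOf.apply, hF0] at h1
  by_contra hne
  have h3 := hF1 b hne
  rw [h1.1 rfl] at h3
  exact absurd (WithTop.coe_le_coe.1 h3) (by norm_num)

lemma isNoetherianRing (hc : H.IsCenter π b h Φ) : IsNoetherianRing (Y.presheaf.stalk y) := by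
  let g : Y.presheaf.stalk y →+* branchRing Φ :=
    (toBranch Y h).codRestrict (branchRing Φ).toSubring fun f => (hc.mem_iff _).2 ⟨f, rfl⟩
  have hg : Function.Bijective g := by
    refine ⟨fun a b hab => hc.injective (congrArg Subtype.val hab), fun z => ?_⟩
    obtain ⟨f, hf⟩ := (hc.mem_iff z).1 z.2
    exact ⟨f, Subtype.ext hf⟩
  exact isNoetherianRing_of_ringEquiv _ (RingEquiv.ofBijective g hg).symm

/-- The local ring at a point above `p` has one formal branch, with expansion `Φ`. -/
lemma exists_isFormalBranches [IsNoetherianRing (Y.presheaf.stalk y)] (hc : H.IsCenter π b h Φ) :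
    ∃ (ψ : Unit → Y.presheaf.stalk y →+* PowerSeries k)
      (H' : IsFormalBranches (toStalk k Y y) ψ 0),
      (∀ f, HahnSeries.ofPowerSeries ℤ k (ψ () f) = Φ (toBranch Y h f)) ∧
      ∀ (W : Y.Opens) (τ : RatDiff k Y W) (hy : y ∈ W) (b' : Branch Y y),
        H'.expansion τ hy b' =
          expand Φ (τ ⟨η, hc.isLiftOf.generic, h.mem_open W.isOpen hy⟩) := by
  obtain ⟨F, hF⟩ := H.exists_orderTop_eq (fun _ => 1)
  obtain ⟨ψ, H', hψ⟩ := exists_isFormalBranches_of_range_eq (c₀ := toStalk k Y y)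
    (ρ := toBranch Y h) (toBranch_toStalk k h) hc.injective Φ hc.mem_iff
    (g := (π.residueFieldMap η).hom (F (π η))) (by rw [hc.isLiftOf.apply, hF]; rfl)
  refine ⟨ψ, H', hψ, fun W τ hy b' => ?_⟩
  have hb : ∀ f, H'.branchMap b' (toBranch Y b'.specializes f) = Φ (toBranch Y h f) := fun f =>
    (H'.branchMap_toBranch b' f).trans (hψ f)
  have hη := hc.eq_of_specializes b'.η b'.generic b'.specializes
  unfold IsFormalBranches.expansion RatDiff.atBranch
  generalize H'.branchMap b' = Ψ at hb
  obtain ⟨η', h1, h2, R, h3, h4⟩ := b'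
  obtain rfl : η' = η := hη
  have : Ψ = Φ := by
    refine AlgHom.ext fun z => ?_
    obtain ⟨a, s, -, rfl⟩ := exists_toBranch_div h z
    rw [map_div₀, map_div₀, ← hb, ← hb]
  rw [this]

variable [LocallyOfFiniteType (X ↘ Spec (.of k))]

lemma isExactSpan (N : IsNormalizationAt π p) (hp : IsClosed {p}) (hc : H.IsCenter π b h Φ) :
    ∀ η' ∈ genericPoints Y, η' ⤳ y → IsExactSpan k (Y.residueField η') := by
  intro η' hη' h'
  obtain rfl := hc.eq_of_specializes η' hη' h'
  have := N.isIso_restrict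
  have hm := N.generic_map_mem H hp hη'
  refine isExactSpan_of_residueFieldMap k π
    (residueFieldMap_bijective_of_isIso_restrict π (complement X p) hm) ?_
  rw [hc.isLiftOf.map_eq]
  exact H.isExactSpan_residueField b.η b.generic b.specializes

lemma residueSumVanishes (N : IsNormalizationAt π p) (hp : IsClosed {p})
    (hc : H.IsCenter π b h Φ) {U : X.Opens} {ω : RatDiff k X U} (hpU : p ∈ U)
    (hyU : y ∈ π ⁻¹ᵁ U) (hω : ((-1 : ℤ) : WithTop ℤ) ≤ (H.expansion ω hpU b).orderTop) :
    ∀ f ∈ maximalIdeal (Y.presheaf.stalk y) ^ 2,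
      ResidueSumVanishes (pullbackRatDiff k π ω) hyU f := by
  have := hc.isNoetherianRing
  obtain ⟨ψ, H', -, hH'⟩ := hc.exists_isFormalBranches
  refine (H'.forall_residueSumVanishes_iff (hc.isExactSpan N hp) 2).2 fun b' => ?_
  rw [hH', hc.isLiftOf.expand_pullbackRatDiff ω hpU (h.mem_open (π ⁻¹ᵁ U).isOpen hyU)]
  exact hω

lemma generatesAt (N : IsNormalizationAt π p) (hp : IsClosed {p})
    (hc : H.IsCenter π b h Φ) {U : X.Opens} {σ : RatDiff k X U} (hpU : p ∈ U)
    (hyU : y ∈ π ⁻¹ᵁ U) (hσ : (H.expansion σ hpU b).orderTop = (-1 : ℤ)) :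
    GeneratesAt 2 (pullbackRatDiff k π σ) hyU := by
  have := hc.isNoetherianRing
  obtain ⟨ψ, H', -, hH'⟩ := hc.exists_isFormalBranches
  refine H'.generatesAt (hc.isExactSpan N hp) 2 fun b' => ?_
  rw [hH', hc.isLiftOf.expand_pullbackRatDiff σ hpU (h.mem_open (π ⁻¹ᵁ U).isOpen hyU), hσ]
  rfl

/-- A differential whose coefficient with respect to `dt / t` has a simple pole along the branch `b`
has a double pole at the center of `b`. -/
lemma hasPoleOfOrder (N : IsNormalizationAt π p) (hp : IsClosed {p})
    (hc : H.IsCenter π b h Φ) {U : X.Opens} {σ : RatDiff k X U} (hpU : p ∈ U)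
    (hyU : y ∈ π ⁻¹ᵁ U) (hσ : (H.expansion σ hpU b).orderTop = (-1 : ℤ)) :
    HasPoleOfOrder (pullbackRatDiff k π σ) y 2 := by
  have := hc.isNoetherianRing
  obtain ⟨ψ, H', hψ, hH'⟩ := hc.exists_isFormalBranches
  obtain ⟨t, v, hv, ht, hspan⟩ := H'.exists_uniformizer
  have ht1 : (Φ (toBranch Y h t)).orderTop = (1 : ℤ) := by
    rw [← hψ, show ψ () t = _ from ht, ← pow_one PowerSeries.X]
    exact orderTop_X_pow_mul 1 hv
  have hηU : η ∈ π ⁻¹ᵁ U := h.mem_open (π ⁻¹ᵁ U).isOpen hyU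
  obtain ⟨g, hg⟩ := (hc.isExactSpan N hp η hc.isLiftOf.generic h).exists_eq (Φ := Φ) ht1
    (pullbackRatDiff k π σ ⟨η, hc.isLiftOf.generic, hηU⟩)
  have hord : (Φ g).orderTop + 1 = (-1 : ℤ) := by
    rw [← hσ, ← hc.isLiftOf.expand_pullbackRatDiff σ hpU hηU, hg]
    exact (orderTop_expand_smul_D ht1 g).symm
  have hg2 : (Φ (toBranch Y h t ^ 2 * g)).orderTop = (0 : ℤ) := by
    have hne : Φ g ≠ 0 := by
      intro h0
      rw [h0, HahnSeries.orderTop_zero] at hord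
      exact WithTop.top_ne_coe hord
    obtain ⟨n, hn⟩ := orderTop_eq_coe hne
    rw [hn] at hord
    have hn2 : n + 1 = -1 := WithTop.coe_injective hord
    rw [map_mul, map_pow, orderTop_mul, orderTop_pow, ht1, hn, ← WithTop.coe_nsmul,
      ← WithTop.coe_add]
    exact congrArg WithTop.some (by simp; omega)
  obtain ⟨v', hv'⟩ := (hc.mem_iff _).1 (mem_branchRing.2 hg2.ge)
  refine ⟨hyU, t, v', hspan, (hc.isUnit_iff v').2 (hv' ▸ hg2), fun η' h' => ?_⟩
  obtain ⟨η', hη', hηU'⟩ := η'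
  obtain rfl := hc.eq_of_specializes η' hη' h'
  rw [hg, smul_smul, hv']

end IsFormalBranches.IsCenter

end

/-! ### The pullback of the dualizing sheaf -/

open IsLocalRing

section

variable {k : Type u} [Field k] {X Y : Scheme.{u}} [X.Over (Spec (.of k))] {π : Y ⟶ X} {p : X}
  {ι : Type*} {φ : ι → X.presheaf.stalk p →+* PowerSeries k} {e : ℕ}

namespace IsNormalizationAt

/-- Open sets of `Y` correspond to open sets of `X` away from `p`. -/
lemma exists_preimage_eq (N : IsNormalizationAt π p) (W : Y.Opens) :
    ∃ V ≤ complement X p, π ⁻¹ᵁ V = W ⊓ π ⁻¹ᵁ complement X p := by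
  have := N.isIso_restrict
  refine ⟨⟨π '' (W ⊓ π ⁻¹ᵁ complement X p : Y.Opens), isOpen_image_of_isIso_restrict π
    (complement X p) (W ⊓ π ⁻¹ᵁ complement X p).isOpen inf_le_right⟩, ?_, ?_⟩
  · rintro _ ⟨y, hy, rfl⟩
    exact hy.2
  · ext y
    constructor
    · rintro ⟨z, hz, hzy⟩
      exact injOn_of_isIso_restrict π (complement X p) hz.2 hzy ▸ hz
    · exact fun hy => ⟨y, hy, rfl⟩

variable [Finite ι] [IsNoetherian X]

lemma map_mem_genericPoints (N : IsNormalizationAt π p) (H : IsFormalBranches (toStalk k X p) φ e)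
    (hp : IsClosed {p}) {η : Y} (hη : η ∈ genericPoints Y) : π η ∈ genericPoints X :=
  have := N.isIso_restrict
  (generic_iff_of_isIso_restrict π (complement X p) (N.generic_map_mem H hp hη)).1 hη

lemma finite_genericPoints (N : IsNormalizationAt π p) (H : IsFormalBranches (toStalk k X p) φ e)
    (hp : IsClosed {p}) : (genericPoints Y).Finite := by
  have := N.isIso_restrict
  have hfin : (genericPoints X).Finite := genericPoints.finite
    (NoetherianSpace.finite_irreducibleComponents)
  refine Set.Finite.of_finite_image (f := π) (hfin.subset ?_) fun η hη η' _ h =>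
    injOn_of_isIso_restrict π (complement X p) (N.generic_map_mem H hp hη) h
  rintro _ ⟨η, hη, rfl⟩
  exact N.map_mem_genericPoints H hp hη

end IsNormalizationAt

end

section

variable {k : Type u} [Field k] {X Y : Scheme.{u}} [X.Over (Spec (.of k))] [Y.Over (Spec (.of k))]

section

variable (π : Y ⟶ X) [π.IsOver (Spec (.of k))]

lemma pullbackRatDiff_add {U : X.Opens} (ω ω' : RatDiff k X U) :
    pullbackRatDiff k π (ω + ω') = pullbackRatDiff k π ω + pullbackRatDiff k π ω' := by
  funext η
  by_cases h : π η.1 ∈ genericPoints X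
  · have h1 := pullbackRatDiff_apply k π (ω + ω') η h
    have h2 := pullbackRatDiff_apply k π ω η h
    have h3 := pullbackRatDiff_apply k π ω' η h
    refine h1.trans (Eq.trans (map_add _ _ _) ?_)
    rw [← h2, ← h3]
    rfl
  · have h1 : ∀ ω : RatDiff k X U, pullbackRatDiff k π ω η = 0 := fun ω => dif_neg h
    refine (h1 _).trans (Eq.trans ?_ (congrArg₂ (· + ·) (h1 ω) (h1 ω')).symm)
    exact (add_zero _).symm

lemma pullbackRatDiff_zero (U : X.Opens) :
    pullbackRatDiff k π (0 : RatDiff k X U) = 0 := by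
  have := pullbackRatDiff_add π (0 : RatDiff k X U) 0
  rwa [add_zero, left_eq_add] at this

lemma pullbackRatDiff_smul {U : X.Opens} (g : Γ(X, U)) (ω : RatDiff k X U) :
    pullbackRatDiff k π (g • ω) = (π.app U).hom g • pullbackRatDiff k π ω := by
  funext η
  rw [RatDiff.smul_apply]
  by_cases h : π η.1 ∈ genericPoints X
  · rw [pullbackRatDiff_apply k π _ η h, pullbackRatDiff_apply k π ω η h, RatDiff.smul_apply,
      kaehlerPullback_smul]
    exact congrArg (· • _) (Scheme.evaluation_naturality_apply π η.1 η.2.2 g)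
  · rw [pullbackRatDiff, dif_neg h, pullbackRatDiff, dif_neg h, smul_zero]

end

variable {π : Y ⟶ X} [π.IsOver (Spec (.of k))] {p : X}
  {ι : Type*} {φ : ι → X.presheaf.stalk p →+* PowerSeries k} {e : ℕ} [Finite ι]
  [IsNoetherian X]

namespace IsNormalizationAt

lemma kaehlerPullback_bijective (N : IsNormalizationAt π p)
    (H : IsFormalBranches (toStalk k X p) φ e) (hp : IsClosed {p}) {η : Y}
    (hη : η ∈ genericPoints Y) : Function.Bijective (kaehlerPullback k π η) :=
  have := N.isIso_restrict
  EllipticPoint.kaehlerPullback_bijective k π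
    (residueFieldMap_bijective_of_isIso_restrict π (complement X p) (N.generic_map_mem H hp hη))

/-- Away from `p`, every section of `ω_Y(D)` is a pullback. -/
lemma exists_pullbackRatDiff_eq (N : IsNormalizationAt π p)
    (H : IsFormalBranches (toStalk k X p) φ 2) (hp : IsClosed {p}) {D : Y → ℕ}
    (hD : ∀ y, π y ≠ p → D y = 0) {W : Y.Opens} {V : X.Opens}
    (hV : V ≤ complement X p) (hVW : π ⁻¹ᵁ V ≤ W) {τ : RatDiff k Y W}
    (hτ : τ ∈ omegaSections k Y D W) : ∃ ω ∈ omegaSections k X 0 V,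
      pullbackRatDiff k π ω = τ.res hVW := by
  have := N.isIso_restrict
  have h1 : ∀ ξ : X, ∃ ω : Ω[X.residueField ξ⁄k], ∀ (η : Y) (h : π η = ξ) (hη : η ∈ genericPoints Y)
      (hηW : η ∈ W), kaehlerPullback k π η (h ▸ ω) = τ ⟨η, hη, hηW⟩ := by
    intro ξ
    by_cases h : ∃ η ∈ genericPoints Y, η ∈ W ∧ π η = ξ
    · obtain ⟨η, hη, hηW, rfl⟩ := h
      obtain ⟨ω, hω⟩ := (N.kaehlerPullback_bijective H hp hη).2 (τ ⟨η, hη, hηW⟩)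
      refine ⟨ω, fun η' h hη' hηW' => ?_⟩
      obtain rfl := injOn_of_isIso_restrict π (complement X p) (N.generic_map_mem H hp hη') h
      exact hω
    · exact ⟨0, fun η h' hη hηW => (h ⟨η, hη, hηW, h'⟩).elim⟩
  choose ω hω using h1
  have hω' : ∀ (η : Y) (hη : η ∈ genericPoints Y) (hηW : η ∈ W),
      kaehlerPullback k π η (ω (π η)) = τ ⟨η, hη, hηW⟩ := fun η hη hηW => hω (π η) η rfl hη hηW
  refine ⟨fun ξ => ω ξ.1, ?_, ?_⟩
  · rintro x hxV hx a -
    obtain ⟨y, rfl⟩ := exists_map_eq_of_isIso_restrict π (complement X p) (hV hxV)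
    have hyW : y ∈ W := hVW hxV
    have hcl : IsClosed {y} := by
      have h2 : π ⁻¹' {π y} = {y} := by
        ext z
        exact ⟨fun hz => (injOn_of_isIso_restrict π (complement X p) (hV hxV) hz.symm).symm,
          fun hz => congrArg π hz⟩
      rw [← h2]
      exact hx.preimage π.continuous
    have ha : (π.stalkMap y).hom a ∈ maximalIdeal (Y.presheaf.stalk y) ^ D y := by
      rw [hD y ((mem_complement_iff hp).1 (hV hxV)), pow_zero, Ideal.one_eq_top]
      trivial
    have key := residueSumVanishes_pullback_iff k π (complement X p)
      (fun ξ => ω ξ.1 : RatDiff k X V) τ hxV hyW (hV hxV)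
      (fun b => (hω' b.η b.generic (b.specializes.mem_open W.isOpen hyW)).symm) a
    intro _ r hr
    exact key.1 (fun r hr => hτ y hyW hcl _ ha r hr) r hr
  · funext η
    exact (pullbackRatDiff_apply k π _ η (N.map_mem_genericPoints H hp η.2.1)).trans
      (hω' η.1 η.2.1 (hVW η.2.2))

variable [IsReduced X] [LocallyOfFiniteType (X ↘ Spec (.of k))] {D : Y → ℕ}

/-- Regular differentials acquire at most double poles above `p`. -/
lemma pullbackRatDiff_mem (N : IsNormalizationAt π p) (H : IsFormalBranches (toStalk k X p) φ 2)
    (hp : IsClosed {p}) (hD : ∀ y, π y = p → D y = 2) {V : X.Opens}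
    {ω : RatDiff k X V} (hω : ω ∈ omegaSections k X 0 V) :
    pullbackRatDiff k π ω ∈ omegaSections k Y D (π ⁻¹ᵁ V) := by
  have := N.isIso_restrict
  have := N.isIntegralHom
  have := Fintype.ofFinite ι
  intro y hyV hy f hf
  by_cases hyp : π y = p
  · obtain ⟨b, η, h, Φ, hc⟩ := N.exists_isCenter H hp hyp
    have hpV : p ∈ V := hyp ▸ hyV
    rw [hD y hyp] at hf
    refine hc.residueSumVanishes N hp hpV hyV ?_ f hf
    exact H.le_orderTop_expansion (H.isExactSpan_residueField) le_rfl
      (fun f _ => hω p hpV hp f (by simp)) b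
  · have hyc : π y ∈ complement X p := (mem_complement_iff hp).2 hyp
    have hcl : IsClosed {π y} := by
      have := π.isClosedMap _ hy
      rwa [Set.image_singleton] at this
    obtain ⟨a, rfl⟩ := (stalkMap_bijective_of_isIso_restrict π (complement X p) hyc).2 f
    refine (residueSumVanishes_pullback_iff k π (complement X p) ω _ hyV hyV hyc (fun b => ?_) a).2
      (hω (π y) hyV hcl a (by simp))
    exact pullbackRatDiff_apply k π ω _ (N.map_mem_genericPoints H hp b.generic)

/-- The pullback of regular differentials as a morphism of sheaves. -/
def pullbackHom (N : IsNormalizationAt π p) (H : IsFormalBranches (toStalk k X p) φ 2)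
    (hp : IsClosed {p}) (hD : ∀ y, π y = p → D y = 2) :
    omega k X ⟶ (Scheme.Modules.pushforward π).obj (omegaTwist k Y D) where
  val := PresheafOfModules.homMk
    { app V := AddCommGrpCat.ofHom (X := omegaSections k X 0 V.unop)
        (Y := omegaSections k Y D (π ⁻¹ᵁ V.unop))
        { toFun := fun ω => ⟨pullbackRatDiff k π ω.1, N.pullbackRatDiff_mem H hp hD ω.2⟩
          map_zero' := Subtype.ext (pullbackRatDiff_zero π V.unop)
          map_add' := fun ω ω' => Subtype.ext (pullbackRatDiff_add π ω.1 ω'.1) }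
      naturality := fun _ _ _ => rfl }
    fun _ g ω => Subtype.ext (pullbackRatDiff_smul π g ω.1)

end IsNormalizationAt

namespace IsElliptic

variable [IsReduced X] [LocallyOfFiniteType (X ↘ Spec (.of k))] {D : Y → ℕ} {c : ι → k}

/-- Every section of `ω_Y(D)` is locally a multiple of a pullback of a regular differential. -/
lemma exists_res_eq_smul_pullback [Fintype ι] (N : IsNormalizationAt π p)
    (E : IsElliptic (toStalk k X p) φ c) (hp : IsClosed {p}) (hD : ∀ y, π y = p → D y = 2)
    (hD0 : ∀ y, π y ≠ p → D y = 0) {U : X.Opens} {hpU : p ∈ U} {σ : RatDiff k X U}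
    (hσ : σ ∈ omegaSections k X 0 U) (hadp : E.IsAdapted σ hpU) {W : Y.Opens} {τ : RatDiff k Y W}
    (hτ : τ ∈ omegaSections k Y D W) {y : Y} (hyW : y ∈ W) :
    ∃ (V : X.Opens) (W' : Y.Opens) (h : W' ≤ W) (h' : W' ≤ π ⁻¹ᵁ V) (g : Γ(Y, W'))
      (ω : RatDiff k X V), ω ∈ omegaSections k X 0 V ∧ y ∈ W' ∧
      τ.res h = g • (pullbackRatDiff k π ω).res h' := by
  have H := E.isFormalBranches
  by_cases hyp : π y = p
  · obtain ⟨b, η, h, Φ, hc⟩ := N.exists_isCenter H hp hyp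
    have hyU : y ∈ π ⁻¹ᵁ U := show π y ∈ U from hyp ▸ hpU
    have hgen := hc.generatesAt N hp hpU hyU (hadp.orderTop_eq b)
    obtain ⟨W', h₁, h₂, g, hyW', hg⟩ := exists_opens_res_eq_smul (N.finite_genericPoints H hp)
      hyU hyW (hgen.2 W hyW τ fun f hf =>
        hτ y hyW (N.isClosed_of_isCenter hp hyp hc) f (by rwa [hD y hyp]))
    exact ⟨U, W', h₂, h₁, g, σ, hσ, hyW', hg⟩
  · obtain ⟨V, hV, hVW⟩ := N.exists_preimage_eq W
    obtain ⟨ω, hω, hωτ⟩ := N.exists_pullbackRatDiff_eq H hp hD0 hV (hVW.trans_le inf_le_left) hτ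
    refine ⟨V, π ⁻¹ᵁ V, hVW.trans_le inf_le_left, le_rfl, 1, ω, hω, ?_, ?_⟩
    · rw [hVW]
      exact ⟨hyW, (mem_complement_iff hp).2 hyp⟩
    · rw [one_smul, ← hωτ]
      rfl

end IsElliptic

end

open Scheme.Modules

lemma appTo_smul {X Y : Scheme.{u}} (f : Y ⟶ X) {F : X.Modules} {G : Y.Modules}
    (θ : F ⟶ (pushforward f).obj G) (V : X.Opens) (g : Γ(X, V)) (s : Γ(F, V)) :
    appTo f θ V (g • s) = (f.app V).hom g • appTo f θ V s :=
  Scheme.Modules.Hom.app_smul θ g s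

variable {k : Type u} [Field k] {X Y : Scheme.{u}} [X.Over (Spec (.of k))] [Y.Over (Spec (.of k))]
  {π : Y ⟶ X} [π.IsOver (Spec (.of k))] {p : X} {D : Y → ℕ}
  {θ : omega k X ⟶ (pushforward π).obj (omegaTwist k Y D)}
  {M : Y.Modules} (ψ : omega k X ⟶ (pushforward π).obj M)

/-- Where `ω_X` has a generator, relations between pulled back differentials hold in any sheaf. -/
lemma relation_of_isGenerator [IsReduced Y]
    (hθ : ∀ V s, sectionToRatDiff (appTo π θ V s) = pullbackRatDiff k π (sectionToRatDiff s))
    {U V : X.Opens} {σ : RatDiff k X U} (hσ : IsGenerator σ)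
    (hσ0 : ∀ η, pullbackRatDiff k π σ η ≠ 0) (hVU : V ≤ U) {W : Y.Opens}
    (h : W ≤ π ⁻¹ᵁ V) (g₁ g₂ g₃ : Γ(Y, W)) (s₁ s₂ s₃ : Γ(omega k X, V))
    (hrel : g₁ • resM _ h (appTo π θ V s₁) + g₂ • resM _ h (appTo π θ V s₂) =
      g₃ • resM _ h (appTo π θ V s₃)) :
    g₁ • resM M h (appTo π ψ V s₁) + g₂ • resM M h (appTo π ψ V s₂) =
      g₃ • resM M h (appTo π ψ V s₃) := by
  let σ' : Γ(omega k X, V) := ⟨σ.res hVU, res_mem_omegaSections k X 0 hVU hσ.1⟩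
  have hs : ∀ s : Γ(omega k X, V), ∃ a : Γ(Y, W), ∀ (N : Y.Modules)
      (χ : omega k X ⟶ (pushforward π).obj N),
      resM N h (appTo π χ V s) = a • resM N h (appTo π χ V σ') := by
    intro s
    obtain ⟨g, hg, -⟩ := hσ.2 V hVU (sectionToRatDiff s) s.2
    have hs : s = g • σ' := Subtype.ext hg
    refine ⟨(Y.presheaf.map (homOfLE h).op).hom ((π.app V).hom g), fun N χ => ?_⟩
    rw [hs, appTo_smul, resM_smul]
  obtain ⟨a₁, h₁⟩ := hs s₁
  obtain ⟨a₂, h₂⟩ := hs s₂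
  obtain ⟨a₃, h₃⟩ := hs s₃
  rw [h₁, h₂, h₃, smul_smul, smul_smul, smul_smul, ← add_smul] at hrel ⊢
  congr 1
  refine eq_of_smul_eq (k := k)
    (σ := (pullbackRatDiff k π σ).res (h.trans (π.preimage_mono hVU))) (fun η => hσ0 _) ?_
  have h4 : sectionToRatDiff (resM _ h (appTo π θ V σ')) =
      (pullbackRatDiff k π σ).res (h.trans (π.preimage_mono hVU)) :=
    congrArg (RatDiff.res h) (hθ V σ')
  rw [← h4]
  exact congrArg Subtype.val hrel

namespace IsNormalizationAt

variable {ι : Type*} {φ : ι → X.presheaf.stalk p →+* PowerSeries k} {e : ℕ} [Finite ι]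
  [IsNoetherian X]

lemma pullbackRatDiff_injective (N : IsNormalizationAt π p)
    (H : IsFormalBranches (toStalk k X p) φ e) (hp : IsClosed {p}) {V : X.Opens}
    (hV : V ≤ complement X p) :
    Function.Injective (pullbackRatDiff k π : RatDiff k X V → RatDiff k Y (π ⁻¹ᵁ V)) := by
  have := N.isIso_restrict
  intro ω ω' h
  funext ⟨ξ, hξ, hξV⟩
  obtain ⟨η, rfl⟩ := exists_map_eq_of_isIso_restrict π (complement X p) (hV hξV)
  have hη := (generic_iff_of_isIso_restrict π (complement X p) (hV hξV)).2 hξ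
  apply (N.kaehlerPullback_bijective H hp hη).1
  have := congrFun h ⟨η, hη, hξV⟩
  rwa [pullbackRatDiff_apply k π ω _ hξ, pullbackRatDiff_apply k π ω' _ hξ] at this

/-- Away from `p`, relations between pulled back differentials hold in any sheaf. -/
lemma exists_relation
    (hθ : ∀ V s, sectionToRatDiff (appTo π θ V s) = pullbackRatDiff k π (sectionToRatDiff s))
    (N : IsNormalizationAt π p)
    (H : IsFormalBranches (toStalk k X p) φ e) (hp : IsClosed {p}) {V : X.Opens} {W : Y.Opens}
    (h : W ≤ π ⁻¹ᵁ V) (g₁ g₂ g₃ : Γ(Y, W)) (s₁ s₂ s₃ : Γ(omega k X, V))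
    (hrel : g₁ • resM _ h (appTo π θ V s₁) + g₂ • resM _ h (appTo π θ V s₂) =
      g₃ • resM _ h (appTo π θ V s₃)) {y : Y} (hyW : y ∈ W) (hyp : π y ≠ p) :
    ∃ (W' : Y.Opens) (h' : W' ≤ W), y ∈ W' ∧
      resM M h' (g₁ • resM M h (appTo π ψ V s₁) + g₂ • resM M h (appTo π ψ V s₂)) =
        resM M h' (g₃ • resM M h (appTo π ψ V s₃)) := by
  have := N.isIso_restrict
  obtain ⟨V', hV', hVW⟩ := N.exists_preimage_eq W
  have hW : π ⁻¹ᵁ V' ≤ W := hVW.trans_le inf_le_left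
  have hVV : V' ≤ V := by
    intro x hx
    obtain ⟨z, rfl⟩ := exists_map_eq_of_isIso_restrict π (complement X p) (hV' hx)
    exact h (hW hx)
  have hs : ∀ (g : Γ(Y, W)), ∃ g' : Γ(X, V'), ∀ (s : Γ(omega k X, V)) (L : Y.Modules)
      (χ : omega k X ⟶ (pushforward π).obj L),
      resM L hW (g • resM L h (appTo π χ V s)) = appTo π χ V' (g' • resM _ hVV s) := by
    intro g
    obtain ⟨g', hg⟩ := (app_bijective_of_isIso_restrict π (complement X p) hV').2
      ((Y.presheaf.map (homOfLE hW).op).hom g)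
    refine ⟨g', fun s L χ => ?_⟩
    rw [appTo_smul, hg, resM_smul, resM_resM, appTo_resM]
  obtain ⟨a₁, h₁⟩ := hs g₁
  obtain ⟨a₂, h₂⟩ := hs g₂
  obtain ⟨a₃, h₃⟩ := hs g₃
  refine ⟨π ⁻¹ᵁ V', hW, hVW ▸ ⟨hyW, (mem_complement_iff hp).2 hyp⟩, ?_⟩
  have h4 := congrArg (resM _ hW) hrel
  rw [map_add, h₁, h₂, h₃, ← map_add] at h4 ⊢
  have h5 : sectionToRatDiff (appTo π θ V' _) = sectionToRatDiff (appTo π θ V' _) :=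
    congrArg Subtype.val h4
  rw [hθ, hθ] at h5
  rw [Subtype.ext (N.pullbackRatDiff_injective H hp hV' h5)]

end IsNormalizationAt

open Scheme.Modules

variable {k : Type u} [Field k] {X Y : Scheme.{u}} [X.Over (Spec (.of k))] [Y.Over (Spec (.of k))]
  {π : Y ⟶ X} [π.IsOver (Spec (.of k))] {p : X}
  [IsReduced X] [IsNoetherian X]

/-- The pullback of differentials identifies `π^* ω_X` with `ω_Y(D)`, where `D` is twice the
reduced fibre over `p`. -/
lemma IsElliptic.exists_pullback_iso [IsAlgClosed k]
    [LocallyOfFiniteType (X ↘ Spec (.of k))] {ι : Type*} [Fintype ι]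
    {φ : ι → X.presheaf.stalk p →+* PowerSeries k} {c : ι → k} {D : Y → ℕ}
    (N : IsNormalizationAt π p) (E : IsElliptic (toStalk k X p) φ c) (hp : IsClosed {p})
    (hD : ∀ y, π y = p → D y = 2) (hD0 : ∀ y, π y ≠ p → D y = 0) :
    ∃ e : (pullback π).obj (omega k X) ≅ omegaTwist k Y D,
      ∀ (U : X.Opens) (s : Γ(omega k X, U)),
        sectionToRatDiff (e.hom.app (π ⁻¹ᵁ U)
          ((((pullbackPushforwardAdjunction π).unit.app (omega k X)).app U) s)) =
        pullbackRatDiff k π (sectionToRatDiff s) := by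
  have H := E.isFormalBranches
  have := N.isReduced
  obtain ⟨U, hpU, σ, hσ, hadp, hσ0⟩ := E.exists_isGenerator
  let θ := N.pullbackHom H hp hD
  have hθ : ∀ V s, sectionToRatDiff (appTo π θ V s) = pullbackRatDiff k π (sectionToRatDiff s) :=
    fun V s => rfl
  have hσ1 : ∀ η, pullbackRatDiff k π σ η ≠ 0 := by
    intro η
    have hη := N.map_mem_genericPoints H hp η.2.1
    rw [pullbackRatDiff_apply k π σ η hη]
    exact (map_ne_zero_iff _ (N.kaehlerPullback_bijective H hp η.2.1).1).2 (hσ0 _)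
  have hiso := isIso_of_locally_smul π θ (fun W τ y hyW => by
      obtain ⟨V, W', h, h', g, ω, hω, hyW', hτ⟩ :=
        E.exists_res_eq_smul_pullback N hp hD hD0 hσ.1 hadp τ.2 hyW
      exact ⟨V, W', h, h', g, ⟨ω, hω⟩, hyW', Subtype.ext hτ⟩)
    (fun M ψ V W h g₁ g₂ g₃ s₁ s₂ s₃ hrel y hyW => by
      by_cases hyp : π y = p
      · have hpV : p ∈ V := hyp ▸ h hyW
        have hW : W ⊓ π ⁻¹ᵁ (V ⊓ U) ≤ W := inf_le_left
        refine ⟨W ⊓ π ⁻¹ᵁ (V ⊓ U), hW, ⟨hyW, h hyW, show π y ∈ U from hyp ▸ hpU⟩, ?_⟩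
        have hs : ∀ (g : Γ(Y, W)) (s : Γ(omega k X, V)) (L : Y.Modules)
            (χ : omega k X ⟶ (pushforward π).obj L), resM L hW (g • resM L h (appTo π χ V s)) =
            (Y.presheaf.map (homOfLE hW).op).hom g •
              resM L inf_le_right (appTo π χ (V ⊓ U) (resM _ inf_le_left s)) := by
          intro g s L χ
          rw [resM_smul, appTo_resM, resM_resM, resM_resM]
        have h4 := congrArg (resM _ hW) hrel
        rw [map_add, hs, hs, hs] at h4 ⊢
        exact relation_of_isGenerator ψ hθ hσ hσ1 inf_le_right _ _ _ _ _ _ _ h4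
      · exact N.exists_relation ψ hθ H hp h g₁ g₂ g₃ s₁ s₂ s₃ hrel hyW hyp)
  exact ⟨asIso (((pullbackPushforwardAdjunction π).homEquiv _ _).symm θ), fun V s =>
    congrArg Subtype.val (appTo_pullback_unit π θ V s)⟩

/-- The points above `p` are the centers of the branches of `X` at `p`. -/
lemma IsNormalizationAt.exists_points {ι : Type*} [Finite ι]
    {φ : ι → X.presheaf.stalk p →+* PowerSeries k} {e : ℕ}
    (N : IsNormalizationAt π p) (H : IsFormalBranches (toStalk k X p) φ e) (hp : IsClosed {p}) :
    ∃ q : ι → Y, Function.Injective q ∧ Set.range q = π ⁻¹' {p} ∧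
      ∀ i, ∃ (η : Y) (h : η ⤳ q i) (Φ : _), H.IsCenter π (H.branchEquiv.symm i) h Φ := by
  choose q η h Φ hq hc using fun i => N.exists_point H hp (H.branchEquiv.symm i)
  refine ⟨q, fun i j hij => ?_, ?_, fun i => ⟨η i, h i, Φ i, hc i⟩⟩
  · have key : ∀ {y y' : Y} (_ : y = y') (_ : π y = p) {b b' : Branch X p} {η η' : Y} {h : η ⤳ y}
        {h' : η' ⤳ y'} {Φ Φ'}, H.IsCenter π b h Φ → H.IsCenter π b' h' Φ' → b = b' := by
      rintro y _ rfl hy b b' η η' h h' Φ Φ' hc hc'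
      obtain rfl := hc'.eq_of_specializes η hc.isLiftOf.generic h
      exact hc.eq_branch N hp hy hc'
    exact H.branchEquiv.symm.injective (key hij (hq i) (hc i) (hc j))
  · refine Set.Subset.antisymm (Set.range_subset_iff.2 hq) fun y hy => ?_
    obtain ⟨b, η', h', Φ', hc'⟩ := N.exists_isCenter H hp hy
    refine ⟨H.branchEquiv b, ?_⟩
    have := hc (H.branchEquiv b)
    rw [Equiv.symm_apply_apply] at this
    exact N.eq_of_isCenter hp (hq _) hy this hc'

lemma multipleOfPoints_apply (n : ℕ) {m : ℕ} {q : Fin m → Y} (hq : Function.Injective q)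
    (i : Fin m) : multipleOfPoints n q (q i) = n := by
  simp [multipleOfPoints, hq.eq_iff]

lemma multipleOfPoints_eq_zero (n : ℕ) {m : ℕ} {q : Fin m → Y} {y : Y} (hy : y ∉ Set.range q) :
    multipleOfPoints n q y = 0 :=
  Finset.sum_eq_zero fun i _ => if_neg fun h => hy ⟨i, h.symm⟩

/-- The local ring of an elliptic `m`-fold point has `m` formal branches, up to completion subject
only to the equality of values and one relation between tangent vectors. -/
lemma _root_.RosenlichtCurve.IsEllipticMFoldPoint.exists_isElliptic {k : Type u} [Field k]
    {X : Scheme.{u}} [X.Over (Spec (.of k))] [IsLocallyNoetherian X] {p : X} {m : ℕ}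
    (h : IsEllipticMFoldPoint k X p m) : ∃ (φ : Fin m → X.presheaf.stalk p →+* PowerSeries k)
      (c : Fin m → k), IsElliptic (toStalk k X p) φ c := by
  have key : ∀ {n m : ℕ} {I : Ideal (MvPowerSeries (Fin n) k)},
      (∃ ψ c, IsSeriesModel (ι := Fin m) I ψ c) → HasCompletedLocalRing k X p I →
      ∃ (φ : Fin m → X.presheaf.stalk p →+* PowerSeries k) (c : Fin m → k),
        IsElliptic (toStalk k X p) φ c := by
    rintro n m I ⟨ψ, c, hψ⟩ ⟨ε, hε⟩
    obtain ⟨φ, hφ⟩ := hψ.exists_isElliptic (toStalk k X p) ε hε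
    exact ⟨φ, c, hφ⟩
  match m, h with
  | 1, h => exact key cusp_isSeriesModel h
  | 2, h => exact key tacnode_isSeriesModel h
  | 3, h => exact key tripleLine_isSeriesModel h
  | n + 4, h => exact key (cone_isSeriesModel n) h

end EllipticPoint

end

theorem mainTheorem8 {k : Type u} [Field k] [IsAlgClosed k] (C : Scheme.{u})
    [C.Over (Spec (.of k))] [IsCurve k C] (p : C) (m : ℕ)
    (hp : IsEllipticMFoldPoint k C p m) :
    ∃ q : Fin m → normalizationAt k C p,
      Function.Injective q ∧
      Set.range q = (normalizationMap k C p) ⁻¹' {p} ∧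
      IsGorensteinAt k C p ∧
      (∃ e : (Scheme.Modules.pullback (normalizationMap k C p)).obj
            (omega k C) ≅
          omegaTwist k (normalizationAt k C p)
            (multipleOfPoints 2 q),
        ∀ (U : C.Opens) (s : Γ(omega k C, U)),
          sectionToRatDiff
              (e.hom.app (normalizationMap k C p ⁻¹ᵁ U)
                ((((Scheme.Modules.pullbackPushforwardAdjunction
                  (normalizationMap k C p)).unit.app
                    (omega k C)).app U) s)) =
            pullbackRatDiff k (normalizationMap k C p)
              (sectionToRatDiff s)) ∧
      ∃ U : C.Opens, p ∈ U ∧ ∃ σ : RatDiff k C U,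
        IsGenerator σ ∧
        ∀ i, HasPoleOfOrder
          (pullbackRatDiff k (normalizationMap k C p) σ) (q i) 2 := by
  have := IsCurve.isReduced (k := k) (C := C)
  have := IsCurve.locallyOfFiniteType (k := k) (C := C)
  have := IsCurve.quasiCompact (k := k) (C := C)
  have : IsLocallyNoetherian C := LocallyOfFiniteType.isLocallyNoetherian (C ↘ Spec (.of k))
  have : CompactSpace C := QuasiCompact.compactSpace_of_compactSpace (C ↘ Spec (.of k))
  have : IsNoetherian C := {}
  obtain ⟨φ, c, E⟩ := hp.exists_isElliptic
  have H := E.isFormalBranches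
  have N := EllipticPoint.isNormalizationAt_normalizationMap k C p
  have hpc : IsClosed {p} := EllipticPoint.isClosed_singleton_of_sub_mem k fun f =>
    ⟨_, H.sub_mem H.exists_index.some f⟩
  obtain ⟨q, hq, hrange, hcenter⟩ := N.exists_points H hpc
  obtain ⟨U, hpU, σ, hσ, hadp, -⟩ := E.exists_isGenerator
  refine ⟨q, hq, hrange, EllipticPoint.isGorensteinAt_of_isGenerator hσ hpU, ?_, U, hpU, σ, hσ,
    fun i => ?_⟩
  · refine E.exists_pullback_iso N hpc (fun y hy => ?_) fun y hy =>
      EllipticPoint.multipleOfPoints_eq_zero 2 (hrange ▸ hy)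
    obtain ⟨i, rfl⟩ : y ∈ Set.range q := hrange ▸ hy
    exact EllipticPoint.multipleOfPoints_apply 2 hq i
  · obtain ⟨η, h, Φ, hc⟩ := hcenter i
    have hi : normalizationMap k C p (q i) = p := hrange.subset ⟨i, rfl⟩
    have hU : normalizationMap k C p (q i) ∈ U := by
      rw [hi]
      exact hpU
    exact hc.hasPoleOfOrder N hpc hpU hU (hadp.orderTop_eq _)
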